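/- Let $d\ge 2$ and $\ell>0$, and let $g$ be the metric of global (universal-cover) anti-de Sitter space $\mathrm{AdS}_{d+1}$ of radius $\ell$, $$g=-\Big(1+\frac{r^2}{\ell^2}\Big)dt^2+\frac{dr^2}{1+r^2/\ell^2}+r^2\,d\omega_{d-1}^2 ,$$ with conformal compactification $\tilde g=\Omega^2 g$ on $\mathbb R\times\overline{B^d}$, where $\Omega=1-|y|^2$, $y\in B^d$ is the ball coordinate with $r=2\ell|y|/(1-|y|^2)$, and the conformal boundary is $\mathbb R\times S^{d-1}$. Consider linearized perturbations $h=\delta g$ of $g$ that are regular and $C^2$ and leave the causal structure of the boundary unchanged: $h$ is a symmetric tensor field, $\Omega^2h$ extends to a $C^2$ tensor field $\tilde h$ on $\mathbb R\times\overline{B^d}$, and $\tilde h(v,v)=0$ for every $\tilde g$-null vector $v$ tangent to the boundary. For a complete null geodesic $\gamma$ of $g$ with affine parameter $\lambda$ and tangent $k^a$, put $I(\gamma)=\int_\gamma h_{ab}k^ak^b\,d\lambda$. The boundary causality condition (BCC) is: $I(\gamma)\ge 0$ for all such $\gamma$. Let $\delta\big(\int_\gamma R_{ab}k^ak^b\,d\lambda\big)$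 denote the integral over $\lambda$ of the first-order variation in $\varepsilon$ of $R_{ab}k^ak^b$ when $g$ is replaced by $g+\varepsilon h$ and $\gamma$ by $\gamma+\varepsilon\eta$, where $\eta$ is any $C^2$ deviation such that $\gamma+\varepsilon\eta$ is, to first order in $\varepsilon$, an affinely parametrized null geodesic of $g+\varepsilon h$. The linearized averaged null curvature condition (ANCC) is: $\delta\big(\int_\gamma R_{ab}k^ak^b\,d\lambda\big)\ge 0$ for all such $\gamma$. (i) For every perturbation $h$ in this class and every $\gamma$, the integral $I(\gamma)$ converges absolutely, such deviations $\eta$ exist, and the integral $\delta\big(\int_\gamma R_{ab}k^ak^b\,d\lambda\big)$ converges absolutely to a value that does not depend on $\eta$. If $h$ satisfies the linearized ANCC, then it satisfies the BCC. (ii) The converse fails. For every $\varepsilon>0$ the static, spherically symmetric perturbation $$h=\frac{\varepsilon\, r^2/\ell^2}{(1+r^2/\ell^2)^d}\,dt^2$$ belongs to the class and has $I(\gamma)>0$ for every complete null geodesic $\gamma$ of $g$ (so it satisfies the BCC), but it violates the linearized ANCC: there is an $R$ such that $\delta\big(\int_\gamma R_{ab}k^ak^b\,d\lambda\big)<0$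 for every $\gamma$ on which $r\ge R$ throughout. -/

import Mathlib

open MeasureTheory

noncomputable section

namespace AdS

/-- Coordinate space of dimension `d + 1`; index `0` is time, the indices `i.succ` are spatial. -/
abbrev Coord (d : ℕ) : Type := Fin (d + 1) → ℝ

/-- A field of `(0,2)`-tensors, given by its components in the coordinate basis. -/
abbrev TensorField (d : ℕ) : Type := Coord d → Matrix (Fin (d + 1)) (Fin (d + 1)) ℝ

/-! ### Curvature of a metric in a chart -/

/-- The partial derivative `∂f/∂x^a`. -/
def partialDeriv {d : ℕ} (a : Fin (d + 1)) (f : Coord d → ℝ) (x : Coord d) : ℝ :=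
  fderiv ℝ f x (Pi.single a 1)

/-- The Christoffel symbol `Γ^a_{bc}` of the metric `g`. -/
def christoffel {d : ℕ} (g : TensorField d) (a b c : Fin (d + 1)) (x : Coord d) : ℝ :=
  (1 / 2) * ∑ e, (g x)⁻¹ a e *
    (partialDeriv b (fun y => g y e c) x + partialDeriv c (fun y => g y e b) x
      - partialDeriv e (fun y => g y b c) x)

/-- The Ricci tensor `R_{bc}` of the metric `g` (positive on round spheres). -/
def ricci {d : ℕ} (g : TensorField d) : TensorField d := fun x => Matrix.of fun b c =>
  (∑ a, (partialDeriv a (christoffel g a b c) x - partialDeriv c (christoffel g a b a) x))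
    + ∑ a, ∑ e, (christoffel g a a e x * christoffel g e b c x
        - christoffel g a c e x * christoffel g e b a x)

/-- The value `T_{ab} v^a v^b` of a bilinear form on a vector. -/
def quad {d : ℕ} (T : Matrix (Fin (d + 1)) (Fin (d + 1)) ℝ) (v : Coord d) : ℝ :=
  ∑ a, ∑ b, T a b * v a * v b

/-- The acceleration `k^b ∇_b k^a` of the parametrized curve `c` with velocity `k`. -/
def acceleration {d : ℕ} (g : TensorField d) (c : ℝ → Coord d) (s : ℝ) (a : Fin (d + 1)) : ℝ :=
  deriv (deriv c) s a
    + ∑ b, ∑ e, christoffel g a b e (c s) * deriv c s b * deriv c s e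

/-- The value `T_{ab} k^a k^b` along the parametrized curve `c` with velocity `k`. -/
def along {d : ℕ} (T : TensorField d) (c : ℝ → Coord d) (s : ℝ) : ℝ :=
  quad (T (c s)) (deriv c s)

/-! ### Global anti-de Sitter space

The chart is `ℝ × B^d` with `B^d` the open unit ball. The conformal boundary is `ℝ × S^{d-1}`. -/

/-- `|y|²` for the spatial part `y` of `x`. -/
def normSqSpace {d : ℕ} (x : Coord d) : ℝ := ∑ i : Fin d, x i.succ ^ 2

/-- The interior `ℝ × B^d`. -/
def bulk (d : ℕ) : Set (Coord d) := {x | normSqSpace x < 1}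

/-- The conformal compactification `ℝ × closure B^d`. -/
def compactification (d : ℕ) : Set (Coord d) := {x | normSqSpace x ≤ 1}

/-- The conformal factor `Ω = 1 - |y|²`, a defining function of the conformal boundary. -/
def conformalFactor {d : ℕ} (x : Coord d) : ℝ := 1 - normSqSpace x

/-- The compactified metric `Ω² g = -(1 + |y|²)² dt² + 4 ℓ² |dy|²`. -/
def compactMetric (d : ℕ) (ℓ : ℝ) : TensorField d := fun x =>
  Matrix.diagonal (Fin.cons (-(1 + normSqSpace x) ^ 2) fun _ : Fin d => 4 * ℓ ^ 2)

/-- The metric `g` of global `AdS_{d+1}` of radius `ℓ`. With `r = 2 ℓ |y| / (1 - |y|²)` it is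
`-(1 + r²/ℓ²) dt² + dr² / (1 + r²/ℓ²) + r² dω²`. -/
def metric (d : ℕ) (ℓ : ℝ) : TensorField d := fun x =>
  (conformalFactor x ^ 2)⁻¹ • compactMetric d ℓ x

/-- The areal radius `r = 2 ℓ |y| / (1 - |y|²)`. -/
def arealRadius {d : ℕ} (ℓ : ℝ) (x : Coord d) : ℝ :=
  2 * ℓ * √(normSqSpace x) / (1 - normSqSpace x)

/-- Complete affinely parametrized null geodesics of `AdS_{d+1}`. -/
structure IsNullGeodesic (d : ℕ) (ℓ : ℝ) (γ : ℝ → Coord d) : Prop where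
  mem_bulk : ∀ s, γ s ∈ bulk d
  contDiff : ContDiff ℝ 2 γ
  velocity_ne_zero : ∀ s, deriv γ s ≠ 0
  null : ∀ s, along (metric d ℓ) γ s = 0
  geodesic : ∀ s a, acceleration (metric d ℓ) γ s a = 0

/-! ### Linearized perturbations -/

/-- Regular `C²` perturbations `h = δg` of `AdS_{d+1}` that leave the causal structure of the
conformal boundary unchanged: `Ω² h` extends to a `C²` tensor field on the compactification, and
the extension does not move the light cones of the boundary metric. -/
structure IsAdmissible (d : ℕ) (ℓ : ℝ) (h : TensorField d) : Prop where
  symm : ∀ x ∈ bulk d, (h x).IsSymm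
  regular : ∃ H : TensorField d,
    (∀ a b, ContDiffOn ℝ 2 (fun x => H x a b) (compactification d)) ∧
    (∀ x ∈ bulk d, H x = conformalFactor x ^ 2 • h x) ∧
    ∀ x : Coord d, normSqSpace x = 1 → ∀ v : Coord d,
      ∑ i : Fin d, x i.succ * v i.succ = 0 →
      quad (compactMetric d ℓ x) v = 0 → quad (H x) v = 0

/-- The averaged light cone tilt `I(γ) = ∫ h_{ab} k^a k^b dλ`. -/
def tilt {d : ℕ} (h : TensorField d) (γ : ℝ → Coord d) : ℝ := ∫ s, along h γ s

/-- The boundary causality condition `I(γ) ≥ 0` for all complete null geodesics of AdS. -/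
def BCC (d : ℕ) (ℓ : ℝ) (h : TensorField d) : Prop :=
  ∀ γ, IsNullGeodesic d ℓ γ → 0 ≤ tilt h γ

/-- The perturbed metric `g + ε h`. -/
def perturbed (d : ℕ) (ℓ : ℝ) (h : TensorField d) (ε : ℝ) : TensorField d :=
  fun x => metric d ℓ x + ε • h x

/-- `η` deforms the null geodesic `γ` of `g` into a null geodesic of `g + ε h`, affinely
parametrized, to first order in `ε`: the curve `γ + ε η` satisfies the geodesic equation and the
null condition of `g + ε h` up to `o(ε)`. -/
structure IsNullDeviation (d : ℕ) (ℓ : ℝ) (h : TensorField d) (γ η : ℝ → Coord d) : Prop where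
  contDiff : ContDiff ℝ 2 η
  null : ∀ s, HasDerivAt (fun ε : ℝ => along (perturbed d ℓ h ε) (γ + ε • η) s) 0 0
  geodesic : ∀ s a,
    HasDerivAt (fun ε : ℝ => acceleration (perturbed d ℓ h ε) (γ + ε • η) s a) 0 0

/-- The first-order variation `δ(R_{ab} k^a k^b)` when the metric changes from `g` to `g + ε h`
and the null geodesic from `γ` to `γ + ε η`. -/
def nullCurvatureVariation (d : ℕ) (ℓ : ℝ) (h : TensorField d) (γ η : ℝ → Coord d)
    (s : ℝ) : ℝ :=
  deriv (fun ε : ℝ => along (ricci (perturbed d ℓ h ε)) (γ + ε • η) s) 0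

/-- The linearized averaged null curvature condition `δ(∫ R_{ab} k^a k^b dλ) ≥ 0` along all
complete null geodesics (the unperturbed integral vanishes). -/
def LinearizedANCC (d : ℕ) (ℓ : ℝ) (h : TensorField d) : Prop :=
  ∀ γ η, IsNullGeodesic d ℓ γ → IsNullDeviation d ℓ h γ η →
    0 ≤ ∫ s, nullCurvatureVariation d ℓ h γ η s

/-- The static, spherically symmetric perturbation `ε (r²/ℓ²) / (1 + r²/ℓ²)^d dt²`. -/
def staticPerturbation (d : ℕ) (ℓ ε : ℝ) : TensorField d := fun x =>
  Matrix.single 0 0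
    (ε * (arealRadius ℓ x ^ 2 / ℓ ^ 2) / (1 + arealRadius ℓ x ^ 2 / ℓ ^ 2) ^ d)

end AdS

end

/-!
AdS is the hyperboloid `⟨X, X⟩ = -ℓ²` in the flat ambient space `ℝ^{2,d}`. The restriction `f` to
AdS of a linear function of the ambient space has Hessian `(f / ℓ²) g` (`hessian_ambientFn`), so its
gradient is a closed conformal field. This one fact gives the curvature (`ricci_metric`: AdS is
Einstein) and the null geodesics: linear functions are affine along them, so they are straight lines
of the ambient space. They are labelled by a null covector `N`, that is, a time `t₀` and a unit
vector `e`, and by a point `β ⊥ e` with `|β| < 1`, a position in the Klein model of hyperbolic space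
(`IsNullGeodesic.exists_eq_nullGeodesic`). With `f` and `K = grad f` belonging to `N`, the geodesic
lies in the null hypersurface `f = 0` and has velocity `κ K`.

Because `R_{ab}` is proportional to `g_{ab}`, moving the curve changes `R_{ab} k^a k^b` only through
the linearized null condition, so its variation does not depend on the deviation
(`hasDerivAt_along_ricci`). Contracting the Palatini formula with `K` on `f = 0` turns that variation
into a total derivative along `K` minus `½ □ φ`, where `φ = h(K, K)` (`sum_ricciVar_add`). In
coordinates adapted to the Klein model, `□ φ` on the geodesic is again a total derivative plus second
derivatives of `φ` in the `β` directions (`waveOp_nullCurve`). The total derivatives integrate to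
zero, because `K` vanishes at the endpoints of the geodesic on the conformal boundary while `Ω² h` is
`C²` there (`boundaryTerm_eq`, `boundaryTermExt_eq_zero`). What is left is
`integral_nullCurvatureVariation`: if `U(β)` is the integral over the geodesic of the rescaled tilt
`F` (`rescaledTilt`), then `I(γ)` is a positive multiple of `U(β)`, and the averaged variation of
the null curvature is a negative multiple of `L U(β)`, where `L = ∑ w_i w_i ∂∂` is an elliptic
operator on the open ball in `e^⊥` that degenerates at its boundary.

The ANCC therefore says `L U ≤ 0` for every `t₀` and `e`. For `|β| = 1` the curve lies in the
conformal boundary and has null velocity, so the boundary condition on `h` makes `U` vanish there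
(`rescaledTilt_eq_zero`). The maximum principle gives `U ≥ 0`, which is the BCC
(`rescaledAverage_nonneg`).

The conditions on all geodesics would be void without deviations. In the ambient space the
linearized geodesic equation reads `Ξ'' = source`, so a deviation is obtained by integrating twice;
a suitable initial velocity makes `Ξ` tangent to the hyperboloid and the deviated curve null
(`exists_isNullDeviation`).

For the static perturbation, with `q = 1 - |β|²`,
`F = 4 ℓ² ε (q^d cos^{2d} τ - q^{d+1} cos^{2d+2} τ)`, which is nonnegative and not identically zero.
Near the boundary of the ball, for `q < 1/5`, its transverse Laplacian is positive, so the averaged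
variation of the null curvature is negative; geodesics with `r ≥ 3 ℓ` throughout have `q ≤ 1/10`.
-/

noncomputable section

namespace AdS

open Filter Topology

/-! ### Partial derivatives -/

section PartialDeriv

variable {d : ℕ} {f g : Coord d → ℝ} {x : Coord d} {a : Fin (d + 1)}

theorem partialDeriv_congr (h : f =ᶠ[𝓝 x] g) : partialDeriv a f x = partialDeriv a g x := by
  rw [partialDeriv, h.fderiv_eq, partialDeriv]

theorem partialDeriv_add (hf : DifferentiableAt ℝ f x) (hg : DifferentiableAt ℝ g x) :
    partialDeriv a (fun y => f y + g y) x = partialDeriv a f x + partialDeriv a g x := by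
  simp only [partialDeriv]; rw [fderiv_fun_add hf hg]; rfl

theorem partialDeriv_sub (hf : DifferentiableAt ℝ f x) (hg : DifferentiableAt ℝ g x) :
    partialDeriv a (fun y => f y - g y) x = partialDeriv a f x - partialDeriv a g x := by
  simp only [partialDeriv]; rw [fderiv_fun_sub hf hg]; rfl

theorem partialDeriv_mul (hf : DifferentiableAt ℝ f x) (hg : DifferentiableAt ℝ g x) :
    partialDeriv a (fun y => f y * g y) x
      = partialDeriv a f x * g x + f x * partialDeriv a g x := by
  simp only [partialDeriv]; rw [fderiv_fun_mul hf hg]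
  simp only [FunLike.coe_add, FunLike.coe_smul, Pi.add_apply, Pi.smul_apply, smul_eq_mul]; ring

theorem partialDeriv_const_mul (c : ℝ) (hf : DifferentiableAt ℝ f x) :
    partialDeriv a (fun y => c * f y) x = c * partialDeriv a f x := by
  simp only [partialDeriv]; rw [fderiv_const_mul hf]; rfl

@[simp] theorem partialDeriv_const (c : ℝ) : partialDeriv a (fun _ => c) x = 0 := by
  simp [partialDeriv]

theorem partialDeriv_sum {ι : Type*} {s : Finset ι} {F : ι → Coord d → ℝ}
    (hF : ∀ i ∈ s, DifferentiableAt ℝ (F i) x) :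
    partialDeriv a (fun y => ∑ i ∈ s, F i y) x = ∑ i ∈ s, partialDeriv a (F i) x := by
  simp only [partialDeriv]; rw [fderiv_fun_sum hF]; simp

theorem partialDeriv_coord (b : Fin (d + 1)) :
    partialDeriv a (fun y => y b) x = if a = b then 1 else 0 := by
  have : HasFDerivAt (fun y : Coord d => y b) (ContinuousLinearMap.proj b) x :=
    (ContinuousLinearMap.proj (R := ℝ) (φ := fun _ : Fin (d + 1) => ℝ) b).hasFDerivAt
  rw [partialDeriv, this.fderiv]
  simp [Pi.single_apply, eq_comm]

theorem partialDeriv_comp {φ : ℝ → ℝ} {φ' : ℝ} (hφ : HasDerivAt φ φ' (f x))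
    (hf : DifferentiableAt ℝ f x) :
    partialDeriv a (fun y => φ (f y)) x = φ' * partialDeriv a f x := by
  have := hφ.comp_hasFDerivAt x hf.hasFDerivAt
  rw [partialDeriv, show (fun y => φ (f y)) = φ ∘ f from rfl, this.fderiv]
  simp [partialDeriv]

theorem contDiffAt_partialDeriv {m n : WithTop ℕ∞} (hf : ContDiffAt ℝ n f x) (hmn : m + 1 ≤ n) :
    ContDiffAt ℝ m (partialDeriv a f) x :=
  (hf.fderiv_right hmn).clm_apply contDiffAt_const

theorem partialDeriv_comm (b : Fin (d + 1)) (hf : ContDiffAt ℝ 2 f x) :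
    partialDeriv a (partialDeriv b f) x = partialDeriv b (partialDeriv a f) x := by
  have hs : IsSymmSndFDerivAt ℝ f x := hf.isSymmSndFDerivAt (by simp)
  have hd : DifferentiableAt ℝ (fderiv ℝ f) x :=
    (hf.fderiv_right (m := 1) (by norm_num)).differentiableAt (by norm_num)
  have key : ∀ u v : Coord d, fderiv ℝ (fun y => fderiv ℝ f y u) x v
      = fderiv ℝ (fderiv ℝ f) x v u := by
    intro u v
    rw [fderiv_clm_apply hd (differentiableAt_const u)]
    simp
  change fderiv ℝ (fun y => fderiv ℝ f y _) x _ = fderiv ℝ (fun y => fderiv ℝ f y _) x _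
  rw [key, key]
  exact hs _ _

theorem fderiv_apply_eq_sum (f : Coord d → ℝ) (x v : Coord d) :
    fderiv ℝ f x v = ∑ a, v a * partialDeriv a f x := by
  conv_lhs => rw [← Finset.univ_sum_single v]
  rw [map_sum]
  refine Finset.sum_congr rfl fun a _ => ?_
  rw [show (Pi.single a (v a) : Coord d) = v a • Pi.single a 1 by
    rw [← Pi.single_smul]; simp, map_smul]
  rfl

/-- The chain rule along a curve. -/
theorem hasDerivAt_comp_curve {c : ℝ → Coord d} {c' : Coord d} {s : ℝ}
    (hf : DifferentiableAt ℝ f (c s)) (hc : HasDerivAt c c' s) :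
    HasDerivAt (fun s => f (c s)) (∑ a, c' a * partialDeriv a f (c s)) s := by
  rw [← fderiv_apply_eq_sum]
  exact hf.hasFDerivAt.comp_hasDerivAt s hc

end PartialDeriv

/-! ### Linearization of the curvature -/

section Linearization

variable {E : Type*} [NormedAddCommGroup E] [NormedSpace ℝ E] {n : WithTop ℕ∞}

theorem contDiffAt_det {ι : Type*} [Fintype ι] [DecidableEq ι] {A : E → Matrix ι ι ℝ} {z : E}
    (hA : ∀ a b, ContDiffAt ℝ n (fun y => A y a b) z) :
    ContDiffAt ℝ n (fun y => (A y).det) z := by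
  simp only [Matrix.det_apply']
  exact ContDiffAt.sum fun σ _ => contDiffAt_const.mul (contDiffAt_prod fun i _ => hA _ _)

theorem contDiffAt_inv_apply {ι : Type*} [Fintype ι] [DecidableEq ι] {A : E → Matrix ι ι ℝ}
    {z : E} (hA : ∀ a b, ContDiffAt ℝ n (fun y => A y a b) z) (hdet : (A z).det ≠ 0) (a b : ι) :
    ContDiffAt ℝ n (fun y => (A y)⁻¹ a b) z := by
  simp only [Matrix.inv_def, Ring.inverse_eq_inv', Matrix.smul_apply, smul_eq_mul,
    Matrix.adjugate_apply]
  refine ((contDiffAt_det hA).inv hdet).mul (contDiffAt_det fun i j => ?_)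
  by_cases h : i = b
  · subst h; simpa using contDiffAt_const
  · simpa [Matrix.updateRow_ne h] using hA i j

variable {d : ℕ}

/-- The Christoffel symbol of the first kind `Γ_{e,bc}` of a tensor field. -/
def firstKind (g : TensorField d) (e b c : Fin (d + 1)) (x : Coord d) : ℝ :=
  (1 / 2) * (partialDeriv b (fun y => g y e c) x + partialDeriv c (fun y => g y e b) x
      - partialDeriv e (fun y => g y b c) x)

/-- The variation of the connection with its upper index lowered:
`½ (∇_b h_{ec} + ∇_c h_{eb} - ∇_e h_{bc})`. -/
def connectionVarLower (g h : TensorField d) (e b c : Fin (d + 1)) (x : Coord d) : ℝ :=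
  firstKind h e b c x - ∑ f, h x e f * christoffel g f b c x

/-- The difference quotient `C^a_{bc} = (Γ(g + ε h) - Γ(g)) / ε` of the Christoffel symbols. At
`ε = 0` it is the variation of the connection. -/
def connectionVar (g h : TensorField d) (ε : ℝ) (a b c : Fin (d + 1)) (x : Coord d) : ℝ :=
  ∑ e, (g x + ε • h x)⁻¹ a e * connectionVarLower g h e b c x

/-- The difference quotient `(R_{bc}(g + ε h) - R_{bc}(g)) / ε` of the Ricci tensor. At `ε = 0` it
is the Palatini expression for the variation of the Ricci tensor. -/
def ricciVar (g h : TensorField d) (ε : ℝ) (b c : Fin (d + 1)) (x : Coord d) : ℝ :=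
  (∑ a, (partialDeriv a (connectionVar g h ε a b c) x
      - partialDeriv c (connectionVar g h ε a b a) x))
    + ∑ a, ∑ e, (christoffel g a a e x * connectionVar g h ε e b c x
        + connectionVar g h ε a a e x * christoffel g e b c x
        - christoffel g a c e x * connectionVar g h ε e b a x
        - connectionVar g h ε a c e x * christoffel g e b a x)
    + ε * ∑ a, ∑ e, (connectionVar g h ε a a e x * connectionVar g h ε e b c x
        - connectionVar g h ε a c e x * connectionVar g h ε e b a x)

theorem christoffel_eq_sum_firstKind (g : TensorField d) (a b c : Fin (d + 1)) (x : Coord d) :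
    christoffel g a b c x = ∑ e, (g x)⁻¹ a e * firstKind g e b c x := by
  simp only [christoffel, firstKind, Finset.mul_sum]
  exact Finset.sum_congr rfl fun e _ => by ring

variable {g h : TensorField d} {x : Coord d}

theorem firstKind_add_smul (hg : ∀ a b, DifferentiableAt ℝ (fun y => g y a b) x)
    (hh : ∀ a b, DifferentiableAt ℝ (fun y => h y a b) x) (ε : ℝ) (e b c : Fin (d + 1)) :
    firstKind (fun y => g y + ε • h y) e b c x = firstKind g e b c x + ε * firstKind h e b c x := by
  have key : ∀ i a b, partialDeriv i (fun y => (g y + ε • h y) a b) x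
      = partialDeriv i (fun y => g y a b) x + ε * partialDeriv i (fun y => h y a b) x := by
    intro i a b
    simp only [Matrix.add_apply, Matrix.smul_apply, smul_eq_mul]
    rw [partialDeriv_add (hg a b) ((hh a b).const_mul ε), partialDeriv_const_mul _ (hh a b)]
  simp only [firstKind, key]; ring

/-- The Christoffel symbols of `g + ε h` are exactly `Γ + ε C`, where `C` involves the inverse of
`g + ε h`: both sides agree after multiplication by `g + ε h`. -/
theorem christoffel_add_smul (hg : ∀ a b, DifferentiableAt ℝ (fun y => g y a b) x)
    (hh : ∀ a b, DifferentiableAt ℝ (fun y => h y a b) x) (ε : ℝ)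
    (h0 : (g x).det ≠ 0) (h1 : (g x + ε • h x).det ≠ 0) (a b c : Fin (d + 1)) :
    christoffel (fun y => g y + ε • h y) a b c x
      = christoffel g a b c x + ε * connectionVar g h ε a b c x := by
  set M := g x + ε • h x with hM
  set Γ : Fin (d + 1) → ℝ := fun a => christoffel g a b c x with hΓ
  have e1 : Γ = (g x)⁻¹.mulVec (fun e => firstKind g e b c x) := by
    ext a; simp only [hΓ, christoffel_eq_sum_firstKind, Matrix.mulVec, dotProduct]
  have e2 : (g x).mulVec Γ = fun e => firstKind g e b c x := by
    rw [e1, Matrix.mulVec_mulVec, Matrix.mul_nonsing_inv _ (isUnit_iff_ne_zero.2 h0),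
      Matrix.one_mulVec]
  have e3 : Γ = M⁻¹.mulVec (M.mulVec Γ) := by
    rw [Matrix.mulVec_mulVec, Matrix.nonsing_inv_mul _ (isUnit_iff_ne_zero.2 h1),
      Matrix.one_mulVec]
  have e4 : M.mulVec Γ = (fun e => firstKind g e b c x) + ε • (h x).mulVec Γ := by
    rw [hM, Matrix.add_mulVec, e2, Matrix.smul_mulVec]
  have e5 : christoffel g a b c x
      = ∑ e, M⁻¹ a e * (firstKind g e b c x + ε * ∑ f, h x e f * christoffel g f b c x) := by
    have := congrFun e3 a
    rw [e4] at this
    simpa [Matrix.mulVec, dotProduct, hΓ] using this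
  rw [christoffel_eq_sum_firstKind, e5]
  simp only [firstKind_add_smul hg hh, connectionVar, connectionVarLower, Finset.mul_sum,
    ← Finset.sum_add_distrib]
  refine Finset.sum_congr rfl fun e _ => ?_
  simp only [mul_sub, Finset.mul_sum, mul_add, ← hM]
  simp only [mul_left_comm]
  ring

theorem contDiffAt_firstKind {m n : WithTop ℕ∞} (hg : ∀ a b, ContDiffAt ℝ n (fun y => g y a b) x)
    (hmn : m + 1 ≤ n) (e b c : Fin (d + 1)) : ContDiffAt ℝ m (firstKind g e b c) x :=
  contDiffAt_const.mul (((contDiffAt_partialDeriv (hg _ _) hmn).add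
    (contDiffAt_partialDeriv (hg _ _) hmn)).sub (contDiffAt_partialDeriv (hg _ _) hmn))

theorem contDiffAt_christoffel {m n : WithTop ℕ∞}
    (hg : ∀ a b, ContDiffAt ℝ n (fun y => g y a b) x) (h0 : (g x).det ≠ 0)
    (hmn : m + 1 ≤ n) (a b c : Fin (d + 1)) : ContDiffAt ℝ m (christoffel g a b c) x := by
  have : christoffel g a b c = fun x => ∑ e, (g x)⁻¹ a e * firstKind g e b c x :=
    funext fun x => christoffel_eq_sum_firstKind g a b c x
  rw [this]
  have hm : m ≤ n := le_trans le_self_add hmn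
  exact ContDiffAt.sum fun e _ =>
    (contDiffAt_inv_apply (fun a b => (hg a b).of_le hm) h0 a e).mul
      (contDiffAt_firstKind hg hmn e b c)

theorem contDiffAt_connectionVarLower (hg : ∀ a b, ContDiffAt ℝ 2 (fun y => g y a b) x)
    (hh : ∀ a b, ContDiffAt ℝ 2 (fun y => h y a b) x) (h0 : (g x).det ≠ 0)
    (e b c : Fin (d + 1)) : ContDiffAt ℝ 1 (connectionVarLower g h e b c) x :=
  (contDiffAt_firstKind hh (by norm_num) e b c).sub <| ContDiffAt.sum fun f _ =>
    ((hh e f).of_le (by norm_num)).mul (contDiffAt_christoffel hg h0 (by norm_num) f b c)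

theorem contDiffAt_connectionVar (hg : ∀ a b, ContDiffAt ℝ 2 (fun y => g y a b) x)
    (hh : ∀ a b, ContDiffAt ℝ 2 (fun y => h y a b) x) (h0 : (g x).det ≠ 0)
    (a b c : Fin (d + 1)) :
    ContDiffAt ℝ 1 (fun p : ℝ × Coord d => connectionVar g h p.1 a b c p.2) (0, x) := by
  refine ContDiffAt.sum fun e _ => ContDiffAt.mul ?_ ?_
  · refine contDiffAt_inv_apply (A := fun p : ℝ × Coord d => g p.2 + p.1 • h p.2)
      (fun i j => ?_) (by simpa using h0) a e
    simp only [Matrix.add_apply, Matrix.smul_apply, smul_eq_mul]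
    have h1 := ((hg i j).of_le (m := 1) (by norm_num)).comp ((0 : ℝ), x) contDiffAt_snd
    have h2 := ((hh i j).of_le (m := 1) (by norm_num)).comp ((0 : ℝ), x) contDiffAt_snd
    exact h1.add (contDiffAt_fst.mul h2)
  · exact (contDiffAt_connectionVarLower hg hh h0 e b c).comp ((0 : ℝ), x) contDiffAt_snd

/-- Partial derivatives in the second variable of a jointly `C¹` function are jointly continuous. -/
theorem continuousAt_partialDeriv_param {F : ℝ × Coord d → ℝ} {p : ℝ × Coord d}
    (hF : ContDiffAt ℝ 1 F p) (i : Fin (d + 1)) :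
    ContinuousAt (fun q : ℝ × Coord d => partialDeriv i (fun y => F (q.1, y)) q.2) p := by
  have h1 : ContinuousAt (fun q => fderiv ℝ F q (0, Pi.single i 1)) p :=
    ((hF.fderiv_right (m := 0) (by norm_num)).clm_apply contDiffAt_const).continuousAt
  refine h1.congr ?_
  filter_upwards [hF.eventually (by simp)] with q hq
  have h2 : HasFDerivAt F (fderiv ℝ F q) (q.1, q.2) :=
    (hq.differentiableAt (by norm_num)).hasFDerivAt
  have h3 : HasFDerivAt (fun y : Coord d => ((q.1, y) : ℝ × Coord d))
      (ContinuousLinearMap.inr ℝ ℝ (Coord d)) q.2 := hasFDerivAt_prodMk_right q.1 q.2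
  have h4 := h2.comp q.2 h3
  rw [partialDeriv, show (fun y => F (q.1, y)) = F ∘ fun y => (q.1, y) from rfl, h4.fderiv]
  simp

/-- The product `ε m(ε)` is differentiable at `0` even if `m` is only continuous there. The Ricci
tensor of `g + ε h` at a moving point is `R + ε m(ε)` with `m` built from second derivatives of `h`,
which are continuous but in general not differentiable for `h` of class `C²`. -/
theorem hasDerivAt_mul_of_continuousAt {m : ℝ → ℝ} (hm : ContinuousAt m 0) :
    HasDerivAt (fun ε => ε * m ε) (m 0) 0 := by
  rw [hasDerivAt_iff_tendsto_slope]
  have : Tendsto m (𝓝[≠] 0) (𝓝 (m 0)) := hm.tendsto.mono_left nhdsWithin_le_nhds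
  refine this.congr' ?_
  filter_upwards [self_mem_nhdsWithin] with ε hε
  have : ε ≠ 0 := hε
  simp [slope, this]

/-- Near `(0, x)` the perturbed metric stays invertible, and the difference quotient of the
connections is jointly `C¹` in `(ε, y)`, including at `ε = 0`. -/
theorem eventually_regular (hg : ∀ a b, ContDiffAt ℝ 2 (fun y => g y a b) x)
    (hh : ∀ a b, ContDiffAt ℝ 2 (fun y => h y a b) x) (h0 : (g x).det ≠ 0) :
    ∀ᶠ p : ℝ × Coord d in 𝓝 (0, x),
      (∀ a b, ContDiffAt ℝ 2 (fun y => g y a b) p.2) ∧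
      (∀ a b, ContDiffAt ℝ 2 (fun y => h y a b) p.2) ∧ (g p.2).det ≠ 0 ∧
      (g p.2 + p.1 • h p.2).det ≠ 0 ∧
      ∀ a b c, ContDiffAt ℝ 1 (fun q : ℝ × Coord d => connectionVar g h q.1 a b c q.2) p := by
  have hsnd : Tendsto (fun p : ℝ × Coord d => p.2) (𝓝 (0, x)) (𝓝 x) :=
    continuous_snd.tendsto _
  have e1 : ∀ᶠ y in 𝓝 x, ∀ a b, ContDiffAt ℝ 2 (fun y => g y a b) y :=
    eventually_all.2 fun a => eventually_all.2 fun b => (hg a b).eventually (by simp)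
  have e2 : ∀ᶠ y in 𝓝 x, ∀ a b, ContDiffAt ℝ 2 (fun y => h y a b) y :=
    eventually_all.2 fun a => eventually_all.2 fun b => (hh a b).eventually (by simp)
  have e3 : ∀ᶠ y in 𝓝 x, (g y).det ≠ 0 :=
    (contDiffAt_det hg).continuousAt.eventually_ne h0
  have e4 : ∀ᶠ p : ℝ × Coord d in 𝓝 (0, x), (g p.2 + p.1 • h p.2).det ≠ 0 := by
    refine ContinuousAt.eventually_ne (ContDiffAt.continuousAt (𝕜 := ℝ) (n := 2)
      (contDiffAt_det (A := fun p : ℝ × Coord d => g p.2 + p.1 • h p.2) fun i j => ?_))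
      (by simpa using h0)
    simp only [Matrix.add_apply, Matrix.smul_apply, smul_eq_mul]
    have h1 := (hg i j).comp ((0 : ℝ), x) contDiffAt_snd
    have h2 := (hh i j).comp ((0 : ℝ), x) contDiffAt_snd
    exact h1.add (contDiffAt_fst.mul h2)
  have e5 : ∀ᶠ p : ℝ × Coord d in 𝓝 (0, x),
      ∀ a b c, ContDiffAt ℝ 1 (fun q : ℝ × Coord d => connectionVar g h q.1 a b c q.2) p :=
    eventually_all.2 fun a => eventually_all.2 fun b => eventually_all.2 fun c =>
      (contDiffAt_connectionVar hg hh h0 a b c).eventually (by simp)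
  filter_upwards [hsnd.eventually e1, hsnd.eventually e2, hsnd.eventually e3, e4, e5]
    with p h1 h2 h3 h4 h5
  exact ⟨h1, h2, h3, h4, h5⟩

theorem differentiableAt_of_param {F : ℝ × Coord d → ℝ} {p : ℝ × Coord d}
    (hF : ContDiffAt ℝ 1 F p) : DifferentiableAt ℝ (fun y => F (p.1, y)) p.2 :=
  DifferentiableAt.comp (g := F) p.2 (hF.differentiableAt (by norm_num))
    (hasFDerivAt_prodMk_right p.1 p.2).differentiableAt

/-- The Ricci tensor of `g + ε h` is exactly `R + ε (ricciVar)` for `(ε, y)` near `(0, x)`. -/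
theorem eventually_ricci_add_smul (hg : ∀ a b, ContDiffAt ℝ 2 (fun y => g y a b) x)
    (hh : ∀ a b, ContDiffAt ℝ 2 (fun y => h y a b) x) (h0 : (g x).det ≠ 0) :
    ∀ᶠ p : ℝ × Coord d in 𝓝 (0, x), ∀ b c,
      ricci (fun y => g y + p.1 • h y) p.2 b c
        = ricci g p.2 b c + p.1 * ricciVar g h p.1 b c p.2 := by
  filter_upwards [(eventually_regular hg hh h0).eventually_nhds] with p hp b c
  obtain ⟨ε, y⟩ := p
  have hy : ∀ᶠ z in 𝓝 y, ∀ a b c, christoffel (fun y => g y + ε • h y) a b c z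
      = christoffel g a b c z + ε * connectionVar g h ε a b c z := by
    have : Tendsto (fun z : Coord d => ((ε, z) : ℝ × Coord d)) (𝓝 y) (𝓝 (ε, y)) :=
      (Continuous.prodMk_right ε).tendsto y
    filter_upwards [this.eventually hp] with z hz a b c
    exact christoffel_add_smul (fun a b => (hz.1 a b).differentiableAt (by norm_num))
      (fun a b => (hz.2.1 a b).differentiableAt (by norm_num)) ε hz.2.2.1 hz.2.2.2.1 a b c
  obtain ⟨q1, q2, q3, q4, q5⟩ := hp.self_of_nhds
  have hpd : ∀ i a b c, partialDeriv i (christoffel (fun y => g y + ε • h y) a b c) y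
      = partialDeriv i (christoffel g a b c) y
        + ε * partialDeriv i (connectionVar g h ε a b c) y := by
    intro i a b c
    have hC : DifferentiableAt ℝ (connectionVar g h ε a b c) y := differentiableAt_of_param (q5 a b c)
    rw [partialDeriv_congr (hy.mono fun z hz => hz a b c),
      partialDeriv_add ((contDiffAt_christoffel q1 q3 (m := 1) (by norm_num) a b c).differentiableAt
        (by norm_num)) (hC.const_mul ε), partialDeriv_const_mul _ hC]
  have hv := hy.self_of_nhds
  simp only [ricci, Matrix.of_apply, ricciVar, hpd, hv]
  have h2 : ∀ X Y Z W : Fin (d + 1) → Fin (d + 1) → ℝ,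
      (∀ a e, X a e = Y a e + ε * (Z a e + ε * W a e)) →
      (∑ a, ∑ e, X a e)
        = (∑ a, ∑ e, Y a e) + ε * ((∑ a, ∑ e, Z a e) + ε * ∑ a, ∑ e, W a e) := by
    intro X Y Z W h
    simp only [h, Finset.sum_add_distrib, ← Finset.mul_sum]
  have h3 : ∀ X Y Z : Fin (d + 1) → ℝ, (∀ a, X a = Y a + ε * Z a) →
      ∑ a, X a = (∑ a, Y a) + ε * ∑ a, Z a := by
    intro X Y Z h
    simp only [h, Finset.sum_add_distrib, ← Finset.mul_sum]
  rw [h3 _ (fun a => partialDeriv a (christoffel g a b c) y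
      - partialDeriv c (christoffel g a b a) y)
    (fun a => partialDeriv a (connectionVar g h ε a b c) y
      - partialDeriv c (connectionVar g h ε a b a) y) (fun a => by ring),
    h2 _ (fun a e => christoffel g a a e y * christoffel g e b c y
        - christoffel g a c e y * christoffel g e b a y)
      (fun a e => christoffel g a a e y * connectionVar g h ε e b c y
        + connectionVar g h ε a a e y * christoffel g e b c y
        - christoffel g a c e y * connectionVar g h ε e b a y
        - connectionVar g h ε a c e y * christoffel g e b a y)
      (fun a e => connectionVar g h ε a a e y * connectionVar g h ε e b c y
        - connectionVar g h ε a c e y * connectionVar g h ε e b a y) (fun a e => by ring)]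
  ring

theorem continuousAt_ricciVar (hg : ∀ a b, ContDiffAt ℝ 2 (fun y => g y a b) x)
    (hh : ∀ a b, ContDiffAt ℝ 2 (fun y => h y a b) x) (h0 : (g x).det ≠ 0)
    (b c : Fin (d + 1)) :
    ContinuousAt (fun p : ℝ × Coord d => ricciVar g h p.1 b c p.2) (0, x) := by
  have hC : ∀ a b c, ContinuousAt
      (fun p : ℝ × Coord d => connectionVar g h p.1 a b c p.2) (0, x) := fun a b c =>
    (contDiffAt_connectionVar hg hh h0 a b c).continuousAt
  have hdC : ∀ i a b c, ContinuousAt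
      (fun p : ℝ × Coord d => partialDeriv i (connectionVar g h p.1 a b c) p.2) (0, x) :=
    fun i a b c => continuousAt_partialDeriv_param (contDiffAt_connectionVar hg hh h0 a b c) i
  have hΓ : ∀ a b c, ContinuousAt (fun p : ℝ × Coord d => christoffel g a b c p.2) (0, x) :=
    fun a b c => ContinuousAt.comp (g := christoffel g a b c)
      (contDiffAt_christoffel hg h0 (m := 1) (by norm_num) a b c).continuousAt
      continuous_snd.continuousAt
  refine ContinuousAt.add (ContinuousAt.add ?_ ?_) (continuousAt_fst.mul ?_)
  · exact tendsto_finsetSum _ fun a _ => (hdC _ _ _ _).sub (hdC _ _ _ _)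
  · exact tendsto_finsetSum _ fun a _ => tendsto_finsetSum _ fun e _ =>
      ((((hΓ _ _ _).mul (hC _ _ _)).add ((hC _ _ _).mul (hΓ _ _ _))).sub
        ((hΓ _ _ _).mul (hC _ _ _))).sub ((hC _ _ _).mul (hΓ _ _ _))
  · exact tendsto_finsetSum _ fun a _ => tendsto_finsetSum _ fun e _ =>
      ((hC _ _ _).mul (hC _ _ _)).sub ((hC _ _ _).mul (hC _ _ _))

/-- First-order variation of the Ricci tensor along a moving point. The point may move with `ε`,
and only two derivatives of `h` are needed. -/
theorem hasDerivAt_ricci_sub (hg : ∀ a b, ContDiffAt ℝ 2 (fun y => g y a b) x)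
    (hh : ∀ a b, ContDiffAt ℝ 2 (fun y => h y a b) x) (h0 : (g x).det ≠ 0)
    {c : ℝ → Coord d} (hc : ContinuousAt c 0) (hcx : c 0 = x) (a b : Fin (d + 1)) :
    HasDerivAt (fun ε => ricci (fun y => g y + ε • h y) (c ε) a b - ricci g (c ε) a b)
      (ricciVar g h 0 a b x) 0 := by
  subst hcx
  have ht : Tendsto (fun ε => (ε, c ε)) (𝓝 0) (𝓝 ((0 : ℝ), c 0)) :=
    (continuousAt_id.prodMk hc : ContinuousAt (fun ε => (id ε, c ε)) 0)
  have hm : ContinuousAt (fun ε => ricciVar g h ε a b (c ε)) 0 :=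
    ContinuousAt.comp_of_eq (f := fun ε => ((ε, c ε) : ℝ × Coord d))
      (g := fun p : ℝ × Coord d => ricciVar g h p.1 a b p.2)
      (continuousAt_ricciVar hg hh h0 a b) ht rfl
  have hd := hasDerivAt_mul_of_continuousAt hm
  refine hd.congr_of_eventuallyEq ?_
  filter_upwards [ht.eventually (eventually_ricci_add_smul hg hh h0)] with ε hε
  rw [hε]; ring

/-- First-order variation of the Christoffel symbols along a moving point. -/
theorem hasDerivAt_christoffel_sub (hg : ∀ a b, ContDiffAt ℝ 2 (fun y => g y a b) x)
    (hh : ∀ a b, ContDiffAt ℝ 2 (fun y => h y a b) x) (h0 : (g x).det ≠ 0)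
    {c : ℝ → Coord d} (hc : ContinuousAt c 0) (hcx : c 0 = x) (a b e : Fin (d + 1)) :
    HasDerivAt (fun ε => christoffel (fun y => g y + ε • h y) a b e (c ε)
      - christoffel g a b e (c ε)) (connectionVar g h 0 a b e x) 0 := by
  subst hcx
  have ht : Tendsto (fun ε => (ε, c ε)) (𝓝 0) (𝓝 ((0 : ℝ), c 0)) :=
    (continuousAt_id.prodMk hc : ContinuousAt (fun ε => (id ε, c ε)) 0)
  have hm : ContinuousAt (fun ε => connectionVar g h ε a b e (c ε)) 0 :=
    ContinuousAt.comp_of_eq (f := fun ε => ((ε, c ε) : ℝ × Coord d))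
      (g := fun p : ℝ × Coord d => connectionVar g h p.1 a b e p.2)
      (contDiffAt_connectionVar hg hh h0 a b e).continuousAt ht rfl
  have hd := hasDerivAt_mul_of_continuousAt hm
  refine hd.congr_of_eventuallyEq ?_
  filter_upwards [ht.eventually (eventually_regular hg hh h0)] with ε hε
  rw [christoffel_add_smul (fun a b => (hε.1 a b).differentiableAt (by norm_num))
      (fun a b => (hε.2.1 a b).differentiableAt (by norm_num)) ε hε.2.2.1 hε.2.2.2.1]
  ring

end Linearization

/-! ### The connection of anti-de Sitter space -/

section Chart

variable {d : ℕ} {ℓ : ℝ} {x : Coord d}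

/-- The spatial part of a point, as a vector with vanishing time component. -/
def spatial (x : Coord d) : Coord d := fun a => if a = 0 then 0 else x a

/-- The scalar product of a spatial vector with the spatial part of a point. -/
def spaceDot (v : Fin d → ℝ) (x : Coord d) : ℝ := ∑ i, v i * x i.succ

/-- The diagonal entries of the AdS metric. -/
def metricDiag (ℓ : ℝ) (x : Coord d) (a : Fin (d + 1)) : ℝ :=
  if a = 0 then -((2 - conformalFactor x) / conformalFactor x) ^ 2
  else (2 * ℓ / conformalFactor x) ^ 2

/-- The diagonal entries of the inverse AdS metric. -/
def invMetricDiag (ℓ : ℝ) (x : Coord d) (a : Fin (d + 1)) : ℝ :=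
  if a = 0 then -(conformalFactor x / (2 - conformalFactor x)) ^ 2
  else (conformalFactor x / (2 * ℓ)) ^ 2

/-- The coefficient `m_a` in `∂_b g_{aa} = 2 m_a y_b g_{aa}`. -/
def logSlope (x : Coord d) (a : Fin (d + 1)) : ℝ :=
  if a = 0 then 4 / (conformalFactor x * (2 - conformalFactor x)) else 2 / conformalFactor x

@[simp] theorem spatial_zero (x : Coord d) : spatial x 0 = 0 := by simp [spatial]
@[simp] theorem spatial_succ (x : Coord d) (i : Fin d) : spatial x i.succ = x i.succ := by
  simp [spatial]

theorem normSqSpace_nonneg (x : Coord d) : 0 ≤ normSqSpace x :=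
  Finset.sum_nonneg fun _ _ => sq_nonneg _

theorem sum_sq_eq (x : Coord d) : ∑ i : Fin d, x i.succ ^ 2 = 1 - conformalFactor x := by
  simp [conformalFactor, normSqSpace]

theorem conformalFactor_pos (hx : x ∈ bulk d) : 0 < conformalFactor x := by
  have : normSqSpace x < 1 := hx
  simp only [conformalFactor]; linarith

theorem conformalFactor_le_one (x : Coord d) : conformalFactor x ≤ 1 := by
  have := normSqSpace_nonneg x
  simp only [conformalFactor]; linarith

theorem two_sub_conformalFactor_pos (x : Coord d) : 0 < 2 - conformalFactor x := by
  linarith [conformalFactor_le_one x]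

@[fun_prop]
theorem contDiff_conformalFactor {n : WithTop ℕ∞} :
    ContDiff ℝ n (conformalFactor : Coord d → ℝ) := by
  unfold conformalFactor normSqSpace; fun_prop

@[fun_prop]
theorem differentiable_conformalFactor :
    Differentiable ℝ (conformalFactor : Coord d → ℝ) :=
  (contDiff_conformalFactor (n := 1)).differentiable (by norm_num)

@[fun_prop]
theorem continuous_conformalFactor : Continuous (conformalFactor : Coord d → ℝ) :=
  (contDiff_conformalFactor (n := 1)).continuous

theorem isOpen_bulk : IsOpen (bulk d) := by
  have : bulk d = {x | 0 < conformalFactor x} := by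
    ext x; simp [bulk, conformalFactor]
  rw [this]
  exact isOpen_lt continuous_const continuous_conformalFactor

theorem bulk_mem_nhds (hx : x ∈ bulk d) : bulk d ∈ 𝓝 x := isOpen_bulk.mem_nhds hx

@[fun_prop]
theorem contDiff_spaceDot {n : WithTop ℕ∞} (v : Fin d → ℝ) :
    ContDiff ℝ n (spaceDot v : Coord d → ℝ) := by
  unfold spaceDot; fun_prop

@[fun_prop]
theorem differentiable_spaceDot (v : Fin d → ℝ) : Differentiable ℝ (spaceDot v : Coord d → ℝ) :=
  (contDiff_spaceDot (n := 1) v).differentiable (by norm_num)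

theorem partialDeriv_conformalFactor (a : Fin (d + 1)) (x : Coord d) :
    partialDeriv a conformalFactor x = -2 * spatial x a := by
  unfold conformalFactor normSqSpace
  rw [partialDeriv_sub (by fun_prop) (by fun_prop), partialDeriv_sum (fun i _ => by fun_prop)]
  have : ∀ i : Fin d, partialDeriv a (fun y : Coord d => y i.succ ^ 2) x
      = 2 * x i.succ * if a = i.succ then 1 else 0 := by
    intro i
    rw [partialDeriv_comp (f := fun y : Coord d => y i.succ) (φ := fun r => r ^ 2)
      (φ' := 2 * x i.succ) (by simpa using hasDerivAt_pow 2 (x i.succ)) (by fun_prop),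
      partialDeriv_coord]
  simp only [this, partialDeriv_const]
  refine Fin.cases ?_ (fun j => ?_) a
  · simp [(Fin.succ_ne_zero _).symm]
  · simp [Fin.succ_inj]

theorem partialDeriv_spaceDot (v : Fin d → ℝ) (a : Fin (d + 1)) (x : Coord d) :
    partialDeriv a (spaceDot v) x = (Fin.cons 0 v : Fin (d + 1) → ℝ) a := by
  unfold spaceDot
  rw [partialDeriv_sum (fun i _ => by fun_prop)]
  have : ∀ i : Fin d, partialDeriv a (fun y : Coord d => v i * y i.succ) x
      = v i * if a = i.succ then 1 else 0 := by
    intro i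
    rw [partialDeriv_const_mul _ (by fun_prop), partialDeriv_coord]
  simp only [this]
  refine Fin.cases ?_ (fun j => ?_) a
  · simp [(Fin.succ_ne_zero _).symm]
  · simp [Fin.succ_inj]

theorem metric_eq_diagonal (hx : x ∈ bulk d) :
    metric d ℓ x = Matrix.diagonal (metricDiag ℓ x) := by
  have h := (conformalFactor_pos hx).ne'
  ext a b
  by_cases hab : a = b
  · subst hab
    have hn : 1 + normSqSpace x = 2 - conformalFactor x := by simp [conformalFactor]; ring
    simp only [metric, compactMetric, Matrix.smul_apply, Matrix.diagonal_apply_eq, metricDiag, hn]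
    refine Fin.cases ?_ (fun j => ?_) a
    · simp; field_simp
    · simp; field_simp; ring
  · simp [metric, compactMetric, hab]

theorem metricDiag_mul_inv (hℓ : ℓ ≠ 0) (hx : x ∈ bulk d) (a : Fin (d + 1)) :
    metricDiag ℓ x a * invMetricDiag ℓ x a = 1 := by
  have h := (conformalFactor_pos hx).ne'
  have h2 := (two_sub_conformalFactor_pos x).ne'
  unfold metricDiag invMetricDiag
  split_ifs <;> field_simp

theorem inv_metric (hℓ : ℓ ≠ 0) (hx : x ∈ bulk d) :
    (metric d ℓ x)⁻¹ = Matrix.diagonal (invMetricDiag ℓ x) := by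
  rw [metric_eq_diagonal hx]
  refine Matrix.inv_eq_right_inv ?_
  rw [Matrix.diagonal_mul_diagonal, ← Matrix.diagonal_one]
  congr 1; ext a; exact metricDiag_mul_inv hℓ hx a

theorem det_metric_ne_zero (hℓ : ℓ ≠ 0) (hx : x ∈ bulk d) : (metric d ℓ x).det ≠ 0 := by
  rw [metric_eq_diagonal hx, Matrix.det_diagonal]
  exact Finset.prod_ne_zero_iff.2 fun a _ => left_ne_zero_of_mul_eq_one (metricDiag_mul_inv hℓ hx a)

theorem contDiffAt_metric {n : WithTop ℕ∞} (hx : x ∈ bulk d) (a b : Fin (d + 1)) :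
    ContDiffAt ℝ n (fun y => metric d ℓ y a b) x := by
  have h := (conformalFactor_pos hx).ne'
  simp only [metric, Matrix.smul_apply, smul_eq_mul]
  refine ContDiffAt.mul (ContDiffAt.inv (by fun_prop) (pow_ne_zero 2 h)) ?_
  by_cases hab : a = b
  · subst hab
    simp only [compactMetric, Matrix.diagonal_apply_eq]
    refine Fin.cases ?_ (fun j => ?_) a
    · simp only [Fin.cons_zero]; unfold normSqSpace; fun_prop
    · simp only [Fin.cons_succ]; fun_prop
  · simp only [compactMetric, Matrix.diagonal_apply_ne _ hab]; fun_prop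

theorem contDiffAt_metricDiag {n : WithTop ℕ∞} (hx : x ∈ bulk d) (a : Fin (d + 1)) :
    ContDiffAt ℝ n (fun y => metricDiag ℓ y a) x := by
  have h := (conformalFactor_pos hx).ne'
  unfold metricDiag
  split_ifs
  · exact ((ContDiffAt.div (n := n) (x := x) (f := fun y => 2 - conformalFactor y) (g := conformalFactor)
      (by fun_prop) (by fun_prop) h).pow 2).neg
  · exact (ContDiffAt.div (n := n) (x := x) (f := fun _ => 2 * ℓ) (g := conformalFactor)
      (by fun_prop) (by fun_prop) h).pow 2

theorem contDiffAt_invMetricDiag {n : WithTop ℕ∞} (ℓ : ℝ) (x : Coord d) (a : Fin (d + 1)) :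
    ContDiffAt ℝ n (fun y => invMetricDiag ℓ y a) x := by
  have h2 := (two_sub_conformalFactor_pos x).ne'
  unfold invMetricDiag
  split_ifs
  · exact ((ContDiffAt.div (n := n) (x := x) (f := conformalFactor)
      (g := fun y => 2 - conformalFactor y) (by fun_prop) (by fun_prop) h2).pow 2).neg
  · fun_prop

theorem partialDeriv_metricDiag (hx : x ∈ bulk d) (a b : Fin (d + 1)) :
    partialDeriv b (fun y => metricDiag ℓ y a) x
      = 2 * logSlope x a * spatial x b * metricDiag ℓ x a := by
  have h := (conformalFactor_pos hx).ne'
  have h2 := (two_sub_conformalFactor_pos x).ne'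
  unfold metricDiag logSlope
  split_ifs
  · rw [partialDeriv_comp (f := conformalFactor) (φ := fun r => -((2 - r) / r) ^ 2)
      (φ' := 4 * (2 - conformalFactor x) / conformalFactor x ^ 3) ?_ (by fun_prop),
      partialDeriv_conformalFactor]
    · field_simp; try ring
    · have := (((hasDerivAt_id (conformalFactor x)).const_sub 2).div
        (hasDerivAt_id (conformalFactor x)) h).pow 2
      refine (this.neg).congr_deriv ?_
      simp only [id, Pi.div_apply, Nat.add_one_sub_one, pow_one, Nat.cast_ofNat]; field_simp; try ring
  · rw [partialDeriv_comp (f := conformalFactor) (φ := fun r => (2 * ℓ / r) ^ 2)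
      (φ' := -8 * ℓ ^ 2 / conformalFactor x ^ 3) ?_ (by fun_prop),
      partialDeriv_conformalFactor]
    · field_simp; try ring
    · have := ((hasDerivAt_const (conformalFactor x) (2 * ℓ)).div
        (hasDerivAt_id (conformalFactor x)) h).pow 2
      refine this.congr_deriv ?_
      simp only [id, Pi.div_apply, Nat.add_one_sub_one, pow_one, Nat.cast_ofNat]; field_simp; try ring

theorem partialDeriv_invMetricDiag (hℓ : ℓ ≠ 0) (hx : x ∈ bulk d) (a b : Fin (d + 1)) :
    partialDeriv b (fun y => invMetricDiag ℓ y a) x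
      = -2 * logSlope x a * spatial x b * invMetricDiag ℓ x a := by
  have h := (conformalFactor_pos hx).ne'
  have h2 := (two_sub_conformalFactor_pos x).ne'
  unfold invMetricDiag logSlope
  split_ifs
  · rw [partialDeriv_comp (f := conformalFactor) (φ := fun r => -(r / (2 - r)) ^ 2)
      (φ' := -4 * conformalFactor x / (2 - conformalFactor x) ^ 3) ?_ (by fun_prop),
      partialDeriv_conformalFactor]
    · field_simp; try ring
    · have := ((hasDerivAt_id (conformalFactor x)).div
        ((hasDerivAt_id (conformalFactor x)).const_sub 2) h2).pow 2
      refine (this.neg).congr_deriv ?_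
      simp only [id, Pi.div_apply, Nat.add_one_sub_one, pow_one, Nat.cast_ofNat]; field_simp; try ring
  · rw [partialDeriv_comp (f := conformalFactor) (φ := fun r => (r / (2 * ℓ)) ^ 2)
      (φ' := conformalFactor x / (2 * ℓ ^ 2)) ?_ (by fun_prop),
      partialDeriv_conformalFactor]
    · field_simp
    · have := ((hasDerivAt_id (conformalFactor x)).div_const (2 * ℓ)).pow 2
      refine this.congr_deriv ?_
      simp only [id, Nat.add_one_sub_one, pow_one, Nat.cast_ofNat]; field_simp; try ring

theorem partialDeriv_metric (hx : x ∈ bulk d) (a b c : Fin (d + 1)) :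
    partialDeriv c (fun y => metric d ℓ y a b) x
      = if a = b then 2 * logSlope x a * spatial x c * metricDiag ℓ x a else 0 := by
  rw [partialDeriv_congr (g := fun y => if a = b then metricDiag ℓ y a else 0)]
  · split_ifs
    · exact partialDeriv_metricDiag hx a c
    · simp
  · filter_upwards [bulk_mem_nhds hx] with y hy
    rw [metric_eq_diagonal hy, Matrix.diagonal_apply]

theorem christoffel_metric (hℓ : ℓ ≠ 0) (hx : x ∈ bulk d) (a b c : Fin (d + 1)) :
    christoffel (metric d ℓ) a b c x
      = (if a = c then logSlope x a * spatial x b else 0)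
        + (if a = b then logSlope x a * spatial x c else 0)
        - (if b = c then invMetricDiag ℓ x a * metricDiag ℓ x b * logSlope x b * spatial x a
            else 0) := by
  have h1 := metricDiag_mul_inv hℓ hx a
  simp only [christoffel, inv_metric hℓ hx, Matrix.diagonal_apply, partialDeriv_metric hx]
  rw [Finset.sum_eq_single a (fun e _ he => by simp [he.symm]) (by simp)]
  simp only [if_true]
  have h2 : ∀ z : ℝ, invMetricDiag ℓ x a * (z * metricDiag ℓ x a) = z := fun z => by
    linear_combination z * h1
  split_ifs <;> simp only [mul_add, mul_sub, h2] <;> ring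

theorem sum_christoffel_metric (hℓ : ℓ ≠ 0) (hx : x ∈ bulk d) (c : Fin (d + 1)) :
    ∑ a, christoffel (metric d ℓ) a a c x = (∑ a, logSlope x a) * spatial x c := by
  rw [Finset.sum_mul]
  refine Finset.sum_congr rfl fun a _ => ?_
  have h1 := metricDiag_mul_inv hℓ hx a
  rw [christoffel_metric hℓ hx]
  by_cases hac : a = c
  · subst hac; simp only [if_true]; linear_combination -(logSlope x a * spatial x a) * h1
  · simp [hac]

end Chart

/-! ### Linear functions of the ambient space and their gradients -/

section Ambient

variable {d : ℕ} {ℓ : ℝ} {x : Coord d}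

/-- Covectors `(p, q, v)` of the ambient space `ℝ^{2,d}` in which AdS is the hyperboloid
`-X₋₁² - X₀² + X₁² + ⋯ + X_d² = -ℓ²`. -/
abbrev Ambient (d : ℕ) : Type := ℝ × ℝ × (Fin d → ℝ)

/-- The factor `p cos (t / ℓ) + q sin (t / ℓ)`. -/
def timePart (ℓ : ℝ) (A : Ambient d) (x : Coord d) : ℝ :=
  A.1 * Real.cos (x 0 / ℓ) + A.2.1 * Real.sin (x 0 / ℓ)

/-- The derivative of `timePart` with respect to `t / ℓ`. -/
def timePartDeriv (ℓ : ℝ) (A : Ambient d) (x : Coord d) : ℝ :=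
  A.2.1 * Real.cos (x 0 / ℓ) - A.1 * Real.sin (x 0 / ℓ)

/-- The restriction to AdS of the linear function `p X₋₁ + q X₀ + v · X` of the ambient space. -/
def ambientFn (ℓ : ℝ) (A : Ambient d) (x : Coord d) : ℝ :=
  ℓ * ((2 / conformalFactor x - 1) * timePart ℓ A x
    + 2 / conformalFactor x * spaceDot A.2.2 x)

/-- The gradient of `ambientFn`. -/
def ambientGrad (ℓ : ℝ) (A : Ambient d) (x : Coord d) : Coord d :=
  Fin.cons (-(conformalFactor x / (2 - conformalFactor x)) * timePartDeriv ℓ A x) fun i =>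
    ℓ⁻¹ * (x i.succ * (timePart ℓ A x + spaceDot A.2.2 x) + conformalFactor x * A.2.2 i / 2)

/-- The derivative `∂_b K^a` of the field `K = ambientGrad`. -/
def ambientGradDeriv (ℓ : ℝ) (A : Ambient d) (x : Coord d) (a b : Fin (d + 1)) : ℝ :=
  (Fin.cons
    (Fin.cons (conformalFactor x * timePart ℓ A x / ((2 - conformalFactor x) * ℓ))
      fun i => timePartDeriv ℓ A x * 4 * x i.succ / (2 - conformalFactor x) ^ 2)
    fun i => Fin.cons (ℓ⁻¹ * (x i.succ * timePartDeriv ℓ A x / ℓ)) fun j =>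
      ℓ⁻¹ * ((if i = j then timePart ℓ A x + spaceDot A.2.2 x else 0)
        + x i.succ * A.2.2 j - x j.succ * A.2.2 i) :
    Fin (d + 1) → Fin (d + 1) → ℝ) a b

theorem ambientGrad_zero (ℓ : ℝ) (A : Ambient d) (x : Coord d) : ambientGrad ℓ A x 0
    = -(conformalFactor x / (2 - conformalFactor x)) * timePartDeriv ℓ A x := rfl

theorem ambientGrad_succ (ℓ : ℝ) (A : Ambient d) (x : Coord d) (i : Fin d) :
    ambientGrad ℓ A x i.succ = ℓ⁻¹ * (x i.succ * (timePart ℓ A x + spaceDot A.2.2 x)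
      + conformalFactor x * A.2.2 i / 2) := rfl

@[fun_prop]
theorem contDiff_timePart {n : WithTop ℕ∞} (ℓ : ℝ) (A : Ambient d) :
    ContDiff ℝ n (timePart ℓ A) := by
  unfold timePart; fun_prop

@[fun_prop]
theorem contDiff_timePartDeriv {n : WithTop ℕ∞} (ℓ : ℝ) (A : Ambient d) :
    ContDiff ℝ n (timePartDeriv ℓ A) := by
  unfold timePartDeriv; fun_prop

@[fun_prop]
theorem differentiable_timePart (ℓ : ℝ) (A : Ambient d) : Differentiable ℝ (timePart ℓ A) :=
  (contDiff_timePart (n := 1) ℓ A).differentiable (by norm_num)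

@[fun_prop]
theorem differentiable_timePartDeriv (ℓ : ℝ) (A : Ambient d) :
    Differentiable ℝ (timePartDeriv ℓ A) :=
  (contDiff_timePartDeriv (n := 1) ℓ A).differentiable (by norm_num)

theorem partialDeriv_timePart (ℓ : ℝ) (A : Ambient d) (a : Fin (d + 1)) (x : Coord d) :
    partialDeriv a (timePart ℓ A) x = if a = 0 then timePartDeriv ℓ A x / ℓ else 0 := by
  unfold timePart
  rw [partialDeriv_comp (f := fun y : Coord d => y 0)
    (φ := fun r => A.1 * Real.cos (r / ℓ) + A.2.1 * Real.sin (r / ℓ))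
    (φ' := timePartDeriv ℓ A x / ℓ) ?_ (by fun_prop), partialDeriv_coord]
  · simp
  · have h := (hasDerivAt_id (x 0)).div_const ℓ
    refine ((h.cos.const_mul A.1).add (h.sin.const_mul A.2.1)).congr_deriv ?_
    simp only [id, timePartDeriv]; ring

theorem partialDeriv_timePartDeriv (ℓ : ℝ) (A : Ambient d) (a : Fin (d + 1)) (x : Coord d) :
    partialDeriv a (timePartDeriv ℓ A) x = if a = 0 then -timePart ℓ A x / ℓ else 0 := by
  unfold timePartDeriv
  rw [partialDeriv_comp (f := fun y : Coord d => y 0)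
    (φ := fun r => A.2.1 * Real.cos (r / ℓ) - A.1 * Real.sin (r / ℓ))
    (φ' := -timePart ℓ A x / ℓ) ?_ (by fun_prop), partialDeriv_coord]
  · simp
  · have h := (hasDerivAt_id (x 0)).div_const ℓ
    refine ((h.cos.const_mul A.2.1).sub (h.sin.const_mul A.1)).congr_deriv ?_
    simp only [id, timePart]; ring

theorem contDiffAt_ambientFn {n : WithTop ℕ∞} (hx : x ∈ bulk d) (A : Ambient d) :
    ContDiffAt ℝ n (ambientFn ℓ A) x := by
  have h := (conformalFactor_pos hx).ne'
  have h1 : ContDiffAt ℝ n (fun y : Coord d => 2 / conformalFactor y) x :=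
    contDiffAt_const.div (contDiff_conformalFactor.contDiffAt) h
  exact contDiffAt_const.mul (((h1.sub contDiffAt_const).mul
    (contDiff_timePart ℓ A).contDiffAt).add (h1.mul (contDiff_spaceDot _).contDiffAt))

@[fun_prop]
theorem contDiff_ambientGrad {n : WithTop ℕ∞} (A : Ambient d) (a : Fin (d + 1)) :
    ContDiff ℝ n (fun x => ambientGrad ℓ A x a) := by
  refine Fin.cases ?_ (fun i => ?_) a
  · simp only [ambientGrad_zero]
    exact ((contDiff_conformalFactor.div (contDiff_const.sub contDiff_conformalFactor)
      fun x => (two_sub_conformalFactor_pos x).ne').neg).mul (contDiff_timePartDeriv ℓ A)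
  · simp only [ambientGrad_succ]; fun_prop

theorem partialDeriv_ambientGrad (A : Ambient d) (a b : Fin (d + 1)) (x : Coord d) :
    partialDeriv b (fun y => ambientGrad ℓ A y a) x = ambientGradDeriv ℓ A x a b := by
  have h2 := (two_sub_conformalFactor_pos x).ne'
  refine Fin.cases ?_ (fun i => ?_) a
  · simp only [ambientGrad_zero]
    have hφ : HasDerivAt (fun r : ℝ => -(r / (2 - r))) (-(2 / (2 - conformalFactor x) ^ 2))
        (conformalFactor x) := by
      have := ((hasDerivAt_id (conformalFactor x)).div
        ((hasDerivAt_id (conformalFactor x)).const_sub 2) h2).neg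
      refine this.congr_deriv ?_
      simp only [id]; ring
    have hd : DifferentiableAt ℝ (fun y : Coord d =>
        -(conformalFactor y / (2 - conformalFactor y))) x :=
      hφ.differentiableAt.comp x (differentiable_conformalFactor x)
    rw [partialDeriv_mul hd (by fun_prop), partialDeriv_comp (f := conformalFactor) (φ := fun r => -(r / (2 - r))) hφ
      (by fun_prop), partialDeriv_conformalFactor, partialDeriv_timePartDeriv]
    refine Fin.cases ?_ (fun j => ?_) b
    · simp [ambientGradDeriv, div_eq_mul_inv]; ring
    · simp [ambientGradDeriv]; ring
  · simp only [ambientGrad_succ]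
    rw [partialDeriv_const_mul _ (by fun_prop), partialDeriv_add (by fun_prop) (by fun_prop),
      partialDeriv_mul (by fun_prop) (by fun_prop), partialDeriv_coord,
      partialDeriv_add (by fun_prop) (by fun_prop), partialDeriv_timePart, partialDeriv_spaceDot]
    have : partialDeriv b (fun y : Coord d => conformalFactor y * A.2.2 i / 2) x
        = A.2.2 i / 2 * (-2 * spatial x b) := by
      rw [← partialDeriv_conformalFactor, ← partialDeriv_const_mul _ (by fun_prop)]
      congr 1; ext y; ring
    rw [this]
    refine Fin.cases ?_ (fun j => ?_) b
    · simp only [ambientGradDeriv, (Fin.succ_ne_zero _).symm, Fin.cons_succ, Fin.cons_zero,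
        spatial_zero, if_true, if_false]
      ring
    · simp only [Fin.succ_inj, spatial_succ, ambientGradDeriv, Fin.cons_succ, Fin.succ_ne_zero,
        if_false, eq_comm (a := j) (b := i)]
      split_ifs <;> ring

theorem sum_spatial_ambientGrad (A : Ambient d) (x : Coord d) :
    ∑ a, spatial x a * ambientGrad ℓ A x a
      = ℓ⁻¹ * ((1 - conformalFactor x) * (timePart ℓ A x + spaceDot A.2.2 x)
        + conformalFactor x * spaceDot A.2.2 x / 2) := by
  rw [Fin.sum_univ_succ, ← sum_sq_eq]
  simp only [spatial_zero, spatial_succ, ambientGrad_succ, zero_mul, zero_add]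
  conv_rhs => rw [mul_add, Finset.sum_mul, spaceDot, Finset.mul_sum, Finset.mul_sum,
    Finset.sum_div, Finset.mul_sum, ← Finset.sum_add_distrib]
  refine Finset.sum_congr rfl fun i _ => ?_
  simp only [spaceDot]; ring

theorem partialDeriv_ambientFn (hℓ : ℓ ≠ 0) (hx : x ∈ bulk d) (A : Ambient d)
    (a : Fin (d + 1)) :
    partialDeriv a (ambientFn ℓ A) x = metricDiag ℓ x a * ambientGrad ℓ A x a := by
  have h := (conformalFactor_pos hx).ne'
  have h2 := (two_sub_conformalFactor_pos x).ne'
  have hφ : HasDerivAt (fun r : ℝ => 2 / r) (-(2 / conformalFactor x ^ 2))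
      (conformalFactor x) := by
    refine ((hasDerivAt_const (conformalFactor x) (2 : ℝ)).div
      (hasDerivAt_id (conformalFactor x)) h).congr_deriv ?_
    simp only [id]; ring
  have hd : DifferentiableAt ℝ (fun y : Coord d => 2 / conformalFactor y) x :=
    hφ.differentiableAt.comp x (differentiable_conformalFactor x)
  have e1 : partialDeriv a (fun y : Coord d => 2 / conformalFactor y) x
      = 4 / conformalFactor x ^ 2 * spatial x a := by
    rw [partialDeriv_comp (f := conformalFactor) (φ := fun r => 2 / r) hφ (by fun_prop),
      partialDeriv_conformalFactor]; ring
  unfold ambientFn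
  have hd1 : DifferentiableAt ℝ (fun y : Coord d => 2 / conformalFactor y - 1) x :=
    hd.sub_const 1
  rw [partialDeriv_const_mul _ (by fun_prop), partialDeriv_add (by fun_prop) (by fun_prop),
    partialDeriv_mul hd1 (by fun_prop), partialDeriv_mul hd (by fun_prop),
    partialDeriv_sub hd (by fun_prop), e1, partialDeriv_const, partialDeriv_timePart,
    partialDeriv_spaceDot]
  refine Fin.cases ?_ (fun j => ?_) a
  · simp [metricDiag, ambientGrad_zero]; field_simp
  · simp [metricDiag, ambientGrad_succ]; field_simp; ring

/-- The gradient `K` of a linear function `f` of the ambient space is a closed conformal field: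
`∇_b K^a = (f / ℓ²) δ_b^a`. -/
theorem ambientGrad_covariant (hℓ : ℓ ≠ 0) (hx : x ∈ bulk d) (A : Ambient d)
    (a b : Fin (d + 1)) :
    ambientGradDeriv ℓ A x a b
        + ∑ m, christoffel (metric d ℓ) a b m x * ambientGrad ℓ A x m
      = if a = b then ambientFn ℓ A x / ℓ ^ 2 else 0 := by
  have h := (conformalFactor_pos hx).ne'
  have h2 := (two_sub_conformalFactor_pos x).ne'
  have key : ∑ m, christoffel (metric d ℓ) a b m x * ambientGrad ℓ A x m
      = logSlope x a * spatial x b * ambientGrad ℓ A x a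
        + (if a = b then logSlope x a * ∑ m, spatial x m * ambientGrad ℓ A x m else 0)
        - invMetricDiag ℓ x a * metricDiag ℓ x b * logSlope x b * spatial x a
          * ambientGrad ℓ A x b := by
    simp only [christoffel_metric hℓ hx, sub_mul, add_mul, Finset.sum_sub_distrib,
      Finset.sum_add_distrib, ite_mul, zero_mul, Finset.sum_ite_eq, Finset.mem_univ, if_true]
    congr 2
    split_ifs with hab
    · rw [Finset.mul_sum]; exact Finset.sum_congr rfl fun m _ => by ring
    · simp
  rw [key, sum_spatial_ambientGrad]
  refine Fin.cases ?_ (fun i => ?_) a <;> refine Fin.cases ?_ (fun j => ?_) b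
  · simp [logSlope, ambientGradDeriv, ambientFn]; field_simp; ring
  · simp [logSlope, ambientGradDeriv, ambientGrad_zero, invMetricDiag, metricDiag,
      (Fin.succ_ne_zero _).symm]
    field_simp; ring
  · simp [logSlope, ambientGradDeriv, ambientGrad_zero, invMetricDiag, metricDiag]
    field_simp; ring
  · simp only [logSlope, ambientGradDeriv, ambientGrad_succ, invMetricDiag, metricDiag,
      ambientFn, Fin.cons_succ, Fin.succ_ne_zero, if_false, spatial_succ, Fin.succ_inj]
    by_cases hij : i = j
    · subst hij; simp only [if_true]; field_simp; ring
    · simp only [hij, if_false]; field_simp; ring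

/-- The gradient `K` of a linear function `f` of the ambient space satisfies the conformal Killing
equation `L_K g⁻¹ = -2 (f / ℓ²) g⁻¹`. -/
theorem ambientGrad_conformalKilling (hℓ : ℓ ≠ 0) (hx : x ∈ bulk d) (A : Ambient d)
    (a c : Fin (d + 1)) :
    (if a = c then -2 * logSlope x a * invMetricDiag ℓ x a
        * ∑ b, spatial x b * ambientGrad ℓ A x b else 0)
      - invMetricDiag ℓ x c * ambientGradDeriv ℓ A x a c
      - invMetricDiag ℓ x a * ambientGradDeriv ℓ A x c a
      = if a = c then -2 * (ambientFn ℓ A x / ℓ ^ 2) * invMetricDiag ℓ x a else 0 := by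
  have h := (conformalFactor_pos hx).ne'
  have h2 := (two_sub_conformalFactor_pos x).ne'
  rw [sum_spatial_ambientGrad]
  refine Fin.cases ?_ (fun i => ?_) a <;> refine Fin.cases ?_ (fun j => ?_) c
  · simp [logSlope, ambientGradDeriv, ambientFn, invMetricDiag]; field_simp; ring
  · simp [ambientGradDeriv, invMetricDiag, (Fin.succ_ne_zero _).symm]
    field_simp; ring
  · simp [ambientGradDeriv, invMetricDiag]
    field_simp; ring
  · simp only [logSlope, ambientGradDeriv, invMetricDiag,
      ambientFn, Fin.cons_succ, Fin.succ_ne_zero, if_false, Fin.succ_inj]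
    by_cases hij : i = j
    · subst hij; simp only [if_true]; field_simp; ring
    · simp only [hij, if_false, Ne.symm hij]; field_simp; ring

/-- The ambient scalar product of two covectors. -/
def ambientInner (A B : Ambient d) : ℝ := -(A.1 * B.1) - A.2.1 * B.2.1 + ∑ i, A.2.2 i * B.2.2 i

/-- The gradient of a linear function is the projection of its ambient covector to the tangent space
of the hyperboloid, whose normal is the position vector `X` with `⟨X, X⟩ = -ℓ²`. -/
theorem inner_ambientGrad (hℓ : ℓ ≠ 0) (hx : x ∈ bulk d) (A B : Ambient d) :
    ∑ a, metricDiag ℓ x a * ambientGrad ℓ A x a * ambientGrad ℓ B x a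
      = ambientInner A B + ambientFn ℓ A x * ambientFn ℓ B x / ℓ ^ 2 := by
  have h := (conformalFactor_pos hx).ne'
  have h2 := (two_sub_conformalFactor_pos x).ne'
  have e : ∑ i : Fin d, (x i.succ * (timePart ℓ A x + spaceDot A.2.2 x)
        + conformalFactor x * A.2.2 i / 2)
      * (x i.succ * (timePart ℓ B x + spaceDot B.2.2 x) + conformalFactor x * B.2.2 i / 2)
      = (1 - conformalFactor x) * (timePart ℓ A x + spaceDot A.2.2 x)
          * (timePart ℓ B x + spaceDot B.2.2 x)
        + conformalFactor x / 2 * ((timePart ℓ A x + spaceDot A.2.2 x) * spaceDot B.2.2 x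
          + (timePart ℓ B x + spaceDot B.2.2 x) * spaceDot A.2.2 x)
        + conformalFactor x ^ 2 / 4 * ∑ i, A.2.2 i * B.2.2 i := by
    rw [← sum_sq_eq, Finset.sum_mul, Finset.sum_mul]
    conv_rhs => rw [mul_add, Finset.mul_sum]
    have e1 : spaceDot A.2.2 x = ∑ i, A.2.2 i * x i.succ := rfl
    have e2 : spaceDot B.2.2 x = ∑ i, B.2.2 i * x i.succ := rfl
    conv_rhs =>
      enter [1, 2]
      rw [show ∀ P Q : ℝ, conformalFactor x / 2 * (P * spaceDot B.2.2 x) +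
        conformalFactor x / 2 * (Q * spaceDot A.2.2 x)
          = ∑ i, (conformalFactor x / 2 * (P * (B.2.2 i * x i.succ)
            + Q * (A.2.2 i * x i.succ))) from fun P Q => by
          rw [← Finset.mul_sum, Finset.sum_add_distrib, ← Finset.mul_sum, ← Finset.mul_sum,
            ← e1, ← e2]; ring]
    rw [← Finset.sum_add_distrib, ← Finset.sum_add_distrib]
    exact Finset.sum_congr rfl fun i _ => by ring
  have e3 : ∑ i : Fin d, metricDiag ℓ x i.succ * ambientGrad ℓ A x i.succ
        * ambientGrad ℓ B x i.succ
      = 4 / conformalFactor x ^ 2 * ∑ i : Fin d, (x i.succ * (timePart ℓ A x + spaceDot A.2.2 x)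
        + conformalFactor x * A.2.2 i / 2)
      * (x i.succ * (timePart ℓ B x + spaceDot B.2.2 x) + conformalFactor x * B.2.2 i / 2) := by
    rw [Finset.mul_sum]
    refine Finset.sum_congr rfl fun i _ => ?_
    simp only [metricDiag, ambientGrad_succ, Fin.succ_ne_zero, if_false]; field_simp; ring
  have e4 : timePartDeriv ℓ A x * timePartDeriv ℓ B x
      = A.1 * B.1 + A.2.1 * B.2.1 - timePart ℓ A x * timePart ℓ B x := by
    simp only [timePart, timePartDeriv]
    linear_combination (A.1 * B.1 + A.2.1 * B.2.1) * Real.sin_sq_add_cos_sq (x 0 / ℓ)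
  rw [Fin.sum_univ_succ, e3, e, ambientInner]
  simp only [metricDiag, ambientGrad_zero, if_true, ambientFn]
  field_simp
  linear_combination (-2 * conformalFactor x ^ 2) * e4

end Ambient

/-! ### Curvature of anti-de Sitter space and the ambient form of geodesics -/

section Hessian

variable {d : ℕ} {ℓ : ℝ} {x : Coord d}

theorem christoffel_metric_symm (hℓ : ℓ ≠ 0) (hx : x ∈ bulk d) (a b c : Fin (d + 1)) :
    christoffel (metric d ℓ) a b c x = christoffel (metric d ℓ) a c b x := by
  rw [christoffel_metric hℓ hx, christoffel_metric hℓ hx]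
  by_cases hbc : b = c
  · subst hbc; rfl
  · simp only [hbc, Ne.symm hbc, if_false]; ring

theorem sum_mul_christoffel_metric (hℓ : ℓ ≠ 0) (hx : x ∈ bulk d) (w : Coord d)
    (a b : Fin (d + 1)) :
    ∑ c, christoffel (metric d ℓ) c a b x * w c
      = logSlope x b * spatial x a * w b + logSlope x a * spatial x b * w a
        - (if a = b then metricDiag ℓ x a * logSlope x a
            * ∑ c, spatial x c * (invMetricDiag ℓ x c * w c) else 0) := by
  simp only [christoffel_metric hℓ hx, sub_mul, add_mul, Finset.sum_sub_distrib,
    Finset.sum_add_distrib, ite_mul, zero_mul, Finset.sum_ite_eq', Finset.mem_univ, if_true]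
  congr 1
  split_ifs with hab
  · rw [Finset.mul_sum]; exact Finset.sum_congr rfl fun m _ => by subst hab; ring
  · simp

/-- The Hessian of a linear function `f` of the ambient space is `(f / ℓ²) g`. -/
theorem hessian_ambientFn (hℓ : ℓ ≠ 0) (hx : x ∈ bulk d) (A : Ambient d) (a b : Fin (d + 1)) :
    partialDeriv a (partialDeriv b (ambientFn ℓ A)) x
      = ∑ c, christoffel (metric d ℓ) c a b x * partialDeriv c (ambientFn ℓ A) x
        + ambientFn ℓ A x / ℓ ^ 2 * metric d ℓ x a b := by
  have e1 : partialDeriv a (partialDeriv b (ambientFn ℓ A)) x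
      = partialDeriv a (fun y => metricDiag ℓ y b * ambientGrad ℓ A y b) x := by
    refine partialDeriv_congr ?_
    filter_upwards [bulk_mem_nhds hx] with y hy
    exact partialDeriv_ambientFn hℓ hy A b
  have hg := metricDiag_mul_inv hℓ hx
  have e2 := ambientGrad_covariant hℓ hx A b a
  have key : ∑ m, christoffel (metric d ℓ) b a m x * ambientGrad ℓ A x m
      = logSlope x b * spatial x a * ambientGrad ℓ A x b
        + (if b = a then logSlope x b * ∑ m, spatial x m * ambientGrad ℓ A x m else 0)
        - invMetricDiag ℓ x b * metricDiag ℓ x a * logSlope x a * spatial x b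
          * ambientGrad ℓ A x a := by
    simp only [christoffel_metric hℓ hx, sub_mul, add_mul, Finset.sum_sub_distrib,
      Finset.sum_add_distrib, ite_mul, zero_mul, Finset.sum_ite_eq, Finset.mem_univ, if_true]
    congr 2
    split_ifs with hab
    · rw [Finset.mul_sum]; exact Finset.sum_congr rfl fun m _ => by ring
    · simp
  rw [e1, partialDeriv_mul ((contDiffAt_metricDiag (n := 1) hx b).differentiableAt (by norm_num))
    ((contDiff_ambientGrad (n := 1) A b).differentiable (by norm_num) x),
    partialDeriv_metricDiag hx, partialDeriv_ambientGrad, sum_mul_christoffel_metric hℓ hx,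
    metric_eq_diagonal hx, Matrix.diagonal_apply]
  simp only [partialDeriv_ambientFn hℓ hx]
  have e3 : ∑ c, spatial x c * (invMetricDiag ℓ x c * (metricDiag ℓ x c * ambientGrad ℓ A x c))
      = ∑ c, spatial x c * ambientGrad ℓ A x c :=
    Finset.sum_congr rfl fun c _ => by
      linear_combination (spatial x c * ambientGrad ℓ A x c) * hg c
  rw [e3]
  rw [key] at e2
  by_cases hab : a = b
  · subst hab
    simp only [if_true] at e2 ⊢
    linear_combination metricDiag ℓ x a * e2
      + (metricDiag ℓ x a * logSlope x a * spatial x a * ambientGrad ℓ A x a) * hg a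
  · simp only [hab, Ne.symm hab, if_false] at e2 ⊢
    linear_combination metricDiag ℓ x b * e2
      + (metricDiag ℓ x a * logSlope x a * spatial x b * ambientGrad ℓ A x a) * hg b

/-- The linear functions of the ambient space that vanish at a point of AdS have arbitrary
gradients there. -/
theorem exists_ambientGrad_eq (hℓ : ℓ ≠ 0) (hx : x ∈ bulk d) (k : Coord d) :
    ∃ A : Ambient d, ambientFn ℓ A x = 0 ∧ ambientGrad ℓ A x = k := by
  have h := (conformalFactor_pos hx).ne'
  have h2 := (two_sub_conformalFactor_pos x).ne'
  set Ω := conformalFactor x with hΩ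
  set m : ℝ := 2 * (2 - Ω) * ℓ / Ω ^ 2 * ∑ i : Fin d, k i.succ * x i.succ with hm
  set v : Fin d → ℝ := fun i => 2 * ℓ * k i.succ / Ω + 2 * x i.succ * m / (2 - Ω) with hv
  set T : ℝ := -2 * m / (2 - Ω) with hT
  set T' : ℝ := -k 0 * (2 - Ω) / Ω with hT'
  set C := Real.cos (x 0 / ℓ)
  set S := Real.sin (x 0 / ℓ)
  have hCS : S ^ 2 + C ^ 2 = 1 := Real.sin_sq_add_cos_sq _
  have hvm : spaceDot v x = m := by
    have : spaceDot v x = 2 * ℓ / Ω * (∑ i : Fin d, k i.succ * x i.succ)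
        + 2 * m / (2 - Ω) * ∑ i : Fin d, x i.succ ^ 2 := by
      rw [spaceDot, Finset.mul_sum, Finset.mul_sum, ← Finset.sum_add_distrib]
      exact Finset.sum_congr rfl fun i _ => by simp only [hv]; ring
    rw [this, sum_sq_eq, hm]; field_simp; ring
  refine ⟨(T * C - T' * S, T * S + T' * C, v), ?_, ?_⟩
  · have : timePart ℓ (T * C - T' * S, T * S + T' * C, v) x = T := by
      simp only [timePart]; linear_combination T * hCS
    rw [ambientFn, this, hvm, hT, ← hΩ]; field_simp; ring
  · have e1 : timePart ℓ (T * C - T' * S, T * S + T' * C, v) x = T := by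
      simp only [timePart]; linear_combination T * hCS
    have e2 : timePartDeriv ℓ (T * C - T' * S, T * S + T' * C, v) x = T' := by
      simp only [timePartDeriv]; linear_combination T' * hCS
    ext a
    refine Fin.cases ?_ (fun i => ?_) a
    · rw [ambientGrad_zero, e2, hT', ← hΩ]; field_simp
    · rw [ambientGrad_succ, e1, hvm, hT, ← hΩ]; simp only [hv]; field_simp; ring

/-- The linear functions vanishing at a point separate tangent vectors there. -/
theorem eq_zero_of_forall_ambientFn (hℓ : ℓ ≠ 0) (hx : x ∈ bulk d) {w : Coord d}
    (hw : ∀ A : Ambient d, ambientFn ℓ A x = 0 →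
      ∑ a, partialDeriv a (ambientFn ℓ A) x * w a = 0) : w = 0 := by
  ext b
  obtain ⟨A, hA0, hA⟩ := exists_ambientGrad_eq hℓ hx (Pi.single b (invMetricDiag ℓ x b))
  have := hw A hA0
  simp only [partialDeriv_ambientFn hℓ hx, hA] at this
  rw [Finset.sum_eq_single b (fun a _ ha => by simp [ha]) (by simp)] at this
  simpa [metricDiag_mul_inv hℓ hx] using this

theorem contDiffAt_christoffel_metric {n : WithTop ℕ∞} (hℓ : ℓ ≠ 0) (hx : x ∈ bulk d)
    (a b c : Fin (d + 1)) : ContDiffAt ℝ n (christoffel (metric d ℓ) a b c) x :=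
  contDiffAt_christoffel (n := n + 1) (fun a b => contDiffAt_metric hx a b)
    (det_metric_ne_zero hℓ hx) le_rfl a b c

theorem contDiffAt_partialDeriv_ambientFn {n : WithTop ℕ∞} (hx : x ∈ bulk d) (A : Ambient d)
    (a : Fin (d + 1)) : ContDiffAt ℝ n (partialDeriv a (ambientFn ℓ A)) x :=
  contDiffAt_partialDeriv (n := n + 1) (contDiffAt_ambientFn hx A) le_rfl

/-- The Riemann tensor of AdS, obtained by commuting third derivatives of the linear functions of
the ambient space. -/
theorem riemann_metric (hℓ : ℓ ≠ 0) (hx : x ∈ bulk d) (a b c m : Fin (d + 1)) :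
    partialDeriv c (christoffel (metric d ℓ) m a b) x
      - partialDeriv a (christoffel (metric d ℓ) m c b) x
      + ∑ n, (christoffel (metric d ℓ) n a b x * christoffel (metric d ℓ) m c n x
        - christoffel (metric d ℓ) n c b x * christoffel (metric d ℓ) m a n x)
      + ((if m = c then metric d ℓ x a b else 0) - (if m = a then metric d ℓ x c b else 0)) / ℓ ^ 2
      = 0 := by
  refine congrFun (eq_zero_of_forall_ambientFn (w := fun m =>
    partialDeriv c (christoffel (metric d ℓ) m a b) x
      - partialDeriv a (christoffel (metric d ℓ) m c b) x
      + ∑ n, (christoffel (metric d ℓ) n a b x * christoffel (metric d ℓ) m c n x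
        - christoffel (metric d ℓ) n c b x * christoffel (metric d ℓ) m a n x)
      + ((if m = c then metric d ℓ x a b else 0) - (if m = a then metric d ℓ x c b else 0))
        / ℓ ^ 2) hℓ hx fun A hA => ?_) m
  have third : ∀ a c, partialDeriv c (partialDeriv a (partialDeriv b (ambientFn ℓ A))) x
      = ∑ m, partialDeriv m (ambientFn ℓ A) x * (partialDeriv c (christoffel (metric d ℓ) m a b) x
          + ∑ n, christoffel (metric d ℓ) n a b x * christoffel (metric d ℓ) m c n x
          + (if m = c then metric d ℓ x a b else 0) / ℓ ^ 2) := by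
    intro a c
    have hc : ∀ m, DifferentiableAt ℝ (fun y => christoffel (metric d ℓ) m a b y
        * partialDeriv m (ambientFn ℓ A) y) x := fun m =>
      ((contDiffAt_christoffel_metric (n := 1) hℓ hx m a b).differentiableAt (by norm_num)).mul
      ((contDiffAt_partialDeriv_ambientFn (n := 1) hx A m).differentiableAt (by norm_num))
    have hf := (contDiffAt_ambientFn (ℓ := ℓ) (n := 1) hx A).differentiableAt (by norm_num)
    have hm := (contDiffAt_metric (ℓ := ℓ) (n := 1) hx a b).differentiableAt (by norm_num)
    have hfm : DifferentiableAt ℝ (fun y => ambientFn ℓ A y * metric d ℓ y a b) x := hf.mul hm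
    rw [partialDeriv_congr (g := fun y =>
        ∑ m, christoffel (metric d ℓ) m a b y * partialDeriv m (ambientFn ℓ A) y
          + (1 / ℓ ^ 2) * (ambientFn ℓ A y * metric d ℓ y a b)),
      partialDeriv_add (DifferentiableAt.fun_sum fun m _ => hc m) (hfm.const_mul _),
      partialDeriv_sum (fun m _ => hc m), partialDeriv_const_mul _ hfm,
      partialDeriv_mul hf hm, hA]
    · have e : ∀ m, partialDeriv c (fun y => christoffel (metric d ℓ) m a b y
          * partialDeriv m (ambientFn ℓ A) y) x
          = partialDeriv c (christoffel (metric d ℓ) m a b) x * partialDeriv m (ambientFn ℓ A) x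
            + christoffel (metric d ℓ) m a b x
              * ∑ n, christoffel (metric d ℓ) n c m x * partialDeriv n (ambientFn ℓ A) x := by
        intro m
        rw [partialDeriv_mul
          ((contDiffAt_christoffel_metric (n := 1) hℓ hx m a b).differentiableAt (by norm_num))
          ((contDiffAt_partialDeriv_ambientFn (n := 1) hx A m).differentiableAt (by norm_num)),
          hessian_ambientFn hℓ hx, hA]
        simp
      simp only [e, mul_add, Finset.sum_add_distrib, Finset.mul_sum]
      rw [Finset.sum_comm (f := fun m n => christoffel (metric d ℓ) m a b x
        * (christoffel (metric d ℓ) n c m x * partialDeriv n (ambientFn ℓ A) x))]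
      congr 1
      · congr 1
        · exact Finset.sum_congr rfl fun m _ => mul_comm _ _
        · exact Finset.sum_congr rfl fun m _ => Finset.sum_congr rfl fun n _ => by ring
      · simp [ite_div, mul_ite]; ring
    · filter_upwards [bulk_mem_nhds hx] with y hy
      rw [hessian_ambientFn hℓ hy]; ring
  have hcomm := partialDeriv_comm (a := c) a
    (contDiffAt_partialDeriv_ambientFn (ℓ := ℓ) (n := 2) hx A b)
  rw [third, third, ← sub_eq_zero, ← Finset.sum_sub_distrib] at hcomm
  refine Eq.trans ?_ hcomm
  refine Finset.sum_congr rfl fun m _ => ?_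
  rw [Finset.sum_sub_distrib]; ring

/-- AdS is an Einstein space. -/
theorem ricci_metric (hℓ : ℓ ≠ 0) (hx : x ∈ bulk d) (b c : Fin (d + 1)) :
    ricci (metric d ℓ) x b c = -(d / ℓ ^ 2) * metric d ℓ x b c := by
  have hs : metric d ℓ x c b = metric d ℓ x b c := by
    rw [metric_eq_diagonal hx, Matrix.diagonal_apply, Matrix.diagonal_apply]
    by_cases h : b = c
    · subst h; rfl
    · simp [h, Ne.symm h]
  have hpd : ∀ i a b c, partialDeriv i (christoffel (metric d ℓ) a b c) x
      = partialDeriv i (christoffel (metric d ℓ) a c b) x := fun i a b c =>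
    partialDeriv_congr (by
      filter_upwards [bulk_mem_nhds hx] with y hy using christoffel_metric_symm hℓ hy a b c)
  have h := Finset.sum_congr rfl fun a (_ : a ∈ Finset.univ) => riemann_metric hℓ hx c b a a
  simp only [if_true, Finset.sum_add_distrib, Finset.sum_const_zero] at h
  have h3 : ∑ a : Fin (d + 1), (metric d ℓ x c b - if a = c then metric d ℓ x a b else 0) / ℓ ^ 2
      = d / ℓ ^ 2 * metric d ℓ x b c := by
    rw [← Finset.sum_div, Finset.sum_sub_distrib]
    simp [hs]; ring
  rw [h3] at h
  simp only [ricci, Matrix.of_apply]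
  have e1 : ∑ a, (partialDeriv a (christoffel (metric d ℓ) a b c) x
        - partialDeriv c (christoffel (metric d ℓ) a b a) x)
      = ∑ a, (partialDeriv a (christoffel (metric d ℓ) a c b) x
        - partialDeriv c (christoffel (metric d ℓ) a a b) x) :=
    Finset.sum_congr rfl fun a _ => by rw [hpd a a b c, hpd c a b a]
  have e2 : ∑ a, ∑ e, (christoffel (metric d ℓ) a a e x * christoffel (metric d ℓ) e b c x
        - christoffel (metric d ℓ) a c e x * christoffel (metric d ℓ) e b a x)
      = ∑ a, ∑ e, (christoffel (metric d ℓ) e c b x * christoffel (metric d ℓ) a a e x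
        - christoffel (metric d ℓ) e a b x * christoffel (metric d ℓ) a c e x) :=
    Finset.sum_congr rfl fun a _ => Finset.sum_congr rfl fun e _ => by
      rw [christoffel_metric_symm hℓ hx e b c, christoffel_metric_symm hℓ hx e b a]; ring
  rw [e1, e2]
  linarith

theorem quad_metric (hx : x ∈ bulk d) (v : Coord d) :
    quad (metric d ℓ x) v = ∑ a, metricDiag ℓ x a * v a ^ 2 := by
  rw [metric_eq_diagonal hx]
  refine Finset.sum_congr rfl fun a _ => ?_
  simp only [Matrix.diagonal_apply, ite_mul, zero_mul, Finset.sum_ite_eq, Finset.mem_univ, if_true]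
  ring

/-- Along any curve `c`, the second derivative of a linear function of the ambient space is
`(f / ℓ²) g(c', c') + df(∇_{c'} c')`. -/
theorem hasDerivAt_ambientFn_velocity (hℓ : ℓ ≠ 0) (A : Ambient d) {c : ℝ → Coord d} {s : ℝ}
    (hc : ContDiff ℝ 2 c) (hs : c s ∈ bulk d) :
    HasDerivAt (fun s => ∑ a, deriv c s a * partialDeriv a (ambientFn ℓ A) (c s))
      (ambientFn ℓ A (c s) / ℓ ^ 2 * along (metric d ℓ) c s
        + ∑ a, acceleration (metric d ℓ) c s a * partialDeriv a (ambientFn ℓ A) (c s)) s := by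
  have h1 : HasDerivAt c (deriv c s) s :=
    (hc.differentiable (by norm_num) s).hasDerivAt
  have h2 : HasDerivAt (deriv c) (deriv (deriv c) s) s :=
    ((hc.iterate_deriv' 1 1).differentiable (by norm_num) s).hasDerivAt
  have h3 : ∀ a, HasDerivAt (fun s => deriv c s a) (deriv (deriv c) s a) s := fun a =>
    hasDerivAt_pi.1 h2 a
  have h4 : ∀ a, HasDerivAt (fun s => partialDeriv a (ambientFn ℓ A) (c s))
      (∑ b, deriv c s b * partialDeriv b (partialDeriv a (ambientFn ℓ A)) (c s)) s := fun a =>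
    hasDerivAt_comp_curve
      ((contDiffAt_partialDeriv_ambientFn (n := 1) hs A a).differentiableAt (by norm_num)) h1
  refine (HasDerivAt.fun_sum fun a _ => (h3 a).mul (h4 a)).congr_deriv ?_
  simp only [hessian_ambientFn hℓ hs, along, quad, acceleration]
  simp only [add_mul, mul_add, Finset.sum_add_distrib, Finset.mul_sum, Finset.sum_mul]
  have e1 : ∑ a, ∑ b, ∑ e, deriv c s a * (deriv c s b * (christoffel (metric d ℓ) e b a (c s)
        * partialDeriv e (ambientFn ℓ A) (c s)))
      = ∑ a, ∑ b, ∑ e, christoffel (metric d ℓ) a b e (c s) * deriv c s b * deriv c s e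
          * partialDeriv a (ambientFn ℓ A) (c s) := by
    rw [Finset.sum_congr rfl fun a _ => Finset.sum_comm, Finset.sum_comm]
    refine Finset.sum_congr rfl fun e _ => ?_
    rw [Finset.sum_comm]
    exact Finset.sum_congr rfl fun a _ => Finset.sum_congr rfl fun b _ => by ring
  have e2 : ∑ a, ∑ b, deriv c s a * (deriv c s b * (ambientFn ℓ A (c s) / ℓ ^ 2
        * metric d ℓ (c s) b a))
      = ∑ a, ∑ b, ambientFn ℓ A (c s) / ℓ ^ 2
          * (metric d ℓ (c s) a b * deriv c s a * deriv c s b) := by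
    rw [Finset.sum_comm]
    exact Finset.sum_congr rfl fun a _ => Finset.sum_congr rfl fun b _ => by ring
  rw [e1, e2]; ring

end Hessian

/-! ### First-order variation of the null curvature -/

section Variation

variable {d : ℕ} {ℓ : ℝ} {h : TensorField d} {γ η : ℝ → Coord d} {s : ℝ}

theorem IsAdmissible.contDiffAt (hh : IsAdmissible d ℓ h) {x : Coord d} (hx : x ∈ bulk d)
    (a b : Fin (d + 1)) : ContDiffAt ℝ 2 (fun y => h y a b) x := by
  obtain ⟨H, hH, hHh, -⟩ := hh.regular
  have hsub : bulk d ⊆ compactification d := fun y hy => le_of_lt (show normSqSpace y < 1 from hy)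
  have h1 : ContDiffAt ℝ 2 (fun y => H y a b) x :=
    (hH a b).contDiffAt (mem_of_superset (bulk_mem_nhds hx) hsub)
  have h2 : ContDiffAt ℝ 2 (fun y => (conformalFactor y ^ 2)⁻¹ * H y a b) x :=
    (ContDiffAt.inv (f := fun y : Coord d => conformalFactor y ^ 2) (by fun_prop)
      (pow_ne_zero 2 (conformalFactor_pos hx).ne')).mul h1
  refine h2.congr_of_eventuallyEq ?_
  filter_upwards [bulk_mem_nhds hx] with y hy
  have := (conformalFactor_pos hy).ne'
  rw [hHh y hy, Matrix.smul_apply, smul_eq_mul]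
  field_simp

theorem deriv_add_smul (hγ : Differentiable ℝ γ) (hη : Differentiable ℝ η) (ε s : ℝ) :
    deriv (γ + ε • η) s = deriv γ s + ε • deriv η s := by
  rw [deriv_add (hγ s) ((hη s).const_smul ε), deriv_const_smul _ (hη s)]

theorem along_add_smul (T : TensorField d) (hγ : Differentiable ℝ γ) (hη : Differentiable ℝ η)
    (ε s : ℝ) : along T (γ + ε • η) s
      = ∑ a, ∑ b, T (γ s + ε • η s) a b * (deriv γ s a + ε * deriv η s a)
        * (deriv γ s b + ε * deriv η s b) := by
  simp only [along, quad, deriv_add_smul hγ hη]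
  rfl

theorem hasDerivAt_affine (p q : ℝ) : HasDerivAt (fun ε : ℝ => p + ε * q) q 0 := by
  simpa using ((hasDerivAt_id (0 : ℝ)).mul_const q).const_add p

theorem continuousAt_line (p q : Coord d) : ContinuousAt (fun ε : ℝ => p + ε • q) 0 := by
  fun_prop

theorem along_perturbed (ε : ℝ) (c : ℝ → Coord d) (s : ℝ) :
    along (perturbed d ℓ h ε) c s = along (metric d ℓ) c s + ε * along h c s := by
  simp only [along, quad, perturbed, Matrix.add_apply, Matrix.smul_apply, smul_eq_mul, add_mul,
    Finset.sum_add_distrib, Finset.mul_sum]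
  congr 1
  exact Finset.sum_congr rfl fun a _ => Finset.sum_congr rfl fun b _ => by ring

/-- To first order the deviated curve `γ + ε η` changes `g(k, k)` by `-h(k, k)`. -/
theorem hasDerivAt_along_metric (hh : ∀ a b, ContinuousAt (fun y => h y a b) (γ s))
    (hγ : Differentiable ℝ γ) (hη : Differentiable ℝ η)
    (hnull : HasDerivAt (fun ε : ℝ => along (perturbed d ℓ h ε) (γ + ε • η) s) 0 0) :
    HasDerivAt (fun ε : ℝ => along (metric d ℓ) (γ + ε • η) s) (-along h γ s) 0 := by
  have hm : ContinuousAt (fun ε : ℝ => along h (γ + ε • η) s) 0 := by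
    simp only [along_add_smul h hγ hη]
    refine tendsto_finsetSum _ fun a _ => tendsto_finsetSum _ fun b _ => ?_
    refine ((ContinuousAt.comp_of_eq (f := fun ε : ℝ => γ s + ε • η s) (hh a b)
      (continuousAt_line _ _) (by simp)).mul (by fun_prop)).mul (by fun_prop)
  have h1 := hnull.sub (hasDerivAt_mul_of_continuousAt hm)
  simp only [zero_smul, add_zero, zero_sub] at h1
  refine h1.congr_of_eventuallyEq (Eventually.of_forall fun ε => ?_)
  simp only [Pi.sub_apply, along_perturbed]; ring

/-- The variation of `R_{ab} k^a k^b` does not depend on the deviation: since `R_{ab}` is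
proportional to `g_{ab}`, moving the curve contributes only through the null condition. -/
theorem hasDerivAt_along_ricci (hℓ : ℓ ≠ 0)
    (hh : ∀ x ∈ bulk d, ∀ a b, ContDiffAt ℝ 2 (fun y => h y a b) x)
    (hs : γ s ∈ bulk d) (hγ : Differentiable ℝ γ) (hη : Differentiable ℝ η)
    (hnull : HasDerivAt (fun ε : ℝ => along (perturbed d ℓ h ε) (γ + ε • η) s) 0 0) :
    HasDerivAt (fun ε : ℝ => along (ricci (perturbed d ℓ h ε)) (γ + ε • η) s)
      (d / ℓ ^ 2 * along h γ s + ∑ a, ∑ b, ricciVar (metric d ℓ) h 0 a b (γ s)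
        * deriv γ s a * deriv γ s b) 0 := by
  have hc := continuousAt_line (γ s) (η s)
  have h0 : γ s + (0 : ℝ) • η s = γ s := by simp
  have hd : ∀ a b, HasDerivAt (fun ε : ℝ => ricci (perturbed d ℓ h ε) (γ s + ε • η s) a b
      - ricci (metric d ℓ) (γ s + ε • η s) a b) (ricciVar (metric d ℓ) h 0 a b (γ s)) 0 :=
    fun a b => hasDerivAt_ricci_sub (fun a b => contDiffAt_metric hs a b) (hh _ hs)
      (det_metric_ne_zero hℓ hs) hc h0 a b
  have hz : ∀ a b, ricci (perturbed d ℓ h 0) (γ s + (0 : ℝ) • η s) a b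
      - ricci (metric d ℓ) (γ s + (0 : ℝ) • η s) a b = 0 := by
    intro a b
    have : perturbed d ℓ h 0 = metric d ℓ := by funext y; simp [perturbed]
    rw [this, sub_self]
  have h1 : HasDerivAt (fun ε : ℝ => ∑ a, ∑ b,
      (ricci (perturbed d ℓ h ε) (γ s + ε • η s) a b - ricci (metric d ℓ) (γ s + ε • η s) a b)
        * (deriv γ s a + ε * deriv η s a) * (deriv γ s b + ε * deriv η s b))
      (∑ a, ∑ b, ricciVar (metric d ℓ) h 0 a b (γ s) * deriv γ s a * deriv γ s b) 0 := by
    refine HasDerivAt.fun_sum fun a _ => HasDerivAt.fun_sum fun b _ => ?_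
    refine (((hd a b).mul (hasDerivAt_affine _ _)).mul (hasDerivAt_affine _ _)).congr_deriv ?_
    simp only [Pi.mul_apply, hz]
    ring
  have h2 := (hasDerivAt_along_metric (fun a b => (hh _ hs a b).continuousAt) hγ hη
    hnull).const_mul (-(d / ℓ ^ 2))
  refine ((h1.add h2).congr_deriv (by ring)).congr_of_eventuallyEq ?_
  have hb : ∀ᶠ ε : ℝ in 𝓝 0, γ s + ε • η s ∈ bulk d :=
    hc.tendsto.eventually (by rw [h0]; exact bulk_mem_nhds hs)
  filter_upwards [hb] with ε hε
  simp only [Pi.add_apply, along_add_smul _ hγ hη, ricci_metric hℓ hε, Finset.mul_sum,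
    ← Finset.sum_add_distrib]
  exact Finset.sum_congr rfl fun a _ => Finset.sum_congr rfl fun b _ => by ring

end Variation

/-! ### The Palatini expression contracted with a closed conformal field -/

section Contraction

variable {d : ℕ} {ℓ : ℝ} {h : TensorField d} {x : Coord d}

/-- The function `φ = h(K, K)` for the gradient `K` of a linear function of the ambient space. -/
def tiltDensity (ℓ : ℝ) (h : TensorField d) (A : Ambient d) (x : Coord d) : ℝ :=
  ∑ a, ∑ c, h x a c * ambientGrad ℓ A x a * ambientGrad ℓ A x c

/-- The covector `h(K, ·)`. -/
def contractLower (ℓ : ℝ) (h : TensorField d) (A : Ambient d) (a : Fin (d + 1))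
    (x : Coord d) : ℝ :=
  ∑ c, h x a c * ambientGrad ℓ A x c

/-- The vector field `W = h(K, ·)`, with its index raised. -/
def contractUpper (ℓ : ℝ) (h : TensorField d) (A : Ambient d) (a : Fin (d + 1))
    (x : Coord d) : ℝ :=
  invMetricDiag ℓ x a * contractLower ℓ h A a x

/-- Half the trace of `h`. -/
def halfTrace (ℓ : ℝ) (h : TensorField d) (x : Coord d) : ℝ :=
  1 / 2 * ∑ a, invMetricDiag ℓ x a * h x a a

/-- The contracted Christoffel symbols `Γ^a_{ab} = ∂_b log √|g|` of AdS. -/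
def traceChristoffel (b : Fin (d + 1)) (x : Coord d) : ℝ :=
  (∑ a, logSlope x a) * spatial x b

/-- The covariant divergence of a vector field on AdS. -/
def divergence (V : Fin (d + 1) → Coord d → ℝ) (x : Coord d) : ℝ :=
  ∑ a, partialDeriv a (V a) x + ∑ a, traceChristoffel a x * V a x

/-- The wave operator of AdS on functions. -/
def waveOp (ℓ : ℝ) (φ : Coord d → ℝ) : Coord d → ℝ :=
  divergence fun a x => invMetricDiag ℓ x a * partialDeriv a φ x

/-- The derivative of a function along `K`. -/
def derivAlong (ℓ : ℝ) (A : Ambient d) (u : Coord d → ℝ) (x : Coord d) : ℝ :=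
  ∑ b, ambientGrad ℓ A x b * partialDeriv b u x

theorem differentiableAt_ambientGrad (A : Ambient d) (a : Fin (d + 1)) (x : Coord d) :
    DifferentiableAt ℝ (fun y => ambientGrad ℓ A y a) x :=
  (contDiff_ambientGrad (n := 1) A a).differentiable (by norm_num) x

theorem contDiffAt_contractLower {n : WithTop ℕ∞} (hh : ∀ a b, ContDiffAt ℝ n (fun y => h y a b) x)
    (A : Ambient d) (a : Fin (d + 1)) : ContDiffAt ℝ n (contractLower ℓ h A a) x :=
  ContDiffAt.sum fun c _ => (hh a c).mul (contDiff_ambientGrad A c).contDiffAt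

theorem contDiffAt_contractUpper {n : WithTop ℕ∞} (hh : ∀ a b, ContDiffAt ℝ n (fun y => h y a b) x)
    (A : Ambient d) (a : Fin (d + 1)) : ContDiffAt ℝ n (contractUpper ℓ h A a) x :=
  (contDiffAt_invMetricDiag ℓ x a).mul (contDiffAt_contractLower hh A a)

theorem contDiffAt_tiltDensity {n : WithTop ℕ∞} (hh : ∀ a b, ContDiffAt ℝ n (fun y => h y a b) x)
    (A : Ambient d) : ContDiffAt ℝ n (tiltDensity ℓ h A) x :=
  ContDiffAt.sum fun a _ => ContDiffAt.sum fun c _ =>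
    ((hh a c).mul (contDiff_ambientGrad A a).contDiffAt).mul (contDiff_ambientGrad A c).contDiffAt

theorem contDiffAt_halfTrace {n : WithTop ℕ∞} (hh : ∀ a b, ContDiffAt ℝ n (fun y => h y a b) x) :
    ContDiffAt ℝ n (halfTrace ℓ h) x :=
  contDiffAt_const.mul (ContDiffAt.sum fun a _ => (contDiffAt_invMetricDiag ℓ x a).mul (hh a a))

theorem partialDeriv_contractLower (hh : ∀ a b, DifferentiableAt ℝ (fun y => h y a b) x)
    (A : Ambient d) (a b : Fin (d + 1)) :
    partialDeriv b (contractLower ℓ h A a) x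
      = ∑ c, (partialDeriv b (fun y => h y a c) x * ambientGrad ℓ A x c
        + h x a c * ambientGradDeriv ℓ A x c b) := by
  unfold contractLower
  rw [partialDeriv_sum fun c _ => (hh a c).fun_mul (differentiableAt_ambientGrad A c x)]
  refine Finset.sum_congr rfl fun c _ => ?_
  rw [partialDeriv_mul (hh a c) (differentiableAt_ambientGrad A c x), partialDeriv_ambientGrad]

theorem partialDeriv_tiltDensity (hh : ∀ a b, DifferentiableAt ℝ (fun y => h y a b) x)
    (hsymm : (h x).IsSymm) (A : Ambient d) (a : Fin (d + 1)) :
    partialDeriv a (tiltDensity ℓ h A) x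
      = (∑ b, ∑ c, partialDeriv a (fun y => h y b c) x * ambientGrad ℓ A x b * ambientGrad ℓ A x c)
        + 2 * ∑ b, contractLower ℓ h A b x * ambientGradDeriv ℓ A x b a := by
  have hK := fun b => differentiableAt_ambientGrad (ℓ := ℓ) A b x
  unfold tiltDensity
  rw [partialDeriv_sum fun b _ => DifferentiableAt.fun_sum fun c _ =>
    ((hh b c).fun_mul (hK b)).fun_mul (hK c)]
  have e : ∀ b, partialDeriv a (fun y => ∑ c, h y b c * ambientGrad ℓ A y b * ambientGrad ℓ A y c) x
      = ∑ c, (partialDeriv a (fun y => h y b c) x * ambientGrad ℓ A x b * ambientGrad ℓ A x c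
        + h x b c * ambientGradDeriv ℓ A x b a * ambientGrad ℓ A x c
        + h x b c * ambientGrad ℓ A x b * ambientGradDeriv ℓ A x c a) := by
    intro b
    rw [partialDeriv_sum fun c _ => ((hh b c).fun_mul (hK b)).fun_mul (hK c)]
    refine Finset.sum_congr rfl fun c _ => ?_
    have h1 : DifferentiableAt ℝ (fun y => h y b c * ambientGrad ℓ A y b) x := (hh b c).mul (hK b)
    rw [partialDeriv_mul h1 (hK c), partialDeriv_mul (hh b c) (hK b),
      partialDeriv_ambientGrad, partialDeriv_ambientGrad]
    ring
  simp only [e, Finset.sum_add_distrib, contractLower, Finset.sum_mul]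
  have e2 : ∑ b, ∑ c, h x b c * ambientGrad ℓ A x b * ambientGradDeriv ℓ A x c a
      = ∑ b, ∑ c, h x b c * ambientGrad ℓ A x c * ambientGradDeriv ℓ A x b a := by
    rw [Finset.sum_comm]
    exact Finset.sum_congr rfl fun b _ => Finset.sum_congr rfl fun c _ => by
      rw [hsymm.apply c b]
  have e3 : ∑ b, ∑ c, h x b c * ambientGradDeriv ℓ A x b a * ambientGrad ℓ A x c
      = ∑ b, ∑ c, h x b c * ambientGrad ℓ A x c * ambientGradDeriv ℓ A x b a :=
    Finset.sum_congr rfl fun b _ => Finset.sum_congr rfl fun c _ => by ring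
  rw [e2, e3]; ring

theorem connectionVar_zero_metric (hℓ : ℓ ≠ 0) (hx : x ∈ bulk d) (a b c : Fin (d + 1)) :
    connectionVar (metric d ℓ) h 0 a b c x
      = invMetricDiag ℓ x a * connectionVarLower (metric d ℓ) h a b c x := by
  simp only [connectionVar, zero_smul, add_zero, inv_metric hℓ hx, Matrix.diagonal_apply,
    ite_mul, zero_mul, Finset.sum_ite_eq, Finset.mem_univ, if_true]

theorem connectionVar_symm (hℓ : ℓ ≠ 0) (hsymm : ∀ x ∈ bulk d, (h x).IsSymm) (hx : x ∈ bulk d)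
    (a b c : Fin (d + 1)) :
    connectionVar (metric d ℓ) h 0 a b c x = connectionVar (metric d ℓ) h 0 a c b x := by
  rw [connectionVar_zero_metric hℓ hx, connectionVar_zero_metric hℓ hx]
  have e : partialDeriv a (fun y => h y b c) x = partialDeriv a (fun y => h y c b) x :=
    partialDeriv_congr (by
      filter_upwards [bulk_mem_nhds hx] with y hy using (hsymm y hy).apply c b)
  simp only [connectionVarLower, firstKind, e]
  rw [Finset.sum_congr rfl fun f _ => by rw [christoffel_metric_symm hℓ hx f b c]]
  ring

/-- The covector `½ (2 ∇_K h_{Ka} - ∇_a h_{KK})` in terms of ordinary derivatives only. -/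
theorem sum_connectionVarLower (hℓ : ℓ ≠ 0) (hx : x ∈ bulk d)
    (hh : ∀ a b, DifferentiableAt ℝ (fun y => h y a b) x) (hsymm : (h x).IsSymm)
    (A : Ambient d) (a : Fin (d + 1)) :
    ∑ b, ∑ c, connectionVarLower (metric d ℓ) h a b c x * ambientGrad ℓ A x b
        * ambientGrad ℓ A x c
      = derivAlong ℓ A (contractLower ℓ h A a) x
        + ∑ b, contractLower ℓ h A b x * ambientGradDeriv ℓ A x b a
        - ambientFn ℓ A x / ℓ ^ 2 * contractLower ℓ h A a x
        - 1 / 2 * partialDeriv a (tiltDensity ℓ h A) x := by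
  set K := ambientGrad ℓ A x with hK
  have hΓ : ∀ f b, ∑ c, christoffel (metric d ℓ) f b c x * K c
      = (if f = b then ambientFn ℓ A x / ℓ ^ 2 else 0) - ambientGradDeriv ℓ A x f b := fun f b => by
    rw [← ambientGrad_covariant hℓ hx A f b]; ring
  have e1 : ∑ b, ∑ c, partialDeriv c (fun y => h y a b) x * K b * K c
      = ∑ b, ∑ c, partialDeriv b (fun y => h y a c) x * K b * K c := by
    rw [Finset.sum_comm]
    exact Finset.sum_congr rfl fun b _ => Finset.sum_congr rfl fun c _ => by ring
  have e2 : ∑ b, ∑ c, (∑ f, h x a f * christoffel (metric d ℓ) f b c x) * K b * K c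
      = ambientFn ℓ A x / ℓ ^ 2 * contractLower ℓ h A a x
        - ∑ b, ∑ f, h x a f * ambientGradDeriv ℓ A x f b * K b := by
    have : ∀ b, ∑ c, (∑ f, h x a f * christoffel (metric d ℓ) f b c x) * K b * K c
        = ambientFn ℓ A x / ℓ ^ 2 * (h x a b * K b)
          - ∑ f, h x a f * ambientGradDeriv ℓ A x f b * K b := by
      intro b
      simp only [Finset.sum_mul]
      rw [Finset.sum_comm]
      have : ∀ f, ∑ c, h x a f * christoffel (metric d ℓ) f b c x * K b * K c
          = h x a f * K b * (if f = b then ambientFn ℓ A x / ℓ ^ 2 else 0)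
            - h x a f * ambientGradDeriv ℓ A x f b * K b := by
        intro f
        rw [show h x a f * K b * (if f = b then ambientFn ℓ A x / ℓ ^ 2 else 0)
            - h x a f * ambientGradDeriv ℓ A x f b * K b = h x a f * K b *
            ((if f = b then ambientFn ℓ A x / ℓ ^ 2 else 0) - ambientGradDeriv ℓ A x f b) by ring,
          ← hΓ, Finset.mul_sum]
        exact Finset.sum_congr rfl fun c _ => by ring
      simp only [this, Finset.sum_sub_distrib, mul_ite, mul_zero, Finset.sum_ite_eq',
        Finset.mem_univ, if_true]
      ring
    simp only [this, Finset.sum_sub_distrib, ← Finset.mul_sum]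
    rfl
  have e3 : derivAlong ℓ A (contractLower ℓ h A a) x
      = (∑ b, ∑ c, partialDeriv b (fun y => h y a c) x * K b * K c)
        + ∑ b, ∑ f, h x a f * ambientGradDeriv ℓ A x f b * K b := by
    simp only [derivAlong, partialDeriv_contractLower hh, ← Finset.sum_add_distrib,
      Finset.mul_sum, ← hK]
    exact Finset.sum_congr rfl fun b _ => Finset.sum_congr rfl fun c _ => by ring
  have e4 : ∑ b, ∑ c, connectionVarLower (metric d ℓ) h a b c x * K b * K c
      = 1 / 2 * ((∑ b, ∑ c, partialDeriv b (fun y => h y a c) x * K b * K c)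
          + (∑ b, ∑ c, partialDeriv c (fun y => h y a b) x * K b * K c)
          - ∑ b, ∑ c, partialDeriv a (fun y => h y b c) x * K b * K c)
        - ∑ b, ∑ c, (∑ f, h x a f * christoffel (metric d ℓ) f b c x) * K b * K c := by
    simp only [← Finset.sum_add_distrib, ← Finset.sum_sub_distrib, Finset.mul_sum]
    refine Finset.sum_congr rfl fun b _ => Finset.sum_congr rfl fun c _ => ?_
    simp only [connectionVarLower, firstKind]
    rw [show ∑ f, h x a f * christoffel (metric d ℓ) f b c x
      = ∑ i, h x a i * christoffel (metric d ℓ) i b c x from rfl]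
    ring
  rw [e4, e1, e2, e3, partialDeriv_tiltDensity hh hsymm]
  ring

/-- The vector `V^a = C^a_{bc} K^b K^c` equals `[K, W] + (f / ℓ²) W - ½ ∇φ`. -/
theorem sum_connectionVar (hℓ : ℓ ≠ 0) (hx : x ∈ bulk d)
    (hh : ∀ a b, DifferentiableAt ℝ (fun y => h y a b) x) (hsymm : (h x).IsSymm)
    (A : Ambient d) (a : Fin (d + 1)) :
    ∑ b, ∑ c, connectionVar (metric d ℓ) h 0 a b c x * ambientGrad ℓ A x b * ambientGrad ℓ A x c
      = derivAlong ℓ A (contractUpper ℓ h A a) x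
        - ∑ b, contractUpper ℓ h A b x * ambientGradDeriv ℓ A x a b
        + ambientFn ℓ A x / ℓ ^ 2 * contractUpper ℓ h A a x
        - 1 / 2 * (invMetricDiag ℓ x a * partialDeriv a (tiltDensity ℓ h A) x) := by
  have e1 : ∑ b, ∑ c, connectionVar (metric d ℓ) h 0 a b c x * ambientGrad ℓ A x b
        * ambientGrad ℓ A x c
      = invMetricDiag ℓ x a * ∑ b, ∑ c, connectionVarLower (metric d ℓ) h a b c x
        * ambientGrad ℓ A x b * ambientGrad ℓ A x c := by
    simp only [connectionVar_zero_metric hℓ hx, Finset.mul_sum]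
    exact Finset.sum_congr rfl fun b _ => Finset.sum_congr rfl fun c _ => by ring
  have hL : DifferentiableAt ℝ (contractLower ℓ h A a) x :=
    DifferentiableAt.fun_sum fun c _ => (hh a c).mul (differentiableAt_ambientGrad A c x)
  have e2 : derivAlong ℓ A (contractUpper ℓ h A a) x
      = invMetricDiag ℓ x a * derivAlong ℓ A (contractLower ℓ h A a) x
        + (-2 * logSlope x a * invMetricDiag ℓ x a * ∑ b, spatial x b * ambientGrad ℓ A x b)
          * contractLower ℓ h A a x := by
    simp only [derivAlong, Finset.mul_sum, Finset.sum_mul, ← Finset.sum_add_distrib]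
    refine Finset.sum_congr rfl fun b _ => ?_
    have : partialDeriv b (contractUpper ℓ h A a) x
        = partialDeriv b (fun y => invMetricDiag ℓ y a) x * contractLower ℓ h A a x
          + invMetricDiag ℓ x a * partialDeriv b (contractLower ℓ h A a) x :=
      partialDeriv_mul ((contDiffAt_invMetricDiag (n := 1) ℓ x a).differentiableAt (by norm_num)) hL
    rw [this, partialDeriv_invMetricDiag hℓ hx]
    ring
  have e3 : invMetricDiag ℓ x a * ∑ b, contractLower ℓ h A b x * ambientGradDeriv ℓ A x b a
      = (-2 * logSlope x a * invMetricDiag ℓ x a * ∑ b, spatial x b * ambientGrad ℓ A x b)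
          * contractLower ℓ h A a x
        + 2 * (ambientFn ℓ A x / ℓ ^ 2) * contractUpper ℓ h A a x
        - ∑ b, contractUpper ℓ h A b x * ambientGradDeriv ℓ A x a b := by
    have hk : ∀ b, invMetricDiag ℓ x a * (contractLower ℓ h A b x * ambientGradDeriv ℓ A x b a)
        = (if a = b then ((-2 * logSlope x a * invMetricDiag ℓ x a
            * ∑ b, spatial x b * ambientGrad ℓ A x b)
              + 2 * (ambientFn ℓ A x / ℓ ^ 2) * invMetricDiag ℓ x a) * contractLower ℓ h A b x
            else 0)
          - contractUpper ℓ h A b x * ambientGradDeriv ℓ A x a b := by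
      intro b
      have := ambientGrad_conformalKilling hℓ hx A a b
      unfold contractUpper
      split_ifs at this ⊢ with hab
      · linear_combination (-contractLower ℓ h A b x) * this
      · linear_combination (-contractLower ℓ h A b x) * this
    rw [Finset.mul_sum]
    simp only [hk, Finset.sum_sub_distrib, Finset.sum_ite_eq, Finset.mem_univ, if_true]
    unfold contractUpper; ring
  rw [e1, sum_connectionVarLower hℓ hx hh hsymm, e2]
  unfold contractUpper at e3 ⊢
  linear_combination e3

end Contraction

/-! ### Divergences and the wave operator -/

section Divergence

variable {d : ℕ} {ℓ : ℝ} {h : TensorField d} {x : Coord d}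

theorem contDiffAt_traceChristoffel {n : WithTop ℕ∞} (hx : x ∈ bulk d) (a : Fin (d + 1)) :
    ContDiffAt ℝ n (traceChristoffel a) x := by
  have h1 := (conformalFactor_pos hx).ne'
  have h2 := (two_sub_conformalFactor_pos x).ne'
  refine ContDiffAt.mul (ContDiffAt.sum fun b _ => ?_) ?_
  · unfold logSlope
    split_ifs
    · exact contDiffAt_const.div (contDiff_conformalFactor.mul
        (contDiff_const.sub contDiff_conformalFactor)).contDiffAt (mul_ne_zero h1 h2)
    · exact contDiffAt_const.div contDiff_conformalFactor.contDiffAt h1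
  · unfold spatial; split_ifs <;> fun_prop

theorem partialDeriv_traceChristoffel_symm (hx : x ∈ bulk d) (a b : Fin (d + 1)) :
    partialDeriv b (traceChristoffel a) x = partialDeriv a (traceChristoffel b) x := by
  have h1 := (conformalFactor_pos hx).ne'
  have h2 := (two_sub_conformalFactor_pos x).ne'
  obtain ⟨M', hM'⟩ : ∃ M', ∀ b, partialDeriv b (fun y => ∑ a : Fin (d + 1), logSlope y a) x
      = M' * spatial x b := by
    have hm : ∀ a : Fin (d + 1), ∃ m, HasDerivAt (fun r : ℝ =>
        if a = 0 then 4 / (r * (2 - r)) else 2 / r) m (conformalFactor x) := by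
      intro a
      by_cases ha : a = 0
      · simp only [ha, if_true]
        exact ⟨_, (hasDerivAt_const _ _).div ((hasDerivAt_id _).mul ((hasDerivAt_id _).const_sub 2))
          (mul_ne_zero h1 h2)⟩
      · simp only [ha, if_false]
        exact ⟨_, (hasDerivAt_const _ _).div (hasDerivAt_id _) h1⟩
    choose m hm using hm
    refine ⟨-2 * ∑ a, m a, fun b => ?_⟩
    have e : ∀ a : Fin (d + 1), partialDeriv b (fun y => logSlope y a) x
        = m a * (-2 * spatial x b) := by
      intro a
      rw [← partialDeriv_conformalFactor]
      exact partialDeriv_comp (f := conformalFactor) (hm a) (by fun_prop)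
    rw [partialDeriv_sum fun a _ => ?_]
    · simp only [e, ← Finset.sum_mul]; ring
    · exact (hm a).differentiableAt.comp (f := conformalFactor) x (by fun_prop)
  have hd : DifferentiableAt ℝ (fun y => ∑ a : Fin (d + 1), logSlope y a) x := by
    refine DifferentiableAt.fun_sum fun b _ => ?_
    unfold logSlope
    split_ifs
    · exact (ContDiffAt.div (n := 1) contDiffAt_const (contDiff_conformalFactor.mul
        (contDiff_const.sub contDiff_conformalFactor)).contDiffAt
        (mul_ne_zero h1 h2)).differentiableAt (by norm_num)
    · exact (ContDiffAt.div (n := 1) contDiffAt_const contDiff_conformalFactor.contDiffAt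
        h1).differentiableAt (by norm_num)
  have hs : ∀ a, DifferentiableAt ℝ (fun y : Coord d => spatial y a) x := by
    intro a; unfold spatial; split_ifs <;> fun_prop
  have hsp : ∀ a b, partialDeriv b (fun y : Coord d => spatial y a) x
      = if a = 0 then 0 else if a = b then 1 else 0 := by
    intro a b
    unfold spatial
    split_ifs with h3 h4
    · simp
    · rw [partialDeriv_coord, if_pos h4.symm]
    · rw [partialDeriv_coord, if_neg (Ne.symm h4)]
  unfold traceChristoffel
  rw [partialDeriv_mul hd (hs a), partialDeriv_mul hd (hs b), hM', hM', hsp, hsp]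
  by_cases hab : a = b
  · subst hab; rfl
  · simp only [hab, Ne.symm hab, if_false, ite_self]; ring

theorem divergence_congr {V U : Fin (d + 1) → Coord d → ℝ} (hVU : ∀ a, V a =ᶠ[𝓝 x] U a) :
    divergence V x = divergence U x := by
  simp only [divergence, partialDeriv_congr (hVU _), (hVU _).self_of_nhds]

theorem divergence_add {V U : Fin (d + 1) → Coord d → ℝ} (hV : ∀ a, DifferentiableAt ℝ (V a) x)
    (hU : ∀ a, DifferentiableAt ℝ (U a) x) :
    divergence (fun a y => V a y + U a y) x = divergence V x + divergence U x := by
  simp only [divergence, partialDeriv_add (hV _) (hU _), Finset.sum_add_distrib, mul_add]; ring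

theorem divergence_mul {V : Fin (d + 1) → Coord d → ℝ} {u : Coord d → ℝ}
    (hu : DifferentiableAt ℝ u x) (hV : ∀ a, DifferentiableAt ℝ (V a) x) :
    divergence (fun a y => u y * V a y) x
      = ∑ a, V a x * partialDeriv a u x + u x * divergence V x := by
  simp only [divergence, partialDeriv_mul hu (hV _), mul_add, Finset.mul_sum,
    Finset.sum_add_distrib]
  rw [add_assoc]
  congr 1
  · exact Finset.sum_congr rfl fun a _ => mul_comm _ _
  · congr 1; exact Finset.sum_congr rfl fun a _ => by ring

theorem differentiableAt_partialDeriv {u : Coord d → ℝ} (hu : ContDiffAt ℝ 2 u x)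
    (a : Fin (d + 1)) : DifferentiableAt ℝ (partialDeriv a u) x :=
  (contDiffAt_partialDeriv (m := 1) hu (by norm_num)).differentiableAt (by norm_num)

theorem contDiffAt_divergence {V : Fin (d + 1) → Coord d → ℝ} (hx : x ∈ bulk d)
    (hV : ∀ a, ContDiffAt ℝ 2 (V a) x) : ContDiffAt ℝ 1 (divergence V) x :=
  (ContDiffAt.sum fun a _ => contDiffAt_partialDeriv (m := 1) (hV a) (by norm_num)).add
    (ContDiffAt.sum fun a _ => (contDiffAt_traceChristoffel hx a).mul
      ((hV a).of_le (by norm_num)))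

theorem partialDeriv_divergence {V : Fin (d + 1) → Coord d → ℝ} (hx : x ∈ bulk d)
    (hV : ∀ a, ContDiffAt ℝ 2 (V a) x) (b : Fin (d + 1)) :
    partialDeriv b (divergence V) x
      = ∑ a, (partialDeriv a (partialDeriv b (V a)) x
        + partialDeriv b (traceChristoffel a) x * V a x
        + traceChristoffel a x * partialDeriv b (V a) x) := by
  have h1 : ∀ a, DifferentiableAt ℝ (V a) x := fun a => (hV a).differentiableAt (by norm_num)
  have h2 : ∀ a, DifferentiableAt ℝ (traceChristoffel a) x := fun a =>
    (contDiffAt_traceChristoffel (n := 1) hx a).differentiableAt (by norm_num)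
  unfold divergence
  rw [partialDeriv_add (DifferentiableAt.fun_sum fun a _ => differentiableAt_partialDeriv (hV a) a)
      (DifferentiableAt.fun_sum fun a _ => (h2 a).fun_mul (h1 a)),
    partialDeriv_sum fun a _ => differentiableAt_partialDeriv (hV a) a,
    partialDeriv_sum fun a _ => (h2 a).fun_mul (h1 a), ← Finset.sum_add_distrib]
  refine Finset.sum_congr rfl fun a _ => ?_
  rw [partialDeriv_mul (h2 a) (h1 a), partialDeriv_comm a (hV a)]; ring

/-- The divergence of a commutator: `div [K, W] = K (div W) - W (div K)`. -/
theorem divergence_bracket {K W : Fin (d + 1) → Coord d → ℝ} (hx : x ∈ bulk d)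
    (hK : ∀ a, ContDiffAt ℝ 2 (K a) x) (hW : ∀ a, ContDiffAt ℝ 2 (W a) x) :
    divergence (fun a y => ∑ b, (K b y * partialDeriv b (W a) y - W b y * partialDeriv b (K a) y)) x
      = ∑ b, K b x * partialDeriv b (divergence W) x
        - ∑ b, W b x * partialDeriv b (divergence K) x := by
  have k1 : ∀ a, DifferentiableAt ℝ (K a) x := fun a => (hK a).differentiableAt (by norm_num)
  have w1 : ∀ a, DifferentiableAt ℝ (W a) x := fun a => (hW a).differentiableAt (by norm_num)
  have k2 := fun a b => differentiableAt_partialDeriv (hK a) b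
  have w2 := fun a b => differentiableAt_partialDeriv (hW a) b
  have e : ∀ a, partialDeriv a (fun y => ∑ b, (K b y * partialDeriv b (W a) y
        - W b y * partialDeriv b (K a) y)) x
      = ∑ b, (partialDeriv a (K b) x * partialDeriv b (W a) x
        + K b x * partialDeriv a (partialDeriv b (W a)) x
        - (partialDeriv a (W b) x * partialDeriv b (K a) x
        + W b x * partialDeriv a (partialDeriv b (K a)) x)) := by
    intro a
    rw [partialDeriv_sum fun b _ => ((k1 b).fun_mul (w2 a b)).fun_sub ((w1 b).fun_mul (k2 a b))]
    refine Finset.sum_congr rfl fun b _ => ?_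
    rw [partialDeriv_sub ((k1 b).fun_mul (w2 a b)) ((w1 b).fun_mul (k2 a b)),
      partialDeriv_mul (k1 b) (w2 a b), partialDeriv_mul (w1 b) (k2 a b)]
  have e2 : ∑ a, ∑ b, (partialDeriv a (K b) x * partialDeriv b (W a) x
        - partialDeriv a (W b) x * partialDeriv b (K a) x) = 0 := by
    simp only [Finset.sum_sub_distrib]
    rw [sub_eq_zero, Finset.sum_comm]
    exact Finset.sum_congr rfl fun a _ => Finset.sum_congr rfl fun b _ => mul_comm _ _
  have e3 : ∑ b, ∑ a, (K b x * (partialDeriv b (traceChristoffel a) x * W a x)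
        - W b x * (partialDeriv b (traceChristoffel a) x * K a x)) = 0 := by
    simp only [Finset.sum_sub_distrib]
    rw [sub_eq_zero, Finset.sum_comm]
    refine Finset.sum_congr rfl fun a _ => Finset.sum_congr rfl fun b _ => ?_
    rw [partialDeriv_traceChristoffel_symm hx a b]; ring
  have lhs : divergence (fun a y => ∑ b, (K b y * partialDeriv b (W a) y
        - W b y * partialDeriv b (K a) y)) x
      = ∑ b, ∑ a, (K b x * (partialDeriv a (partialDeriv b (W a)) x
          + traceChristoffel a x * partialDeriv b (W a) x)
          - W b x * (partialDeriv a (partialDeriv b (K a)) x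
          + traceChristoffel a x * partialDeriv b (K a) x))
        + ∑ a, ∑ b, (partialDeriv a (K b) x * partialDeriv b (W a) x
        - partialDeriv a (W b) x * partialDeriv b (K a) x) := by
    rw [Finset.sum_comm, ← Finset.sum_add_distrib]
    unfold divergence
    rw [← Finset.sum_add_distrib]
    refine Finset.sum_congr rfl fun a _ => ?_
    rw [e, Finset.mul_sum, ← Finset.sum_add_distrib, ← Finset.sum_add_distrib]
    exact Finset.sum_congr rfl fun b _ => by ring
  have rhs : ∑ b, K b x * partialDeriv b (divergence W) x
        - ∑ b, W b x * partialDeriv b (divergence K) x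
      = ∑ b, ∑ a, (K b x * (partialDeriv a (partialDeriv b (W a)) x
          + traceChristoffel a x * partialDeriv b (W a) x)
          - W b x * (partialDeriv a (partialDeriv b (K a)) x
          + traceChristoffel a x * partialDeriv b (K a) x))
        + ∑ b, ∑ a, (K b x * (partialDeriv b (traceChristoffel a) x * W a x)
        - W b x * (partialDeriv b (traceChristoffel a) x * K a x)) := by
    rw [← Finset.sum_sub_distrib, ← Finset.sum_add_distrib]
    refine Finset.sum_congr rfl fun b _ => ?_
    rw [partialDeriv_divergence hx hW, partialDeriv_divergence hx hK, Finset.mul_sum,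
      Finset.mul_sum, ← Finset.sum_sub_distrib, ← Finset.sum_add_distrib]
    exact Finset.sum_congr rfl fun a _ => by ring
  rw [lhs, rhs, e2, e3]

theorem divergence_ambientGrad (hℓ : ℓ ≠ 0) (hx : x ∈ bulk d) (A : Ambient d) :
    divergence (fun a y => ambientGrad ℓ A y a) x = (d + 1) / ℓ ^ 2 * ambientFn ℓ A x := by
  have h1 := Finset.sum_congr rfl fun a (_ : a ∈ Finset.univ) =>
    ambientGrad_covariant hℓ hx A a a
  simp only [if_true, Finset.sum_add_distrib, Finset.sum_const, Finset.card_univ,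
    Fintype.card_fin, nsmul_eq_mul] at h1
  rw [Finset.sum_comm] at h1
  simp only [← Finset.sum_mul, sum_christoffel_metric hℓ hx] at h1
  simp only [divergence, partialDeriv_ambientGrad, traceChristoffel]
  push_cast at h1
  linear_combination h1

theorem sum_contractUpper_partialDeriv (hℓ : ℓ ≠ 0) (hx : x ∈ bulk d) (A : Ambient d) :
    ∑ a, contractUpper ℓ h A a x * partialDeriv a (ambientFn ℓ A) x = tiltDensity ℓ h A x := by
  refine Finset.sum_congr rfl fun a _ => ?_
  have hg := metricDiag_mul_inv hℓ hx a
  rw [partialDeriv_ambientFn hℓ hx, contractUpper]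
  rw [show invMetricDiag ℓ x a * contractLower ℓ h A a x * (metricDiag ℓ x a * ambientGrad ℓ A x a)
    = (metricDiag ℓ x a * invMetricDiag ℓ x a) * (contractLower ℓ h A a x * ambientGrad ℓ A x a) by
      ring, hg, one_mul, contractLower, Finset.sum_mul]
  exact Finset.sum_congr rfl fun c _ => by ring

/-- The divergence of `V^a = C^a_{bc} K^b K^c` on the null hypersurface `f = 0`. -/
theorem divergence_connectionVar (hℓ : ℓ ≠ 0) (hx : x ∈ bulk d)
    (hh : ∀ x ∈ bulk d, ∀ a b, ContDiffAt ℝ 2 (fun y => h y a b) x)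
    (hsymm : ∀ x ∈ bulk d, (h x).IsSymm) (A : Ambient d) (hA : ambientFn ℓ A x = 0) :
    divergence (fun a y => ∑ b, ∑ c, connectionVar (metric d ℓ) h 0 a b c y
        * ambientGrad ℓ A y b * ambientGrad ℓ A y c) x
      = derivAlong ℓ A (divergence (contractUpper ℓ h A)) x - d / ℓ ^ 2 * tiltDensity ℓ h A x
        - 1 / 2 * waveOp ℓ (tiltDensity ℓ h A) x := by
  have hW : ∀ a, ContDiffAt ℝ 2 (contractUpper ℓ h A a) x := fun a =>
    contDiffAt_contractUpper (hh x hx) A a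
  have hK : ∀ a, ContDiffAt ℝ 2 (fun y => ambientGrad ℓ A y a) x := fun a =>
    (contDiff_ambientGrad A a).contDiffAt
  have hφ : ContDiffAt ℝ 2 (tiltDensity ℓ h A) x := contDiffAt_tiltDensity (hh x hx) A
  have hf : DifferentiableAt ℝ (ambientFn ℓ A) x :=
    (contDiffAt_ambientFn (n := 1) hx A).differentiableAt (by norm_num)
  have d1 : ∀ a, DifferentiableAt ℝ (contractUpper ℓ h A a) x := fun a =>
    (hW a).differentiableAt (by norm_num)
  have d2 : ∀ a, DifferentiableAt ℝ
      (fun y => invMetricDiag ℓ y a * partialDeriv a (tiltDensity ℓ h A) y) x := fun a =>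
    ((contDiffAt_invMetricDiag (n := 1) ℓ x a).differentiableAt (by norm_num)).fun_mul
      (differentiableAt_partialDeriv hφ a)
  have d3 : ∀ a, DifferentiableAt ℝ (fun y => ∑ b, (ambientGrad ℓ A y b
        * partialDeriv b (contractUpper ℓ h A a) y
        - contractUpper ℓ h A b y * partialDeriv b (fun z => ambientGrad ℓ A z a) y)) x := fun a =>
    DifferentiableAt.fun_sum fun b _ =>
      ((differentiableAt_ambientGrad A b x).fun_mul (differentiableAt_partialDeriv (hW a) b)).fun_sub
      ((d1 b).fun_mul (differentiableAt_partialDeriv (hK a) b))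
  rw [divergence_congr (U := fun a y => (∑ b, (ambientGrad ℓ A y b
        * partialDeriv b (contractUpper ℓ h A a) y
        - contractUpper ℓ h A b y * partialDeriv b (fun z => ambientGrad ℓ A z a) y))
      + ((1 / ℓ ^ 2 * ambientFn ℓ A y) * contractUpper ℓ h A a y
        + (-(1 / 2)) * (invMetricDiag ℓ y a * partialDeriv a (tiltDensity ℓ h A) y)))]
  · have d4 : DifferentiableAt ℝ (fun y => 1 / ℓ ^ 2 * ambientFn ℓ A y) x := hf.const_mul _
    rw [divergence_add d3 (fun a => (d4.fun_mul (d1 a)).fun_add ((d2 a).const_mul _)),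
      divergence_add (fun a => d4.fun_mul (d1 a)) (fun a => (d2 a).const_mul _),
      divergence_mul d4 d1, divergence_mul (differentiableAt_const _) d2,
      divergence_bracket hx hK hW]
    simp only [partialDeriv_const_mul _ hf, hA, partialDeriv_const]
    have e1 : ∀ b, partialDeriv b (divergence fun a y => ambientGrad ℓ A y a) x
        = (d + 1) / ℓ ^ 2 * partialDeriv b (ambientFn ℓ A) x := by
      intro b
      rw [← partialDeriv_const_mul _ hf]
      refine partialDeriv_congr ?_
      filter_upwards [bulk_mem_nhds hx] with y hy using divergence_ambientGrad hℓ hy A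
    have e2 := sum_contractUpper_partialDeriv (h := h) hℓ hx A
    have e3 : ∀ r : ℝ, ∑ a, contractUpper ℓ h A a x * (r * partialDeriv a (ambientFn ℓ A) x)
        = r * tiltDensity ℓ h A x := by
      intro r
      rw [← e2, Finset.mul_sum]
      exact Finset.sum_congr rfl fun a _ => by ring
    simp only [e1, e3, derivAlong, waveOp, mul_zero, Finset.sum_const_zero]
    ring
  · intro a
    filter_upwards [bulk_mem_nhds hx] with y hy
    rw [sum_connectionVar hℓ hy (fun a b => (hh y hy a b).differentiableAt (by norm_num))
      (hsymm y hy)]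
    simp only [Finset.sum_sub_distrib, partialDeriv_ambientGrad, derivAlong]
    ring

/-- The contracted variation of the connection is the gradient of half the trace of `h`. -/
theorem sum_connectionVar_trace (hℓ : ℓ ≠ 0) (hx : x ∈ bulk d)
    (hh : ∀ a b, DifferentiableAt ℝ (fun y => h y a b) x) (hsymm : ∀ x ∈ bulk d, (h x).IsSymm)
    (b : Fin (d + 1)) :
    ∑ a, connectionVar (metric d ℓ) h 0 a a b x = partialDeriv b (halfTrace ℓ h) x := by
  have hG : ∀ a, DifferentiableAt ℝ (fun y => invMetricDiag ℓ y a) x := fun a =>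
    (contDiffAt_invMetricDiag (n := 1) ℓ x a).differentiableAt (by norm_num)
  have e1 : partialDeriv b (halfTrace ℓ h) x = ∑ a, 1 / 2 * (-2 * logSlope x a * spatial x b
      * invMetricDiag ℓ x a * h x a a + invMetricDiag ℓ x a * partialDeriv b (fun y => h y a a) x) := by
    unfold halfTrace
    rw [partialDeriv_const_mul _ (DifferentiableAt.fun_sum fun a _ => (hG a).fun_mul (hh a a)),
      partialDeriv_sum fun a _ => (hG a).fun_mul (hh a a), Finset.mul_sum]
    refine Finset.sum_congr rfl fun a _ => ?_
    rw [partialDeriv_mul (hG a) (hh a a), partialDeriv_invMetricDiag hℓ hx]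
  have e2 : ∀ a, connectionVar (metric d ℓ) h 0 a a b x
      = 1 / 2 * (invMetricDiag ℓ x a * partialDeriv b (fun y => h y a a) x)
        - invMetricDiag ℓ x a * (logSlope x b * spatial x a * h x a b
          + logSlope x a * spatial x b * h x a a
          - if a = b then metricDiag ℓ x a * logSlope x a
            * ∑ c, spatial x c * (invMetricDiag ℓ x c * h x a c) else 0) := by
    intro a
    have := sum_mul_christoffel_metric hℓ hx (fun f => h x a f) a b
    rw [connectionVar_zero_metric hℓ hx, connectionVarLower, firstKind, ← this]
    rw [Finset.sum_congr rfl fun f _ => mul_comm (h x a f) _]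
    ring
  rw [e1]
  simp only [e2]
  rw [← sub_eq_zero, ← Finset.sum_sub_distrib]
  have e3 : ∑ a, invMetricDiag ℓ x a * (if a = b then metricDiag ℓ x a * logSlope x a
      * ∑ c, spatial x c * (invMetricDiag ℓ x c * h x a c) else 0)
      = ∑ a, invMetricDiag ℓ x a * (logSlope x b * spatial x a * h x a b) := by
    simp only [mul_ite, mul_zero, Finset.sum_ite_eq', Finset.mem_univ, if_true, Finset.mul_sum]
    refine Finset.sum_congr rfl fun c _ => ?_
    rw [(hsymm x hx).apply c b]
    linear_combination (logSlope x b * spatial x c * invMetricDiag ℓ x c * h x c b)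
      * metricDiag_mul_inv hℓ hx b
  rw [← sub_eq_zero, ← Finset.sum_sub_distrib] at e3
  refine Eq.trans ?_ e3
  exact Finset.sum_congr rfl fun a _ => by ring

theorem sum_comm_pairs {ι : Type*} [Fintype ι] (F : ι → ι → ι → ι → ℝ) :
    ∑ b, ∑ c, ∑ a, ∑ e, F b c a e = ∑ a, ∑ e, ∑ b, ∑ c, F b c a e := by
  have h1 : ∀ b, ∑ c, ∑ a, ∑ e, F b c a e = ∑ a, ∑ e, ∑ c, F b c a e := fun b => by
    rw [Finset.sum_comm]
    exact Finset.sum_congr rfl fun a _ => Finset.sum_comm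
  simp only [h1]
  rw [Finset.sum_comm]
  exact Finset.sum_congr rfl fun a _ => Finset.sum_comm

/-- The variation of the Ricci tensor contracted with `K` on the null hypersurface `f = 0`: a
divergence minus a second derivative of the trace along `K`. -/
theorem sum_ricciVar_eq_divergence (hℓ : ℓ ≠ 0) (hx : x ∈ bulk d)
    (hh : ∀ x ∈ bulk d, ∀ a b, ContDiffAt ℝ 2 (fun y => h y a b) x)
    (hsymm : ∀ x ∈ bulk d, (h x).IsSymm) (A : Ambient d) (hA : ambientFn ℓ A x = 0) :
    ∑ b, ∑ c, ricciVar (metric d ℓ) h 0 b c x * ambientGrad ℓ A x b * ambientGrad ℓ A x c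
      = divergence (fun a y => ∑ b, ∑ c, connectionVar (metric d ℓ) h 0 a b c y
          * ambientGrad ℓ A y b * ambientGrad ℓ A y c) x
        - derivAlong ℓ A (derivAlong ℓ A (halfTrace ℓ h)) x := by
  have hC1 : ∀ a b c, DifferentiableAt ℝ (connectionVar (metric d ℓ) h 0 a b c) x := fun a b c =>
    differentiableAt_of_param (p := ((0 : ℝ), x)) (contDiffAt_connectionVar
      (fun a b => contDiffAt_metric hx a b) (hh x hx) (det_metric_ne_zero hℓ hx) a b c)
  have hK := fun b => differentiableAt_ambientGrad (ℓ := ℓ) A b x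
  set K := ambientGrad ℓ A x with hKdef
  set C : Fin (d + 1) → Fin (d + 1) → Fin (d + 1) → ℝ := fun a b c =>
    connectionVar (metric d ℓ) h 0 a b c x with hC
  set Γ : Fin (d + 1) → Fin (d + 1) → Fin (d + 1) → ℝ := fun a b c =>
    christoffel (metric d ℓ) a b c x with hΓ
  have hCs : ∀ a b c, C a b c = C a c b := fun a b c => connectionVar_symm hℓ hsymm hx a b c
  have hΓs : ∀ a b c, Γ a b c = Γ a c b := fun a b c => christoffel_metric_symm hℓ hx a b c
  set N : Fin (d + 1) → Fin (d + 1) → ℝ := fun a b => ∑ m, Γ a b m * K m with hN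
  set P : Fin (d + 1) → Fin (d + 1) → ℝ := fun a b => ∑ m, C a b m * K m with hP
  have hD : ∀ a b, ambientGradDeriv ℓ A x a b = -N a b := fun a b => by
    have := ambientGrad_covariant hℓ hx A a b
    simp only [hA, zero_div, ite_self] at this
    exact eq_neg_of_add_eq_zero_left this
  set X := ∑ a, ∑ b, P a b * N b a with hX
  -- the four groups of terms in the Palatini expression
  have t1 : ∑ b, ∑ c, (∑ a, partialDeriv a (connectionVar (metric d ℓ) h 0 a b c) x) * K b * K c
      = (∑ a, partialDeriv a (fun y => ∑ b, ∑ c, connectionVar (metric d ℓ) h 0 a b c y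
          * ambientGrad ℓ A y b * ambientGrad ℓ A y c) x) + 2 * X := by
    have e : ∀ a, partialDeriv a (fun y => ∑ b, ∑ c, connectionVar (metric d ℓ) h 0 a b c y
          * ambientGrad ℓ A y b * ambientGrad ℓ A y c) x
        = ∑ b, ∑ c, (partialDeriv a (connectionVar (metric d ℓ) h 0 a b c) x * K b * K c
          - C a b c * N b a * K c - C a b c * K b * N c a) := by
      intro a
      rw [partialDeriv_sum fun b _ => DifferentiableAt.fun_sum fun c _ =>
        ((hC1 a b c).fun_mul (hK b)).fun_mul (hK c)]
      refine Finset.sum_congr rfl fun b _ => ?_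
      rw [partialDeriv_sum fun c _ => ((hC1 a b c).fun_mul (hK b)).fun_mul (hK c)]
      refine Finset.sum_congr rfl fun c _ => ?_
      rw [partialDeriv_mul ((hC1 a b c).fun_mul (hK b)) (hK c), partialDeriv_mul (hC1 a b c) (hK b),
        partialDeriv_ambientGrad, partialDeriv_ambientGrad, hD, hD]
      ring
    have x1 : ∑ a, ∑ b, ∑ c, C a b c * N b a * K c = X := by
      refine Finset.sum_congr rfl fun a _ => Finset.sum_congr rfl fun b _ => ?_
      rw [hP, Finset.sum_mul]
      exact Finset.sum_congr rfl fun c _ => by ring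
    have x2 : ∑ a, ∑ b, ∑ c, C a b c * K b * N c a = X := by
      rw [← x1]
      refine Finset.sum_congr rfl fun a _ => ?_
      rw [Finset.sum_comm]
      refine Finset.sum_congr rfl fun b _ => Finset.sum_congr rfl fun c _ => ?_
      rw [hCs a c b]; ring
    have x3 : ∑ b, ∑ c, (∑ a, partialDeriv a (connectionVar (metric d ℓ) h 0 a b c) x) * K b * K c
        = ∑ a, ∑ b, ∑ c, partialDeriv a (connectionVar (metric d ℓ) h 0 a b c) x * K b * K c := by
      simp only [Finset.sum_mul]
      rw [Finset.sum_congr rfl fun b _ => Finset.sum_comm, Finset.sum_comm]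
    rw [x3]
    simp only [e, Finset.sum_sub_distrib, x1, x2]
    ring
  have hψ := contDiffAt_halfTrace (ℓ := ℓ) (hh x hx)
  have htr : ∀ b c, ∑ a, partialDeriv c (connectionVar (metric d ℓ) h 0 a b a) x
      = partialDeriv c (partialDeriv b (halfTrace ℓ h)) x := by
    intro b c
    rw [← partialDeriv_sum fun a _ => hC1 a b a]
    refine partialDeriv_congr ?_
    filter_upwards [bulk_mem_nhds hx] with y hy
    rw [← sum_connectionVar_trace hℓ hy (fun a b => (hh y hy a b).differentiableAt (by norm_num))
      hsymm]
    exact Finset.sum_congr rfl fun a _ => connectionVar_symm hℓ hsymm hy a b a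
  have t2 : ∑ b, ∑ c, (∑ a, partialDeriv c (connectionVar (metric d ℓ) h 0 a b a) x) * K b * K c
      = derivAlong ℓ A (derivAlong ℓ A (halfTrace ℓ h)) x
        + ∑ c, ∑ b, K c * N b c * partialDeriv b (halfTrace ℓ h) x := by
    simp only [htr]
    have e : ∀ c, partialDeriv c (derivAlong ℓ A (halfTrace ℓ h)) x
        = ∑ b, (-N b c * partialDeriv b (halfTrace ℓ h) x
          + K b * partialDeriv c (partialDeriv b (halfTrace ℓ h)) x) := by
      intro c
      unfold derivAlong
      rw [partialDeriv_sum fun b _ => (hK b).fun_mul (differentiableAt_partialDeriv hψ b)]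
      refine Finset.sum_congr rfl fun b _ => ?_
      rw [partialDeriv_mul (hK b) (differentiableAt_partialDeriv hψ b), partialDeriv_ambientGrad, hD]
    rw [derivAlong, Finset.sum_comm, ← Finset.sum_add_distrib]
    refine Finset.sum_congr rfl fun c _ => ?_
    rw [e, Finset.mul_sum, ← Finset.sum_add_distrib]
    exact Finset.sum_congr rfl fun b _ => by simp only [← hKdef]; ring
  have t3 : ∑ b, ∑ c, (∑ a, ∑ e, Γ a a e * C e b c) * K b * K c
      = ∑ e, traceChristoffel e x * ∑ b, ∑ c, C e b c * K b * K c := by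
    simp only [Finset.sum_mul]
    rw [sum_comm_pairs, Finset.sum_comm]
    refine Finset.sum_congr rfl fun e _ => ?_
    rw [traceChristoffel, ← sum_christoffel_metric hℓ hx, Finset.sum_mul]
    refine Finset.sum_congr rfl fun a _ => ?_
    simp only [Finset.mul_sum]
    exact Finset.sum_congr rfl fun b _ => Finset.sum_congr rfl fun c _ => by ring
  have t4 : ∑ b, ∑ c, (∑ a, ∑ e, C a a e * Γ e b c) * K b * K c
      = ∑ c, ∑ b, K c * N b c * partialDeriv b (halfTrace ℓ h) x := by
    simp only [Finset.sum_mul]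
    rw [sum_comm_pairs, Finset.sum_comm]
    conv_rhs => rw [Finset.sum_comm]
    refine Finset.sum_congr rfl fun e _ => ?_
    rw [← sum_connectionVar_trace hℓ hx (fun a b => (hh x hx a b).differentiableAt (by norm_num))
      hsymm]
    have : ∀ c, K c * N e c * ∑ a, connectionVar (metric d ℓ) h 0 a a e x
        = ∑ a, ∑ m, C a a e * Γ e c m * K c * K m := by
      intro c
      rw [Finset.mul_sum]
      refine Finset.sum_congr rfl fun a _ => ?_
      simp only [hN, Finset.mul_sum, Finset.sum_mul]
      exact Finset.sum_congr rfl fun m _ => by simp only [hC]; ring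
    simp only [this]
    rw [Finset.sum_comm]
  have t5 : ∑ b, ∑ c, (∑ a, ∑ e, Γ a c e * C e b a) * K b * K c = X := by
    simp only [Finset.sum_mul]
    rw [sum_comm_pairs, Finset.sum_comm]
    refine Finset.sum_congr rfl fun e _ => Finset.sum_congr rfl fun a _ => ?_
    simp only [hP, hN, Finset.sum_mul_sum]
    refine Finset.sum_congr rfl fun b _ => Finset.sum_congr rfl fun c _ => ?_
    rw [hCs e b a, hΓs a c e]; ring
  have t6 : ∑ b, ∑ c, (∑ a, ∑ e, C a c e * Γ e b a) * K b * K c = X := by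
    simp only [Finset.sum_mul]
    rw [sum_comm_pairs]
    refine Finset.sum_congr rfl fun a _ => Finset.sum_congr rfl fun e _ => ?_
    simp only [hP, hN, Finset.sum_mul_sum]
    rw [Finset.sum_comm]
    refine Finset.sum_congr rfl fun b _ => Finset.sum_congr rfl fun c _ => ?_
    rw [hCs a b e, hΓs e c a]; ring
  have split : ∑ b, ∑ c, ricciVar (metric d ℓ) h 0 b c x * K b * K c
      = (∑ b, ∑ c, (∑ a, partialDeriv a (connectionVar (metric d ℓ) h 0 a b c) x) * K b * K c)
        - (∑ b, ∑ c, (∑ a, partialDeriv c (connectionVar (metric d ℓ) h 0 a b a) x) * K b * K c)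
        + (∑ b, ∑ c, (∑ a, ∑ e, Γ a a e * C e b c) * K b * K c)
        + (∑ b, ∑ c, (∑ a, ∑ e, C a a e * Γ e b c) * K b * K c)
        - (∑ b, ∑ c, (∑ a, ∑ e, Γ a c e * C e b a) * K b * K c)
        - (∑ b, ∑ c, (∑ a, ∑ e, C a c e * Γ e b a) * K b * K c) := by
    simp only [← Finset.sum_add_distrib, ← Finset.sum_sub_distrib]
    refine Finset.sum_congr rfl fun b _ => Finset.sum_congr rfl fun c _ => ?_
    simp only [ricciVar, zero_mul, add_zero, Finset.sum_sub_distrib, Finset.sum_add_distrib]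
    ring
  rw [split, t1, t2, t3, t4, t5, t6, divergence]
  ring

/-- On the null hypersurface `f = 0` the variation of `R_{KK} + (d / ℓ²) g_{KK}` is a total
derivative along `K` minus half the wave operator of `h_{KK}`. -/
theorem sum_ricciVar_add (hℓ : ℓ ≠ 0) (hx : x ∈ bulk d)
    (hh : ∀ x ∈ bulk d, ∀ a b, ContDiffAt ℝ 2 (fun y => h y a b) x)
    (hsymm : ∀ x ∈ bulk d, (h x).IsSymm) (A : Ambient d) (hA : ambientFn ℓ A x = 0) :
    (∑ b, ∑ c, ricciVar (metric d ℓ) h 0 b c x * ambientGrad ℓ A x b * ambientGrad ℓ A x c)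
        + d / ℓ ^ 2 * tiltDensity ℓ h A x
      = derivAlong ℓ A (fun y => divergence (contractUpper ℓ h A) y
          - derivAlong ℓ A (halfTrace ℓ h) y) x
        - 1 / 2 * waveOp ℓ (tiltDensity ℓ h A) x := by
  rw [sum_ricciVar_eq_divergence hℓ hx hh hsymm A hA,
    divergence_connectionVar hℓ hx hh hsymm A hA]
  have h1 : DifferentiableAt ℝ (divergence (contractUpper ℓ h A)) x :=
    (contDiffAt_divergence hx fun a => contDiffAt_contractUpper (hh x hx) A a).differentiableAt
      (by norm_num)
  have h2 : DifferentiableAt ℝ (derivAlong ℓ A (halfTrace ℓ h)) x :=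
    DifferentiableAt.fun_sum fun b _ => (differentiableAt_ambientGrad A b x).fun_mul
      (differentiableAt_partialDeriv (contDiffAt_halfTrace (hh x hx)) b)
  have : ∀ b, partialDeriv b (fun y => divergence (contractUpper ℓ h A) y
      - derivAlong ℓ A (halfTrace ℓ h) y) x = partialDeriv b (divergence (contractUpper ℓ h A)) x
      - partialDeriv b (derivAlong ℓ A (halfTrace ℓ h)) x := fun b => partialDeriv_sub h1 h2
  have e : derivAlong ℓ A (fun y => divergence (contractUpper ℓ h A) y
      - derivAlong ℓ A (halfTrace ℓ h) y) x
      = derivAlong ℓ A (divergence (contractUpper ℓ h A)) x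
        - derivAlong ℓ A (derivAlong ℓ A (halfTrace ℓ h)) x := by
    rw [derivAlong]
    simp only [this, mul_sub, Finset.sum_sub_distrib]
    rfl
  rw [e]
  ring

end Divergence

/-! ### Null geodesics of anti-de Sitter space -/

section Geodesics

variable {d : ℕ} {ℓ t₀ τ : ℝ} {e β : Fin d → ℝ}

/-- Data of a null geodesic: `e` is the direction in which it meets the boundary sphere and `β` is
its position in the Klein model, the open unit ball of `e^⊥`, of the hyperbolic space formed by all
null geodesics with the same endpoints. The closed ball is allowed here. -/
structure IsKleinPoint (e β : Fin d → ℝ) : Prop where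
  unit : ∑ i, e i ^ 2 = 1
  orth : ∑ i, β i * e i = 0
  le_one : ∑ i, β i ^ 2 ≤ 1

/-- The factor `√(1 - |β|²)`. -/
def kleinFactor (β : Fin d → ℝ) : ℝ := √(1 - ∑ i, β i ^ 2)

/-- The denominator `1 + √(1 - |β|²) cos τ`. -/
def curveDenom (β : Fin d → ℝ) (τ : ℝ) : ℝ := 1 + kleinFactor β * Real.cos τ

/-- The null geodesic with data `e`, `β` and initial time `t₀`, parametrized on `[-π/2, π/2]` by
`τ = (t - t₀) / ℓ`. Its endpoints lie on the conformal boundary. -/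
def nullCurve (ℓ t₀ : ℝ) (e β : Fin d → ℝ) (τ : ℝ) : Coord d :=
  Fin.cons (t₀ + ℓ * τ) fun i => (Real.cos τ * β i + Real.sin τ * e i) / curveDenom β τ

/-- The velocity of `nullCurve`, multiplied by `curveDenom`. -/
def nullVelocity (ℓ : ℝ) (e β : Fin d → ℝ) (τ : ℝ) : Coord d :=
  Fin.cons (ℓ * curveDenom β τ) fun i => (Real.cos τ * e i - Real.sin τ * β i)
    + kleinFactor β * Real.sin τ * ((Real.cos τ * β i + Real.sin τ * e i) / curveDenom β τ)

/-- The null covector of the ambient space whose linear function vanishes on all null geodesics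
with data `e`, `t₀`, and whose gradient is tangent to them. -/
def nullCovector (ℓ t₀ : ℝ) (e : Fin d → ℝ) : Ambient d :=
  (Real.sin (t₀ / ℓ), -Real.cos (t₀ / ℓ), e)

theorem kleinFactor_nonneg (β : Fin d → ℝ) : 0 ≤ kleinFactor β := Real.sqrt_nonneg _

theorem kleinFactor_sq (hβ : ∑ i, β i ^ 2 ≤ 1) : kleinFactor β ^ 2 = 1 - ∑ i, β i ^ 2 :=
  Real.sq_sqrt (by linarith)

theorem kleinFactor_pos (hβ : ∑ i, β i ^ 2 < 1) : 0 < kleinFactor β :=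
  Real.sqrt_pos.2 (by linarith)

theorem curveDenom_pos (β : Fin d → ℝ) (hτ : 0 ≤ Real.cos τ) : 0 < curveDenom β τ := by
  have := mul_nonneg (kleinFactor_nonneg β) hτ
  unfold curveDenom; linarith

@[simp] theorem nullCurve_zero : nullCurve ℓ t₀ e β τ 0 = t₀ + ℓ * τ := rfl
@[simp] theorem nullCurve_succ (i : Fin d) : nullCurve ℓ t₀ e β τ i.succ
    = (Real.cos τ * β i + Real.sin τ * e i) / curveDenom β τ := rfl
@[simp] theorem nullVelocity_zero : nullVelocity ℓ e β τ 0 = ℓ * curveDenom β τ := rfl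
@[simp] theorem nullVelocity_succ (i : Fin d) : nullVelocity ℓ e β τ i.succ
    = (Real.cos τ * e i - Real.sin τ * β i) + kleinFactor β * Real.sin τ
      * ((Real.cos τ * β i + Real.sin τ * e i) / curveDenom β τ) := rfl

theorem hasDerivAt_curveDenom (β : Fin d → ℝ) (τ : ℝ) :
    HasDerivAt (curveDenom β) (-(kleinFactor β * Real.sin τ)) τ := by
  have h := ((Real.hasDerivAt_cos τ).const_mul (kleinFactor β)).const_add 1
  exact h.congr_deriv (by ring)

theorem hasDerivAt_nullCurve (hD : curveDenom β τ ≠ 0) :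
    HasDerivAt (nullCurve ℓ t₀ e β) ((curveDenom β τ)⁻¹ • nullVelocity ℓ e β τ) τ := by
  rw [hasDerivAt_pi]
  intro a
  refine Fin.cases ?_ (fun i => ?_) a
  · simp only [nullCurve_zero, Pi.smul_apply, nullVelocity_zero, smul_eq_mul]
    have h := ((hasDerivAt_id τ).const_mul ℓ).const_add t₀
    simp only [id, mul_one] at h
    exact h.congr_deriv (by field_simp)
  · simp only [nullCurve_succ, Pi.smul_apply, nullVelocity_succ, smul_eq_mul]
    have h := (((Real.hasDerivAt_cos τ).mul_const (β i)).add
      ((Real.hasDerivAt_sin τ).mul_const (e i))).div (hasDerivAt_curveDenom β τ) hD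
    refine h.congr_deriv ?_
    simp only [Pi.add_apply]
    field_simp
    ring

theorem sum_sq_combination (he : ∑ i, e i ^ 2 = 1) (hβe : ∑ i, β i * e i = 0) (p q : ℝ) :
    ∑ i, (p * β i + q * e i) ^ 2 = p ^ 2 * ∑ i, β i ^ 2 + q ^ 2 := by
  have : ∑ i, (p * β i + q * e i) ^ 2
      = p ^ 2 * ∑ i, β i ^ 2 + 2 * p * q * ∑ i, β i * e i + q ^ 2 * ∑ i, e i ^ 2 := by
    simp only [Finset.mul_sum, ← Finset.sum_add_distrib]
    exact Finset.sum_congr rfl fun i _ => by ring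
  rw [this, he, hβe]; ring

theorem conformalFactor_nullCurve (hβ : IsKleinPoint e β) (hD : curveDenom β τ ≠ 0) :
    conformalFactor (nullCurve ℓ t₀ e β τ)
      = 2 * kleinFactor β * Real.cos τ / curveDenom β τ := by
  have h1 : normSqSpace (nullCurve ℓ t₀ e β τ)
      = (1 - kleinFactor β ^ 2 * Real.cos τ ^ 2) / curveDenom β τ ^ 2 := by
    simp only [normSqSpace, nullCurve_succ, div_pow, ← Finset.sum_div]
    rw [sum_sq_combination hβ.unit hβ.orth, kleinFactor_sq hβ.le_one]
    congr 1
    linear_combination Real.sin_sq_add_cos_sq τ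
  rw [conformalFactor, h1]
  field_simp
  unfold curveDenom; ring

theorem nullCurve_mem_compactification (hβ : IsKleinPoint e β) (hτ : 0 ≤ Real.cos τ) :
    nullCurve ℓ t₀ e β τ ∈ compactification d := by
  have hD := curveDenom_pos β hτ
  have h : 0 ≤ conformalFactor (nullCurve ℓ t₀ e β τ) := by
    rw [conformalFactor_nullCurve hβ hD.ne']
    have := kleinFactor_nonneg β
    positivity
  have : normSqSpace (nullCurve ℓ t₀ e β τ) ≤ 1 := by
    rw [conformalFactor] at h; linarith
  exact this

theorem nullCurve_mem_bulk (hβ : IsKleinPoint e β) (hβ1 : ∑ i, β i ^ 2 < 1)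
    (hτ : 0 < Real.cos τ) : nullCurve ℓ t₀ e β τ ∈ bulk d := by
  have hD := curveDenom_pos β hτ.le
  have h : 0 < conformalFactor (nullCurve ℓ t₀ e β τ) := by
    rw [conformalFactor_nullCurve hβ hD.ne']
    have := kleinFactor_pos hβ1
    positivity
  have : normSqSpace (nullCurve ℓ t₀ e β τ) < 1 := by
    rw [conformalFactor] at h; linarith
  exact this

theorem two_sub_conformalFactor_nullCurve (hβ : IsKleinPoint e β) (hD : curveDenom β τ ≠ 0) :
    2 - conformalFactor (nullCurve ℓ t₀ e β τ) = 2 / curveDenom β τ := by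
  rw [conformalFactor_nullCurve hβ hD]
  field_simp
  unfold curveDenom; ring

theorem timePart_nullCurve (hℓ : ℓ ≠ 0) :
    timePart ℓ (nullCovector ℓ t₀ e) (nullCurve ℓ t₀ e β τ) = -Real.sin τ := by
  simp only [timePart, nullCovector, nullCurve_zero]
  rw [show τ = (t₀ + ℓ * τ) / ℓ - t₀ / ℓ by field_simp; ring, Real.sin_sub]
  rw [show (t₀ + ℓ * ((t₀ + ℓ * τ) / ℓ - t₀ / ℓ)) / ℓ = (t₀ + ℓ * τ) / ℓ by field_simp; ring]
  ring

theorem timePartDeriv_nullCurve (hℓ : ℓ ≠ 0) :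
    timePartDeriv ℓ (nullCovector ℓ t₀ e) (nullCurve ℓ t₀ e β τ) = -Real.cos τ := by
  simp only [timePartDeriv, nullCovector, nullCurve_zero]
  rw [show τ = (t₀ + ℓ * τ) / ℓ - t₀ / ℓ by field_simp; ring, Real.cos_sub]
  rw [show (t₀ + ℓ * ((t₀ + ℓ * τ) / ℓ - t₀ / ℓ)) / ℓ = (t₀ + ℓ * τ) / ℓ by field_simp; ring]
  ring

theorem spaceDot_nullCurve (hβ : IsKleinPoint e β) :
    spaceDot e (nullCurve ℓ t₀ e β τ) = Real.sin τ / curveDenom β τ := by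
  have : ∑ i, e i * (Real.cos τ * β i + Real.sin τ * e i)
      = Real.cos τ * ∑ i, β i * e i + Real.sin τ * ∑ i, e i ^ 2 := by
    simp only [Finset.mul_sum, ← Finset.sum_add_distrib]
    exact Finset.sum_congr rfl fun i _ => by ring
  simp only [spaceDot, nullCurve_succ, mul_div_assoc', ← Finset.sum_div]
  rw [this, hβ.unit, hβ.orth]; ring

theorem ambientFn_nullCurve (hℓ : ℓ ≠ 0) (hβ : IsKleinPoint e β) (hβ1 : ∑ i, β i ^ 2 < 1)
    (hτ : 0 < Real.cos τ) :
    ambientFn ℓ (nullCovector ℓ t₀ e) (nullCurve ℓ t₀ e β τ) = 0 := by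
  have hD := (curveDenom_pos β hτ.le).ne'
  have hσ := (kleinFactor_pos hβ1).ne'
  have hc := hτ.ne'
  rw [ambientFn, timePart_nullCurve hℓ, show (nullCovector ℓ t₀ e).2.2 = e from rfl,
    spaceDot_nullCurve hβ, conformalFactor_nullCurve hβ hD]
  field_simp
  unfold curveDenom; ring

/-- The gradient of the null linear function is tangent to the null geodesics. -/
theorem ambientGrad_nullCurve (hℓ : ℓ ≠ 0) (hβ : IsKleinPoint e β) (hD : curveDenom β τ ≠ 0) :
    ambientGrad ℓ (nullCovector ℓ t₀ e) (nullCurve ℓ t₀ e β τ)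
      = (kleinFactor β * Real.cos τ ^ 2 / (ℓ * curveDenom β τ)) • nullVelocity ℓ e β τ := by
  ext a
  refine Fin.cases ?_ (fun i => ?_) a
  · rw [ambientGrad_zero, timePartDeriv_nullCurve hℓ, two_sub_conformalFactor_nullCurve hβ hD,
      conformalFactor_nullCurve hβ hD, Pi.smul_apply, nullVelocity_zero, smul_eq_mul]
    field_simp
  · rw [ambientGrad_succ, timePart_nullCurve hℓ, show (nullCovector ℓ t₀ e).2.2 = e from rfl,
      spaceDot_nullCurve hβ, conformalFactor_nullCurve hβ hD, Pi.smul_apply, nullVelocity_succ,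
      smul_eq_mul, nullCurve_succ]
    have h := Real.sin_sq_add_cos_sq τ
    field_simp
    unfold curveDenom
    linear_combination (-(e i * kleinFactor β * Real.cos τ
      * (1 + kleinFactor β * Real.cos τ))) * h

end Geodesics

/-! ### Null geodesics are straight lines of the ambient space -/

section Classification

variable {d : ℕ} {ℓ t₀ κ s₀ : ℝ} {e β : Fin d → ℝ}

/-- The value of `τ` at affine parameter `s`. -/
def geodesicAngle (ℓ : ℝ) (β : Fin d → ℝ) (κ s₀ s : ℝ) : ℝ :=
  Real.arctan (kleinFactor β * κ / ℓ * (s - s₀))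

/-- The affinely parametrized null geodesic along `nullCurve`, with velocity `κ` times the gradient
of the null linear function. -/
def nullGeodesic (ℓ t₀ : ℝ) (e β : Fin d → ℝ) (κ s₀ s : ℝ) : Coord d :=
  nullCurve ℓ t₀ e β (geodesicAngle ℓ β κ s₀ s)

theorem cos_geodesicAngle_pos (s : ℝ) : 0 < Real.cos (geodesicAngle ℓ β κ s₀ s) :=
  Real.cos_arctan_pos _

theorem hasDerivAt_geodesicAngle (s : ℝ) :
    HasDerivAt (geodesicAngle ℓ β κ s₀)
      (kleinFactor β * κ / ℓ * Real.cos (geodesicAngle ℓ β κ s₀ s) ^ 2) s := by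
  have h := (((hasDerivAt_id s).sub_const s₀).const_mul (kleinFactor β * κ / ℓ)).arctan
  refine h.congr_deriv ?_
  rw [geodesicAngle, Real.cos_sq_arctan]
  simp only [id]
  ring

theorem hasDerivAt_nullGeodesic (hℓ : ℓ ≠ 0) (hβ : IsKleinPoint e β) (s : ℝ) :
    HasDerivAt (nullGeodesic ℓ t₀ e β κ s₀)
      (κ • ambientGrad ℓ (nullCovector ℓ t₀ e) (nullGeodesic ℓ t₀ e β κ s₀ s)) s := by
  have hD := (curveDenom_pos β (cos_geodesicAngle_pos (ℓ := ℓ) (β := β) (κ := κ) (s₀ := s₀) s).le).ne'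
  have h := (hasDerivAt_nullCurve (ℓ := ℓ) (t₀ := t₀) (e := e) hD).scomp s
    (hasDerivAt_geodesicAngle (ℓ := ℓ) (β := β) (κ := κ) (s₀ := s₀) s)
  refine h.congr_deriv ?_
  rw [nullGeodesic, ambientGrad_nullCurve hℓ hβ hD, smul_smul, smul_smul]
  congr 1
  field_simp

theorem nullGeodesic_mem_bulk (hβ : IsKleinPoint e β) (hβ1 : ∑ i, β i ^ 2 < 1) (s : ℝ) :
    nullGeodesic ℓ t₀ e β κ s₀ s ∈ bulk d :=
  nullCurve_mem_bulk hβ hβ1 (cos_geodesicAngle_pos s)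

theorem contDiff_nullGeodesic : ContDiff ℝ 2 (nullGeodesic ℓ t₀ e β κ s₀) := by
  have hθ : ContDiff ℝ 2 (geodesicAngle ℓ β κ s₀) := by
    unfold geodesicAngle
    exact Real.contDiff_arctan.comp (by fun_prop)
  rw [contDiff_pi]
  intro a
  refine Fin.cases ?_ (fun i => ?_) a
  · simp only [nullGeodesic, nullCurve_zero]
    exact contDiff_const.add (contDiff_const.mul hθ)
  · simp only [nullGeodesic, nullCurve_succ]
    refine ContDiff.div ?_ ?_ fun s => (curveDenom_pos β (cos_geodesicAngle_pos s).le).ne'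
    · exact ((Real.contDiff_cos.comp hθ).mul contDiff_const).add
        ((Real.contDiff_sin.comp hθ).mul contDiff_const)
    · exact contDiff_const.add (contDiff_const.mul (Real.contDiff_cos.comp hθ))

theorem ambientInner_nullCovector (he : ∑ i, e i ^ 2 = 1) :
    ambientInner (nullCovector ℓ t₀ e) (nullCovector ℓ t₀ e) = 0 := by
  simp only [ambientInner, nullCovector, ← pow_two, he]
  linear_combination -Real.sin_sq_add_cos_sq (t₀ / ℓ)

theorem quad_metric_ambientGrad_nullCurve (hℓ : ℓ ≠ 0) (hβ : IsKleinPoint e β)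
    (hβ1 : ∑ i, β i ^ 2 < 1) {τ : ℝ} (hτ : 0 < Real.cos τ) :
    quad (metric d ℓ (nullCurve ℓ t₀ e β τ))
      (ambientGrad ℓ (nullCovector ℓ t₀ e) (nullCurve ℓ t₀ e β τ)) = 0 := by
  have hx := nullCurve_mem_bulk (ℓ := ℓ) (t₀ := t₀) hβ hβ1 hτ
  have h := inner_ambientGrad hℓ hx (nullCovector ℓ t₀ e) (nullCovector ℓ t₀ e)
  rw [ambientInner_nullCovector hβ.unit, ambientFn_nullCurve hℓ hβ hβ1 hτ] at h
  rw [quad_metric hx]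
  refine Eq.trans (Finset.sum_congr rfl fun a _ => ?_) (h.trans (by ring))
  ring

/-- The velocity is `κ K` with `K` the gradient of a linear function `f` that vanishes on the curve,
and `∇_K K = (f / ℓ²) K`. -/
theorem isNullGeodesic_nullGeodesic (hℓ : ℓ ≠ 0) (hβ : IsKleinPoint e β)
    (hβ1 : ∑ i, β i ^ 2 < 1) (hκ : κ ≠ 0) :
    IsNullGeodesic d ℓ (nullGeodesic ℓ t₀ e β κ s₀) := by
  have hder : deriv (nullGeodesic ℓ t₀ e β κ s₀) = fun s =>
      κ • ambientGrad ℓ (nullCovector ℓ t₀ e) (nullGeodesic ℓ t₀ e β κ s₀ s) :=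
    funext fun s => (hasDerivAt_nullGeodesic hℓ hβ s).deriv
  refine ⟨nullGeodesic_mem_bulk hβ hβ1, contDiff_nullGeodesic, fun s hs => ?_, fun s => ?_,
    fun s a => ?_⟩
  · have hc := cos_geodesicAngle_pos (ℓ := ℓ) (β := β) (κ := κ) (s₀ := s₀) s
    have hD := (curveDenom_pos β hc.le).ne'
    have hσ := (kleinFactor_pos hβ1).ne'
    have := congrFun hs 0
    rw [hder] at this
    simp only [nullGeodesic] at this
    rw [ambientGrad_nullCurve hℓ hβ hD, Pi.smul_apply, Pi.smul_apply, nullVelocity_zero] at this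
    simp [hκ, hℓ, hD, hσ, hc.ne'] at this
  · have h := quad_metric_ambientGrad_nullCurve (t₀ := t₀) hℓ hβ hβ1
      (cos_geodesicAngle_pos (ℓ := ℓ) (β := β) (κ := κ) (s₀ := s₀) s)
    rw [along, hder]
    simp only [quad, Pi.smul_apply, smul_eq_mul] at h ⊢
    refine Eq.trans ?_ ((congrArg (κ ^ 2 * ·) h).trans (mul_zero _))
    simp only [Finset.mul_sum]
    exact Finset.sum_congr rfl fun a _ => Finset.sum_congr rfl fun b _ => by
      rw [nullGeodesic]; ring
  · have hx := nullGeodesic_mem_bulk (ℓ := ℓ) (t₀ := t₀) (κ := κ) (s₀ := s₀) hβ hβ1 s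
    have h2 : HasDerivAt (deriv (nullGeodesic ℓ t₀ e β κ s₀)) (fun a => κ * ∑ b,
        (κ * ambientGrad ℓ (nullCovector ℓ t₀ e) (nullGeodesic ℓ t₀ e β κ s₀ s) b)
        * ambientGradDeriv ℓ (nullCovector ℓ t₀ e) (nullGeodesic ℓ t₀ e β κ s₀ s) a b) s := by
      rw [hder, hasDerivAt_pi]
      intro a
      have h3 := hasDerivAt_comp_curve (f := fun y => ambientGrad ℓ (nullCovector ℓ t₀ e) y a)
        (differentiableAt_ambientGrad _ a _)
        (hasDerivAt_nullGeodesic (t₀ := t₀) (κ := κ) (s₀ := s₀) hℓ hβ s)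
      refine (h3.const_mul κ).congr_deriv ?_
      simp only [partialDeriv_ambientGrad, Pi.smul_apply, smul_eq_mul]
    have hcov := ambientGrad_covariant hℓ hx (nullCovector ℓ t₀ e) a
    have hf : ambientFn ℓ (nullCovector ℓ t₀ e) (nullGeodesic ℓ t₀ e β κ s₀ s) = 0 :=
      ambientFn_nullCurve hℓ hβ hβ1 (cos_geodesicAngle_pos s)
    rw [hf] at hcov
    rw [acceleration, h2.deriv, hder]
    set x := nullGeodesic ℓ t₀ e β κ s₀ s
    set K := ambientGrad ℓ (nullCovector ℓ t₀ e) x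
    have : ∀ b, ambientGradDeriv ℓ (nullCovector ℓ t₀ e) x a b
        = - ∑ m, christoffel (metric d ℓ) a b m x * K m := fun b => by
      have := hcov b
      rw [zero_div, ite_self] at this
      linarith
    simp only [this, Pi.smul_apply, smul_eq_mul, Finset.mul_sum, mul_neg, Finset.sum_neg_distrib]
    rw [neg_add_eq_zero]
    exact Finset.sum_congr rfl fun b _ => Finset.sum_congr rfl fun m _ => by ring

theorem eq_affine_of_deriv_deriv_zero {f f' : ℝ → ℝ} (hf : ∀ s, HasDerivAt f (f' s) s)
    (hf' : ∀ s, HasDerivAt f' 0 s) (s : ℝ) : f' s = f' 0 ∧ f s = f 0 + f' 0 * s := by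
  have h1 : ∀ s, f' s = f' 0 := fun s =>
    is_const_of_deriv_eq_zero (fun s => (hf' s).differentiableAt) (fun s => (hf' s).deriv) s 0
  have h2 : ∀ s, HasDerivAt (fun s => f s - f' 0 * s) 0 s := fun s =>
    ((hf s).sub ((hasDerivAt_id s).const_mul (f' 0))).congr_deriv (by rw [h1 s]; ring)
  have h3 := is_const_of_deriv_eq_zero (fun s => (h2 s).differentiableAt) (fun s => (h2 s).deriv) s 0
  exact ⟨h1 s, by linarith⟩

theorem ambientFn_eq_combination (A : Ambient d) (x : Coord d) :
    ambientFn ℓ A x = A.1 * ambientFn ℓ (1, 0, 0) x + A.2.1 * ambientFn ℓ (0, 1, 0) x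
      + ∑ i, A.2.2 i * ambientFn ℓ (0, 0, Pi.single i 1) x := by
  have h : ∀ i, spaceDot (Pi.single i 1) x = x (Fin.succ i) := fun i => by
    simp [spaceDot, Pi.single_apply]
  have h0 : spaceDot (0 : Fin d → ℝ) x = 0 := by simp [spaceDot]
  have : ∑ i, A.2.2 i * ambientFn ℓ (0, 0, Pi.single i 1) x
      = ℓ * (2 / conformalFactor x) * spaceDot A.2.2 x := by
    rw [spaceDot, Finset.mul_sum]
    refine Finset.sum_congr rfl fun i _ => ?_
    simp only [ambientFn, timePart, h]; ring
  rw [this]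
  simp only [ambientFn, timePart, h0]; ring

/-- AdS is the hyperboloid `-X₋₁² - X₀² + |X|² = -ℓ²` of the ambient space. -/
theorem hyperboloid {x : Coord d} (hx : x ∈ bulk d) :
    -ambientFn ℓ (1, 0, 0) x ^ 2 - ambientFn ℓ (0, 1, 0) x ^ 2
      + ∑ i, ambientFn ℓ (0, 0, Pi.single i 1) x ^ 2 = -ℓ ^ 2 := by
  have h : ∀ i, spaceDot (Pi.single i 1) x = x (Fin.succ i) := fun i => by
    simp [spaceDot, Pi.single_apply]
  have h0 : spaceDot (0 : Fin d → ℝ) x = 0 := by simp [spaceDot]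
  have hΩ := (conformalFactor_pos hx).ne'
  have : ∑ i, ambientFn ℓ (0, 0, Pi.single i 1) x ^ 2
      = (ℓ * (2 / conformalFactor x)) ^ 2 * (1 - conformalFactor x) := by
    rw [← sum_sq_eq, Finset.mul_sum]
    refine Finset.sum_congr rfl fun i _ => ?_
    simp only [ambientFn, timePart, h]; ring
  rw [this]
  simp only [ambientFn, timePart, h0]
  have hsc := Real.sin_sq_add_cos_sq (x 0 / ℓ)
  field_simp
  linear_combination (-(ℓ ^ 2 * (2 - conformalFactor x) ^ 2)) * hsc

/-- Every null geodesic of AdS is one of the curves `nullGeodesic`: the linear functions of the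
ambient space are affine along it, so it is a straight line of the ambient space. -/
theorem IsNullGeodesic.exists_eq_nullGeodesic (hℓ : 0 < ℓ) {γ : ℝ → Coord d}
    (hγ : IsNullGeodesic d ℓ γ) :
    ∃ (t₀ : ℝ) (e β : Fin d → ℝ) (κ s₀ : ℝ), IsKleinPoint e β ∧ ∑ i, β i ^ 2 < 1 ∧ κ ≠ 0 ∧
      γ = nullGeodesic ℓ t₀ e β κ s₀ := by
  have hdγ : ∀ s, HasDerivAt γ (deriv γ s) s := fun s =>
    (hγ.contDiff.differentiable (by norm_num) s).hasDerivAt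
  have hd1 : ∀ (A : Ambient d) s, HasDerivAt (fun s => ambientFn ℓ A (γ s))
      (∑ a, deriv γ s a * partialDeriv a (ambientFn ℓ A) (γ s)) s := fun A s =>
    hasDerivAt_comp_curve ((contDiffAt_ambientFn (n := 1) (hγ.mem_bulk s) A).differentiableAt
      (by norm_num)) (hdγ s)
  have hd2 : ∀ (A : Ambient d) s, HasDerivAt
      (fun s => ∑ a, deriv γ s a * partialDeriv a (ambientFn ℓ A) (γ s)) 0 s := fun A s =>
    (hasDerivAt_ambientFn_velocity hℓ.ne' A hγ.contDiff (hγ.mem_bulk s)).congr_deriv (by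
      rw [hγ.null s]
      simp only [hγ.geodesic s, zero_mul, mul_zero, Finset.sum_const_zero, add_zero])
  set v : Ambient d → ℝ := fun A => ∑ a, deriv γ 0 a * partialDeriv a (ambientFn ℓ A) (γ 0)
    with hv
  have haff : ∀ (A : Ambient d) s, ambientFn ℓ A (γ s) = ambientFn ℓ A (γ 0) + v A * s :=
    fun A s => (eq_affine_of_deriv_deriv_zero (hd1 A) (hd2 A) s).2
  set a1 := v (1, 0, 0) with ha1
  set b1 := v (0, 1, 0) with hb1
  set c1 : Fin d → ℝ := fun i => v (0, 0, Pi.single i 1) with hc1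
  set a0 := ambientFn ℓ (1, 0, 0) (γ 0) with ha0
  set b0 := ambientFn ℓ (0, 1, 0) (γ 0) with hb0
  set c0 : Fin d → ℝ := fun i => ambientFn ℓ (0, 0, Pi.single i 1) (γ 0) with hc0
  have hyp : ∀ s, -(a0 + a1 * s) ^ 2 - (b0 + b1 * s) ^ 2 + (∑ i, c0 i ^ 2
      + 2 * s * (∑ i, c0 i * c1 i) + s ^ 2 * ∑ i, c1 i ^ 2) = -ℓ ^ 2 := fun s => by
    have h := hyperboloid (ℓ := ℓ) (hγ.mem_bulk s)
    simp only [haff _ s] at h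
    rw [← h, Finset.mul_sum, Finset.mul_sum, ← Finset.sum_add_distrib, ← Finset.sum_add_distrib]
    congr 1
    exact Finset.sum_congr rfl fun i _ => by ring
  -- compare the coefficients of the two polynomials in `s`
  have q0 := hyp 0
  have q1 := hyp 1
  have q2 := hyp (-1)
  have r2 : ∑ i, c1 i ^ 2 = a1 ^ 2 + b1 ^ 2 := by linarith
  have r1 : ∑ i, c0 i * c1 i = a0 * a1 + b0 * b1 := by linarith
  have r0 : ∑ i, c0 i ^ 2 = a0 ^ 2 + b0 ^ 2 - ℓ ^ 2 := by linarith
  -- the velocity in the ambient space does not vanish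
  have hN : 0 < a1 ^ 2 + b1 ^ 2 := by
    rcases (add_nonneg (sq_nonneg a1) (sq_nonneg b1)).lt_or_eq with h | h
    · exact h
    · exfalso
      have z1 : a1 = 0 := by nlinarith [sq_nonneg b1]
      have z2 : b1 = 0 := by nlinarith [sq_nonneg a1]
      have z3 : ∀ i, c1 i = 0 := fun i => by
        have := (Finset.sum_eq_zero_iff_of_nonneg fun i _ => sq_nonneg (c1 i)).1
          (r2.trans h.symm) i (Finset.mem_univ i)
        exact pow_eq_zero_iff (two_ne_zero) |>.1 this
      refine hγ.velocity_ne_zero 0 (eq_zero_of_forall_ambientFn hℓ.ne' (hγ.mem_bulk 0)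
        fun A _ => ?_)
      have h1 : v A = 0 := by
        have e1 := haff A 1
        rw [ambientFn_eq_combination A (γ 1), ambientFn_eq_combination A (γ 0)] at e1
        simp only [haff _ 1] at e1
        have e2 : ∀ i, v (0, 0, Pi.single i 1) = 0 := z3
        rw [← ha1, ← hb1, z1, z2] at e1
        simp only [e2, add_zero, mul_one] at e1
        linarith
      exact Eq.trans (Finset.sum_congr rfl fun a _ => mul_comm _ _) h1
  -- `s₀` minimizes `X₋₁² + X₀²` along the line: it is the point of closest approach to the centre
  set s₀ := -(a0 * a1 + b0 * b1) / (a1 ^ 2 + b1 ^ 2) with hs₀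
  set P := a0 + a1 * s₀ with hP
  set Q := b0 + b1 * s₀ with hQ
  have horth : P * a1 + Q * b1 = 0 := by
    rw [hP, hQ, hs₀]; field_simp; ring
  clear_value P Q s₀ a0 b0 c0 a1 b1 c1 v
  have hB2 : ∑ i, (c0 i + c1 i * s₀) ^ 2 = P ^ 2 + Q ^ 2 - ℓ ^ 2 := by
    have : ∑ i, (c0 i + c1 i * s₀) ^ 2 = ∑ i, c0 i ^ 2 + 2 * s₀ * (∑ i, c0 i * c1 i)
        + s₀ ^ 2 * ∑ i, c1 i ^ 2 := by
      rw [Finset.mul_sum, Finset.mul_sum, ← Finset.sum_add_distrib, ← Finset.sum_add_distrib]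
      exact Finset.sum_congr rfl fun i _ => by ring
    rw [this, r0, r1, r2, hP, hQ]; ring
  have hB1 : ∑ i, (c0 i + c1 i * s₀) * c1 i = 0 := by
    have : ∑ i, (c0 i + c1 i * s₀) * c1 i = ∑ i, c0 i * c1 i + s₀ * ∑ i, c1 i ^ 2 := by
      rw [Finset.mul_sum, ← Finset.sum_add_distrib]
      exact Finset.sum_congr rfl fun i _ => by ring
    rw [this, r1, r2, ← horth, hP, hQ]; ring
  have hRpos : 0 < P ^ 2 + Q ^ 2 := by
    have : 0 ≤ ∑ i, (c0 i + c1 i * s₀) ^ 2 := Finset.sum_nonneg fun i _ => sq_nonneg _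
    have := pow_pos hℓ 2
    linarith
  set R := √(P ^ 2 + Q ^ 2) with hR
  have hR0 : 0 < R := Real.sqrt_pos.2 hRpos
  have hR2 : R ^ 2 = P ^ 2 + Q ^ 2 := Real.sq_sqrt hRpos.le
  set κ := (P * b1 - Q * a1) / R with hκdef
  have hκ2 : κ ^ 2 = a1 ^ 2 + b1 ^ 2 := by
    rw [hκdef, div_pow, div_eq_iff (by positivity), hR2]
    linear_combination -(P * a1 + Q * b1) * horth
  have hκ : κ ≠ 0 := fun h => by rw [h] at hκ2; simp at hκ2; linarith
  clear_value κ R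
  have haκ : a1 = -(κ * Q / R) := by
    rw [hκdef]; field_simp; rw [hR2]; linear_combination P * horth
  have hbκ : b1 = κ * P / R := by
    rw [hκdef]; field_simp; rw [hR2]; linear_combination Q * horth
  set e : Fin d → ℝ := fun i => c1 i / κ with he
  set β : Fin d → ℝ := fun i => (c0 i + c1 i * s₀) / R with hβdef
  set t₀ := γ s₀ 0 with ht₀
  have hβsq : ∑ i, β i ^ 2 = 1 - (ℓ / R) ^ 2 := by
    simp only [hβdef, div_pow, ← Finset.sum_div]
    rw [hB2, ← hR2]; field_simp
  have hβ1 : ∑ i, β i ^ 2 < 1 := by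
    rw [hβsq]; have : 0 < (ℓ / R) ^ 2 := by positivity
    linarith
  have hσ : kleinFactor β = ℓ / R := by
    rw [kleinFactor, hβsq, sub_sub_cancel, Real.sqrt_sq (by positivity)]
  have hβ : IsKleinPoint e β := by
    refine ⟨?_, ?_, hβ1.le⟩
    · simp only [he, div_pow, ← Finset.sum_div]
      rw [r2, ← hκ2]; field_simp
    · simp only [he, hβdef, div_mul_div_comm, ← Finset.sum_div]
      rw [hB1, zero_div]
  refine ⟨t₀, e, β, κ, s₀, hβ, hβ1, hκ, ?_⟩
  -- comparison of the ambient coordinates of the two curves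
  set θ := geodesicAngle ℓ β κ s₀ with hθ
  have hcθ : ∀ s, 0 < Real.cos (θ s) := fun s => cos_geodesicAngle_pos s
  have htan : ∀ s, Real.sin (θ s) = κ / R * (s - s₀) * Real.cos (θ s) := fun s => by
    have h1 : Real.tan (θ s) = κ / R * (s - s₀) := by
      rw [hθ, geodesicAngle, Real.tan_arctan, hσ]; field_simp
    rw [← h1, Real.tan_mul_cos (hcθ s).ne']
  have hρ : ∀ s, 0 < 2 / conformalFactor (γ s) - 1 := fun s => by
    have h1 := conformalFactor_pos (hγ.mem_bulk s)
    have h2 := conformalFactor_le_one (γ s)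
    rw [sub_pos, lt_div_iff₀ h1]; linarith
  have hsd : ∀ x : Coord d, spaceDot (0 : Fin d → ℝ) x = 0 := fun x => by simp [spaceDot]
  have hXc : ∀ s, ℓ * (2 / conformalFactor (γ s) - 1) * Real.cos (γ s 0 / ℓ) = a0 + a1 * s := by
    intro s
    rw [ha0, ha1, ← haff]; simp only [ambientFn, timePart, hsd]; ring
  have hXs : ∀ s, ℓ * (2 / conformalFactor (γ s) - 1) * Real.sin (γ s 0 / ℓ) = b0 + b1 * s := by
    intro s
    rw [hb0, hb1, ← haff]; simp only [ambientFn, timePart, hsd]; ring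
  have hXi : ∀ s i, ℓ * (2 / conformalFactor (γ s)) * γ s i.succ = c0 i + c1 i * s := by
    intro s i
    have : ∀ x : Coord d, spaceDot (Pi.single i 1) x = x (Fin.succ i) := fun x => by
      simp [spaceDot, Pi.single_apply]
    simp only [hc0, hc1]
    rw [← haff]; simp only [ambientFn, timePart, this]; ring
  have hρR : ∀ s, ℓ * (2 / conformalFactor (γ s) - 1) * Real.cos (θ s) = R := by
    intro s
    have h1 := Real.sin_sq_add_cos_sq (γ s 0 / ℓ)
    have h2 := Real.sin_sq_add_cos_sq (θ s)
    have h3 : (ℓ * (2 / conformalFactor (γ s) - 1)) ^ 2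
        = R ^ 2 * (1 + (κ / R * (s - s₀)) ^ 2) := by
      have e1 : (ℓ * (2 / conformalFactor (γ s) - 1)) ^ 2
          = (a0 + a1 * s) ^ 2 + (b0 + b1 * s) ^ 2 := by
        rw [← hXc, ← hXs]
        linear_combination (-(ℓ * (2 / conformalFactor (γ s) - 1)) ^ 2) * h1
      have e2 : a0 + a1 * s = P + a1 * (s - s₀) := by rw [hP]; ring
      have e3 : b0 + b1 * s = Q + b1 * (s - s₀) := by rw [hQ]; ring
      rw [e1, e2, e3]
      have e4 : R ^ 2 * (1 + (κ / R * (s - s₀)) ^ 2) = R ^ 2 + κ ^ 2 * (s - s₀) ^ 2 := by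
        field_simp
      rw [e4, hR2, hκ2]
      linear_combination 2 * (s - s₀) * horth
    have h4 : (ℓ * (2 / conformalFactor (γ s) - 1) * Real.cos (θ s)) ^ 2 = R ^ 2 := by
      rw [mul_pow, h3]
      rw [htan s] at h2
      linear_combination R ^ 2 * h2
    exact (sq_eq_sq₀ (mul_nonneg (mul_nonneg hℓ.le (hρ s).le) (hcθ s).le) hR0.le).1 h4
  have hθ0 : θ s₀ = 0 := by simp [hθ, geodesicAngle]
  have hP0 : R * Real.cos (t₀ / ℓ) = P := by
    rw [hP, ← hXc s₀, ← hρR s₀, hθ0, Real.cos_zero, mul_one]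
  have hQ0 : R * Real.sin (t₀ / ℓ) = Q := by
    rw [hQ, ← hXs s₀, ← hρR s₀, hθ0, Real.cos_zero, mul_one]
  have hcos : ∀ s, Real.cos (γ s 0 / ℓ) = Real.cos (t₀ / ℓ + θ s) := by
    intro s
    refine mul_left_cancel₀ hR0.ne' ?_
    rw [Real.cos_add, mul_sub, ← mul_assoc, ← mul_assoc, hP0, hQ0]
    nth_rw 1 [← hρR s]
    rw [mul_right_comm, hXc, htan s]
    have : a0 + a1 * s = P + a1 * (s - s₀) := by rw [hP]; ring
    rw [this, haκ]; ring
  have hsin : ∀ s, Real.sin (γ s 0 / ℓ) = Real.sin (t₀ / ℓ + θ s) := by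
    intro s
    refine mul_left_cancel₀ hR0.ne' ?_
    rw [Real.sin_add, mul_add, ← mul_assoc, ← mul_assoc, hP0, hQ0]
    nth_rw 1 [← hρR s]
    rw [mul_right_comm, hXs, htan s]
    have : b0 + b1 * s = Q + b1 * (s - s₀) := by rw [hQ]; ring
    rw [this, hbκ]; ring
  -- the times agree modulo `2π`, hence everywhere by continuity
  have htime : ∀ s, γ s 0 / ℓ = t₀ / ℓ + θ s := by
    have hd : ∀ s, HasDerivAt (fun s => γ s 0 / ℓ - (t₀ / ℓ + θ s))
        (deriv γ s 0 / ℓ - kleinFactor β * κ / ℓ * Real.cos (θ s) ^ 2) s := fun s =>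
      (((hasDerivAt_pi.1 (hdγ s)) 0).div_const ℓ).sub
        ((hasDerivAt_geodesicAngle s).const_add (t₀ / ℓ))
    have hsin0 : ∀ s, Real.sin (γ s 0 / ℓ - (t₀ / ℓ + θ s)) = 0 := fun s => by
      rw [Real.sin_sub, hcos, hsin]; ring
    have hcos1 : ∀ s, Real.cos (γ s 0 / ℓ - (t₀ / ℓ + θ s)) = 1 := fun s => by
      rw [Real.cos_sub, hcos, hsin]
      linear_combination Real.sin_sq_add_cos_sq (t₀ / ℓ + θ s)
    have hd0 : ∀ s, HasDerivAt (fun s => γ s 0 / ℓ - (t₀ / ℓ + θ s)) 0 s := fun s => by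
      refine (hd s).congr_deriv ?_
      have h1 := (hd s).sin
      simp only [hsin0, hcos1, one_mul] at h1
      exact h1.unique (hasDerivAt_const s 0)
    intro s
    have := is_const_of_deriv_eq_zero (fun s => (hd0 s).differentiableAt)
      (fun s => (hd0 s).deriv) s s₀
    simp only [hθ0, ← ht₀] at this
    linarith
  ext s a
  refine Fin.cases ?_ (fun i => ?_) a
  · rw [nullGeodesic, nullCurve_zero, ← hθ]
    have := htime s
    field_simp at this
    linarith
  · rw [nullGeodesic, nullCurve_succ, ← hθ]
    have hD : curveDenom β (θ s) = 1 + ℓ / R * Real.cos (θ s) := by rw [curveDenom, hσ]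
    have hDp := curveDenom_pos β (hcθ s).le
    rw [eq_div_iff hDp.ne', hD, htan s]
    have h1 := hXi s i
    have h2 := hρR s
    have h3 : R * (1 + ℓ / R * Real.cos (θ s))
        = ℓ * (2 / conformalFactor (γ s)) * Real.cos (θ s) := by
      rw [← mul_right_inj' hR0.ne'] at h2
      field_simp
      field_simp at h2
      linear_combination -h2
    refine mul_left_cancel₀ hR0.ne' ?_
    rw [mul_left_comm, h3]
    simp only [hβdef, he]
    have h4 : c0 i + c1 i * s = (c0 i + c1 i * s₀) + c1 i * (s - s₀) := by ring
    rw [h4] at h1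
    field_simp
    field_simp at h1
    linear_combination Real.cos (θ s) * h1

end Classification

/-! ### The wave operator in Klein coordinates -/

section Klein

variable {d : ℕ} {ℓ : ℝ} {x : Coord d}

theorem partialDeriv_comp_map {Φ : Fin (d + 1) → Coord d → ℝ} {ψ : Coord d → ℝ}
    (hψ : DifferentiableAt ℝ ψ fun j => Φ j x) (hΦ : ∀ j, DifferentiableAt ℝ (Φ j) x)
    (a : Fin (d + 1)) :
    partialDeriv a (fun y => ψ fun j => Φ j y) x
      = ∑ j, partialDeriv a (Φ j) x * partialDeriv j ψ fun j => Φ j x := by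
  have h1 : HasFDerivAt (fun y => fun j => Φ j y)
      (ContinuousLinearMap.pi fun j => fderiv ℝ (Φ j) x) x :=
    hasFDerivAt_pi.2 fun j => (hΦ j).hasFDerivAt
  have h2 := hψ.hasFDerivAt.comp x h1
  rw [partialDeriv, show (fun y => ψ fun j => Φ j y) = ψ ∘ fun y j => Φ j y from rfl, h2.fderiv,
    ContinuousLinearMap.comp_apply, fderiv_apply_eq_sum]
  rfl

theorem divergence_sum {ι : Type*} {s : Finset ι} {V : ι → Fin (d + 1) → Coord d → ℝ}
    (hV : ∀ i ∈ s, ∀ a, DifferentiableAt ℝ (V i a) x) :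
    divergence (fun a y => ∑ i ∈ s, V i a y) x = ∑ i ∈ s, divergence (V i) x := by
  simp only [divergence, Finset.sum_add_distrib]
  congr 1
  · rw [Finset.sum_comm]
    exact Finset.sum_congr rfl fun a _ => partialDeriv_sum fun i hi => hV i hi a
  · rw [Finset.sum_comm]
    exact Finset.sum_congr rfl fun a _ => Finset.mul_sum _ _ _

/-- The chain rule for the wave operator, under a change of coordinates `Φ`. -/
theorem waveOp_comp {Φ : Fin (d + 1) → Coord d → ℝ} {ψ : Coord d → ℝ}
    (hψ : ContDiffAt ℝ 2 ψ fun j => Φ j x) (hΦ : ∀ j, ContDiff ℝ 2 (Φ j)) :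
    waveOp ℓ (fun y => ψ fun j => Φ j y) x
      = ∑ j, ∑ k, partialDeriv k (partialDeriv j ψ) (fun j => Φ j x)
          * ∑ a, invMetricDiag ℓ x a * partialDeriv a (Φ j) x * partialDeriv a (Φ k) x
        + ∑ j, partialDeriv j ψ (fun j => Φ j x) * waveOp ℓ (Φ j) x := by
  have hΦc : ContinuousAt (fun y => fun j => Φ j y) x :=
    continuousAt_pi.2 fun j => (hΦ j).continuous.continuousAt
  have hnear : ∀ᶠ y in 𝓝 x, ContDiffAt ℝ 2 ψ fun j => Φ j y :=
    hΦc.eventually (hψ.eventually (by simp))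
  have hΦ1 : ∀ j y, DifferentiableAt ℝ (Φ j) y := fun j => (hΦ j).differentiable (by norm_num)
  have hu : ∀ j, DifferentiableAt ℝ (fun y => partialDeriv j ψ fun j => Φ j y) x := fun j =>
    DifferentiableAt.comp x (g := partialDeriv j ψ) (f := fun y => fun j => Φ j y)
      (differentiableAt_partialDeriv hψ j) (differentiableAt_pi.2 fun j => hΦ1 j x)
  have hV : ∀ j a, DifferentiableAt ℝ (fun y => invMetricDiag ℓ y a * partialDeriv a (Φ j) y) x :=
    fun j a => ((contDiffAt_invMetricDiag (n := 1) ℓ x a).differentiableAt (by norm_num)).fun_mul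
      (differentiableAt_partialDeriv (hΦ j).contDiffAt a)
  have e1 : waveOp ℓ (fun y => ψ fun j => Φ j y) x
      = divergence (fun a y => ∑ j, (partialDeriv j ψ fun j => Φ j y)
          * (invMetricDiag ℓ y a * partialDeriv a (Φ j) y)) x := by
    refine divergence_congr fun a => ?_
    filter_upwards [hnear] with y hy
    rw [partialDeriv_comp_map (hy.differentiableAt (by norm_num)) (fun j => hΦ1 j y) a,
      Finset.mul_sum]
    exact Finset.sum_congr rfl fun j _ => by ring
  rw [e1, divergence_sum fun j _ a => (hu j).fun_mul (hV j a)]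
  simp only [divergence_mul (hu _) (hV _), Finset.sum_add_distrib]
  congr 1
  refine Finset.sum_congr rfl fun j _ => ?_
  simp only [partialDeriv_comp_map (differentiableAt_partialDeriv hψ j) (fun j => hΦ1 j x),
    Finset.mul_sum]
  rw [Finset.sum_comm]
  exact Finset.sum_congr rfl fun k _ => Finset.sum_congr rfl fun a _ => by ring

/-- The map to Klein coordinates `(t, 2 y / (1 + |y|²))`, in which null geodesics project to
ellipses `cos τ β + sin τ e` centred at the origin. -/
def toKlein (a : Fin (d + 1)) (x : Coord d) : ℝ :=
  (Fin.cons (x 0) fun i => 2 * x i.succ / (2 - conformalFactor x) : Coord d) a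

/-- The inverse of `toKlein`. -/
def ofKlein (z : Coord d) : Coord d :=
  Fin.cons (z 0) fun i => z i.succ / (1 + √(1 - normSqSpace z))

@[simp] theorem toKlein_zero (x : Coord d) : toKlein 0 x = x 0 := rfl
@[simp] theorem toKlein_succ (i : Fin d) (x : Coord d) :
    toKlein i.succ x = 2 * x i.succ / (2 - conformalFactor x) := rfl

theorem contDiff_toKlein {n : WithTop ℕ∞} (a : Fin (d + 1)) :
    ContDiff ℝ n (toKlein a : Coord d → ℝ) := by
  refine Fin.cases ?_ (fun i => ?_) a
  · simp only [funext (toKlein_zero (d := d))]; fun_prop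
  · simp only [funext (toKlein_succ i)]
    exact ContDiff.div (by fun_prop) (by fun_prop) fun x => (two_sub_conformalFactor_pos x).ne'

theorem normSqSpace_toKlein (x : Coord d) : 1 - normSqSpace (fun a => toKlein a x)
    = (conformalFactor x / (2 - conformalFactor x)) ^ 2 := by
  have h2 := (two_sub_conformalFactor_pos x).ne'
  have : normSqSpace (fun a => toKlein a x)
      = 4 * (1 - conformalFactor x) / (2 - conformalFactor x) ^ 2 := by
    simp only [normSqSpace, toKlein_succ, div_pow, mul_pow, ← Finset.sum_div, ← Finset.mul_sum,
      sum_sq_eq]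
    norm_num
  rw [this]
  field_simp
  ring

theorem ofKlein_toKlein (hx : x ∈ bulk d) : ofKlein (fun a => toKlein a x) = x := by
  have h := conformalFactor_pos hx
  have h2 := two_sub_conformalFactor_pos x
  ext a
  refine Fin.cases rfl (fun i => ?_) a
  simp only [ofKlein, Fin.cons_succ, normSqSpace_toKlein, toKlein_succ]
  rw [Real.sqrt_sq (by positivity)]
  field_simp
  ring

theorem partialDeriv_toKlein_zero (a : Fin (d + 1)) (x : Coord d) :
    partialDeriv a (toKlein 0) x = if a = 0 then 1 else 0 := by
  rw [funext (toKlein_zero (d := d)), partialDeriv_coord]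

theorem partialDeriv_toKlein_succ (i : Fin d) (a : Fin (d + 1)) (x : Coord d) :
    partialDeriv a (toKlein i.succ) x
      = (if a = i.succ then 2 / (2 - conformalFactor x) else 0)
        - 4 * x i.succ * spatial x a / (2 - conformalFactor x) ^ 2 := by
  have h2 := (two_sub_conformalFactor_pos x).ne'
  have hM : DifferentiableAt ℝ (fun y : Coord d => 2 - conformalFactor y) x := by fun_prop
  have hinv : HasDerivAt (fun r : ℝ => 2 * r⁻¹) (2 * (-((2 - conformalFactor x) ^ 2)⁻¹))
      (2 - conformalFactor x) := (hasDerivAt_inv h2).const_mul 2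
  have e : (toKlein i.succ : Coord d → ℝ)
      = fun y => y i.succ * (2 * (2 - conformalFactor y)⁻¹) := by
    ext y; rw [toKlein_succ]; ring
  have hd2 : DifferentiableAt ℝ (fun y : Coord d => 2 * (2 - conformalFactor y)⁻¹) x :=
    DifferentiableAt.comp (g := fun r : ℝ => 2 * r⁻¹) (f := fun y : Coord d => 2 - conformalFactor y)
      x hinv.differentiableAt hM
  rw [e, partialDeriv_mul (by fun_prop) hd2,
    partialDeriv_comp (f := fun y : Coord d => 2 - conformalFactor y) hinv hM,
    partialDeriv_sub (by fun_prop) (by fun_prop), partialDeriv_conformalFactor, partialDeriv_const,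
    partialDeriv_coord]
  split_ifs <;> field_simp <;> ring

theorem invMetricDiag_zero (x : Coord d) :
    invMetricDiag ℓ x 0 = -(conformalFactor x / (2 - conformalFactor x)) ^ 2 := by
  simp [invMetricDiag]

theorem invMetricDiag_succ (x : Coord d) (i : Fin d) :
    invMetricDiag ℓ x i.succ = (conformalFactor x / (2 * ℓ)) ^ 2 := by
  simp [invMetricDiag]

theorem inner_toKlein_zero_zero : ∑ a, invMetricDiag ℓ x a * partialDeriv a (toKlein 0) x
    * partialDeriv a (toKlein 0) x = -(conformalFactor x / (2 - conformalFactor x)) ^ 2 := by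
  simp only [partialDeriv_toKlein_zero, mul_ite, mul_one, mul_zero, Finset.sum_ite_eq',
    Finset.mem_univ, if_true, invMetricDiag_zero]

theorem inner_toKlein_zero_succ (i : Fin d) : ∑ a, invMetricDiag ℓ x a
    * partialDeriv a (toKlein 0) x * partialDeriv a (toKlein i.succ) x = 0 := by
  simp only [partialDeriv_toKlein_zero, mul_ite, mul_one, mul_zero, ite_mul, zero_mul,
    Finset.sum_ite_eq', Finset.mem_univ, if_true, partialDeriv_toKlein_succ]
  simp [(Fin.succ_ne_zero i).symm]

theorem inner_toKlein_succ_succ (hℓ : ℓ ≠ 0) (i j : Fin d) : ∑ a, invMetricDiag ℓ x a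
    * partialDeriv a (toKlein i.succ) x * partialDeriv a (toKlein j.succ) x
    = (conformalFactor x / (2 - conformalFactor x)) ^ 2 / ℓ ^ 2
      * ((if i = j then 1 else 0) - toKlein i.succ x * toKlein j.succ x) := by
  have h2 := (two_sub_conformalFactor_pos x).ne'
  rw [Fin.sum_univ_succ]
  simp only [partialDeriv_toKlein_succ, spatial_zero, spatial_succ, invMetricDiag_succ,
    (Fin.succ_ne_zero _).symm, if_false, mul_zero, zero_div, sub_zero, zero_add, Fin.succ_inj,
    toKlein_succ]
  set Ω := conformalFactor x with hΩ
  have : ∀ k : Fin d, (Ω / (2 * ℓ)) ^ 2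
      * ((if k = i then 2 / (2 - Ω) else 0) - 4 * x i.succ * x k.succ / (2 - Ω) ^ 2)
      * ((if k = j then 2 / (2 - Ω) else 0) - 4 * x j.succ * x k.succ / (2 - Ω) ^ 2)
      = (Ω / (2 * ℓ)) ^ 2 * ((if k = i then (if k = j then 4 / (2 - Ω) ^ 2 else 0) else 0)
        - (if k = i then 8 * x k.succ * x j.succ / (2 - Ω) ^ 3 else 0)
        - (if k = j then 8 * x k.succ * x i.succ / (2 - Ω) ^ 3 else 0)
        + 16 * x i.succ * x j.succ / (2 - Ω) ^ 4 * x k.succ ^ 2) := fun k => by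
    split_ifs <;> field_simp <;> ring
  simp only [this, ← Finset.mul_sum, Finset.sum_add_distrib, Finset.sum_sub_distrib,
    Finset.sum_ite_eq', Finset.mem_univ, if_true, sum_sq_eq]
  rw [← hΩ]
  split_ifs <;> field_simp <;> ring

theorem waveOp_toKlein_zero (hℓ : ℓ ≠ 0) (hx : x ∈ bulk d) : waveOp ℓ (toKlein 0) x = 0 := by
  have e : ∀ a, (fun y : Coord d => invMetricDiag ℓ y a * partialDeriv a (toKlein 0) y)
      = fun y => if a = 0 then invMetricDiag ℓ y 0 else 0 := fun a => by
    ext y; rw [partialDeriv_toKlein_zero]; split_ifs with h <;> simp [h]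
  simp only [waveOp, divergence, e]
  rw [Fin.sum_univ_succ, Fin.sum_univ_succ]
  simp only [if_true, Fin.succ_ne_zero, if_false, partialDeriv_const, mul_zero,
    Finset.sum_const_zero, add_zero, partialDeriv_invMetricDiag hℓ hx, traceChristoffel,
    spatial_zero, zero_mul, partialDeriv_toKlein_zero]

theorem partialDeriv_partialDeriv_toKlein (i k : Fin d) :
    partialDeriv k.succ (partialDeriv k.succ (toKlein i.succ)) x
      = (if k = i then -8 * x i.succ / (2 - conformalFactor x) ^ 2 else 0)
        - 4 * x i.succ / (2 - conformalFactor x) ^ 2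
        + 16 * x i.succ * x k.succ ^ 2 / (2 - conformalFactor x) ^ 3 := by
  have h2 := (two_sub_conformalFactor_pos x).ne'
  have hM : DifferentiableAt ℝ (fun y : Coord d => 2 - conformalFactor y) x := by fun_prop
  have hM' : partialDeriv k.succ (fun y : Coord d => 2 - conformalFactor y) x = 2 * x k.succ := by
    rw [partialDeriv_sub (by fun_prop) (by fun_prop), partialDeriv_conformalFactor,
      partialDeriv_const, spatial_succ]; ring
  have hinv : HasDerivAt (fun r : ℝ => (if k = i then 2 else 0) * r⁻¹)
      ((if k = i then 2 else 0) * (-((2 - conformalFactor x) ^ 2)⁻¹))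
      (2 - conformalFactor x) := (hasDerivAt_inv h2).const_mul _
  have hinv2 : HasDerivAt (fun r : ℝ => 4 * (r ^ 2)⁻¹)
      (4 * (-(2 * (2 - conformalFactor x)) / ((2 - conformalFactor x) ^ 2) ^ 2))
      (2 - conformalFactor x) := by
    have := ((hasDerivAt_pow 2 (2 - conformalFactor x)).inv (pow_ne_zero 2 h2)).const_mul 4
    refine this.congr_deriv ?_
    norm_num
  have hd1 : DifferentiableAt ℝ
      (fun y : Coord d => (if k = i then 2 else 0) * (2 - conformalFactor y)⁻¹) x :=
    DifferentiableAt.comp (g := fun r : ℝ => (if k = i then 2 else 0) * r⁻¹)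
      (f := fun y : Coord d => 2 - conformalFactor y) x hinv.differentiableAt hM
  have hd2 : DifferentiableAt ℝ (fun y : Coord d => 4 * ((2 - conformalFactor y) ^ 2)⁻¹) x :=
    DifferentiableAt.comp (g := fun r : ℝ => 4 * (r ^ 2)⁻¹)
      (f := fun y : Coord d => 2 - conformalFactor y) x hinv2.differentiableAt hM
  have e : partialDeriv k.succ (toKlein i.succ : Coord d → ℝ)
      = fun y => (if k = i then 2 else 0) * (2 - conformalFactor y)⁻¹
        - (y i.succ * y k.succ) * (4 * ((2 - conformalFactor y) ^ 2)⁻¹) := by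
    ext y
    rw [partialDeriv_toKlein_succ, spatial_succ]
    simp only [Fin.succ_inj]
    split_ifs <;> ring
  have hd3 : DifferentiableAt ℝ (fun y : Coord d => y i.succ * y k.succ) x := by fun_prop
  rw [e, partialDeriv_sub hd1 (hd3.fun_mul hd2), partialDeriv_mul hd3 hd2,
    partialDeriv_comp (f := fun y : Coord d => 2 - conformalFactor y) hinv hM,
    partialDeriv_comp (f := fun y : Coord d => 2 - conformalFactor y) hinv2 hM, hM',
    partialDeriv_mul (by fun_prop) (by fun_prop), partialDeriv_coord, partialDeriv_coord]
  simp only [Fin.succ_inj, if_true]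
  split_ifs with hki
  · subst hki; field_simp; ring
  · field_simp; ring

theorem waveOp_toKlein_succ (hℓ : ℓ ≠ 0) (hx : x ∈ bulk d) (i : Fin d) :
    waveOp ℓ (toKlein i.succ) x = -(conformalFactor x / (2 - conformalFactor x)) ^ 2 / ℓ ^ 2
      * toKlein i.succ x := by
  have h := (conformalFactor_pos hx).ne'
  have h2 := (two_sub_conformalFactor_pos x).ne'
  have hG : ∀ a, DifferentiableAt ℝ (fun y => invMetricDiag ℓ y a) x := fun a =>
    (contDiffAt_invMetricDiag (n := 1) ℓ x a).differentiableAt (by norm_num)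
  have hT : ∀ a, DifferentiableAt ℝ (partialDeriv a (toKlein i.succ)) x := fun a =>
    differentiableAt_partialDeriv (contDiff_toKlein i.succ).contDiffAt a
  have e0 : partialDeriv 0 (toKlein i.succ : Coord d → ℝ) = fun _ => 0 := by
    ext y; simp [partialDeriv_toKlein_succ, (Fin.succ_ne_zero i).symm]
  have hL : ∑ a, logSlope x a = 4 / (conformalFactor x * (2 - conformalFactor x))
      + d * (2 / conformalFactor x) := by
    rw [Fin.sum_univ_succ]
    simp [logSlope]
  simp only [waveOp, divergence]
  rw [Fin.sum_univ_succ, Fin.sum_univ_succ (f := fun a => traceChristoffel a x * _)]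
  simp only [traceChristoffel, spatial_zero, mul_zero, zero_mul, zero_add, hL]
  rw [partialDeriv_mul (hG 0) (hT 0), e0]
  simp only [partialDeriv_const, mul_zero, add_zero, zero_add,
    partialDeriv_mul (hG _) (hT _), partialDeriv_invMetricDiag hℓ hx,
    partialDeriv_partialDeriv_toKlein, spatial_succ]
  simp only [partialDeriv_toKlein_succ, spatial_succ, invMetricDiag_succ, Fin.succ_inj,
    toKlein_succ, logSlope, Fin.succ_ne_zero, if_false]
  set Ω := conformalFactor x with hΩ
  rw [← Finset.sum_add_distrib]
  have : ∀ k : Fin d,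
      -2 * (2 / Ω) * x k.succ * (Ω / (2 * ℓ)) ^ 2 *
              ((if k = i then 2 / (2 - Ω) else 0) - 4 * x i.succ * x k.succ / (2 - Ω) ^ 2) +
            (Ω / (2 * ℓ)) ^ 2 *
              ((if k = i then -8 * x i.succ / (2 - Ω) ^ 2 else 0) - 4 * x i.succ / (2 - Ω) ^ 2 +
                16 * x i.succ * x k.succ ^ 2 / (2 - Ω) ^ 3) +
          (4 / (Ω * (2 - Ω)) + ↑d * (2 / Ω)) * x k.succ *
            ((Ω / (2 * ℓ)) ^ 2 *
              ((if k = i then 2 / (2 - Ω) else 0) - 4 * x i.succ * x k.succ / (2 - Ω) ^ 2))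
      = (Ω / (2 * ℓ)) ^ 2 * ((if k = i then x i.succ * ((4 / (Ω * (2 - Ω)) + d * (2 / Ω) - 4 / Ω)
            * (2 / (2 - Ω)) - 8 / (2 - Ω) ^ 2) else 0)
          - 4 * x i.succ / (2 - Ω) ^ 2 + x i.succ * (16 / (2 - Ω) ^ 3
            - (4 / (Ω * (2 - Ω)) + d * (2 / Ω) - 4 / Ω) * (4 / (2 - Ω) ^ 2)) * x k.succ ^ 2) := by
    intro k
    split_ifs with hki
    · subst hki; field_simp; ring
    · field_simp; ring
  rw [Finset.sum_congr rfl fun k _ => this k]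
  simp only [← Finset.mul_sum, Finset.sum_add_distrib, Finset.sum_sub_distrib,
    Finset.sum_ite_eq', Finset.mem_univ, if_true, sum_sq_eq, Finset.sum_const, Finset.card_univ,
    Fintype.card_fin, nsmul_eq_mul]
  rw [← hΩ]
  field_simp
  ring

theorem contDiffAt_ofKlein {n : WithTop ℕ∞} {z : Coord d} (hz : normSqSpace z < 1) :
    ContDiffAt ℝ n (ofKlein : Coord d → Coord d) z := by
  have h1 : ContDiffAt ℝ n (fun y : Coord d => √(1 - normSqSpace y)) z := by
    refine ContDiffAt.sqrt ?_ (by linarith)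
    unfold normSqSpace
    fun_prop
  rw [contDiffAt_pi]
  intro a
  refine Fin.cases ?_ (fun i => ?_) a
  · simp only [ofKlein, Fin.cons_zero]; fun_prop
  · simp only [ofKlein, Fin.cons_succ]
    refine ContDiffAt.div (by fun_prop) (contDiffAt_const.add h1) ?_
    have := Real.sqrt_nonneg (1 - normSqSpace z)
    positivity

theorem normSqSpace_toKlein_lt (hx : x ∈ bulk d) : normSqSpace (fun a => toKlein a x) < 1 := by
  have h1 := normSqSpace_toKlein x
  have h2 := conformalFactor_pos hx
  have h3 := two_sub_conformalFactor_pos x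
  have : 0 < (conformalFactor x / (2 - conformalFactor x)) ^ 2 := by positivity
  linarith

/-- In Klein coordinates `z = (t, p)` the wave operator is
`(1 - |p|²) / ℓ² (-ℓ² ∂_t² + (δ_ij - p_i p_j) ∂_i ∂_j - p_i ∂_i)`. -/
theorem waveOp_eq_klein (hℓ : ℓ ≠ 0) (hx : x ∈ bulk d) {φ : Coord d → ℝ}
    (hφ : ContDiffAt ℝ 2 φ x) {z : Coord d} (hz : z = fun a => toKlein a x) :
    waveOp ℓ φ x = (1 - normSqSpace z) / ℓ ^ 2
      * (-ℓ ^ 2 * partialDeriv 0 (partialDeriv 0 fun y => φ (ofKlein y)) z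
        + ∑ i : Fin d, ∑ j : Fin d, ((if i = j then 1 else 0) - z i.succ * z j.succ)
          * partialDeriv j.succ (partialDeriv i.succ fun y => φ (ofKlein y)) z
        - ∑ i : Fin d, z i.succ * partialDeriv i.succ (fun y => φ (ofKlein y)) z) := by
  have hψ : ContDiffAt ℝ 2 (fun y => φ (ofKlein y)) fun a => toKlein a x := by
    refine ContDiffAt.comp _ ?_ (contDiffAt_ofKlein (normSqSpace_toKlein_lt hx))
    rwa [ofKlein_toKlein hx]
  have e1 : waveOp ℓ φ x = waveOp ℓ (fun y => φ (ofKlein fun a => toKlein a y)) x := by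
    refine divergence_congr fun a => ?_
    filter_upwards [bulk_mem_nhds hx] with y hy
    rw [partialDeriv_congr (g := fun y => φ (ofKlein fun a => toKlein a y))]
    filter_upwards [bulk_mem_nhds hy] with w hw
    rw [ofKlein_toKlein hw]
  have hin : ∀ i : Fin d, ∑ a, invMetricDiag ℓ x a * partialDeriv a (toKlein i.succ) x
      * partialDeriv a (toKlein 0) x = 0 := fun i =>
    (Finset.sum_congr rfl fun a _ => by ring).trans (inner_toKlein_zero_succ (ℓ := ℓ) (x := x) i)
  rw [e1, waveOp_comp hψ fun j => contDiff_toKlein j, hz, normSqSpace_toKlein]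
  set ψ : Coord d → ℝ := fun y => φ (ofKlein y)
  set z' : Coord d := fun a => toKlein a x
  obtain ⟨G, hG⟩ : ∃ G : Fin (d + 1) → Fin (d + 1) → ℝ, ∀ j k, ∑ a, invMetricDiag ℓ x a
      * partialDeriv a (toKlein j) x * partialDeriv a (toKlein k) x = G j k := ⟨_, fun _ _ => rfl⟩
  have g00 : G 0 0 = _ := (hG 0 0).symm.trans inner_toKlein_zero_zero
  have g0 : ∀ i : Fin d, G 0 i.succ = 0 := fun i => (hG 0 _).symm.trans (inner_toKlein_zero_succ i)
  have g1 : ∀ i : Fin d, G i.succ 0 = 0 := fun i => (hG _ 0).symm.trans (hin i)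
  have g2 : ∀ i j : Fin d, G i.succ j.succ = _ := fun i j =>
    (hG _ _).symm.trans (inner_toKlein_succ_succ hℓ i j)
  simp only [hG, Fin.sum_univ_succ (n := d), g00, g0, g1, g2, mul_zero, Finset.sum_const_zero,
    add_zero, zero_add, waveOp_toKlein_zero hℓ hx, waveOp_toKlein_succ hℓ hx]
  rw [mul_sub, mul_add, sub_eq_add_neg (_ + _) (_ * _)]
  simp only [Finset.mul_sum, ← Finset.sum_neg_distrib]
  rw [add_assoc, add_assoc]
  congr 1
  · field_simp
  congr 1
  · exact Finset.sum_congr rfl fun i _ => Finset.sum_congr rfl fun j _ => by ring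
  · exact Finset.sum_congr rfl fun i _ => by ring

/-- The null geodesics in Klein coordinates. -/
def kleinLine (ℓ t₀ : ℝ) (e β : Fin d → ℝ) (τ : ℝ) : Coord d :=
  Fin.cons (t₀ + ℓ * τ) fun i => Real.cos τ * β i + Real.sin τ * e i

theorem toKlein_nullCurve {t₀ τ : ℝ} {e β : Fin d → ℝ} (hβ : IsKleinPoint e β)
    (hτ : 0 ≤ Real.cos τ) :
    (fun a => toKlein a (nullCurve ℓ t₀ e β τ)) = kleinLine ℓ t₀ e β τ := by
  have hD := (curveDenom_pos β hτ).ne'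
  ext a
  refine Fin.cases rfl (fun i => ?_) a
  rw [toKlein_succ, two_sub_conformalFactor_nullCurve hβ hD, nullCurve_succ]
  simp only [kleinLine, Fin.cons_succ]
  field_simp

theorem normSqSpace_kleinLine {t₀ τ : ℝ} {e β : Fin d → ℝ} (hβ : IsKleinPoint e β) :
    1 - normSqSpace (kleinLine ℓ t₀ e β τ) = (kleinFactor β * Real.cos τ) ^ 2 := by
  simp only [normSqSpace, kleinLine, Fin.cons_succ]
  rw [sum_sq_combination hβ.unit hβ.orth, mul_pow, kleinFactor_sq hβ.le_one]
  linear_combination -Real.sin_sq_add_cos_sq τ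

theorem ofKlein_kleinLine {t₀ τ : ℝ} {e β : Fin d → ℝ} (hβ : IsKleinPoint e β)
    (hτ : 0 ≤ Real.cos τ) : ofKlein (kleinLine ℓ t₀ e β τ) = nullCurve ℓ t₀ e β τ := by
  ext a
  refine Fin.cases rfl (fun i => ?_) a
  simp only [ofKlein, Fin.cons_succ, normSqSpace_kleinLine hβ]
  rw [Real.sqrt_sq (mul_nonneg (kleinFactor_nonneg β) hτ)]
  rfl

/-- Vectors `w_i` with `∑ w_i w_iᵀ` the orthogonal projection to `e^⊥` minus `β βᵀ`. -/
def kleinFrame (e β : Fin d → ℝ) (i j : Fin d) : ℝ :=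
  (if i = j then 1 else 0) - e i * e j - (1 + kleinFactor β)⁻¹ * β i * β j

/-- The frame is the square root of the projection to `e^⊥` minus `β βᵀ`: on the line of `β` it acts
as `√(1 - |β|²)`. -/
theorem sum_kleinFrame_mul {e β : Fin d → ℝ} (hβ : IsKleinPoint e β) (j k : Fin d) :
    ∑ i, kleinFrame e β i j * kleinFrame e β i k
      = (if j = k then 1 else 0) - e j * e k - β j * β k := by
  have hσ := kleinFactor_nonneg β
  have hσ1 : 1 + kleinFactor β ≠ 0 := by positivity
  have hσ2 := kleinFactor_sq hβ.le_one
  set c := (1 + kleinFactor β)⁻¹ with hc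
  have e1 : ∀ i, kleinFrame e β i j * kleinFrame e β i k
      = (if i = j then ((if j = k then 1 else 0) - e j * e k - c * β j * β k) else 0)
        + (if i = k then (- e i * e j - c * β i * β j) else 0)
        + e i ^ 2 * (e j * e k) + β i * e i * (c * (e j * β k + e k * β j))
        + β i ^ 2 * (c ^ 2 * β j * β k) := by
    intro i
    unfold kleinFrame
    rw [← hc]
    by_cases h1 : i = j
    · subst h1
      by_cases h2 : i = k
      · subst h2; simp only [if_true]; ring
      · simp only [if_true, h2, if_false]; ring
    · by_cases h2 : i = k
      · subst h2; simp only [h1, if_true, if_false]; ring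
      · simp only [h1, h2, if_false]; ring
  rw [Finset.sum_congr rfl fun i _ => e1 i]
  simp only [Finset.sum_add_distrib, ← Finset.sum_mul, Finset.sum_ite_eq', Finset.mem_univ, if_true,
    hβ.unit, hβ.orth]
  have e2 : ∑ i, β i ^ 2 = 1 - kleinFactor β ^ 2 := by linarith
  rw [e2]
  have e3 : (1 - kleinFactor β ^ 2) * c ^ 2 - 2 * c = -1 := by
    rw [hc]; field_simp; ring
  linear_combination (β j * β k) * e3

theorem sum_kleinFrame_orth {e β : Fin d → ℝ} (hβ : IsKleinPoint e β) (i : Fin d) :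
    ∑ j, kleinFrame e β i j * e j = 0 := by
  have : ∀ j, kleinFrame e β i j * e j = (if i = j then e j else 0) - e i * e j ^ 2
      - (1 + kleinFactor β)⁻¹ * β i * (β j * e j) := fun j => by
    unfold kleinFrame; split_ifs <;> ring
  simp only [this, Finset.sum_sub_distrib, Finset.sum_ite_eq, Finset.mem_univ, if_true,
    ← Finset.mul_sum, hβ.unit, hβ.orth]
  ring

end Klein

/-! ### The variation of the null curvature along a null geodesic -/

section Variation

variable {d : ℕ} {ℓ t₀ τ : ℝ} {e β : Fin d → ℝ}

/-- The velocity of `kleinLine`. -/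
def kleinVelocity (ℓ : ℝ) (e β : Fin d → ℝ) (τ : ℝ) : Coord d :=
  Fin.cons ℓ fun i => Real.cos τ * e i - Real.sin τ * β i

/-- The acceleration of `kleinLine`. -/
def kleinAcceleration (e β : Fin d → ℝ) (τ : ℝ) : Coord d :=
  Fin.cons 0 fun i => -(Real.cos τ * β i + Real.sin τ * e i)

theorem hasDerivAt_kleinLine (τ : ℝ) :
    HasDerivAt (kleinLine ℓ t₀ e β) (kleinVelocity ℓ e β τ) τ := by
  rw [hasDerivAt_pi]
  intro a
  refine Fin.cases ?_ (fun i => ?_) a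
  · simp only [kleinLine, kleinVelocity, Fin.cons_zero]
    simpa using ((hasDerivAt_id τ).const_mul ℓ).const_add t₀
  · simp only [kleinLine, kleinVelocity, Fin.cons_succ]
    exact (((Real.hasDerivAt_cos τ).mul_const (β i)).add
      ((Real.hasDerivAt_sin τ).mul_const (e i))).congr_deriv (by ring)

theorem hasDerivAt_kleinVelocity (τ : ℝ) :
    HasDerivAt (kleinVelocity ℓ e β) (kleinAcceleration e β τ) τ := by
  rw [hasDerivAt_pi]
  intro a
  refine Fin.cases ?_ (fun i => ?_) a
  · simp only [kleinVelocity, kleinAcceleration, Fin.cons_zero]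
    exact hasDerivAt_const τ ℓ
  · simp only [kleinAcceleration, kleinVelocity, Fin.cons_succ]
    exact (((Real.hasDerivAt_cos τ).mul_const (e i)).sub
      ((Real.hasDerivAt_sin τ).mul_const (β i))).congr_deriv (by ring)

theorem normSqSpace_kleinLine_lt (hβ : IsKleinPoint e β) (hβ1 : ∑ i, β i ^ 2 < 1)
    (hτ : 0 < Real.cos τ) : normSqSpace (kleinLine ℓ t₀ e β τ) < 1 := by
  have h1 := normSqSpace_kleinLine (ℓ := ℓ) (t₀ := t₀) (τ := τ) hβ
  have h2 := kleinFactor_pos hβ1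
  have : 0 < (kleinFactor β * Real.cos τ) ^ 2 := by positivity
  linarith

theorem partialDeriv_zero_comp_ofKlein {φ : Coord d → ℝ} {z : Coord d} (hz : normSqSpace z < 1)
    (hφ : DifferentiableAt ℝ φ (ofKlein z)) :
    partialDeriv 0 (fun y => φ (ofKlein y)) z = partialDeriv 0 φ (ofKlein z) := by
  have h1 : ∀ s : ℝ, ofKlein (z + s • (Pi.single 0 1 : Coord d))
      = ofKlein z + s • (Pi.single 0 1 : Coord d) := by
    intro s
    have hn : normSqSpace (z + s • (Pi.single 0 1 : Coord d)) = normSqSpace z := by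
      simp [normSqSpace]
    ext a
    refine Fin.cases ?_ (fun i => ?_) a
    · simp [ofKlein]
    · simp [ofKlein, hn]
  have hψ : DifferentiableAt ℝ (fun y => φ (ofKlein y)) z :=
    DifferentiableAt.comp z hφ ((contDiffAt_ofKlein (n := 1) hz).differentiableAt (by norm_num))
  have hl : ∀ w : Coord d, HasDerivAt (fun s : ℝ => w + s • (Pi.single 0 1 : Coord d))
      (Pi.single 0 1) 0 := fun w => by
    simpa using ((hasDerivAt_id (0 : ℝ)).smul_const (Pi.single 0 1 : Coord d)).const_add w
  have h2 := HasFDerivAt.comp_hasDerivAt_of_eq (x := (0 : ℝ)) (hl := hψ.hasFDerivAt)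
    (hf := hl z) (by simp)
  have h3 := HasFDerivAt.comp_hasDerivAt_of_eq (x := (0 : ℝ)) (hl := hφ.hasFDerivAt)
    (hf := hl (ofKlein z)) (by simp)
  refine h2.unique (h3.congr_of_eventuallyEq (Eventually.of_forall fun s => ?_))
  simp only [Function.comp, h1]

/-- The wave operator along a null geodesic, split into a total derivative along the curve and
second derivatives in directions transverse to it. -/
theorem waveOp_nullCurve (hℓ : ℓ ≠ 0) (hβ : IsKleinPoint e β) (hβ1 : ∑ i, β i ^ 2 < 1)
    (hτ : 0 < Real.cos τ) {φ : Coord d → ℝ} (hφ : ∀ x ∈ bulk d, ContDiffAt ℝ 2 φ x) :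
    HasDerivAt (fun τ => deriv (fun τ => φ (nullCurve ℓ t₀ e β τ)) τ
        - 2 * ℓ * partialDeriv 0 φ (nullCurve ℓ t₀ e β τ))
      (ℓ ^ 2 / (kleinFactor β * Real.cos τ) ^ 2 * waveOp ℓ φ (nullCurve ℓ t₀ e β τ)
        - ∑ i : Fin d, ∑ j : Fin d, ((if i = j then 1 else 0) - e i * e j - β i * β j)
          * partialDeriv j.succ (partialDeriv i.succ fun y => φ (ofKlein y))
            (kleinLine ℓ t₀ e β τ)) τ := by
  have hσ := kleinFactor_pos hβ1
  set ψ : Coord d → ℝ := fun y => φ (ofKlein y) with hψdef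
  have hcos : ∀ᶠ s in 𝓝 τ, 0 < Real.cos s :=
    Real.continuous_cos.continuousAt.eventually (lt_mem_nhds hτ)
  have hψ : ∀ s, 0 < Real.cos s → ContDiffAt ℝ 2 ψ (kleinLine ℓ t₀ e β s) := fun s hs => by
    refine ContDiffAt.comp _ ?_ (contDiffAt_ofKlein (normSqSpace_kleinLine_lt hβ hβ1 hs))
    rw [ofKlein_kleinLine hβ hs.le]
    exact hφ _ (nullCurve_mem_bulk hβ hβ1 hs)
  have h1 : ∀ s, 0 < Real.cos s → HasDerivAt (fun τ => φ (nullCurve ℓ t₀ e β τ))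
      (∑ a, kleinVelocity ℓ e β s a * partialDeriv a ψ (kleinLine ℓ t₀ e β s)) s := fun s hs => by
    refine (hasDerivAt_comp_curve ((hψ s hs).differentiableAt (by norm_num))
      (hasDerivAt_kleinLine s)).congr_of_eventuallyEq ?_
    filter_upwards [Real.continuous_cos.continuousAt.eventually (lt_mem_nhds hs)] with r hr
    rw [hψdef]
    simp only [ofKlein_kleinLine hβ (le_of_lt hr)]
  have h2 : ∀ a, HasDerivAt (fun s => partialDeriv a ψ (kleinLine ℓ t₀ e β s))
      (∑ b, kleinVelocity ℓ e β τ b * partialDeriv b (partialDeriv a ψ) (kleinLine ℓ t₀ e β τ)) τ :=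
    fun a => hasDerivAt_comp_curve (differentiableAt_partialDeriv (hψ τ hτ) a)
      (hasDerivAt_kleinLine τ)
  have h3 := (HasDerivAt.fun_sum fun a (_ : a ∈ Finset.univ) =>
    ((hasDerivAt_pi.1 (hasDerivAt_kleinVelocity (ℓ := ℓ) (e := e) (β := β) τ)) a).mul (h2 a)).sub
    ((h2 0).const_mul (2 * ℓ))
  refine (h3.congr_of_eventuallyEq ?_).congr_deriv ?_
  · filter_upwards [hcos] with s hs
    rw [(h1 s hs).deriv, ← ofKlein_kleinLine hβ hs.le, ← partialDeriv_zero_comp_ofKlein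
      (normSqSpace_kleinLine_lt hβ hβ1 hs)]
    · rfl
    · rw [ofKlein_kleinLine hβ hs.le]
      exact (hφ _ (nullCurve_mem_bulk hβ hβ1 hs)).differentiableAt (by norm_num)
  · have hx := nullCurve_mem_bulk (ℓ := ℓ) (t₀ := t₀) hβ hβ1 hτ
    rw [waveOp_eq_klein hℓ hx (hφ _ hx) (toKlein_nullCurve hβ hτ.le).symm,
      normSqSpace_kleinLine hβ]
    have hsymm : ∀ a b, partialDeriv a (partialDeriv b ψ) (kleinLine ℓ t₀ e β τ)
        = partialDeriv b (partialDeriv a ψ) (kleinLine ℓ t₀ e β τ) := fun a b =>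
      partialDeriv_comm b (hψ τ hτ)
    have hc : ℓ ^ 2 / (kleinFactor β * Real.cos τ) ^ 2
        * ((kleinFactor β * Real.cos τ) ^ 2 / ℓ ^ 2) = 1 := by field_simp
    rw [← mul_assoc, hc, one_mul]
    obtain ⟨S, hS⟩ : ∃ S : Fin (d + 1) → Fin (d + 1) → ℝ, ∀ a b,
      partialDeriv a (partialDeriv b ψ) (kleinLine ℓ t₀ e β τ) = S a b := ⟨_, fun _ _ => rfl⟩
    simp only [hS] at hsymm ⊢
    obtain ⟨p, hp⟩ : ∃ p : Fin (d + 1) → ℝ, ∀ a,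
      partialDeriv a ψ (kleinLine ℓ t₀ e β τ) = p a := ⟨_, fun _ => rfl⟩
    simp only [← hψdef, hS, hp]
    simp only [Fin.sum_univ_succ (n := d)]
    simp only [kleinVelocity, kleinAcceleration, kleinLine, Fin.cons_zero, Fin.cons_succ]
    have hs2 : ∀ i : Fin d, S 0 i.succ = S i.succ 0 := fun i => hsymm 0 _
    have hq : ∀ i j : Fin d, (Real.cos τ * e i - Real.sin τ * β i)
        * (Real.cos τ * e j - Real.sin τ * β j) = e i * e j + β i * β j
        - (Real.cos τ * β i + Real.sin τ * e i) * (Real.cos τ * β j + Real.sin τ * e j) :=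
      fun i j => by linear_combination (e i * e j + β i * β j) * Real.sin_sq_add_cos_sq τ
    have e1 : ∑ i : Fin d, (-(Real.cos τ * β i + Real.sin τ * e i) * p i.succ
          + (Real.cos τ * e i - Real.sin τ * β i) * (ℓ * S 0 i.succ
            + ∑ j : Fin d, (Real.cos τ * e j - Real.sin τ * β j) * S j.succ i.succ))
        = -∑ i : Fin d, (Real.cos τ * β i + Real.sin τ * e i) * p i.succ
          + ℓ * ∑ i : Fin d, (Real.cos τ * e i - Real.sin τ * β i) * S i.succ 0
          + ∑ i : Fin d, ∑ j : Fin d, (Real.cos τ * e i - Real.sin τ * β i)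
            * (Real.cos τ * e j - Real.sin τ * β j) * S j.succ i.succ := by
      rw [Finset.mul_sum, ← Finset.sum_neg_distrib, ← Finset.sum_add_distrib,
        ← Finset.sum_add_distrib]
      refine Finset.sum_congr rfl fun i _ => ?_
      rw [hs2, mul_add, Finset.mul_sum]
      simp only [← mul_assoc]
      ring
    have e2 : ∑ i : Fin d, ∑ j : Fin d, ((if i = j then 1 else 0)
          - (Real.cos τ * β i + Real.sin τ * e i) * (Real.cos τ * β j + Real.sin τ * e j))
            * S j.succ i.succ
        - ∑ i : Fin d, ∑ j : Fin d, ((if i = j then 1 else 0) - e i * e j - β i * β j)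
            * S j.succ i.succ
        = ∑ i : Fin d, ∑ j : Fin d, (Real.cos τ * e i - Real.sin τ * β i)
            * (Real.cos τ * e j - Real.sin τ * β j) * S j.succ i.succ := by
      rw [← Finset.sum_sub_distrib]
      refine Finset.sum_congr rfl fun i _ => ?_
      rw [← Finset.sum_sub_distrib]
      exact Finset.sum_congr rfl fun j _ => by rw [hq]; ring
    rw [e1]
    linear_combination -e2

theorem kleinLine_add_smul (w : Fin d → ℝ) (θ : ℝ) : kleinLine ℓ t₀ e (β + θ • w) τ
    = kleinLine ℓ t₀ e β τ + θ • (Fin.cons 0 (Real.cos τ • w) : Coord d) := by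
  ext a
  refine Fin.cases ?_ (fun i => ?_) a
  · simp [kleinLine]
  · simp [kleinLine]; ring

/-- Points of the Klein model near a given one. -/
theorem eventually_isKleinPoint (hβ : IsKleinPoint e β) (hβ1 : ∑ i, β i ^ 2 < 1)
    {w : Fin d → ℝ} (hw : ∑ i, w i * e i = 0) :
    ∀ᶠ θ : ℝ in 𝓝 0, IsKleinPoint e (β + θ • w) ∧ ∑ i, (β + θ • w) i ^ 2 < 1 := by
  have hc : Continuous fun θ : ℝ => ∑ i, (β + θ • w) i ^ 2 := by
    simp only [Pi.add_apply, Pi.smul_apply, smul_eq_mul]; fun_prop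
  have h := hc.continuousAt.eventually (gt_mem_nhds (show ∑ i, (β + (0 : ℝ) • w) i ^ 2 < 1 by simpa))
  filter_upwards [h] with θ hθ
  refine ⟨⟨hβ.unit, ?_, hθ.le⟩, hθ⟩
  have : ∀ i, (β + θ • w) i * e i = β i * e i + θ * (w i * e i) := fun i => by
    simp only [Pi.add_apply, Pi.smul_apply, smul_eq_mul]; ring
  simp only [this, Finset.sum_add_distrib, ← Finset.mul_sum, hβ.orth, hw, mul_zero, add_zero]

/-- The second derivative of a function on AdS under a transverse displacement of the null
geodesic. -/
theorem deriv_deriv_nullCurve (hβ : IsKleinPoint e β) (hβ1 : ∑ i, β i ^ 2 < 1)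
    (hτ : 0 < Real.cos τ) {w : Fin d → ℝ} (hw : ∑ i, w i * e i = 0) {φ : Coord d → ℝ}
    (hφ : ∀ x ∈ bulk d, ContDiffAt ℝ 2 φ x) :
    deriv (deriv fun θ : ℝ => φ (nullCurve ℓ t₀ e (β + θ • w) τ)) 0
      = Real.cos τ ^ 2 * ∑ i : Fin d, ∑ j : Fin d, w i * w j
        * partialDeriv j.succ (partialDeriv i.succ fun y => φ (ofKlein y))
          (kleinLine ℓ t₀ e β τ) := by
  set ψ : Coord d → ℝ := fun y => φ (ofKlein y) with hψdef
  have hψ : ∀ {b : Fin d → ℝ}, IsKleinPoint e b → ∑ i, b i ^ 2 < 1 →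
      ContDiffAt ℝ 2 ψ (kleinLine ℓ t₀ e b τ) := fun {b} hb hb1 => by
    refine ContDiffAt.comp _ ?_ (contDiffAt_ofKlein (normSqSpace_kleinLine_lt hb hb1 hτ))
    rw [ofKlein_kleinLine hb hτ.le]
    exact hφ _ (nullCurve_mem_bulk hb hb1 hτ)
  set v : Coord d := Fin.cons 0 (Real.cos τ • w) with hv
  have hl : ∀ θ : ℝ, HasDerivAt (fun θ : ℝ => kleinLine ℓ t₀ e (β + θ • w) τ) v θ := fun θ => by
    simp only [kleinLine_add_smul]
    simpa using ((hasDerivAt_id θ).smul_const v).const_add (kleinLine ℓ t₀ e β τ)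
  have hev := eventually_isKleinPoint hβ hβ1 hw
  have h1 : deriv (fun θ : ℝ => φ (nullCurve ℓ t₀ e (β + θ • w) τ))
      =ᶠ[𝓝 0] fun θ => ∑ a, v a * partialDeriv a ψ (kleinLine ℓ t₀ e (β + θ • w) τ) := by
    filter_upwards [hev.eventually_nhds] with θ hθ
    refine (HasDerivAt.congr_of_eventuallyEq (hasDerivAt_comp_curve
      (c := fun θ : ℝ => kleinLine ℓ t₀ e (β + θ • w) τ) ((hψ hθ.self_of_nhds.1 hθ.self_of_nhds.2).differentiableAt (by norm_num)) (hl θ)) ?_).deriv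
    filter_upwards [hθ] with r hr
    rw [hψdef]
    simp only [ofKlein_kleinLine hr.1 hτ.le]
  have h0 : ContDiffAt ℝ 2 ψ (kleinLine ℓ t₀ e (β + (0 : ℝ) • w) τ) := by
    rw [zero_smul, add_zero]; exact hψ hβ hβ1
  rw [h1.deriv_eq, (HasDerivAt.fun_sum fun a _ => (hasDerivAt_comp_curve
    (c := fun θ : ℝ => kleinLine ℓ t₀ e (β + θ • w) τ) (differentiableAt_partialDeriv h0 a) (hl 0)).const_mul (v a)).deriv]
  simp only [zero_smul, add_zero]
  rw [Fin.sum_univ_succ]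
  simp only [Fin.sum_univ_succ (n := d), hv, Fin.cons_zero, Fin.cons_succ, zero_mul, zero_add,
    Pi.smul_apply, smul_eq_mul, Finset.mul_sum, Finset.sum_const_zero]
  exact Finset.sum_congr rfl fun i _ => Finset.sum_congr rfl fun j _ => by ring

/-- The function `Ω² h(u, u)` along a null geodesic, for the rescaled velocity `u` that stays finite
at its endpoints. -/
def rescaledTilt (H : TensorField d) (ℓ t₀ : ℝ) (e β : Fin d → ℝ) (τ : ℝ) : ℝ :=
  quad (H (nullCurve ℓ t₀ e β τ)) (nullVelocity ℓ e β τ)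

theorem tiltDensity_nullCurve (hℓ : ℓ ≠ 0) (hβ : IsKleinPoint e β) (hβ1 : ∑ i, β i ^ 2 < 1)
    (hτ : 0 < Real.cos τ) {h H : TensorField d}
    (hH : ∀ x ∈ bulk d, H x = conformalFactor x ^ 2 • h x) :
    tiltDensity ℓ h (nullCovector ℓ t₀ e) (nullCurve ℓ t₀ e β τ)
      = Real.cos τ ^ 2 / (4 * ℓ ^ 2) * rescaledTilt H ℓ t₀ e β τ := by
  have hD := (curveDenom_pos β hτ.le).ne'
  have hσ := (kleinFactor_pos hβ1).ne'
  have hc := hτ.ne'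
  rw [tiltDensity, rescaledTilt, quad, hH _ (nullCurve_mem_bulk hβ hβ1 hτ),
    ambientGrad_nullCurve hℓ hβ hD, conformalFactor_nullCurve hβ hD, Finset.mul_sum]
  refine Finset.sum_congr rfl fun a _ => ?_
  rw [Finset.mul_sum]
  refine Finset.sum_congr rfl fun c _ => ?_
  simp only [Pi.smul_apply, smul_eq_mul, Matrix.smul_apply]
  field_simp
  norm_num

/-- The second derivatives left over by `waveOp_nullCurve` are second derivatives with respect to the
Klein position `β`. The directions `kleinFrame e β i` are orthogonal to `e`, so the displaced curves
belong to the same null covector, and the factor between `h(K, K)` and the rescaled tilt does not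
depend on `β`. -/
theorem transverse_eq_rescaledTilt (hℓ : ℓ ≠ 0) (hβ : IsKleinPoint e β) (hβ1 : ∑ i, β i ^ 2 < 1)
    (hτ : 0 < Real.cos τ) {h H : TensorField d}
    (hh : ∀ x ∈ bulk d, ∀ a b, ContDiffAt ℝ 2 (fun y => h y a b) x)
    (hH : ∀ x ∈ bulk d, H x = conformalFactor x ^ 2 • h x) :
    ∑ i : Fin d, ∑ j : Fin d, ((if i = j then 1 else 0) - e i * e j - β i * β j)
        * partialDeriv j.succ (partialDeriv i.succ fun y =>
          tiltDensity ℓ h (nullCovector ℓ t₀ e) (ofKlein y)) (kleinLine ℓ t₀ e β τ)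
      = 1 / (4 * ℓ ^ 2) * ∑ i : Fin d, deriv (deriv fun θ : ℝ =>
        rescaledTilt H ℓ t₀ e (β + θ • kleinFrame e β i) τ) 0 := by
  have hc := hτ.ne'
  set φ := tiltDensity ℓ h (nullCovector ℓ t₀ e) with hφ
  have key : ∀ i : Fin d, deriv (deriv fun θ : ℝ =>
      rescaledTilt H ℓ t₀ e (β + θ • kleinFrame e β i) τ) 0
      = 4 * ℓ ^ 2 * ∑ j : Fin d, ∑ k : Fin d, kleinFrame e β i j * kleinFrame e β i k
        * partialDeriv k.succ (partialDeriv j.succ fun y => φ (ofKlein y))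
          (kleinLine ℓ t₀ e β τ) := fun i => by
    have hw := sum_kleinFrame_orth hβ i
    have e1 : (fun θ : ℝ => rescaledTilt H ℓ t₀ e (β + θ • kleinFrame e β i) τ)
        =ᶠ[𝓝 0] fun θ : ℝ => 4 * ℓ ^ 2 / Real.cos τ ^ 2
          * φ (nullCurve ℓ t₀ e (β + θ • kleinFrame e β i) τ) := by
      filter_upwards [eventually_isKleinPoint hβ hβ1 hw] with θ hθ
      rw [hφ, tiltDensity_nullCurve hℓ hθ.1 hθ.2 hτ hH]
      field_simp
    rw [e1.deriv.deriv_eq]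
    have e2 : deriv (fun θ : ℝ => 4 * ℓ ^ 2 / Real.cos τ ^ 2
        * φ (nullCurve ℓ t₀ e (β + θ • kleinFrame e β i) τ))
        = fun θ => 4 * ℓ ^ 2 / Real.cos τ ^ 2
          * deriv (fun θ : ℝ => φ (nullCurve ℓ t₀ e (β + θ • kleinFrame e β i) τ)) θ := by
      ext θ; exact deriv_const_mul_field _
    rw [e2, deriv_const_mul_field, deriv_deriv_nullCurve hβ hβ1 hτ hw
      fun x hx => contDiffAt_tiltDensity (hh x hx) _]
    field_simp
    rfl
  simp only [key, ← Finset.mul_sum]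
  rw [← mul_assoc, show 1 / (4 * ℓ ^ 2) * (4 * ℓ ^ 2) = 1 by field_simp, one_mul]
  simp only [← sum_kleinFrame_mul hβ, Finset.sum_mul]
  symm
  rw [Finset.sum_comm]
  exact Finset.sum_congr rfl fun j _ => Finset.sum_comm

/-- The function `div W - K (½ tr h)`, whose derivative along `K` enters the variation of the curvature. -/
def divergenceTerm (ℓ : ℝ) (h : TensorField d) (A : Ambient d) (x : Coord d) : ℝ :=
  divergence (contractUpper ℓ h A) x - derivAlong ℓ A (halfTrace ℓ h) x

theorem contDiffAt_divergenceTerm {h : TensorField d} {x : Coord d} (hx : x ∈ bulk d)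
    (hh : ∀ a b, ContDiffAt ℝ 2 (fun y => h y a b) x) (A : Ambient d) :
    ContDiffAt ℝ 1 (divergenceTerm ℓ h A) x :=
  (contDiffAt_divergence hx fun a => contDiffAt_contractUpper hh A a).sub
    (ContDiffAt.sum fun a _ => (contDiff_ambientGrad A a).contDiffAt.mul
      (contDiffAt_partialDeriv (contDiffAt_halfTrace hh) (by norm_num)))

/-- The quantity whose total derivative along a null geodesic, up to transverse second derivatives,
is the variation of the null curvature. -/
def boundaryTerm (ℓ t₀ : ℝ) (h : TensorField d) (e β : Fin d → ℝ) (τ : ℝ) : ℝ :=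
  divergenceTerm ℓ h (nullCovector ℓ t₀ e) (nullCurve ℓ t₀ e β τ)
    - kleinFactor β / (2 * ℓ)
      * (deriv (fun τ => tiltDensity ℓ h (nullCovector ℓ t₀ e) (nullCurve ℓ t₀ e β τ)) τ
        - 2 * ℓ * partialDeriv 0 (tiltDensity ℓ h (nullCovector ℓ t₀ e)) (nullCurve ℓ t₀ e β τ))

theorem hasDerivAt_boundaryTerm (hℓ : ℓ ≠ 0) (hβ : IsKleinPoint e β) (hβ1 : ∑ i, β i ^ 2 < 1)
    (hτ : 0 < Real.cos τ) {h H : TensorField d}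
    (hh : ∀ x ∈ bulk d, ∀ a b, ContDiffAt ℝ 2 (fun y => h y a b) x)
    (hH : ∀ x ∈ bulk d, H x = conformalFactor x ^ 2 • h x) :
    HasDerivAt (boundaryTerm ℓ t₀ h e β)
      (ℓ / (kleinFactor β * Real.cos τ ^ 2)
          * (derivAlong ℓ (nullCovector ℓ t₀ e) (divergenceTerm ℓ h (nullCovector ℓ t₀ e))
              (nullCurve ℓ t₀ e β τ)
            - 1 / 2 * waveOp ℓ (tiltDensity ℓ h (nullCovector ℓ t₀ e)) (nullCurve ℓ t₀ e β τ))
        + kleinFactor β / (8 * ℓ ^ 3) * ∑ i : Fin d, deriv (deriv fun θ : ℝ =>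
          rescaledTilt H ℓ t₀ e (β + θ • kleinFrame e β i) τ) 0) τ := by
  have hσ := (kleinFactor_pos hβ1).ne'
  have hD := (curveDenom_pos β hτ.le).ne'
  have hc := hτ.ne'
  have hx := nullCurve_mem_bulk (ℓ := ℓ) (t₀ := t₀) hβ hβ1 hτ
  have h1 := hasDerivAt_comp_curve ((contDiffAt_divergenceTerm (ℓ := ℓ) hx (hh _ hx)
    (nullCovector ℓ t₀ e)).differentiableAt (by norm_num)) (hasDerivAt_nullCurve hD)
  have h2 := waveOp_nullCurve (t₀ := t₀) hℓ hβ hβ1 hτ (φ := tiltDensity ℓ h (nullCovector ℓ t₀ e))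
    fun x hx => contDiffAt_tiltDensity (hh x hx) _
  rw [transverse_eq_rescaledTilt hℓ hβ hβ1 hτ hh hH] at h2
  refine (h1.sub (h2.const_mul (kleinFactor β / (2 * ℓ)))).congr_deriv ?_
  rw [derivAlong, ambientGrad_nullCurve hℓ hβ hD]
  simp only [Pi.smul_apply, smul_eq_mul, mul_sub, Finset.mul_sum]
  have e1 : ∀ a, (curveDenom β τ)⁻¹ * nullVelocity ℓ e β τ a
      * partialDeriv a (divergenceTerm ℓ h (nullCovector ℓ t₀ e)) (nullCurve ℓ t₀ e β τ)
      = ℓ / (kleinFactor β * Real.cos τ ^ 2) * (kleinFactor β * Real.cos τ ^ 2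
        / (ℓ * curveDenom β τ) * nullVelocity ℓ e β τ a
        * partialDeriv a (divergenceTerm ℓ h (nullCovector ℓ t₀ e)) (nullCurve ℓ t₀ e β τ)) :=
    fun a => by field_simp
  rw [← Finset.sum_congr rfl fun a _ => e1 a]
  simp only [← Finset.mul_sum]
  field_simp
  ring

/-- The variation of the null curvature at a point of the null geodesic. -/
theorem nullCurvatureVariation_eq (hℓ : ℓ ≠ 0) {κ s₀ : ℝ} (hβ : IsKleinPoint e β)
    (hβ1 : ∑ i, β i ^ 2 < 1) {h : TensorField d}
    (hh : ∀ x ∈ bulk d, ∀ a b, ContDiffAt ℝ 2 (fun y => h y a b) x)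
    (hsymm : ∀ x ∈ bulk d, (h x).IsSymm) {η : ℝ → Coord d}
    (hη : IsNullDeviation d ℓ h (nullGeodesic ℓ t₀ e β κ s₀) η) (s : ℝ) :
    nullCurvatureVariation d ℓ h (nullGeodesic ℓ t₀ e β κ s₀) η s
      = κ ^ 2 * (derivAlong ℓ (nullCovector ℓ t₀ e) (divergenceTerm ℓ h (nullCovector ℓ t₀ e))
              (nullGeodesic ℓ t₀ e β κ s₀ s)
            - 1 / 2 * waveOp ℓ (tiltDensity ℓ h (nullCovector ℓ t₀ e))
              (nullGeodesic ℓ t₀ e β κ s₀ s)) := by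
  have hx := nullGeodesic_mem_bulk (ℓ := ℓ) (t₀ := t₀) (κ := κ) (s₀ := s₀) hβ hβ1 s
  have hd := (hasDerivAt_nullGeodesic (t₀ := t₀) (κ := κ) (s₀ := s₀) hℓ hβ s).deriv
  have h1 := (hasDerivAt_along_ricci hℓ hh hx
    (contDiff_nullGeodesic.differentiable (by norm_num)) (hη.contDiff.differentiable (by norm_num))
    (hη.null s)).deriv
  have hf : ambientFn ℓ (nullCovector ℓ t₀ e) (nullGeodesic ℓ t₀ e β κ s₀ s) = 0 :=
    ambientFn_nullCurve hℓ hβ hβ1 (cos_geodesicAngle_pos s)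
  have h2 := sum_ricciVar_add hℓ hx hh hsymm (nullCovector ℓ t₀ e) hf
  rw [nullCurvatureVariation, h1, along, hd]
  unfold divergenceTerm
  rw [← h2]
  simp only [quad, tiltDensity, Pi.smul_apply, smul_eq_mul, Finset.mul_sum, mul_add]
  rw [add_comm]
  congr 1 <;> exact Finset.sum_congr rfl fun a _ => Finset.sum_congr rfl fun b _ => by ring

end Variation

/-! ### Regularity up to the conformal boundary -/

section Boundary

variable {d : ℕ} {ℓ t₀ : ℝ} {e β w : Fin d → ℝ}

theorem uniqueDiffOn_compactification : UniqueDiffOn ℝ (compactification d) := by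
  refine uniqueDiffOn_convex ?_ ⟨0, ?_⟩
  · intro x hx y hy a b ha hb hab
    have h1 : ∑ i : Fin d, x i.succ ^ 2 ≤ 1 := hx
    have h2 : ∑ i : Fin d, y i.succ ^ 2 ≤ 1 := hy
    have h3 : ∑ i : Fin d, (a • x + b • y) i.succ ^ 2
        ≤ a * ∑ i : Fin d, x i.succ ^ 2 + b * ∑ i : Fin d, y i.succ ^ 2 := by
      rw [Finset.mul_sum, Finset.mul_sum, ← Finset.sum_add_distrib]
      refine Finset.sum_le_sum fun i _ => ?_
      simp only [Pi.add_apply, Pi.smul_apply, smul_eq_mul]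
      have hb' : b = 1 - a := by linarith
      subst hb'
      nlinarith [mul_nonneg (mul_nonneg ha hb) (sq_nonneg (x i.succ - y i.succ))]
    have h4 : a * ∑ i : Fin d, x i.succ ^ 2 + b * ∑ i : Fin d, y i.succ ^ 2 ≤ 1 := by nlinarith
    exact h3.trans h4
  · refine interior_mono (s := bulk d) (fun x hx => le_of_lt (show normSqSpace x < 1 from hx)) ?_
    rw [isOpen_bulk.interior_eq]
    simp [bulk, normSqSpace]

theorem bulk_subset_compactification : bulk d ⊆ compactification d :=
  fun x hx => le_of_lt (show normSqSpace x < 1 from hx)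

/-- The partial derivative of a function on the compactification, one-sided at the boundary. -/
def extDeriv (a : Fin (d + 1)) (f : Coord d → ℝ) (x : Coord d) : ℝ :=
  fderivWithin ℝ f (compactification d) x (Pi.single a 1)

theorem extDeriv_eq {x : Coord d} (hx : x ∈ bulk d) (a : Fin (d + 1)) (f : Coord d → ℝ) :
    extDeriv a f x = partialDeriv a f x := by
  rw [extDeriv, fderivWithin_of_mem_nhds (mem_of_superset (bulk_mem_nhds hx)
    bulk_subset_compactification), partialDeriv]

theorem contDiffOn_extDeriv {f : Coord d → ℝ} (hf : ContDiffOn ℝ 2 f (compactification d))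
    (a : Fin (d + 1)) : ContDiffOn ℝ 1 (extDeriv a f) (compactification d) :=
  (hf.fderivWithin uniqueDiffOn_compactification (by norm_num)).clm_apply contDiffOn_const

/-- The displacements `θ` for which `β + θ w` stays in the open Klein ball. -/
def kleinInterval (β w : Fin d → ℝ) : Set ℝ := {θ | ∑ i, (β + θ • w) i ^ 2 < 1}

/-- The closed parameter interval of `nullCurve`. -/
abbrev angles : Set ℝ := Set.Icc (-(Real.pi / 2)) (Real.pi / 2)

theorem isOpen_kleinInterval (β w : Fin d → ℝ) : IsOpen (kleinInterval β w) := by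
  refine isOpen_lt ?_ continuous_const
  simp only [Pi.add_apply, Pi.smul_apply, smul_eq_mul]; fun_prop

theorem isKleinPoint_add (hβ : IsKleinPoint e β) (hw : ∑ i, w i * e i = 0) {θ : ℝ}
    (hθ : θ ∈ kleinInterval β w) : IsKleinPoint e (β + θ • w) := by
  refine ⟨hβ.unit, ?_, le_of_lt hθ⟩
  have : ∀ i, (β + θ • w) i * e i = β i * e i + θ * (w i * e i) := fun i => by
    simp only [Pi.add_apply, Pi.smul_apply, smul_eq_mul]; ring
  simp only [this, Finset.sum_add_distrib, ← Finset.mul_sum, hβ.orth, hw, mul_zero, add_zero]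

theorem cos_nonneg_of_mem_angles {τ : ℝ} (hτ : τ ∈ angles) : 0 ≤ Real.cos τ :=
  Real.cos_nonneg_of_mem_Icc hτ

theorem contDiffOn_kleinFactor {n : WithTop ℕ∞} (β w : Fin d → ℝ) :
    ContDiffOn ℝ n (fun q : ℝ × ℝ => kleinFactor (β + q.1 • w)) (kleinInterval β w ×ˢ angles) := by
  unfold kleinFactor
  refine ContDiffOn.sqrt ?_ fun q hq => ?_
  · simp only [Pi.add_apply, Pi.smul_apply, smul_eq_mul]; fun_prop
  · have : ∑ i, (β + q.1 • w) i ^ 2 < 1 := hq.1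
    linarith

theorem contDiffOn_curveDenom {n : WithTop ℕ∞} (β w : Fin d → ℝ) :
    ContDiffOn ℝ n (fun q : ℝ × ℝ => curveDenom (β + q.1 • w) q.2)
      (kleinInterval β w ×ˢ angles) :=
  contDiffOn_const.add ((contDiffOn_kleinFactor β w).mul (by fun_prop))

theorem contDiffOn_nullCurve {n : WithTop ℕ∞} (ℓ t₀ : ℝ) (e β w : Fin d → ℝ) :
    ContDiffOn ℝ n (fun q : ℝ × ℝ => nullCurve ℓ t₀ e (β + q.1 • w) q.2)
      (kleinInterval β w ×ˢ angles) := by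
  rw [contDiffOn_pi]
  intro a
  refine Fin.cases ?_ (fun i => ?_) a
  · simp only [nullCurve_zero]; fun_prop
  · simp only [nullCurve_succ]
    refine ContDiffOn.div ?_ (contDiffOn_curveDenom β w) fun q hq =>
      (curveDenom_pos _ (cos_nonneg_of_mem_angles hq.2)).ne'
    simp only [Pi.add_apply, Pi.smul_apply, smul_eq_mul]; fun_prop

theorem contDiffOn_nullVelocity {n : WithTop ℕ∞} (ℓ : ℝ) (e β w : Fin d → ℝ) (a : Fin (d + 1)) :
    ContDiffOn ℝ n (fun q : ℝ × ℝ => nullVelocity ℓ e (β + q.1 • w) q.2 a)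
      (kleinInterval β w ×ˢ angles) := by
  refine Fin.cases ?_ (fun i => ?_) a
  · simp only [nullVelocity_zero]
    exact contDiffOn_const.mul (contDiffOn_curveDenom β w)
  · have h := contDiffOn_pi.1 (contDiffOn_nullCurve (n := n) ℓ 0 e β w) i.succ
    simp only [nullCurve_succ] at h
    simp only [nullVelocity_succ]
    refine ContDiffOn.add ?_ (((contDiffOn_kleinFactor β w).mul (by fun_prop)).mul h)
    simp only [Pi.add_apply, Pi.smul_apply, smul_eq_mul]; fun_prop

theorem mapsTo_nullCurve (hβ : IsKleinPoint e β) (hw : ∑ i, w i * e i = 0) :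
    Set.MapsTo (fun q : ℝ × ℝ => nullCurve ℓ t₀ e (β + q.1 • w) q.2)
      (kleinInterval β w ×ˢ angles) (compactification d) := fun _ hq =>
  nullCurve_mem_compactification (isKleinPoint_add hβ hw hq.1) (cos_nonneg_of_mem_angles hq.2)

theorem contDiffOn_rescaledTilt {H : TensorField d}
    (hH : ∀ a b, ContDiffOn ℝ 2 (fun x => H x a b) (compactification d))
    (hβ : IsKleinPoint e β) (hw : ∑ i, w i * e i = 0) :
    ContDiffOn ℝ 2 (fun q : ℝ × ℝ => rescaledTilt H ℓ t₀ e (β + q.1 • w) q.2)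
      (kleinInterval β w ×ˢ angles) := by
  unfold rescaledTilt quad
  exact ContDiffOn.sum fun a _ => ContDiffOn.sum fun b _ =>
    (((hH a b).comp (contDiffOn_nullCurve ℓ t₀ e β w) (mapsTo_nullCurve hβ hw)).mul
      (contDiffOn_nullVelocity ℓ e β w a)).mul (contDiffOn_nullVelocity ℓ e β w b)

end Boundary

/-! ### Integrals depending on a parameter -/

section Parameter

variable {T : Set ℝ} {a b : ℝ} {G : ℝ × ℝ → ℝ}

/-- Partial derivatives in the first variable of a `C^(m+1)` function on `T × [a, b]`. -/
theorem exists_contDiffOn_hasDerivAt {m : WithTop ℕ∞} (hT : IsOpen T) (hab : a < b)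
    (hG : ContDiffOn ℝ (m + 1) G (T ×ˢ Set.Icc a b)) :
    ∃ G' : ℝ × ℝ → ℝ, ContDiffOn ℝ m G' (T ×ˢ Set.Icc a b) ∧
      ∀ θ ∈ T, ∀ τ ∈ Set.Icc a b, HasDerivAt (fun θ => G (θ, τ)) (G' (θ, τ)) θ := by
  have hu : UniqueDiffOn ℝ (T ×ˢ Set.Icc a b) := hT.uniqueDiffOn.prod (uniqueDiffOn_Icc hab)
  refine ⟨fun q => fderivWithin ℝ G (T ×ˢ Set.Icc a b) q (1, 0),
    (hG.fderivWithin hu le_rfl).clm_apply contDiffOn_const, fun θ hθ τ hτ => ?_⟩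
  have h1 : HasFDerivWithinAt G (fderivWithin ℝ G (T ×ˢ Set.Icc a b) (θ, τ))
      (T ×ˢ Set.Icc a b) (θ, τ) :=
    ((hG.differentiableOn (by simp)) (θ, τ) ⟨hθ, hτ⟩).hasFDerivWithinAt
  have h2 : HasDerivWithinAt (fun θ : ℝ => (θ, τ)) ((1, 0) : ℝ × ℝ) T θ :=
    ((hasDerivAt_id θ).prodMk (hasDerivAt_const θ τ)).hasDerivWithinAt
  have h3 : Set.MapsTo (fun θ : ℝ => (θ, τ)) T (T ×ˢ Set.Icc a b) := fun r hr => ⟨hr, hτ⟩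
  exact (h1.comp_hasDerivWithinAt θ h2 h3).hasDerivAt (hT.mem_nhds hθ)

theorem hasDerivAt_integral_of_continuousOn (hT : IsOpen T) (hab : a ≤ b) {G' : ℝ × ℝ → ℝ}
    (hG : ContinuousOn G (T ×ˢ Set.Icc a b)) (hG' : ContinuousOn G' (T ×ˢ Set.Icc a b))
    (hd : ∀ θ ∈ T, ∀ τ ∈ Set.Icc a b, HasDerivAt (fun θ => G (θ, τ)) (G' (θ, τ)) θ)
    {θ : ℝ} (hθ : θ ∈ T) :
    HasDerivAt (fun θ => ∫ τ in a..b, G (θ, τ)) (∫ τ in a..b, G' (θ, τ)) θ := by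
  obtain ⟨r, hr, hrT⟩ := Metric.isOpen_iff.1 hT θ hθ
  have hsub : Metric.closedBall θ (r / 2) ⊆ T :=
    (Metric.closedBall_subset_ball (by linarith)).trans hrT
  have hcomp : IsCompact (Metric.closedBall θ (r / 2) ×ˢ Set.Icc a b) :=
    (isCompact_closedBall θ (r / 2)).prod isCompact_Icc
  obtain ⟨C, hC⟩ := hcomp.exists_bound_of_continuousOn
    (hG'.mono (Set.prod_mono hsub subset_rfl))
  have hslice : ∀ F : ℝ × ℝ → ℝ, ContinuousOn F (T ×ˢ Set.Icc a b) → ∀ x ∈ T,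
      ContinuousOn (fun τ => F (x, τ)) (Set.uIcc a b) := fun F hF x hx => by
    rw [Set.uIcc_of_le hab]
    exact hF.comp (by fun_prop) fun τ hτ => ⟨hx, hτ⟩
  refine (intervalIntegral.hasDerivAt_integral_of_dominated_loc_of_deriv_le
    (s := Metric.ball θ (r / 2)) (bound := fun _ => C) (F := fun θ τ => G (θ, τ))
    (F' := fun θ τ => G' (θ, τ)) (Metric.ball_mem_nhds θ (by linarith)) ?_ ?_ ?_ ?_ ?_ ?_).2
  · filter_upwards [hT.mem_nhds hθ] with x hx
    exact (hslice G hG x hx).intervalIntegrable.def'.aestronglyMeasurable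
  · exact (hslice G hG θ hθ).intervalIntegrable
  · exact (hslice G' hG' θ hθ).intervalIntegrable.def'.aestronglyMeasurable
  · refine Eventually.of_forall fun τ hτ x hx => hC (x, τ) ⟨Metric.ball_subset_closedBall hx, ?_⟩
    rw [Set.uIoc_of_le hab] at hτ
    exact Set.Ioc_subset_Icc_self hτ
  · exact intervalIntegrable_const
  · refine Eventually.of_forall fun τ hτ x hx => hd x (hsub (Metric.ball_subset_closedBall hx)) τ ?_
    rw [Set.uIoc_of_le hab] at hτ
    exact Set.Ioc_subset_Icc_self hτ

/-- Second derivative of an integral of a `C²` function with respect to a parameter. -/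
theorem deriv_deriv_integral (hT : IsOpen T) (hab : a < b)
    (hG : ContDiffOn ℝ 2 G (T ×ˢ Set.Icc a b)) :
    ContinuousOn (fun q : ℝ × ℝ => deriv (deriv fun θ => G (θ, q.2)) q.1) (T ×ˢ Set.Icc a b) ∧
    ∀ θ ∈ T, DifferentiableAt ℝ (fun θ => ∫ τ in a..b, G (θ, τ)) θ ∧
      HasDerivAt (deriv fun θ => ∫ τ in a..b, G (θ, τ))
        (∫ τ in a..b, deriv (deriv fun θ => G (θ, τ)) θ) θ := by
  obtain ⟨G1, hG1, hd1⟩ := exists_contDiffOn_hasDerivAt (m := 1) hT hab (by exact_mod_cast hG)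
  obtain ⟨G2, hG2, hd2⟩ := exists_contDiffOn_hasDerivAt (m := 0) hT hab (by simpa using hG1)
  have hdd : ∀ θ ∈ T, ∀ τ ∈ Set.Icc a b, deriv (deriv fun θ => G (θ, τ)) θ = G2 (θ, τ) := by
    intro θ hθ τ hτ
    have : (deriv fun θ => G (θ, τ)) =ᶠ[𝓝 θ] fun θ => G1 (θ, τ) := by
      filter_upwards [hT.mem_nhds hθ] with x hx using (hd1 x hx τ hτ).deriv
    rw [this.deriv_eq, (hd2 θ hθ τ hτ).deriv]
  refine ⟨hG2.continuousOn.congr fun q hq => hdd _ hq.1 _ hq.2, fun θ hθ => ?_⟩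
  have h1 : ∀ x ∈ T, HasDerivAt (fun θ => ∫ τ in a..b, G (θ, τ)) (∫ τ in a..b, G1 (x, τ)) x :=
    fun x hx => hasDerivAt_integral_of_continuousOn hT hab.le hG.continuousOn hG1.continuousOn hd1 hx
  refine ⟨(h1 θ hθ).differentiableAt, ?_⟩
  have h2 := hasDerivAt_integral_of_continuousOn hT hab.le hG1.continuousOn hG2.continuousOn hd2 hθ
  refine (h2.congr_of_eventuallyEq ?_).congr_deriv ?_
  · filter_upwards [hT.mem_nhds hθ] with x hx using (h1 x hx).deriv
  · refine intervalIntegral.integral_congr fun τ hτ => ?_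
    rw [Set.uIcc_of_le hab.le] at hτ
    exact (hdd θ hθ τ hτ).symm

end Parameter

/-! ### The boundary term at the endpoints -/

section BoundaryTerm

variable {d : ℕ} {ℓ t₀ τ : ℝ} {e β : Fin d → ℝ} {h H : TensorField d} {x : Coord d}

/-- The diagonal entries of the inverse of the compactified metric. -/
def compactInv (ℓ : ℝ) (x : Coord d) (a : Fin (d + 1)) : ℝ :=
  if a = 0 then -((2 - conformalFactor x)⁻¹) ^ 2 else ((2 * ℓ)⁻¹) ^ 2

theorem invMetricDiag_eq_compactInv (x : Coord d) (a : Fin (d + 1)) :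
    invMetricDiag ℓ x a = conformalFactor x ^ 2 * compactInv ℓ x a := by
  unfold invMetricDiag compactInv
  split_ifs <;> ring

theorem contDiff_compactInv {n : WithTop ℕ∞} (a : Fin (d + 1)) :
    ContDiff ℝ n (fun x : Coord d => compactInv ℓ x a) := by
  unfold compactInv
  split_ifs
  · exact ((ContDiff.inv (by fun_prop) fun x => (two_sub_conformalFactor_pos x).ne').pow 2).neg
  · exact contDiff_const

theorem partialDeriv_compactInv (a : Fin (d + 1)) (x : Coord d) :
    partialDeriv a (fun y => compactInv ℓ y a) x = 0 := by
  have h2 := (two_sub_conformalFactor_pos x).ne'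
  unfold compactInv
  refine Fin.cases ?_ (fun i => ?_) a
  · have hM : DifferentiableAt ℝ (fun y : Coord d => 2 - conformalFactor y) x := by fun_prop
    have hr : DifferentiableAt ℝ (fun r : ℝ => -(r⁻¹) ^ 2) (2 - conformalFactor x) :=
      ((differentiableAt_inv h2).pow 2).neg
    simp only [if_true]
    rw [partialDeriv_comp (f := fun y : Coord d => 2 - conformalFactor y) hr.hasDerivAt hM,
      partialDeriv_sub (by fun_prop) (by fun_prop), partialDeriv_const,
      partialDeriv_conformalFactor, spatial_zero]
    ring
  · simp [Fin.succ_ne_zero, partialDeriv_const]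

theorem contractUpper_eq (hH : ∀ x ∈ bulk d, H x = conformalFactor x ^ 2 • h x) (A : Ambient d)
    (hx : x ∈ bulk d) (a : Fin (d + 1)) :
    contractUpper ℓ h A a x = compactInv ℓ x a * ∑ c, H x a c * ambientGrad ℓ A x c := by
  simp only [contractUpper, contractLower, invMetricDiag_eq_compactInv, hH x hx, Matrix.smul_apply,
    smul_eq_mul, mul_assoc, ← Finset.mul_sum]
  ring

/-- Half the trace of `h`, extended to the compactification. -/
def halfTraceExt (ℓ : ℝ) (H : TensorField d) (x : Coord d) : ℝ :=
  1 / 2 * ∑ a, compactInv ℓ x a * H x a a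

theorem halfTrace_eq (hH : ∀ x ∈ bulk d, H x = conformalFactor x ^ 2 • h x) (hx : x ∈ bulk d) :
    halfTrace ℓ h x = halfTraceExt ℓ H x := by
  simp only [halfTrace, halfTraceExt, invMetricDiag_eq_compactInv, hH x hx, Matrix.smul_apply,
    smul_eq_mul]
  congr 1
  exact Finset.sum_congr rfl fun a _ => by ring

theorem partialDeriv_contractUpper (hH : ∀ x ∈ bulk d, H x = conformalFactor x ^ 2 • h x)
    (A : Ambient d) (hx : x ∈ bulk d) (hd : ∀ a b, DifferentiableAt ℝ (fun y => H y a b) x)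
    (a : Fin (d + 1)) :
    partialDeriv a (contractUpper ℓ h A a) x = compactInv ℓ x a
      * ∑ c, (partialDeriv a (fun y => H y a c) x * ambientGrad ℓ A x c
        + H x a c * partialDeriv a (fun y => ambientGrad ℓ A y c) x) := by
  have e1 : contractUpper ℓ h A a
      =ᶠ[𝓝 x] fun y => compactInv ℓ y a * ∑ c, H y a c * ambientGrad ℓ A y c := by
    filter_upwards [bulk_mem_nhds hx] with y hy using contractUpper_eq hH A hy a
  have hK := fun c => differentiableAt_ambientGrad (ℓ := ℓ) A c x
  have hs : ∀ c ∈ Finset.univ, DifferentiableAt ℝ (fun y => H y a c * ambientGrad ℓ A y c) x :=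
    fun c _ => (hd a c).fun_mul (hK c)
  rw [partialDeriv_congr e1, partialDeriv_mul
    ((contDiff_compactInv (n := 1) a).differentiable (by norm_num) x) (DifferentiableAt.fun_sum hs),
    partialDeriv_compactInv, zero_mul, zero_add, partialDeriv_sum hs]
  simp only [partialDeriv_mul (hd _ _) (hK _)]

theorem partialDeriv_zero_tiltDensity (hH : ∀ x ∈ bulk d, H x = conformalFactor x ^ 2 • h x)
    (A : Ambient d) (hx : x ∈ bulk d) (hd : ∀ a b, DifferentiableAt ℝ (fun y => H y a b) x) :
    partialDeriv 0 (tiltDensity ℓ h A) x = (conformalFactor x ^ 2)⁻¹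
      * ∑ a, ∑ c, (partialDeriv 0 (fun y => H y a c) x * ambientGrad ℓ A x a * ambientGrad ℓ A x c
        + H x a c * (partialDeriv 0 (fun y => ambientGrad ℓ A y a) x * ambientGrad ℓ A x c
          + ambientGrad ℓ A x a * partialDeriv 0 (fun y => ambientGrad ℓ A y c) x)) := by
  have hΩ := (conformalFactor_pos hx).ne'
  have e1 : tiltDensity ℓ h A =ᶠ[𝓝 x] fun y => (conformalFactor y ^ 2)⁻¹
      * ∑ a, ∑ c, H y a c * ambientGrad ℓ A y a * ambientGrad ℓ A y c := by
    filter_upwards [bulk_mem_nhds hx] with y hy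
    have hy' := (conformalFactor_pos hy).ne'
    simp only [tiltDensity, hH y hy, Matrix.smul_apply, smul_eq_mul, mul_assoc, ← Finset.mul_sum]
    field_simp
  have hK := fun c => differentiableAt_ambientGrad (ℓ := ℓ) A c x
  have hr : DifferentiableAt ℝ (fun r : ℝ => (r ^ 2)⁻¹) (conformalFactor x) :=
    DifferentiableAt.inv (by fun_prop) (pow_ne_zero 2 hΩ)
  have hΩd : DifferentiableAt ℝ (fun y : Coord d => (conformalFactor y ^ 2)⁻¹) x :=
    DifferentiableAt.comp (g := fun r : ℝ => (r ^ 2)⁻¹) x hr (by fun_prop)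
  have hm : ∀ a c, DifferentiableAt ℝ (fun y => H y a c * ambientGrad ℓ A y a) x :=
    fun a c => (hd a c).fun_mul (hK a)
  have hs : ∀ a, ∀ c ∈ Finset.univ, DifferentiableAt ℝ
      (fun y => H y a c * ambientGrad ℓ A y a * ambientGrad ℓ A y c) x :=
    fun a c _ => (hm a c).fun_mul (hK c)
  have hss : ∀ a ∈ Finset.univ, DifferentiableAt ℝ
      (fun y => ∑ c, H y a c * ambientGrad ℓ A y a * ambientGrad ℓ A y c) x :=
    fun a _ => DifferentiableAt.fun_sum (hs a)
  rw [partialDeriv_congr e1, partialDeriv_mul hΩd (DifferentiableAt.fun_sum hss),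
    partialDeriv_comp (f := conformalFactor) hr.hasDerivAt (by fun_prop),
    partialDeriv_conformalFactor, spatial_zero, mul_zero, mul_zero, zero_mul, zero_add,
    partialDeriv_sum hss]
  congr 1
  refine Finset.sum_congr rfl fun a _ => ?_
  rw [partialDeriv_sum (hs a)]
  refine Finset.sum_congr rfl fun c _ => ?_
  rw [partialDeriv_mul (hm a c) (hK c), partialDeriv_mul (hd a c) (hK a)]
  ring

/-- The time derivative of `K`, divided by `Ω`, along a null geodesic. -/
def timeShift (ℓ : ℝ) (e β : Fin d → ℝ) (τ : ℝ) : Coord d :=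
  Fin.cons (-(Real.sin τ * curveDenom β τ) / (2 * ℓ)) fun i =>
    -(Real.cos τ * β i + Real.sin τ * e i) / (2 * kleinFactor β * ℓ ^ 2)

theorem partialDeriv_zero_ambientGrad_nullCurve (hℓ : ℓ ≠ 0) (hβ : IsKleinPoint e β)
    (hβ1 : ∑ i, β i ^ 2 < 1) (hτ : 0 < Real.cos τ) (a : Fin (d + 1)) :
    partialDeriv 0 (fun y => ambientGrad ℓ (nullCovector ℓ t₀ e) y a) (nullCurve ℓ t₀ e β τ)
      = conformalFactor (nullCurve ℓ t₀ e β τ) * timeShift ℓ e β τ a := by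
  have hD := (curveDenom_pos β hτ.le).ne'
  have hσ := (kleinFactor_pos hβ1).ne'
  rw [partialDeriv_ambientGrad]
  refine Fin.cases ?_ (fun i => ?_) a
  · simp only [ambientGradDeriv, timeShift, Fin.cons_zero]
    rw [timePart_nullCurve hℓ, two_sub_conformalFactor_nullCurve hβ hD]
    field_simp
  · simp only [ambientGradDeriv, timeShift, Fin.cons_succ, Fin.cons_zero]
    rw [timePartDeriv_nullCurve hℓ, conformalFactor_nullCurve hβ hD, nullCurve_succ]
    field_simp

theorem contDiffOn_slice {n : WithTop ℕ∞} {E : Type*} [NormedAddCommGroup E] [NormedSpace ℝ E]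
    {f : (Fin d → ℝ) → ℝ → E} {w : Fin d → ℝ} (hβ1 : ∑ i, β i ^ 2 < 1)
    (hf : ContDiffOn ℝ n (fun q : ℝ × ℝ => f (β + q.1 • w) q.2) (kleinInterval β w ×ˢ angles)) :
    ContDiffOn ℝ n (f β) angles := by
  have h0 : (0 : ℝ) ∈ kleinInterval β w := by simpa [kleinInterval] using hβ1
  have h1 : Set.MapsTo (fun τ : ℝ => ((0, τ) : ℝ × ℝ)) angles (kleinInterval β w ×ˢ angles) :=
    fun τ hτ => ⟨h0, hτ⟩
  have h2 := hf.comp (contDiffOn_const.prodMk contDiffOn_id) h1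
  refine h2.congr fun τ _ => ?_
  simp

theorem contDiffOn_rescaledTilt_slice (hβ : IsKleinPoint e β) (hβ1 : ∑ i, β i ^ 2 < 1)
    (hHd : ∀ a b, ContDiffOn ℝ 2 (fun x => H x a b) (compactification d)) :
    ContDiffOn ℝ 2 (rescaledTilt H ℓ t₀ e β) angles :=
  contDiffOn_slice (w := 0) hβ1 (contDiffOn_rescaledTilt hHd hβ (by simp))

/-- `boundaryTerm`, written in terms of `H = Ω² h` and extended to the endpoints of the null geodesic,
where the derivatives of `H` are one-sided. -/
def boundaryTermExt (ℓ t₀ : ℝ) (H : TensorField d) (e β : Fin d → ℝ) (τ : ℝ) : ℝ :=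
  ∑ a, compactInv ℓ (nullCurve ℓ t₀ e β τ) a
      * ∑ c, (extDeriv a (fun y => H y a c) (nullCurve ℓ t₀ e β τ)
          * ambientGrad ℓ (nullCovector ℓ t₀ e) (nullCurve ℓ t₀ e β τ) c
        + H (nullCurve ℓ t₀ e β τ) a c
          * partialDeriv a (fun y => ambientGrad ℓ (nullCovector ℓ t₀ e) y c)
            (nullCurve ℓ t₀ e β τ))
    + Real.cos τ / (2 * ℓ) * (4 / (2 - conformalFactor (nullCurve ℓ t₀ e β τ)) + 2 * d)
      * ∑ a, spatial (nullCurve ℓ t₀ e β τ) a * (compactInv ℓ (nullCurve ℓ t₀ e β τ) a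
        * ∑ c, H (nullCurve ℓ t₀ e β τ) a c * nullVelocity ℓ e β τ c)
    - ∑ b, ambientGrad ℓ (nullCovector ℓ t₀ e) (nullCurve ℓ t₀ e β τ) b
      * extDeriv b (halfTraceExt ℓ H) (nullCurve ℓ t₀ e β τ)
    - kleinFactor β / (2 * ℓ) * (Real.cos τ / (4 * ℓ ^ 2)
        * (Real.cos τ * derivWithin (rescaledTilt H ℓ t₀ e β) angles τ
          - 2 * Real.sin τ * rescaledTilt H ℓ t₀ e β τ)
      - 2 * ℓ * (Real.cos τ * ∑ a, ∑ c, (Real.cos τ / (4 * ℓ ^ 2)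
          * (extDeriv 0 (fun y => H y a c) (nullCurve ℓ t₀ e β τ)
            * nullVelocity ℓ e β τ a * nullVelocity ℓ e β τ c)
        + H (nullCurve ℓ t₀ e β τ) a c / (2 * ℓ)
          * (timeShift ℓ e β τ a * nullVelocity ℓ e β τ c
            + nullVelocity ℓ e β τ a * timeShift ℓ e β τ c))))

theorem sum_logSlope_eq (hx : x ∈ bulk d) : ∑ a, logSlope x a
    = (conformalFactor x)⁻¹ * (4 / (2 - conformalFactor x) + 2 * d) := by
  have h1 := (conformalFactor_pos hx).ne'
  have h2 := (two_sub_conformalFactor_pos x).ne'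
  rw [Fin.sum_univ_succ]
  simp only [logSlope, if_true, Fin.succ_ne_zero, if_false, Finset.sum_const, Finset.card_univ,
    Fintype.card_fin, nsmul_eq_mul]
  field_simp

/-- In terms of `H = Ω² h` all negative powers of `Ω` in `boundaryTerm` cancel: raising an index
contributes a factor `Ω²`, and `K` equals `Ω` times a regular field along the geodesic. -/
theorem boundaryTerm_eq (hℓ : ℓ ≠ 0) (hβ : IsKleinPoint e β)
    (hβ1 : ∑ i, β i ^ 2 < 1) (hτ : τ ∈ Set.Ioo (-(Real.pi / 2)) (Real.pi / 2))
    (hHd : ∀ a b, ContDiffOn ℝ 2 (fun x => H x a b) (compactification d))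
    (hH : ∀ x ∈ bulk d, H x = conformalFactor x ^ 2 • h x) :
    boundaryTerm ℓ t₀ h e β τ = boundaryTermExt ℓ t₀ H e β τ := by
  have hc := Real.cos_pos_of_mem_Ioo hτ
  have hx := nullCurve_mem_bulk (ℓ := ℓ) (t₀ := t₀) hβ hβ1 hc
  have hD := (curveDenom_pos β hc.le).ne'
  have hHd' : ∀ a b, DifferentiableAt ℝ (fun y => H y a b) (nullCurve ℓ t₀ e β τ) := fun a b =>
    ((hHd a b).differentiableOn (by norm_num)).differentiableAt
      (mem_of_superset (bulk_mem_nhds hx) bulk_subset_compactification)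
  set A := nullCovector ℓ t₀ e with hA
  have hK : ambientGrad ℓ A (nullCurve ℓ t₀ e β τ) = (conformalFactor (nullCurve ℓ t₀ e β τ)
      * (Real.cos τ / (2 * ℓ))) • nullVelocity ℓ e β τ := by
    rw [ambientGrad_nullCurve hℓ hβ hD, conformalFactor_nullCurve hβ hD]
    congr 1; field_simp
  have hΩ := (conformalFactor_pos hx).ne'
  have hF : DifferentiableAt ℝ (rescaledTilt H ℓ t₀ e β) τ :=
    ((contDiffOn_rescaledTilt_slice hβ hβ1 hHd).differentiableOn (by norm_num)).differentiableAt
      (Icc_mem_nhds hτ.1 hτ.2)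
  have e1 : deriv (fun τ => tiltDensity ℓ h A (nullCurve ℓ t₀ e β τ)) τ
      = Real.cos τ / (4 * ℓ ^ 2) * (Real.cos τ * derivWithin (rescaledTilt H ℓ t₀ e β) angles τ
          - 2 * Real.sin τ * rescaledTilt H ℓ t₀ e β τ) := by
    have h1 : (fun τ => tiltDensity ℓ h A (nullCurve ℓ t₀ e β τ))
        =ᶠ[𝓝 τ] fun τ => Real.cos τ ^ 2 / (4 * ℓ ^ 2) * rescaledTilt H ℓ t₀ e β τ := by
      filter_upwards [Real.continuous_cos.continuousAt.eventually (lt_mem_nhds hc)] with s hs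
      exact tiltDensity_nullCurve hℓ hβ hβ1 hs hH
    have h2 := ((((Real.hasDerivAt_cos τ).fun_pow 2).div_const (4 * ℓ ^ 2)).fun_mul
      hF.hasDerivAt).deriv
    rw [h1.deriv_eq, h2, derivWithin_of_mem_nhds (Icc_mem_nhds hτ.1 hτ.2)]
    norm_num
    ring
  have e2 : partialDeriv 0 (tiltDensity ℓ h A) (nullCurve ℓ t₀ e β τ)
      = Real.cos τ * ∑ a, ∑ c, (Real.cos τ / (4 * ℓ ^ 2)
          * (extDeriv 0 (fun y => H y a c) (nullCurve ℓ t₀ e β τ)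
            * nullVelocity ℓ e β τ a * nullVelocity ℓ e β τ c)
        + H (nullCurve ℓ t₀ e β τ) a c / (2 * ℓ)
          * (timeShift ℓ e β τ a * nullVelocity ℓ e β τ c
            + nullVelocity ℓ e β τ a * timeShift ℓ e β τ c)) := by
    rw [partialDeriv_zero_tiltDensity hH A hx hHd', Finset.mul_sum, Finset.mul_sum]
    refine Finset.sum_congr rfl fun a _ => ?_
    rw [Finset.mul_sum, Finset.mul_sum]
    refine Finset.sum_congr rfl fun c _ => ?_
    rw [hA, partialDeriv_zero_ambientGrad_nullCurve hℓ hβ hβ1 hc,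
      partialDeriv_zero_ambientGrad_nullCurve hℓ hβ hβ1 hc, ← hA, hK, extDeriv_eq hx]
    simp only [Pi.smul_apply, smul_eq_mul]
    field_simp
    ring
  have e3 : divergence (contractUpper ℓ h A) (nullCurve ℓ t₀ e β τ)
      = ∑ a, compactInv ℓ (nullCurve ℓ t₀ e β τ) a
        * ∑ c, (extDeriv a (fun y => H y a c) (nullCurve ℓ t₀ e β τ)
          * ambientGrad ℓ A (nullCurve ℓ t₀ e β τ) c
        + H (nullCurve ℓ t₀ e β τ) a c * partialDeriv a (fun y => ambientGrad ℓ A y c)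
            (nullCurve ℓ t₀ e β τ))
      + Real.cos τ / (2 * ℓ) * (4 / (2 - conformalFactor (nullCurve ℓ t₀ e β τ)) + 2 * d)
        * ∑ a, spatial (nullCurve ℓ t₀ e β τ) a * (compactInv ℓ (nullCurve ℓ t₀ e β τ) a
          * ∑ c, H (nullCurve ℓ t₀ e β τ) a c * nullVelocity ℓ e β τ c) := by
    rw [divergence]
    congr 1
    · refine Finset.sum_congr rfl fun a _ => ?_
      rw [partialDeriv_contractUpper hH A hx hHd' a]
      simp only [extDeriv_eq hx]
    · rw [Finset.mul_sum]
      refine Finset.sum_congr rfl fun a _ => ?_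
      rw [contractUpper_eq hH A hx, traceChristoffel, sum_logSlope_eq hx, hK]
      have : ∑ c, H (nullCurve ℓ t₀ e β τ) a c * ((conformalFactor (nullCurve ℓ t₀ e β τ)
          * (Real.cos τ / (2 * ℓ))) • nullVelocity ℓ e β τ) c
          = conformalFactor (nullCurve ℓ t₀ e β τ) * (Real.cos τ / (2 * ℓ))
            * ∑ c, H (nullCurve ℓ t₀ e β τ) a c * nullVelocity ℓ e β τ c := by
        rw [Finset.mul_sum]
        exact Finset.sum_congr rfl fun c _ => by simp only [Pi.smul_apply, smul_eq_mul]; ring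
      rw [this]
      field_simp
  have e4 : derivAlong ℓ A (halfTrace ℓ h) (nullCurve ℓ t₀ e β τ)
      = ∑ b, ambientGrad ℓ A (nullCurve ℓ t₀ e β τ) b
        * extDeriv b (halfTraceExt ℓ H) (nullCurve ℓ t₀ e β τ) := by
    rw [derivAlong]
    refine Finset.sum_congr rfl fun b _ => ?_
    rw [extDeriv_eq hx]
    congr 1
    refine partialDeriv_congr ?_
    filter_upwards [bulk_mem_nhds hx] with y hy using halfTrace_eq hH hy
  rw [boundaryTerm, ← hA, e1, e2, divergenceTerm, e3, e4, boundaryTermExt]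

theorem neg_pi_div_two_lt : -(Real.pi / 2) < Real.pi / 2 := by linarith [Real.pi_pos]

theorem contDiffOn_boundaryTermExt (hβ : IsKleinPoint e β) (hβ1 : ∑ i, β i ^ 2 < 1)
    (hHd : ∀ a b, ContDiffOn ℝ 2 (fun x => H x a b) (compactification d)) :
    ContDiffOn ℝ 1 (boundaryTermExt ℓ t₀ H e β) angles := by
  have hx : ContDiffOn ℝ 1 (nullCurve ℓ t₀ e β) angles :=
    contDiffOn_slice (w := 0) hβ1 (contDiffOn_nullCurve ℓ t₀ e β 0)
  have hmaps : Set.MapsTo (nullCurve ℓ t₀ e β) angles (compactification d) := fun τ hτ =>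
    nullCurve_mem_compactification hβ (cos_nonneg_of_mem_angles hτ)
  have hu : ∀ a, ContDiffOn ℝ 1 (fun τ => nullVelocity ℓ e β τ a) angles := fun a =>
    contDiffOn_slice (f := fun b τ => nullVelocity ℓ e b τ a) (w := 0) hβ1
      (contDiffOn_nullVelocity ℓ e β 0 a)
  have hD : ContDiffOn ℝ 1 (curveDenom β) angles :=
    contDiffOn_slice (f := curveDenom) (w := 0) hβ1 (contDiffOn_curveDenom β 0)
  have hglob : ∀ {f : Coord d → ℝ}, ContDiff ℝ 1 f →
      ContDiffOn ℝ 1 (fun τ => f (nullCurve ℓ t₀ e β τ)) angles := fun hf => hf.comp_contDiffOn hx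
  have hon : ∀ {f : Coord d → ℝ}, ContDiffOn ℝ 1 f (compactification d) →
      ContDiffOn ℝ 1 (fun τ => f (nullCurve ℓ t₀ e β τ)) angles := fun hf => hf.comp hx hmaps
  have hH : ∀ a c, ContDiffOn ℝ 1 (fun τ => H (nullCurve ℓ t₀ e β τ) a c) angles := fun a c =>
    hon (f := fun x => H x a c) ((hHd a c).of_le (by norm_num))
  have hdH : ∀ b a c, ContDiffOn ℝ 1
      (fun τ => extDeriv b (fun y => H y a c) (nullCurve ℓ t₀ e β τ)) angles := fun b a c =>
    hon (contDiffOn_extDeriv (hHd a c) b)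
  have hinv : ∀ a, ContDiffOn ℝ 1 (fun τ => compactInv ℓ (nullCurve ℓ t₀ e β τ) a) angles :=
    fun a => hglob (f := fun x => compactInv ℓ x a) (contDiff_compactInv a)
  have hK : ∀ c, ContDiffOn ℝ 1
      (fun τ => ambientGrad ℓ (nullCovector ℓ t₀ e) (nullCurve ℓ t₀ e β τ) c) angles := fun c =>
    hglob (f := fun x => ambientGrad ℓ (nullCovector ℓ t₀ e) x c) (contDiff_ambientGrad _ c)
  have hdK : ∀ a c, ContDiffOn ℝ 1 (fun τ => partialDeriv a
      (fun y => ambientGrad ℓ (nullCovector ℓ t₀ e) y c) (nullCurve ℓ t₀ e β τ)) angles :=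
    fun a c => hglob (contDiff_iff_contDiffAt.2 fun x => contDiffAt_partialDeriv (n := 2)
      (contDiff_ambientGrad _ c).contDiffAt (by norm_num))
  have hspat : ∀ a, ContDiffOn ℝ 1 (fun τ => spatial (nullCurve ℓ t₀ e β τ) a) angles := fun a =>
    hglob (f := fun x => spatial x a) (by
      unfold spatial; split_ifs <;> fun_prop)
  have hM : ContDiffOn ℝ 1
      (fun τ => 4 / (2 - conformalFactor (nullCurve ℓ t₀ e β τ))) angles :=
    hglob (f := fun x => 4 / (2 - conformalFactor x)) (ContDiff.div (by fun_prop) (by fun_prop)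
      fun x => (two_sub_conformalFactor_pos x).ne')
  have htr : ∀ b, ContDiffOn ℝ 1
      (fun τ => extDeriv b (halfTraceExt ℓ H) (nullCurve ℓ t₀ e β τ)) angles := fun b => by
    refine hon (contDiffOn_extDeriv ?_ b)
    exact contDiffOn_const.mul (ContDiffOn.sum fun a _ =>
      (contDiff_compactInv a).contDiffOn.mul (hHd a a))
  have hF := contDiffOn_rescaledTilt_slice (ℓ := ℓ) (t₀ := t₀) hβ hβ1 hHd
  have hF' : ContDiffOn ℝ 1 (derivWithin (rescaledTilt H ℓ t₀ e β) angles) angles :=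
    hF.derivWithin (uniqueDiffOn_Icc neg_pi_div_two_lt) (by norm_num)
  have hcos : ContDiffOn ℝ 1 Real.cos angles := Real.contDiff_cos.contDiffOn
  have hsin : ContDiffOn ℝ 1 Real.sin angles := Real.contDiff_sin.contDiffOn
  have hE : ∀ a, ContDiffOn ℝ 1 (fun τ => timeShift ℓ e β τ a) angles := fun a => by
    refine Fin.cases ?_ (fun i => ?_) a
    · simp only [timeShift, Fin.cons_zero]
      exact ((hsin.mul hD).neg).div_const _
    · simp only [timeShift, Fin.cons_succ]
      exact (((hcos.mul contDiffOn_const).add (hsin.mul contDiffOn_const)).neg).div_const _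
  unfold boundaryTermExt
  refine ContDiffOn.sub (ContDiffOn.sub (ContDiffOn.add ?_ ?_) ?_) ?_
  · exact ContDiffOn.sum fun a _ => (hinv a).mul (ContDiffOn.sum fun c _ =>
      ((hdH a a c).mul (hK c)).add ((hH a c).mul (hdK a c)))
  · exact ((hcos.div_const _).mul (hM.add contDiffOn_const)).mul (ContDiffOn.sum fun a _ =>
      (hspat a).mul ((hinv a).mul (ContDiffOn.sum fun c _ => (hH a c).mul (hu c))))
  · exact ContDiffOn.sum fun b _ => (hK b).mul (htr b)
  · refine contDiffOn_const.mul (ContDiffOn.sub ?_ (contDiffOn_const.mul (hcos.mul ?_)))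
    · exact (hcos.div_const _).mul ((hcos.mul hF').sub
        ((contDiffOn_const.mul hsin).mul (hF.of_le (by norm_num))))
    · exact ContDiffOn.sum fun a _ => ContDiffOn.sum fun c _ =>
        ((hcos.div_const _).mul (((hdH 0 a c).mul (hu a)).mul (hu c))).add
          (((hH a c).div_const _).mul (((hE a).mul (hu c)).add ((hu a).mul (hE c))))

/-- At an endpoint `K` and its first derivatives vanish, and every other term carries a factor
`cos τ`. -/
theorem boundaryTermExt_eq_zero (hℓ : ℓ ≠ 0) (hβ : IsKleinPoint e β) (hτ : Real.cos τ = 0) :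
    boundaryTermExt ℓ t₀ H e β τ = 0 := by
  have hD1 : curveDenom β τ = 1 := by rw [curveDenom, hτ]; ring
  have hD : curveDenom β τ ≠ 0 := by rw [hD1]; norm_num
  have hK : ambientGrad ℓ (nullCovector ℓ t₀ e) (nullCurve ℓ t₀ e β τ) = 0 := by
    rw [ambientGrad_nullCurve hℓ hβ hD, hτ]; simp
  have hdK : ∀ a c, partialDeriv a (fun y => ambientGrad ℓ (nullCovector ℓ t₀ e) y c)
      (nullCurve ℓ t₀ e β τ) = 0 := fun a c => by
    have hT := timePart_nullCurve (t₀ := t₀) (e := e) (β := β) (τ := τ) hℓ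
    have hT' := timePartDeriv_nullCurve (t₀ := t₀) (e := e) (β := β) (τ := τ) hℓ
    have hs := spaceDot_nullCurve (ℓ := ℓ) (t₀ := t₀) (τ := τ) hβ
    have hΩ := conformalFactor_nullCurve (ℓ := ℓ) (t₀ := t₀) (τ := τ) hβ hD
    have hx : ∀ i : Fin d, nullCurve ℓ t₀ e β τ i.succ = Real.sin τ * e i := fun i => by
      rw [nullCurve_succ, hD1, hτ]; ring
    have he : (nullCovector ℓ t₀ e).2.2 = e := rfl
    rw [hτ] at hT' hΩ
    rw [hD1] at hs
    rw [partialDeriv_ambientGrad, ambientGradDeriv, hT, hT', he, hs, hΩ]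
    refine Fin.cases (Fin.cases ?_ (fun i => ?_) a) (fun j => Fin.cases ?_ (fun i => ?_) a) c
    · simp
    · simp
    · simp
    · simp only [Fin.cons_succ, hx]
      split_ifs <;> ring
  simp [boundaryTermExt, hK, hdK, hτ]

end BoundaryTerm

/-! ### Integrals along null geodesics -/

section Integrals

variable {d : ℕ} {ℓ t₀ κ s₀ : ℝ} {e β : Fin d → ℝ} {h H : TensorField d}

/-- The interior of `angles`. -/
abbrev openAngles : Set ℝ := Set.Ioo (-(Real.pi / 2)) (Real.pi / 2)

/-- The substitution `s = s₀ + ℓ / (σ κ) tan τ`. -/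
theorem integrable_comp_geodesicAngle (hℓ : 0 < ℓ) (hβ1 : ∑ i, β i ^ 2 < 1) (hκ : κ ≠ 0)
    (g : ℝ → ℝ) :
    (Integrable (fun s => g (geodesicAngle ℓ β κ s₀ s)) ↔
      IntegrableOn (fun τ => ℓ / (kleinFactor β * |κ| * Real.cos τ ^ 2) * g τ) openAngles) ∧
    ∫ s, g (geodesicAngle ℓ β κ s₀ s)
      = ∫ τ in openAngles, ℓ / (kleinFactor β * |κ| * Real.cos τ ^ 2) * g τ := by
  have hσ := kleinFactor_pos hβ1
  set f : ℝ → ℝ := fun τ => s₀ + ℓ / (kleinFactor β * κ) * Real.tan τ with hf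
  have hinv : ∀ τ ∈ openAngles, geodesicAngle ℓ β κ s₀ (f τ) = τ := fun τ hτ => by
    rw [geodesicAngle, hf]
    have : kleinFactor β * κ / ℓ * (s₀ + ℓ / (kleinFactor β * κ) * Real.tan τ - s₀)
        = Real.tan τ := by field_simp; ring
    simp only
    rw [this, Real.arctan_tan hτ.1 hτ.2]
  have hinj : Set.InjOn f openAngles := fun a ha b hb hab => by
    rw [← hinv a ha, hab, hinv b hb]
  have himg : f '' openAngles = Set.univ := by
    refine Set.eq_univ_of_forall fun s => ⟨geodesicAngle ℓ β κ s₀ s,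
      ⟨Real.neg_pi_div_two_lt_arctan _, Real.arctan_lt_pi_div_two _⟩, ?_⟩
    simp only [hf]
    rw [geodesicAngle, Real.tan_arctan]
    field_simp
    ring
  have hder : ∀ τ ∈ openAngles, HasDerivWithinAt f
      (ℓ / (kleinFactor β * κ) * (1 / Real.cos τ ^ 2)) openAngles τ := fun τ hτ =>
    (((Real.hasDerivAt_tan (Real.cos_pos_of_mem_Ioo hτ).ne').const_mul _).const_add
      s₀).hasDerivWithinAt
  have habs : ∀ τ ∈ openAngles, |ℓ / (kleinFactor β * κ) * (1 / Real.cos τ ^ 2)|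
      • g (geodesicAngle ℓ β κ s₀ (f τ)) = ℓ / (kleinFactor β * |κ| * Real.cos τ ^ 2) * g τ := by
    intro τ hτ
    have hc := Real.cos_pos_of_mem_Ioo hτ
    rw [hinv τ hτ, smul_eq_mul, abs_mul, abs_div, abs_mul, abs_of_pos hℓ, abs_of_pos hσ,
      abs_of_pos (by positivity : 0 < 1 / Real.cos τ ^ 2)]
    field_simp
  have h1 := integrableOn_image_iff_integrableOn_abs_deriv_smul measurableSet_Ioo hder hinj
    fun s => g (geodesicAngle ℓ β κ s₀ s)
  have h2 := integral_image_eq_integral_abs_deriv_smul measurableSet_Ioo hder hinj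
    fun s => g (geodesicAngle ℓ β κ s₀ s)
  rw [himg, integrableOn_univ] at h1
  rw [himg, setIntegral_univ] at h2
  rw [h1, h2]
  exact ⟨integrableOn_congr_fun habs measurableSet_Ioo, setIntegral_congr_fun measurableSet_Ioo habs⟩

theorem integrableOn_openAngles {f : ℝ → ℝ} (hf : ContinuousOn f angles) :
    IntegrableOn f openAngles :=
  (hf.integrableOn_compact isCompact_Icc).mono_set Set.Ioo_subset_Icc_self

theorem integral_openAngles (f : ℝ → ℝ) :
    ∫ τ in openAngles, f τ = ∫ τ in (-(Real.pi / 2))..(Real.pi / 2), f τ := by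
  rw [intervalIntegral.integral_of_le neg_pi_div_two_lt.le, integral_Ioc_eq_integral_Ioo]

theorem along_nullGeodesic (hℓ : ℓ ≠ 0) (hβ : IsKleinPoint e β) (hβ1 : ∑ i, β i ^ 2 < 1)
    (hH : ∀ x ∈ bulk d, H x = conformalFactor x ^ 2 • h x) (s : ℝ) :
    along h (nullGeodesic ℓ t₀ e β κ s₀) s = κ ^ 2 * (Real.cos (geodesicAngle ℓ β κ s₀ s) ^ 2
      / (4 * ℓ ^ 2) * rescaledTilt H ℓ t₀ e β (geodesicAngle ℓ β κ s₀ s)) := by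
  rw [← tiltDensity_nullCurve hℓ hβ hβ1 (cos_geodesicAngle_pos s) hH, along,
    (hasDerivAt_nullGeodesic (t₀ := t₀) (κ := κ) (s₀ := s₀) hℓ hβ s).deriv]
  simp only [quad, tiltDensity, Pi.smul_apply, smul_eq_mul, Finset.mul_sum, nullGeodesic]
  exact Finset.sum_congr rfl fun a _ => Finset.sum_congr rfl fun b _ => by ring

/-- The averaged light cone tilt in terms of the rescaled tilt. -/
theorem integrable_along_nullGeodesic (hℓ : 0 < ℓ) (hβ : IsKleinPoint e β)
    (hβ1 : ∑ i, β i ^ 2 < 1) (hκ : κ ≠ 0)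
    (hHd : ∀ a b, ContDiffOn ℝ 2 (fun x => H x a b) (compactification d))
    (hH : ∀ x ∈ bulk d, H x = conformalFactor x ^ 2 • h x) :
    Integrable (fun s => along h (nullGeodesic ℓ t₀ e β κ s₀) s) ∧
    tilt h (nullGeodesic ℓ t₀ e β κ s₀) = |κ| / (4 * ℓ * kleinFactor β)
      * ∫ τ in (-(Real.pi / 2))..(Real.pi / 2), rescaledTilt H ℓ t₀ e β τ := by
  have hσ := kleinFactor_pos hβ1
  have hF := (contDiffOn_rescaledTilt_slice (ℓ := ℓ) (t₀ := t₀) hβ hβ1 hHd).continuousOn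
  have h1 := integrable_comp_geodesicAngle (s₀ := s₀) hℓ hβ1 hκ
    fun τ => κ ^ 2 * (Real.cos τ ^ 2 / (4 * ℓ ^ 2) * rescaledTilt H ℓ t₀ e β τ)
  have h2 : ∀ τ ∈ openAngles, ℓ / (kleinFactor β * |κ| * Real.cos τ ^ 2)
      * (κ ^ 2 * (Real.cos τ ^ 2 / (4 * ℓ ^ 2) * rescaledTilt H ℓ t₀ e β τ))
      = |κ| / (4 * ℓ * kleinFactor β) * rescaledTilt H ℓ t₀ e β τ := fun τ hτ => by
    have hc := (Real.cos_pos_of_mem_Ioo hτ).ne'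
    have hκ' := abs_ne_zero.2 hκ
    rw [← sq_abs κ]
    field_simp
  simp only [tilt, along_nullGeodesic hℓ.ne' hβ hβ1 hH]
  rw [h1.1, h1.2, integrableOn_congr_fun h2 measurableSet_Ioo,
    setIntegral_congr_fun measurableSet_Ioo h2, integral_const_mul, integral_openAngles]
  exact ⟨(integrableOn_openAngles hF).const_mul _, rfl⟩

/-- The sum of the second derivatives of the rescaled tilt in the transverse directions. -/
def transverseLaplacian (H : TensorField d) (ℓ t₀ : ℝ) (e β : Fin d → ℝ) (τ : ℝ) : ℝ :=
  ∑ i : Fin d, deriv (deriv fun θ : ℝ => rescaledTilt H ℓ t₀ e (β + θ • kleinFrame e β i) τ) 0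

theorem zero_mem_kleinInterval (hβ1 : ∑ i, β i ^ 2 < 1) (w : Fin d → ℝ) :
    (0 : ℝ) ∈ kleinInterval β w := by simpa [kleinInterval] using hβ1

theorem continuousOn_deriv_deriv_rescaledTilt (hβ : IsKleinPoint e β) (hβ1 : ∑ i, β i ^ 2 < 1)
    (hHd : ∀ a b, ContDiffOn ℝ 2 (fun x => H x a b) (compactification d)) (i : Fin d) :
    ContinuousOn (fun τ => deriv (deriv fun θ : ℝ =>
      rescaledTilt H ℓ t₀ e (β + θ • kleinFrame e β i) τ) 0) angles := by
  have h1 := (deriv_deriv_integral (isOpen_kleinInterval β (kleinFrame e β i)) neg_pi_div_two_lt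
    (contDiffOn_rescaledTilt (ℓ := ℓ) (t₀ := t₀) hHd hβ (sum_kleinFrame_orth hβ i))).1
  exact h1.comp (f := fun τ : ℝ => ((0, τ) : ℝ × ℝ)) (by fun_prop) fun τ hτ =>
    ⟨zero_mem_kleinInterval hβ1 _, hτ⟩

theorem continuousOn_transverseLaplacian (hβ : IsKleinPoint e β) (hβ1 : ∑ i, β i ^ 2 < 1)
    (hHd : ∀ a b, ContDiffOn ℝ 2 (fun x => H x a b) (compactification d)) :
    ContinuousOn (transverseLaplacian H ℓ t₀ e β) angles :=
  continuousOn_finsetSum _ fun i _ => continuousOn_deriv_deriv_rescaledTilt hβ hβ1 hHd i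

/-- The averaged variation of the null curvature: the total derivative integrates to zero, and the
transverse second derivatives remain. -/
theorem integral_nullCurvatureVariation (hℓ : 0 < ℓ) (hβ : IsKleinPoint e β)
    (hβ1 : ∑ i, β i ^ 2 < 1) (hκ : κ ≠ 0)
    (hsymm : ∀ x ∈ bulk d, (h x).IsSymm)
    (hh : ∀ x ∈ bulk d, ∀ a b, ContDiffAt ℝ 2 (fun y => h y a b) x)
    (hHd : ∀ a b, ContDiffOn ℝ 2 (fun x => H x a b) (compactification d))
    (hH : ∀ x ∈ bulk d, H x = conformalFactor x ^ 2 • h x) {η : ℝ → Coord d}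
    (hη : IsNullDeviation d ℓ h (nullGeodesic ℓ t₀ e β κ s₀) η) :
    Integrable (nullCurvatureVariation d ℓ h (nullGeodesic ℓ t₀ e β κ s₀) η) ∧
    ∫ s, nullCurvatureVariation d ℓ h (nullGeodesic ℓ t₀ e β κ s₀) η s
      = -(|κ| * kleinFactor β / (8 * ℓ ^ 3))
        * ∫ τ in (-(Real.pi / 2))..(Real.pi / 2), transverseLaplacian H ℓ t₀ e β τ := by
  have hσ := kleinFactor_pos hβ1
  set V : ℝ → ℝ := fun τ =>
    derivAlong ℓ (nullCovector ℓ t₀ e) (divergenceTerm ℓ h (nullCovector ℓ t₀ e))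
        (nullCurve ℓ t₀ e β τ)
      - 1 / 2 * waveOp ℓ (tiltDensity ℓ h (nullCovector ℓ t₀ e)) (nullCurve ℓ t₀ e β τ) with hV
  set B := boundaryTermExt ℓ t₀ H e β with hB
  have hBc : ContDiffOn ℝ 1 B angles := contDiffOn_boundaryTermExt hβ hβ1 hHd
  have hB' : ContinuousOn (derivWithin B angles) angles :=
    hBc.continuousOn_derivWithin (uniqueDiffOn_Icc neg_pi_div_two_lt) (by norm_num)
  have hL := continuousOn_transverseLaplacian (ℓ := ℓ) (t₀ := t₀) hβ hβ1 hHd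
  have hBd : ∀ τ ∈ openAngles, HasDerivAt B (derivWithin B angles τ) τ := fun τ hτ => by
    have hn := Icc_mem_nhds hτ.1 hτ.2
    rw [derivWithin_of_mem_nhds hn]
    exact ((hBc.differentiableOn (by norm_num)).differentiableAt hn).hasDerivAt
  have h2 : ∀ τ ∈ openAngles, ℓ / (kleinFactor β * |κ| * Real.cos τ ^ 2) * (κ ^ 2 * V τ)
      = |κ| * (derivWithin B angles τ
        - kleinFactor β / (8 * ℓ ^ 3) * transverseLaplacian H ℓ t₀ e β τ) := fun τ hτ => by
    have hc := Real.cos_pos_of_mem_Ioo hτ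
    have hκ' := abs_ne_zero.2 hκ
    have e1 : boundaryTerm ℓ t₀ h e β =ᶠ[𝓝 τ] B := by
      filter_upwards [isOpen_Ioo.mem_nhds hτ] with s hs
      exact boundaryTerm_eq hℓ.ne' hβ hβ1 hs hHd hH
    have e2 := ((hasDerivAt_boundaryTerm (t₀ := t₀) hℓ.ne' hβ hβ1 hc hh
      hH).congr_of_eventuallyEq e1.symm).unique (hBd τ hτ)
    rw [← e2, transverseLaplacian, ← sq_abs κ]
    simp only [add_sub_cancel_right, hV]
    field_simp
  have hint : IntegrableOn (fun τ => |κ| * (derivWithin B angles τ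
        - kleinFactor β / (8 * ℓ ^ 3) * transverseLaplacian H ℓ t₀ e β τ)) openAngles :=
    integrableOn_openAngles (continuousOn_const.mul (hB'.sub (continuousOn_const.mul hL)))
  have h1 := integrable_comp_geodesicAngle (s₀ := s₀) hℓ hβ1 hκ fun τ => κ ^ 2 * V τ
  have h3 : nullCurvatureVariation d ℓ h (nullGeodesic ℓ t₀ e β κ s₀) η
      = fun s => κ ^ 2 * V (geodesicAngle ℓ β κ s₀ s) :=
    funext fun s => nullCurvatureVariation_eq hℓ.ne' hβ hβ1 hh hsymm hη s
  rw [h3, h1.1, h1.2, integrableOn_congr_fun h2 measurableSet_Ioo,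
    setIntegral_congr_fun measurableSet_Ioo h2]
  refine ⟨hint, ?_⟩
  have hFTC : ∫ τ in openAngles, derivWithin B angles τ = 0 := by
    rw [integral_openAngles, intervalIntegral.integral_eq_sub_of_hasDerivAt_of_le
      neg_pi_div_two_lt.le hBc.continuousOn hBd, hB, boundaryTermExt_eq_zero hℓ.ne' hβ (by simp),
      boundaryTermExt_eq_zero hℓ.ne' hβ (by simp), sub_zero]
    rw [intervalIntegrable_iff_integrableOn_Ioo_of_le neg_pi_div_two_lt.le]
    exact integrableOn_openAngles hB'
  rw [integral_const_mul, integral_sub (integrableOn_openAngles hB')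
    ((integrableOn_openAngles hL).const_mul _), hFTC, integral_const_mul, integral_openAngles]
  field_simp
  ring

end Integrals

/-! ### The maximum principle -/

section MaximumPrinciple

variable {d : ℕ} {ℓ t₀ : ℝ} {e β : Fin d → ℝ} {H : TensorField d}

theorem deriv_deriv_nonneg_of_isLocalMin {f : ℝ → ℝ} {x : ℝ} (hmin : IsLocalMin f x)
    (hc : ContinuousAt f x) : 0 ≤ deriv (deriv f) x := by
  by_contra! hneg
  have hmax := isLocalMax_of_deriv_deriv_neg hneg hmin.deriv_eq_zero hc
  have hconst : f =ᶠ[𝓝 x] fun _ => f x := by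
    filter_upwards [hmin, hmax] with y h1 h2 using le_antisymm h2 h1
  have h1 : deriv f =ᶠ[𝓝 x] deriv fun _ => f x := hconst.deriv
  rw [h1.deriv_eq] at hneg
  simp at hneg

/-- The integral of the rescaled tilt along the null geodesic with Klein position `β`. -/
def rescaledAverage (H : TensorField d) (ℓ t₀ : ℝ) (e β : Fin d → ℝ) : ℝ :=
  ∫ τ in (-(Real.pi / 2))..(Real.pi / 2), rescaledTilt H ℓ t₀ e β τ

theorem isCompact_isKleinPoint (e : Fin d → ℝ) : IsCompact {β | IsKleinPoint e β} := by
  refine Metric.isCompact_of_isClosed_isBounded ?_ ?_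
  · have : {β | IsKleinPoint e β} = {β | ∑ i, e i ^ 2 = 1} ∩ ({β | ∑ i, β i * e i = 0}
        ∩ {β | ∑ i, β i ^ 2 ≤ 1}) := by
      ext β; exact ⟨fun h => ⟨h.1, h.2, h.3⟩, fun h => ⟨h.1, h.2.1, h.2.2⟩⟩
    rw [this]
    exact (isClosed_const).inter ((isClosed_eq (by fun_prop) continuous_const).inter
      (isClosed_le (by fun_prop) continuous_const))
  · refine (Metric.isBounded_closedBall (x := (0 : Fin d → ℝ)) (r := 1)).subset fun β hβ => ?_
    rw [mem_closedBall_zero_iff, pi_norm_le_iff_of_nonneg zero_le_one]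
    intro i
    rw [Real.norm_eq_abs, ← sq_le_one_iff_abs_le_one]
    exact (Finset.single_le_sum (f := fun i => β i ^ 2) (fun j _ => sq_nonneg _)
      (Finset.mem_univ i)).trans hβ.le_one

theorem continuousOn_rescaledTilt
    (hHd : ∀ a b, ContDiffOn ℝ 2 (fun x => H x a b) (compactification d)) :
    ContinuousOn (fun q : (Fin d → ℝ) × ℝ => rescaledTilt H ℓ t₀ e q.1 q.2)
      ({β | IsKleinPoint e β} ×ˢ angles) := by
  have hσ : Continuous fun q : (Fin d → ℝ) × ℝ => kleinFactor q.1 := by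
    unfold kleinFactor; fun_prop
  have hD : Continuous fun q : (Fin d → ℝ) × ℝ => curveDenom q.1 q.2 := by
    unfold curveDenom; fun_prop
  have hDne : ∀ q ∈ {β | IsKleinPoint e β} ×ˢ angles, curveDenom q.1 q.2 ≠ 0 := fun q hq =>
    (curveDenom_pos _ (cos_nonneg_of_mem_angles hq.2)).ne'
  have hx : ContinuousOn (fun q : (Fin d → ℝ) × ℝ => nullCurve ℓ t₀ e q.1 q.2)
      ({β | IsKleinPoint e β} ×ˢ angles) := by
    rw [continuousOn_pi]
    intro a
    refine Fin.cases ?_ (fun i => ?_) a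
    · simp only [nullCurve_zero]; fun_prop
    · simp only [nullCurve_succ]
      exact ContinuousOn.div (by fun_prop) hD.continuousOn hDne
  have hu : ∀ a, ContinuousOn (fun q : (Fin d → ℝ) × ℝ => nullVelocity ℓ e q.1 q.2 a)
      ({β | IsKleinPoint e β} ×ˢ angles) := fun a => by
    refine Fin.cases ?_ (fun i => ?_) a
    · simp only [nullVelocity_zero]; exact (continuous_const.mul hD).continuousOn
    · have h := continuousOn_pi.1 hx i.succ
      simp only [nullCurve_succ] at h
      simp only [nullVelocity_succ]
      exact ContinuousOn.add (by fun_prop) ((by fun_prop : Continuous fun q : (Fin d → ℝ) × ℝ =>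
        kleinFactor q.1 * Real.sin q.2).continuousOn.mul h)
  have hmaps : Set.MapsTo (fun q : (Fin d → ℝ) × ℝ => nullCurve ℓ t₀ e q.1 q.2)
      ({β | IsKleinPoint e β} ×ˢ angles) (compactification d) := fun q hq =>
    nullCurve_mem_compactification hq.1 (cos_nonneg_of_mem_angles hq.2)
  unfold rescaledTilt quad
  exact continuousOn_finsetSum _ fun a _ => continuousOn_finsetSum _ fun b _ =>
    ((((hHd a b).continuousOn).comp hx hmaps).mul (hu a)).mul (hu b)

theorem continuousOn_rescaledAverage
    (hHd : ∀ a b, ContDiffOn ℝ 2 (fun x => H x a b) (compactification d)) :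
    ContinuousOn (rescaledAverage H ℓ t₀ e) {β | IsKleinPoint e β} := by
  rw [continuousOn_iff_continuous_domRestrict]
  have hab := neg_pi_div_two_lt.le
  have h1 : Continuous (Function.uncurry fun (b : {β | IsKleinPoint e β}) (τ : ℝ) =>
      rescaledTilt H ℓ t₀ e b (Set.projIcc _ _ hab τ)) := by
    refine (continuousOn_rescaledTilt (ℓ := ℓ) (t₀ := t₀) (e := e) hHd).comp_continuous
      (f := fun q : {β | IsKleinPoint e β} × ℝ =>
        ((q.1 : Fin d → ℝ), (Set.projIcc _ _ hab q.2 : ℝ))) ?_ fun q => ⟨q.1.2, (Set.projIcc _ _ hab q.2).2⟩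
    exact (continuous_subtype_val.comp continuous_fst).prodMk
      (continuous_subtype_val.comp (continuous_projIcc.comp continuous_snd))
  refine (intervalIntegral.continuous_parametric_intervalIntegral_of_continuous' (μ := volume) h1
    (-(Real.pi / 2)) (Real.pi / 2)).congr fun b => ?_
  rw [Set.domRestrict_apply, rescaledAverage]
  refine intervalIntegral.integral_congr fun τ hτ => ?_
  rw [Set.uIcc_of_le hab] at hτ
  rw [Set.projIcc_of_mem hab hτ]

/-- For `|β| = 1` the curve lies in the conformal boundary and its velocity is null. -/
theorem rescaledTilt_eq_zero (hβ : IsKleinPoint e β) (hβ1 : ∑ i, β i ^ 2 = 1)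
    (hbdy : ∀ x : Coord d, normSqSpace x = 1 → ∀ v : Coord d,
      ∑ i : Fin d, x i.succ * v i.succ = 0 → quad (compactMetric d ℓ x) v = 0 → quad (H x) v = 0)
    (τ : ℝ) : rescaledTilt H ℓ t₀ e β τ = 0 := by
  have hσ : kleinFactor β = 0 := by rw [kleinFactor, hβ1]; simp
  have hD : curveDenom β τ = 1 := by rw [curveDenom, hσ]; ring
  have hx : ∀ i : Fin d, nullCurve ℓ t₀ e β τ i.succ = Real.cos τ * β i + Real.sin τ * e i :=
    fun i => by rw [nullCurve_succ, hD, div_one]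
  have hu : ∀ i : Fin d, nullVelocity ℓ e β τ i.succ = -Real.sin τ * β i + Real.cos τ * e i :=
    fun i => by rw [nullVelocity_succ, hσ]; ring
  have hn : normSqSpace (nullCurve ℓ t₀ e β τ) = 1 := by
    simp only [normSqSpace, hx]
    rw [sum_sq_combination hβ.unit hβ.orth, hβ1]
    linear_combination Real.sin_sq_add_cos_sq τ
  refine hbdy _ hn _ ?_ ?_
  · simp only [hx, hu]
    have : ∑ i, (Real.cos τ * β i + Real.sin τ * e i) * (-Real.sin τ * β i + Real.cos τ * e i)
        = -(Real.cos τ * Real.sin τ) * ∑ i, β i ^ 2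
          + (Real.cos τ ^ 2 - Real.sin τ ^ 2) * ∑ i, β i * e i
          + Real.cos τ * Real.sin τ * ∑ i, e i ^ 2 := by
      simp only [Finset.mul_sum, ← Finset.sum_add_distrib]
      exact Finset.sum_congr rfl fun i _ => by ring
    rw [this, hβ1, hβ.orth, hβ.unit]; ring
  · simp only [quad, compactMetric, Matrix.diagonal_apply, ite_mul, zero_mul, Finset.sum_ite_eq,
      Finset.mem_univ, if_true]
    simp only [Fin.sum_univ_succ (n := d), Fin.cons_zero, Fin.cons_succ, hn, hu,
      nullVelocity_zero, hD]
    have := sum_sq_combination hβ.unit hβ.orth (-Real.sin τ) (Real.cos τ)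
    simp only [mul_assoc, ← Finset.mul_sum, ← pow_two]
    rw [this, hβ1]
    linear_combination 4 * ℓ ^ 2 * Real.sin_sq_add_cos_sq τ

theorem sum_kleinFrame_sq (hβ : IsKleinPoint e β) :
    ∑ i, ∑ j, kleinFrame e β i j ^ 2 = d - 1 - ∑ j, β j ^ 2 := by
  rw [Finset.sum_comm]
  simp only [pow_two, sum_kleinFrame_mul hβ, if_true, Finset.sum_sub_distrib, Finset.sum_const,
    Finset.card_univ, Fintype.card_fin, nsmul_eq_mul, mul_one]
  simp only [← pow_two, hβ.unit]

/-- If the averaged transverse Laplacian of the rescaled tilt is nonpositive on the Klein ball, the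
average, which vanishes on the boundary of the ball, is nonnegative. -/
theorem rescaledAverage_nonneg (hd : 2 ≤ d)
    (hHd : ∀ a b, ContDiffOn ℝ 2 (fun x => H x a b) (compactification d))
    (hbdy : ∀ x : Coord d, normSqSpace x = 1 → ∀ v : Coord d,
      ∑ i : Fin d, x i.succ * v i.succ = 0 → quad (compactMetric d ℓ x) v = 0 → quad (H x) v = 0)
    (hneg : ∀ β, IsKleinPoint e β → ∑ i, β i ^ 2 < 1 →
      ∫ τ in (-(Real.pi / 2))..(Real.pi / 2), transverseLaplacian H ℓ t₀ e β τ ≤ 0)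
    (hβ : IsKleinPoint e β) : 0 ≤ rescaledAverage H ℓ t₀ e β := by
  by_contra! hlt
  set U := rescaledAverage H ℓ t₀ e with hU
  -- the small multiple of `1 - |β|²` makes the inequality strict, and `U β + δ < 0`
  set δ := -U β / 2 with hδ
  have hδ0 : 0 < δ := by rw [hδ]; linarith
  have hcont : ContinuousOn (fun b : Fin d → ℝ => U b + δ * (1 - ∑ i, b i ^ 2))
      {b | IsKleinPoint e b} :=
    (continuousOn_rescaledAverage hHd).add (by fun_prop)
  obtain ⟨b, hb, hmin⟩ := (isCompact_isKleinPoint e).exists_isMinOn ⟨β, hβ⟩ hcont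
  replace hb : IsKleinPoint e b := hb
  have hWb : U b + δ * (1 - ∑ i, b i ^ 2) < 0 := by
    have h1 : U b + δ * (1 - ∑ i, b i ^ 2) ≤ U β + δ * (1 - ∑ i, β i ^ 2) := hmin hβ
    have h2 : 0 ≤ ∑ i, β i ^ 2 := Finset.sum_nonneg fun i _ => sq_nonneg _
    nlinarith
  have hb1 : ∑ i, b i ^ 2 < 1 := by
    refine lt_of_le_of_ne hb.le_one fun hb1 => ?_
    have : U b = 0 := by
      rw [hU, rescaledAverage]
      simp only [rescaledTilt_eq_zero hb hb1 hbdy, intervalIntegral.integral_zero]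
    rw [this, hb1] at hWb
    linarith
  -- second derivatives at the minimum
  have hsecond : ∀ i, 2 * δ * ∑ j, kleinFrame e b i j ^ 2
      ≤ ∫ τ in (-(Real.pi / 2))..(Real.pi / 2), deriv (deriv fun θ : ℝ =>
        rescaledTilt H ℓ t₀ e (b + θ • kleinFrame e b i) τ) 0 := fun i => by
    set w := kleinFrame e b i with hw
    have horth := sum_kleinFrame_orth hb i
    have hTo := isOpen_kleinInterval b w
    have h0 := zero_mem_kleinInterval hb1 w
    have hI := (deriv_deriv_integral hTo neg_pi_div_two_lt
      (contDiffOn_rescaledTilt (ℓ := ℓ) (t₀ := t₀) hHd hb horth)).2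
    set f1 : ℝ → ℝ := fun θ => U (b + θ • w) with hf1
    set f2 : ℝ → ℝ := fun θ => δ * (1 - ∑ i, (b + θ • w) i ^ 2) with hf2
    have hf2d : ∀ θ, HasDerivAt f2 (δ * -(2 * ∑ j, b j * w j + 2 * θ * ∑ j, w j ^ 2)) θ :=
      fun θ => by
        refine (((HasDerivAt.fun_sum fun j _ => ((((hasDerivAt_id θ).mul_const (w j)).const_add
          (b j)).fun_pow 2)).const_sub 1).const_mul δ).congr_deriv ?_
        rw [Finset.mul_sum, Finset.mul_sum, ← Finset.sum_add_distrib]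
        congr 2
        refine Finset.sum_congr rfl fun j _ => ?_
        simp only [id]
        ring
    have hf2dd : HasDerivAt (fun θ : ℝ => δ * -(2 * ∑ j, b j * w j + 2 * θ * ∑ j, w j ^ 2))
        (-(2 * δ * ∑ j, w j ^ 2)) 0 := by
      refine ((((((hasDerivAt_id (0 : ℝ)).const_mul 2).mul_const (∑ j, w j ^ 2)).const_add
        (2 * ∑ j, b j * w j)).neg).const_mul δ).congr_deriv ?_
      ring
    have hdf : deriv (fun θ => f1 θ + f2 θ) =ᶠ[𝓝 0] fun θ => deriv f1 θ
        + δ * -(2 * ∑ j, b j * w j + 2 * θ * ∑ j, w j ^ 2) := by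
      filter_upwards [hTo.mem_nhds h0] with θ hθ
      exact ((hI θ hθ).1.hasDerivAt.add (hf2d θ)).deriv
    have hdd : deriv (deriv fun θ => f1 θ + f2 θ) 0
        = (∫ τ in (-(Real.pi / 2))..(Real.pi / 2), deriv (deriv fun θ : ℝ =>
          rescaledTilt H ℓ t₀ e (b + θ • w) τ) 0) + -(2 * δ * ∑ j, w j ^ 2) := by
      rw [hdf.deriv_eq]
      exact ((hI 0 h0).2.add hf2dd).deriv
    have hlm : IsLocalMin (fun θ => f1 θ + f2 θ) 0 := by
      filter_upwards [hTo.mem_nhds h0] with θ hθ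
      have := hmin (isKleinPoint_add hb horth hθ)
      simpa [hf1, hf2] using this
    have hca : ContinuousAt (fun θ => f1 θ + f2 θ) 0 :=
      (hI 0 h0).1.continuousAt.add (hf2d 0).continuousAt
    have := deriv_deriv_nonneg_of_isLocalMin hlm hca
    rw [hdd] at this
    linarith
  have hsum := Finset.sum_le_sum fun i (_ : i ∈ Finset.univ) => hsecond i
  rw [← Finset.mul_sum, sum_kleinFrame_sq hb, ← intervalIntegral.integral_finsetSum] at hsum
  · have h1 := hneg b hb hb1
    unfold transverseLaplacian at h1
    have h2 : (2 : ℝ) ≤ d := by exact_mod_cast hd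
    have h3 : 0 < 2 * δ * (d - 1 - ∑ j, b j ^ 2) := by
      apply mul_pos <;> linarith
    linarith
  · intro i _
    refine ContinuousOn.intervalIntegrable ?_
    rw [Set.uIcc_of_le neg_pi_div_two_lt.le]
    exact continuousOn_deriv_deriv_rescaledTilt hb hb1 hHd i

end MaximumPrinciple

/-! ### First-order deviations of null geodesics -/

section Deviation

variable {d : ℕ} {ℓ : ℝ} {h : TensorField d} {γ η c : ℝ → Coord d} {s : ℝ}

theorem contDiffAt_partialDeriv_top {f : Coord d → ℝ} {x : Coord d}
    (hf : ∀ n : ℕ, ContDiffAt ℝ n f x) (a : Fin (d + 1)) (n : ℕ) :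
    ContDiffAt ℝ n (partialDeriv a f) x :=
  contDiffAt_partialDeriv (hf (n + 1)) (by norm_cast)

/-- The second derivative of `f ∘ c` for a linear function `f` of the ambient space. -/
theorem ambientFn_second_deriv (hℓ : ℓ ≠ 0) (A : Ambient d) (hc : ContDiff ℝ 2 c)
    (hs : c s ∈ bulk d) :
    ∑ a, deriv (deriv c) s a * partialDeriv a (ambientFn ℓ A) (c s)
        + ∑ a, deriv c s a * ∑ b, deriv c s b * partialDeriv b (partialDeriv a (ambientFn ℓ A)) (c s)
      = ambientFn ℓ A (c s) / ℓ ^ 2 * along (metric d ℓ) c s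
        + ∑ a, acceleration (metric d ℓ) c s a * partialDeriv a (ambientFn ℓ A) (c s) := by
  have h1 : HasDerivAt c (deriv c s) s := (hc.differentiable (by norm_num) s).hasDerivAt
  have h2 : HasDerivAt (deriv c) (deriv (deriv c) s) s :=
    ((hc.iterate_deriv' 1 1).differentiable (by norm_num) s).hasDerivAt
  have h3 := HasDerivAt.fun_sum fun a (_ : a ∈ Finset.univ) => (hasDerivAt_pi.1 h2 a).mul
    (hasDerivAt_comp_curve ((contDiffAt_partialDeriv_ambientFn (ℓ := ℓ) (n := 1) hs A
      a).differentiableAt (by norm_num)) h1)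
  rw [← h3.unique (hasDerivAt_ambientFn_velocity hℓ A hc hs), Finset.sum_add_distrib]

/-- The derivative along `γ` of `df(η)`. -/
def deviationDeriv (γ η : ℝ → Coord d) (f : Coord d → ℝ) (s : ℝ) : ℝ :=
  ∑ a, (deriv η s a * partialDeriv a f (γ s)
    + η s a * ∑ b, deriv γ s b * partialDeriv b (partialDeriv a f) (γ s))

theorem hasDerivAt_deviation (hγ : Differentiable ℝ γ) (hη : Differentiable ℝ η)
    {f : Coord d → ℝ} (hf : ContDiffAt ℝ 2 f (γ s)) :
    HasDerivAt (fun s => ∑ a, η s a * partialDeriv a f (γ s)) (deviationDeriv γ η f s) s :=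
  HasDerivAt.fun_sum fun a _ => (hasDerivAt_pi.1 (hη s).hasDerivAt a).mul
    (hasDerivAt_comp_curve (differentiableAt_partialDeriv hf a) (hγ s).hasDerivAt)

/-- The second derivative of `df(η)` along `γ` is the first-order change of `(f ∘ (γ + ε η))''`. -/
theorem hasDerivAt_deviationDeriv (hγ : ContDiff ℝ 2 γ) (hη : ContDiff ℝ 2 η)
    {f : Coord d → ℝ} (hf : ∀ n : ℕ, ContDiffAt ℝ n f (γ s)) {E : ℝ}
    (hE : HasDerivAt (deviationDeriv γ η f) E s) :
    HasDerivAt (fun ε : ℝ => ∑ a, deriv (deriv (γ + ε • η)) s a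
          * partialDeriv a f ((γ + ε • η) s)
        + ∑ a, deriv (γ + ε • η) s a * ∑ b, deriv (γ + ε • η) s b
          * partialDeriv b (partialDeriv a f) ((γ + ε • η) s)) E 0 := by
  have hγ1 := hγ.differentiable (by norm_num)
  have hη1 := hη.differentiable (by norm_num)
  have hγ2 : Differentiable ℝ (deriv γ) := (hγ.iterate_deriv' 1 1).differentiable (by norm_num)
  have hη2 : Differentiable ℝ (deriv η) := (hη.iterate_deriv' 1 1).differentiable (by norm_num)
  have hf1 : ∀ a, DifferentiableAt ℝ (partialDeriv a f) (γ s) := fun a =>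
    (contDiffAt_partialDeriv_top hf a 1).differentiableAt (by norm_num)
  have hf2 : ∀ a b, DifferentiableAt ℝ (partialDeriv b (partialDeriv a f)) (γ s) := fun a b =>
    (contDiffAt_partialDeriv_top (contDiffAt_partialDeriv_top hf a) b 1).differentiableAt
      (by norm_num)
  have d1 : ∀ ε : ℝ, deriv (γ + ε • η) = deriv γ + ε • deriv η := fun ε =>
    funext fun r => deriv_add_smul hγ1 hη1 ε r
  have hline : HasDerivAt (fun ε : ℝ => γ s + ε • η s) (η s) 0 := by
    simpa using ((hasDerivAt_id (0 : ℝ)).smul_const (η s)).const_add (γ s)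
  have hc0 : γ s + (0 : ℝ) • η s = γ s := by simp
  have g1 : ∀ a, HasDerivAt (fun ε : ℝ => partialDeriv a f (γ s + ε • η s))
      (∑ e, η s e * partialDeriv e (partialDeriv a f) (γ s)) 0 := fun a => by
    have := hasDerivAt_comp_curve (f := partialDeriv a f) (c := fun ε : ℝ => γ s + ε • η s)
      (by rw [hc0]; exact hf1 a) hline
    rwa [hc0] at this
  have g2 : ∀ a b, HasDerivAt (fun ε : ℝ => partialDeriv b (partialDeriv a f) (γ s + ε • η s))
      (∑ e, η s e * partialDeriv e (partialDeriv b (partialDeriv a f)) (γ s)) 0 := fun a b => by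
    have := hasDerivAt_comp_curve (f := partialDeriv b (partialDeriv a f))
      (c := fun ε : ℝ => γ s + ε • η s) (by rw [hc0]; exact hf2 a b) hline
    rwa [hc0] at this
  have hL := (HasDerivAt.fun_sum fun a (_ : a ∈ Finset.univ) =>
      (hasDerivAt_affine (deriv (deriv γ) s a) (deriv (deriv η) s a)).mul (g1 a)).add
    (HasDerivAt.fun_sum fun a (_ : a ∈ Finset.univ) =>
      (hasDerivAt_affine (deriv γ s a) (deriv η s a)).mul
        (HasDerivAt.fun_sum fun b (_ : b ∈ Finset.univ) =>
          (hasDerivAt_affine (deriv γ s b) (deriv η s b)).mul (g2 a b)))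
  have k2 : ∀ a b, HasDerivAt (fun r => partialDeriv b (partialDeriv a f) (γ r))
      (∑ e, deriv γ s e * partialDeriv e (partialDeriv b (partialDeriv a f)) (γ s)) s := fun a b =>
    hasDerivAt_comp_curve (hf2 a b) (hγ1 s).hasDerivAt
  have k1 : ∀ a, HasDerivAt (fun r => partialDeriv a f (γ r))
      (∑ e, deriv γ s e * partialDeriv e (partialDeriv a f) (γ s)) s := fun a =>
    hasDerivAt_comp_curve (hf1 a) (hγ1 s).hasDerivAt
  have hR : HasDerivAt (deviationDeriv γ η f) _ s :=
    HasDerivAt.fun_sum fun a (_ : a ∈ Finset.univ) =>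
      ((hasDerivAt_pi.1 (hη2 s).hasDerivAt a).mul (k1 a)).add
      ((hasDerivAt_pi.1 (hη1 s).hasDerivAt a).mul (HasDerivAt.fun_sum fun b (_ : b ∈ Finset.univ) =>
        (hasDerivAt_pi.1 (hγ2 s).hasDerivAt b).mul (k2 a b)))
  rw [hE.unique hR]
  refine (hL.congr_of_eventuallyEq (Eventually.of_forall fun ε => ?_)).congr_deriv ?_
  · simp only [d1]
    rw [deriv_add_smul hγ2 hη2]
    rfl
  · have hS : ∀ a b, partialDeriv a (partialDeriv b f) (γ s)
        = partialDeriv b (partialDeriv a f) (γ s) := fun a b => partialDeriv_comm b (hf 2)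
    have hT1 : ∀ a b e, partialDeriv a (partialDeriv b (partialDeriv e f)) (γ s)
        = partialDeriv b (partialDeriv a (partialDeriv e f)) (γ s) := fun a b e =>
      partialDeriv_comm b (contDiffAt_partialDeriv_top hf e 2)
    have hev : ∀ᶠ y in 𝓝 (γ s), ContDiffAt ℝ 2 f y := (hf 2).eventually (by simp)
    have hT2 : ∀ a b e, partialDeriv a (partialDeriv b (partialDeriv e f)) (γ s)
        = partialDeriv a (partialDeriv e (partialDeriv b f)) (γ s) := fun a b e =>
      partialDeriv_congr (by filter_upwards [hev] with y hy using partialDeriv_comm e hy)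
    -- from here on only the symmetry of the second and third partial derivatives of `f` matters
    obtain ⟨S, hSd⟩ : ∃ S : Fin (d + 1) → Fin (d + 1) → ℝ, ∀ a b,
      partialDeriv a (partialDeriv b f) (γ s) = S a b := ⟨_, fun _ _ => rfl⟩
    obtain ⟨T, hTd⟩ : ∃ T : Fin (d + 1) → Fin (d + 1) → Fin (d + 1) → ℝ, ∀ a b e,
      partialDeriv a (partialDeriv b (partialDeriv e f)) (γ s) = T a b e := ⟨_, fun _ _ _ => rfl⟩
    simp only [hTd] at hT1 hT2
    simp only [hSd] at hS
    simp only [Pi.mul_apply, zero_mul, add_zero, hc0, hSd, hTd]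
    have swap : ∀ (u v : Coord d) (U : Fin (d + 1) → Fin (d + 1) → ℝ), (∀ a b, U a b = U b a) →
        ∑ a, u a * ∑ b, v b * U b a = ∑ a, v a * ∑ b, u b * U b a := fun u v U hU => by
      simp only [Finset.mul_sum]
      rw [Finset.sum_comm]
      exact Finset.sum_congr rfl fun a _ => Finset.sum_congr rfl fun b _ => by rw [hU]; ring
    have e1 := swap (deriv (deriv γ) s) (η s) S hS
    have e2 := swap (deriv γ s) (deriv η s) S hS
    have e3 : ∑ a, deriv γ s a * ∑ b, deriv γ s b * ∑ e, η s e * T e b a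
        = ∑ a, η s a * ∑ b, deriv γ s b * ∑ e, deriv γ s e * T e b a := by
      have e4 : ∀ a, ∑ b, deriv γ s b * ∑ e, η s e * T e b a
          = ∑ e, η s e * ∑ b, deriv γ s b * T b a e := fun a => by
        simp only [Finset.mul_sum]
        rw [Finset.sum_comm]
        refine Finset.sum_congr rfl fun e _ => Finset.sum_congr rfl fun b _ => ?_
        rw [hT1 e b a, hT2 b e a]; ring
      simp only [e4]
      rw [swap (deriv γ s) (η s) (fun e a => ∑ b, deriv γ s b * T b a e)]
      · refine Finset.sum_congr rfl fun a _ => ?_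
        congr 1
        refine Finset.sum_congr rfl fun b _ => ?_
        congr 1
        exact Finset.sum_congr rfl fun e _ => by rw [hT2]
      · exact fun a b => Finset.sum_congr rfl fun e _ => by rw [hT2]
    simp only [mul_add, Finset.sum_add_distrib, e1, e2, e3]
    ring

end Deviation

/-! ### The linearized null geodesic equation -/

section LinearizedGeodesic

variable {d : ℕ} {ℓ : ℝ} {h : TensorField d} {γ η : ℝ → Coord d} {s : ℝ}

/-- The force `C^a_{bc} k^b k^c` that a perturbation exerts along a curve with velocity `k`. -/
def force (ℓ : ℝ) (h : TensorField d) (γ : ℝ → Coord d) (s : ℝ) (a : Fin (d + 1)) : ℝ :=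
  ∑ b, ∑ e, connectionVar (metric d ℓ) h 0 a b e (γ s) * deriv γ s b * deriv γ s e

theorem differentiableAt_along_add_smul {T : TensorField d}
    (hT : ∀ a b, DifferentiableAt ℝ (fun y => T y a b) (γ s)) (hγ : Differentiable ℝ γ)
    (hη : Differentiable ℝ η) :
    DifferentiableAt ℝ (fun ε : ℝ => along T (γ + ε • η) s) 0 := by
  have hl : DifferentiableAt ℝ (fun ε : ℝ => γ s + ε • η s) 0 := by fun_prop
  have hT' : ∀ a b, DifferentiableAt ℝ (fun ε : ℝ => T (γ s + ε • η s) a b) 0 := fun a b =>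
    DifferentiableAt.comp (g := fun y => T y a b) (f := fun ε : ℝ => γ s + ε • η s) 0
      (by simpa using hT a b) hl
  simp only [along_add_smul T hγ hη]
  refine DifferentiableAt.fun_sum fun a _ => DifferentiableAt.fun_sum fun b _ => ?_
  exact ((hT' a b).fun_mul (by fun_prop)).fun_mul (by fun_prop)

theorem acceleration_add_smul (g : TensorField d) (hγ : ContDiff ℝ 2 γ) (hη : ContDiff ℝ 2 η)
    (ε : ℝ) (a : Fin (d + 1)) : acceleration g (γ + ε • η) s a
      = deriv (deriv γ) s a + ε * deriv (deriv η) s a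
        + ∑ b, ∑ e, christoffel g a b e (γ s + ε • η s) * (deriv γ s b + ε * deriv η s b)
          * (deriv γ s e + ε * deriv η s e) := by
  have hγ1 := hγ.differentiable (by norm_num)
  have hη1 := hη.differentiable (by norm_num)
  have hγ2 : Differentiable ℝ (deriv γ) := (hγ.iterate_deriv' 1 1).differentiable (by norm_num)
  have hη2 : Differentiable ℝ (deriv η) := (hη.iterate_deriv' 1 1).differentiable (by norm_num)
  have d1 : deriv (γ + ε • η) = deriv γ + ε • deriv η :=
    funext fun r => deriv_add_smul hγ1 hη1 ε r
  rw [acceleration, d1, deriv_add_smul hγ2 hη2]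
  rfl

theorem differentiableAt_acceleration_metric (hℓ : ℓ ≠ 0) (hs : γ s ∈ bulk d)
    (hγ : ContDiff ℝ 2 γ) (hη : ContDiff ℝ 2 η) (a : Fin (d + 1)) :
    DifferentiableAt ℝ (fun ε : ℝ => acceleration (metric d ℓ) (γ + ε • η) s a) 0 := by
  have hl : DifferentiableAt ℝ (fun ε : ℝ => γ s + ε • η s) 0 := by fun_prop
  have hC : ∀ b e, DifferentiableAt ℝ (christoffel (metric d ℓ) a b e) (γ s) := fun b e =>
    (contDiffAt_christoffel_metric (n := 1) hℓ hs a b e).differentiableAt (by norm_num)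
  have hT' : ∀ b e, DifferentiableAt ℝ
      (fun ε : ℝ => christoffel (metric d ℓ) a b e (γ s + ε • η s)) 0 := fun b e =>
    DifferentiableAt.comp (g := christoffel (metric d ℓ) a b e) (f := fun ε : ℝ => γ s + ε • η s) 0
      (by simpa using hC b e) hl
  simp only [acceleration_add_smul _ hγ hη]
  refine DifferentiableAt.fun_add (by fun_prop) ?_
  refine DifferentiableAt.fun_sum fun b _ => DifferentiableAt.fun_sum fun e _ => ?_
  exact ((hT' b e).fun_mul (by fun_prop)).fun_mul (by fun_prop)

/-- The first-order change of `g(k, k)`, split into the deviation of the curve in the fixed metric `g`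
and the perturbation of the metric. -/
theorem hasDerivAt_along_perturbed (hs : γ s ∈ bulk d)
    (hh : ∀ a b, ContDiffAt ℝ 2 (fun y => h y a b) (γ s)) (hγ : Differentiable ℝ γ)
    (hη : Differentiable ℝ η) :
    HasDerivAt (fun ε : ℝ => along (perturbed d ℓ h ε) (γ + ε • η) s)
      (deriv (fun ε : ℝ => along (metric d ℓ) (γ + ε • η) s) 0 + along h γ s) 0 := by
  have h1 := (differentiableAt_along_add_smul (T := metric d ℓ) (fun a b =>
    (contDiffAt_metric (n := 1) hs a b).differentiableAt (by norm_num)) hγ hη).hasDerivAt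
  have h2 := hasDerivAt_mul_of_continuousAt (differentiableAt_along_add_smul (T := h) (fun a b =>
    (hh a b).differentiableAt (by norm_num)) hγ hη).continuousAt
  refine ((h1.add h2).congr_of_eventuallyEq
    (Eventually.of_forall fun ε => along_perturbed ε _ s)).congr_deriv ?_
  simp

/-- The first-order change of the acceleration, split into the deviation of the curve in the fixed
metric `g` and the force of the perturbation. -/
theorem hasDerivAt_acceleration_perturbed (hℓ : ℓ ≠ 0) (hs : γ s ∈ bulk d)
    (hh : ∀ a b, ContDiffAt ℝ 2 (fun y => h y a b) (γ s)) (hγ : ContDiff ℝ 2 γ)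
    (hη : ContDiff ℝ 2 η) (a : Fin (d + 1)) :
    HasDerivAt (fun ε : ℝ => acceleration (perturbed d ℓ h ε) (γ + ε • η) s a)
      (deriv (fun ε : ℝ => acceleration (metric d ℓ) (γ + ε • η) s a) 0 + force ℓ h γ s a) 0 := by
  have h1 := (differentiableAt_acceleration_metric hℓ hs hγ hη a).hasDerivAt
  have h2 := HasDerivAt.fun_sum fun b (_ : b ∈ Finset.univ) =>
    HasDerivAt.fun_sum fun e (_ : e ∈ Finset.univ) =>
      ((hasDerivAt_christoffel_sub (g := metric d ℓ) (h := h) (x := γ s)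
        (c := fun ε : ℝ => γ s + ε • η s) (fun a b => contDiffAt_metric hs a b) hh
        (det_metric_ne_zero hℓ hs) (continuousAt_line _ _) (by simp) a b e).mul
        (hasDerivAt_affine (deriv γ s b) (deriv η s b))).mul
        (hasDerivAt_affine (deriv γ s e) (deriv η s e))
  refine ((h1.add h2).congr_of_eventuallyEq (Eventually.of_forall fun ε => ?_)).congr_deriv ?_
  · simp only [Pi.add_apply, Pi.mul_apply, acceleration_add_smul _ hγ hη]
    rw [add_assoc (_ + _), ← Finset.sum_add_distrib]
    congr 1
    refine Finset.sum_congr rfl fun b _ => ?_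
    rw [← Finset.sum_add_distrib]
    exact Finset.sum_congr rfl fun e _ => by
      rw [show (fun y => metric d ℓ y + ε • h y) = perturbed d ℓ h ε from rfl]; ring
  · simp [force]

/-- The linearized null geodesic equation, tested on the linear functions of the ambient space. -/
theorem isNullDeviation_of_hasDerivAt (hℓ : ℓ ≠ 0) (hγ : IsNullGeodesic d ℓ γ)
    (hh : ∀ x ∈ bulk d, ∀ a b, ContDiffAt ℝ 2 (fun y => h y a b) x) (hη : ContDiff ℝ 2 η)
    (hD : ∀ (A : Ambient d) s, HasDerivAt (deviationDeriv γ η (ambientFn ℓ A))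
      (-(ambientFn ℓ A (γ s) / ℓ ^ 2 * along h γ s)
        - ∑ a, force ℓ h γ s a * partialDeriv a (ambientFn ℓ A) (γ s)) s) :
    IsNullDeviation d ℓ h γ η := by
  have key : ∀ s, deriv (fun ε : ℝ => along (metric d ℓ) (γ + ε • η) s) 0 + along h γ s = 0 ∧
      (fun a => deriv (fun ε : ℝ => acceleration (metric d ℓ) (γ + ε • η) s a) 0
        + force ℓ h γ s a) = 0 := by
    intro s
    have hs := hγ.mem_bulk s
    have hγ1 := hγ.contDiff.differentiable (by norm_num)
    have hη1 := hη.differentiable (by norm_num)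
    set q := deriv (fun ε : ℝ => along (metric d ℓ) (γ + ε • η) s) 0 with hq
    set ag : Fin (d + 1) → ℝ :=
      fun a => deriv (fun ε : ℝ => acceleration (metric d ℓ) (γ + ε • η) s a) 0 with hag
    have hq' : HasDerivAt (fun ε : ℝ => along (metric d ℓ) (γ + ε • η) s) q 0 :=
      (differentiableAt_along_add_smul (T := metric d ℓ) (fun a b =>
        (contDiffAt_metric (n := 1) hs a b).differentiableAt (by norm_num)) hγ1 hη1).hasDerivAt
    have hag' : ∀ a, HasDerivAt (fun ε : ℝ => acceleration (metric d ℓ) (γ + ε • η) s a) (ag a) 0 :=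
      fun a => (differentiableAt_acceleration_metric hℓ hs hγ.contDiff hη a).hasDerivAt
    have h00 : γ + (0 : ℝ) • η = γ := by simp
    have main : ∀ A : Ambient d, ambientFn ℓ A (γ s) / ℓ ^ 2 * (q + along h γ s)
        + ∑ a, partialDeriv a (ambientFn ℓ A) (γ s) * (ag a + force ℓ h γ s a) = 0 := by
      intro A
      have h1 := hasDerivAt_deviationDeriv hγ.contDiff hη
        (fun n => contDiffAt_ambientFn (n := n) hs A) (hD A s)
      have hl : HasDerivAt (fun ε : ℝ => γ s + ε • η s) (η s) 0 := by
        simpa using ((hasDerivAt_id (0 : ℝ)).smul_const (η s)).const_add (γ s)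
      have hc0 : γ s + (0 : ℝ) • η s = γ s := by simp
      have f1 := hasDerivAt_comp_curve (f := ambientFn ℓ A) (c := fun ε : ℝ => γ s + ε • η s)
        (by rw [hc0]; exact (contDiffAt_ambientFn (n := 1) hs A).differentiableAt (by norm_num)) hl
      have hd2 : ∀ a, DifferentiableAt ℝ (partialDeriv a (ambientFn ℓ A)) (γ s) := fun a =>
        (contDiffAt_partialDeriv_ambientFn (n := 1) hs A a).differentiableAt (by norm_num)
      have h2 := ((f1.div_const (ℓ ^ 2)).mul hq').add (HasDerivAt.fun_sum
        fun a (_ : a ∈ Finset.univ) => (hag' a).mul (hasDerivAt_comp_curve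
          (f := partialDeriv a (ambientFn ℓ A)) (c := fun ε : ℝ => γ s + ε • η s)
          (by rw [hc0]; exact hd2 a) hl))
      have hev : ∀ᶠ ε : ℝ in 𝓝 0, γ s + ε • η s ∈ bulk d :=
        (continuousAt_line (γ s) (η s)).eventually (by simpa using bulk_mem_nhds hs)
      have h3 := h1.congr_of_eventuallyEq (f₁ := fun ε : ℝ =>
          ambientFn ℓ A ((γ + ε • η) s) / ℓ ^ 2 * along (metric d ℓ) (γ + ε • η) s
          + ∑ a, acceleration (metric d ℓ) (γ + ε • η) s a
            * partialDeriv a (ambientFn ℓ A) ((γ + ε • η) s))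
        (by
          filter_upwards [hev] with ε hε
          exact (ambientFn_second_deriv hℓ A (hγ.contDiff.add (hη.const_smul ε)) hε).symm)
      have h4 := h3.unique h2
      simp only [h00, hγ.null, hγ.geodesic, hc0, mul_zero, zero_mul, add_zero, zero_add] at h4
      have h5 : ∑ a, partialDeriv a (ambientFn ℓ A) (γ s) * (ag a + force ℓ h γ s a)
          = ∑ a, ag a * partialDeriv a (ambientFn ℓ A) (γ s)
            + ∑ a, force ℓ h γ s a * partialDeriv a (ambientFn ℓ A) (γ s) := by
        rw [← Finset.sum_add_distrib]
        exact Finset.sum_congr rfl fun a _ => by ring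
      rw [h5]
      linear_combination -h4
    have hw : (fun a => ag a + force ℓ h γ s a) = 0 :=
      eq_zero_of_forall_ambientFn hℓ hs fun A hA => by
        have := main A
        rwa [hA, zero_div, zero_mul, zero_add] at this
    refine ⟨?_, hw⟩
    have main2 : ∀ A : Ambient d, ambientFn ℓ A (γ s) * (q + along h γ s) = 0 := fun A => by
      have h1 := main A
      simp only [fun a => congrFun hw a, Pi.zero_apply, mul_zero, Finset.sum_const_zero,
        add_zero] at h1
      field_simp at h1
      simpa using h1
    -- some linear function does not vanish at the point, because `0` is not on the hyperboloid
    by_contra hne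
    have hz : ∀ A : Ambient d, ambientFn ℓ A (γ s) = 0 := fun A =>
      (mul_eq_zero.1 (main2 A)).resolve_right hne
    have := hyperboloid (ℓ := ℓ) hs
    simp only [hz] at this
    have : ℓ ^ 2 = 0 := by simpa using this.symm
    exact hℓ (by simpa using this)
  have hγ1 := hγ.contDiff.differentiable (by norm_num)
  have hη1 := hη.differentiable (by norm_num)
  exact ⟨hη,
    fun s => (hasDerivAt_along_perturbed (hγ.mem_bulk s) (hh _ (hγ.mem_bulk s)) hγ1
      hη1).congr_deriv (key s).1,
    fun s a => (hasDerivAt_acceleration_perturbed hℓ (hγ.mem_bulk s) (hh _ (hγ.mem_bulk s))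
      hγ.contDiff hη a).congr_deriv (congrFun (key s).2 a)⟩

end LinearizedGeodesic

/-! ### The source of the deviation equation in the ambient space -/

section Source

variable {d : ℕ} {ℓ : ℝ} {h : TensorField d} {γ η : ℝ → Coord d} {s : ℝ} {x : Coord d}

/-- The ambient vector that represents a linear functional `L` on `Ambient d` with respect to
`ambientInner`. -/
def representer (L : Ambient d → ℝ) : Ambient d :=
  (-L (1, 0, 0), -L (0, 1, 0), fun i => L (0, 0, Pi.single i 1))

theorem ambientInner_representer {L : Ambient d → ℝ}
    (hL : ∀ A, L A = A.1 * L (1, 0, 0) + A.2.1 * L (0, 1, 0)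
      + ∑ i, A.2.2 i * L (0, 0, Pi.single i 1)) (A : Ambient d) :
    ambientInner A (representer L) = L A := by
  rw [hL A]; simp only [ambientInner, representer]; ring

theorem partialDeriv_ambientFn_eq_combination (hx : x ∈ bulk d) (A : Ambient d)
    (a : Fin (d + 1)) : partialDeriv a (ambientFn ℓ A) x
      = A.1 * partialDeriv a (ambientFn ℓ (1, 0, 0)) x
        + A.2.1 * partialDeriv a (ambientFn ℓ (0, 1, 0)) x
        + ∑ i, A.2.2 i * partialDeriv a (ambientFn ℓ (0, 0, Pi.single i 1)) x := by
  have hd : ∀ B : Ambient d, DifferentiableAt ℝ (ambientFn ℓ B) x := fun B =>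
    (contDiffAt_ambientFn (n := 1) hx B).differentiableAt (by norm_num)
  rw [show ambientFn ℓ A = fun y => A.1 * ambientFn ℓ (1, 0, 0) y + A.2.1 * ambientFn ℓ (0, 1, 0) y
      + ∑ i, A.2.2 i * ambientFn ℓ (0, 0, Pi.single i 1) y from
    funext fun y => ambientFn_eq_combination A y]
  rw [partialDeriv_add (((hd _).const_mul _).fun_add ((hd _).const_mul _))
      (DifferentiableAt.fun_sum fun i _ => (hd _).const_mul _),
    partialDeriv_add ((hd _).const_mul _) ((hd _).const_mul _),
    partialDeriv_const_mul _ (hd _), partialDeriv_const_mul _ (hd _),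
    partialDeriv_sum fun i _ => (hd _).const_mul _]
  exact congrArg _ (Finset.sum_congr rfl fun i _ => partialDeriv_const_mul _ (hd _))

/-- The position vector is orthogonal to the coordinate tangent vectors of the hyperboloid. -/
theorem hyperboloid_partialDeriv (hx : x ∈ bulk d) (a : Fin (d + 1)) :
    -(ambientFn ℓ (1, 0, 0) x * partialDeriv a (ambientFn ℓ (1, 0, 0)) x)
      - ambientFn ℓ (0, 1, 0) x * partialDeriv a (ambientFn ℓ (0, 1, 0)) x
      + ∑ i, ambientFn ℓ (0, 0, Pi.single i 1) x
        * partialDeriv a (ambientFn ℓ (0, 0, Pi.single i 1)) x = 0 := by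
  have hd : ∀ B : Ambient d, DifferentiableAt ℝ (ambientFn ℓ B) x := fun B =>
    (contDiffAt_ambientFn (n := 1) hx B).differentiableAt (by norm_num)
  have hc : partialDeriv a (fun y => -1 * (ambientFn ℓ (1, 0, 0) y * ambientFn ℓ (1, 0, 0) y)
      - ambientFn ℓ (0, 1, 0) y * ambientFn ℓ (0, 1, 0) y
      + ∑ i : Fin d, ambientFn ℓ (0, 0, Pi.single i 1) y * ambientFn ℓ (0, 0, Pi.single i 1) y) x
      = 0 := by
    rw [partialDeriv_congr (g := fun _ => -ℓ ^ 2), partialDeriv_const]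
    filter_upwards [bulk_mem_nhds hx] with y hy
    rw [← hyperboloid hy]
    simp only [pow_two]; ring
  rw [partialDeriv_add ((((hd _).fun_mul (hd _)).const_mul _).fun_sub ((hd _).fun_mul (hd _)))
      (DifferentiableAt.fun_sum fun i _ => (hd _).fun_mul (hd _)),
    partialDeriv_sub (((hd _).fun_mul (hd _)).const_mul _) ((hd _).fun_mul (hd _)),
    partialDeriv_const_mul _ ((hd _).fun_mul (hd _)),
    partialDeriv_sum fun i _ => (hd _).fun_mul (hd _)] at hc
  simp only [partialDeriv_mul (hd _) (hd _)] at hc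
  have e : ∀ i : Fin d, partialDeriv a (ambientFn ℓ (0, 0, Pi.single i 1)) x
        * ambientFn ℓ (0, 0, Pi.single i 1) x
      + ambientFn ℓ (0, 0, Pi.single i 1) x
        * partialDeriv a (ambientFn ℓ (0, 0, Pi.single i 1)) x
      = 2 * (ambientFn ℓ (0, 0, Pi.single i 1) x
        * partialDeriv a (ambientFn ℓ (0, 0, Pi.single i 1)) x) := fun i => by ring
  simp only [e, ← Finset.mul_sum] at hc
  linear_combination hc / 2

/-- The right-hand side of the equation that `df(η)` has to satisfy along `γ`, for the linear
function `f` given by `A`. -/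
def deviationSource (ℓ : ℝ) (h : TensorField d) (γ : ℝ → Coord d) (A : Ambient d) (s : ℝ) : ℝ :=
  -(ambientFn ℓ A (γ s) / ℓ ^ 2 * along h γ s)
    - ∑ a, force ℓ h γ s a * partialDeriv a (ambientFn ℓ A) (γ s)

theorem deviationSource_eq_combination (hs : γ s ∈ bulk d) (A : Ambient d) :
    deviationSource ℓ h γ A s = A.1 * deviationSource ℓ h γ (1, 0, 0) s
      + A.2.1 * deviationSource ℓ h γ (0, 1, 0) s
      + ∑ i, A.2.2 i * deviationSource ℓ h γ (0, 0, Pi.single i 1) s := by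
  have h1 : ∑ a, force ℓ h γ s a * partialDeriv a (ambientFn ℓ A) (γ s)
      = A.1 * ∑ a, force ℓ h γ s a * partialDeriv a (ambientFn ℓ (1, 0, 0)) (γ s)
        + A.2.1 * ∑ a, force ℓ h γ s a * partialDeriv a (ambientFn ℓ (0, 1, 0)) (γ s)
        + ∑ i, A.2.2 i * ∑ a, force ℓ h γ s a
          * partialDeriv a (ambientFn ℓ (0, 0, Pi.single i 1)) (γ s) := by
    simp only [partialDeriv_ambientFn_eq_combination hs A, Finset.mul_sum, mul_add,
      Finset.sum_add_distrib]
    rw [Finset.sum_comm (s := (Finset.univ : Finset (Fin d)))]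
    refine congrArg₂ _ (congrArg₂ _ ?_ ?_) ?_
    · exact Finset.sum_congr rfl fun a _ => by ring
    · exact Finset.sum_congr rfl fun a _ => by ring
    · exact Finset.sum_congr rfl fun a _ => Finset.sum_congr rfl fun b _ => by ring
  have h2 : ∑ i, A.2.2 i * deviationSource ℓ h γ (0, 0, Pi.single i 1) s
      = -((∑ i, A.2.2 i * ambientFn ℓ (0, 0, Pi.single i 1) (γ s)) / ℓ ^ 2 * along h γ s)
        - ∑ i, A.2.2 i * ∑ a, force ℓ h γ s a
          * partialDeriv a (ambientFn ℓ (0, 0, Pi.single i 1)) (γ s) := by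
    rw [Finset.sum_div, Finset.sum_mul, ← Finset.sum_neg_distrib, ← Finset.sum_sub_distrib]
    exact Finset.sum_congr rfl fun i _ => by rw [deviationSource]; ring
  rw [h2, deviationSource, h1, ambientFn_eq_combination A, deviationSource, deviationSource]
  ring

/-- The position vector of the hyperboloid is normal to it, with square `-ℓ²`. -/
theorem ambientFn_deviationSource (hℓ : ℓ ≠ 0) (hs : γ s ∈ bulk d) :
    ambientFn ℓ (representer fun A => deviationSource ℓ h γ A s) (γ s) = along h γ s := by
  rw [ambientFn_eq_combination]
  simp only [representer]
  have h2 : ∑ i, deviationSource ℓ h γ (0, 0, Pi.single i 1) s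
        * ambientFn ℓ (0, 0, Pi.single i 1) (γ s)
      = -((∑ i, ambientFn ℓ (0, 0, Pi.single i 1) (γ s) ^ 2) / ℓ ^ 2 * along h γ s)
        - ∑ a, force ℓ h γ s a * ∑ i, ambientFn ℓ (0, 0, Pi.single i 1) (γ s)
          * partialDeriv a (ambientFn ℓ (0, 0, Pi.single i 1)) (γ s) := by
    simp only [Finset.mul_sum]
    rw [Finset.sum_comm, Finset.sum_div, Finset.sum_mul, ← Finset.sum_neg_distrib,
      ← Finset.sum_sub_distrib]
    refine Finset.sum_congr rfl fun i _ => ?_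
    rw [deviationSource, sub_mul, Finset.sum_mul]
    refine congrArg₂ _ (by ring) (Finset.sum_congr rfl fun a _ => by ring)
  rw [h2]
  have h3 : ∀ a, ∑ i, ambientFn ℓ (0, 0, Pi.single i 1) (γ s)
        * partialDeriv a (ambientFn ℓ (0, 0, Pi.single i 1)) (γ s)
      = ambientFn ℓ (1, 0, 0) (γ s) * partialDeriv a (ambientFn ℓ (1, 0, 0)) (γ s)
      + ambientFn ℓ (0, 1, 0) (γ s) * partialDeriv a (ambientFn ℓ (0, 1, 0)) (γ s) := fun a => by
    linear_combination hyperboloid_partialDeriv (ℓ := ℓ) hs a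
  have h4 : ∑ i, ambientFn ℓ (0, 0, Pi.single i 1) (γ s) ^ 2 = -ℓ ^ 2
      + ambientFn ℓ (1, 0, 0) (γ s) ^ 2 + ambientFn ℓ (0, 1, 0) (γ s) ^ 2 := by
    linear_combination hyperboloid (ℓ := ℓ) hs
  have h5 : ∑ a, force ℓ h γ s a * (ambientFn ℓ (1, 0, 0) (γ s)
        * partialDeriv a (ambientFn ℓ (1, 0, 0)) (γ s)
      + ambientFn ℓ (0, 1, 0) (γ s) * partialDeriv a (ambientFn ℓ (0, 1, 0)) (γ s))
      = ambientFn ℓ (1, 0, 0) (γ s)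
          * ∑ a, force ℓ h γ s a * partialDeriv a (ambientFn ℓ (1, 0, 0)) (γ s)
        + ambientFn ℓ (0, 1, 0) (γ s)
          * ∑ a, force ℓ h γ s a * partialDeriv a (ambientFn ℓ (0, 1, 0)) (γ s) := by
    rw [Finset.mul_sum, Finset.mul_sum, ← Finset.sum_add_distrib]
    exact Finset.sum_congr rfl fun a _ => by ring
  simp only [h3, h4, h5, deviationSource]
  field_simp
  ring

theorem continuous_deviationSource (hℓ : ℓ ≠ 0) (hγ : IsNullGeodesic d ℓ γ)
    (hh : ∀ x ∈ bulk d, ∀ a b, ContDiffAt ℝ 2 (fun y => h y a b) x) (A : Ambient d) :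
    Continuous (deviationSource ℓ h γ A) := by
  have hc : Continuous γ := hγ.contDiff.continuous
  have hc' : Continuous (deriv γ) := hγ.contDiff.continuous_deriv (by norm_num)
  have comp : ∀ {f : Coord d → ℝ}, (∀ x ∈ bulk d, ContinuousAt f x) →
      Continuous fun s => f (γ s) := fun {f} hf => continuous_iff_continuousAt.2 fun s =>
    ContinuousAt.comp (g := f) (hf _ (hγ.mem_bulk s)) hc.continuousAt
  have h1 : Continuous fun s => ambientFn ℓ A (γ s) :=
    comp fun x hx => (contDiffAt_ambientFn (n := 1) hx A).continuousAt
  have h2 : ∀ a, Continuous fun s => partialDeriv a (ambientFn ℓ A) (γ s) := fun a =>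
    comp fun x hx => (contDiffAt_partialDeriv_ambientFn (n := 1) hx A a).continuousAt
  have h3 : ∀ a b, Continuous fun s => h (γ s) a b := fun a b =>
    comp (f := fun y => h y a b) fun x hx => (hh x hx a b).continuousAt
  have h4 : ∀ a b e, Continuous fun s => connectionVar (metric d ℓ) h 0 a b e (γ s) :=
    fun a b e => comp fun x hx => (differentiableAt_of_param (p := ((0 : ℝ), x))
      (contDiffAt_connectionVar (fun a b => contDiffAt_metric hx a b) (hh x hx)
        (det_metric_ne_zero hℓ hx) a b e)).continuousAt
  have h5 : ∀ a, Continuous fun s => deriv γ s a := fun a => (continuous_apply a).comp hc'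
  have h6 : Continuous (along h γ) := by
    unfold along quad
    exact continuous_finsetSum _ fun a _ => continuous_finsetSum _ fun b _ =>
      ((h3 a b).mul (h5 a)).mul (h5 b)
  have h7 : ∀ a, Continuous fun s => force ℓ h γ s a := fun a => by
    unfold force
    exact continuous_finsetSum _ fun b _ => continuous_finsetSum _ fun e _ =>
      ((h4 a b e).mul (h5 b)).mul (h5 e)
  have h8 : Continuous fun s => ∑ a, force ℓ h γ s a * partialDeriv a (ambientFn ℓ A) (γ s) :=
    continuous_finsetSum _ fun a _ => (h7 a).mul (h2 a)
  exact ((h1.div_const _).mul h6).neg.sub h8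

/-- Twice integrating a continuous function. -/
theorem exists_second_primitive {E : Type*} [NormedAddCommGroup E] [NormedSpace ℝ E]
    [CompleteSpace E] {f : ℝ → E} (hf : Continuous f) (B : E) :
    ∃ X X' : ℝ → E, (∀ s, HasDerivAt X (X' s) s) ∧ (∀ s, HasDerivAt X' (f s) s) ∧
      X 0 = 0 ∧ X' 0 = B ∧ ContDiff ℝ 2 X := by
  set X' : ℝ → E := fun s => B + ∫ r in (0 : ℝ)..s, f r with hX'
  have h' : ∀ s, HasDerivAt X' (f s) s := fun s =>
    ((hf.integral_hasStrictDerivAt 0 s).hasDerivAt).const_add B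
  have hc' : Continuous X' := continuous_iff_continuousAt.2 fun s => (h' s).continuousAt
  set X : ℝ → E := fun s => ∫ r in (0 : ℝ)..s, X' r with hX
  have h1 : ∀ s, HasDerivAt X (X' s) s := fun s => (hc'.integral_hasStrictDerivAt 0 s).hasDerivAt
  refine ⟨X, X', h1, h', by simp [hX], by simp [hX'], ?_⟩
  have e1 : deriv X = X' := funext fun s => (h1 s).deriv
  have e2 : deriv X' = f := funext fun s => (h' s).deriv
  have c1 : ContDiff ℝ 1 X' := contDiff_one_iff_deriv.2 ⟨fun s => (h' s).differentiableAt, e2 ▸ hf⟩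
  exact (contDiff_succ_iff_deriv (n := 1)).2 ⟨fun s => (h1 s).differentiableAt, by simp, e1 ▸ c1⟩

end Source

/-! ### The null condition along a deviation -/

section NullCondition

variable {d : ℕ} {ℓ : ℝ} {h : TensorField d} {t₀ κ s₀ : ℝ} {e β : Fin d → ℝ} {s : ℝ} {x : Coord d}

theorem ambientFn_nullGeodesic (hℓ : ℓ ≠ 0) (hβ : IsKleinPoint e β) (hβ1 : ∑ i, β i ^ 2 < 1)
    (s : ℝ) : ambientFn ℓ (nullCovector ℓ t₀ e) (nullGeodesic ℓ t₀ e β κ s₀ s) = 0 :=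
  ambientFn_nullCurve hℓ hβ hβ1 (cos_geodesicAngle_pos s)

/-- On `f = 0` the component of the force along the null covector is `K_a C^a_{bc} K^b K^c = ½ K φ`.
-/
theorem sum_force_lower (hℓ : ℓ ≠ 0) (hx : x ∈ bulk d)
    (hh : ∀ a b, DifferentiableAt ℝ (fun y => h y a b) x) (hsymm : (h x).IsSymm)
    (A : Ambient d) (hA : ambientFn ℓ A x = 0) :
    ∑ a, (∑ b, ∑ c, connectionVar (metric d ℓ) h 0 a b c x * ambientGrad ℓ A x b
        * ambientGrad ℓ A x c) * partialDeriv a (ambientFn ℓ A) x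
      = 1 / 2 * derivAlong ℓ A (tiltDensity ℓ h A) x := by
  have e0 : ∀ a, (∑ b, ∑ c, connectionVar (metric d ℓ) h 0 a b c x * ambientGrad ℓ A x b
        * ambientGrad ℓ A x c) * partialDeriv a (ambientFn ℓ A) x
      = ambientGrad ℓ A x a * ∑ b, ∑ c, connectionVarLower (metric d ℓ) h a b c x
        * ambientGrad ℓ A x b * ambientGrad ℓ A x c := fun a => by
    have hg := metricDiag_mul_inv hℓ hx a
    simp only [connectionVar_zero_metric hℓ hx, partialDeriv_ambientFn hℓ hx, Finset.sum_mul,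
      Finset.mul_sum]
    refine Finset.sum_congr rfl fun b _ => Finset.sum_congr rfl fun c _ => ?_
    linear_combination (connectionVarLower (metric d ℓ) h a b c x * ambientGrad ℓ A x b
      * ambientGrad ℓ A x c * ambientGrad ℓ A x a) * hg
  have hW : ∀ a, DifferentiableAt ℝ (contractLower ℓ h A a) x := fun a =>
    DifferentiableAt.fun_sum fun c _ => (hh a c).fun_mul (differentiableAt_ambientGrad A c x)
  have e1 : ∀ b, partialDeriv b (tiltDensity ℓ h A) x
      = ∑ a, (partialDeriv b (contractLower ℓ h A a) x * ambientGrad ℓ A x a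
        + contractLower ℓ h A a x * ambientGradDeriv ℓ A x a b) := fun b => by
    have : tiltDensity ℓ h A = fun y => ∑ a, contractLower ℓ h A a y * ambientGrad ℓ A y a := by
      funext y
      simp only [tiltDensity, contractLower, Finset.sum_mul]
      exact Finset.sum_congr rfl fun a _ => Finset.sum_congr rfl fun c _ => by ring
    rw [this, partialDeriv_sum fun a _ => (hW a).fun_mul (differentiableAt_ambientGrad A a x)]
    refine Finset.sum_congr rfl fun a _ => ?_
    rw [partialDeriv_mul (hW a) (differentiableAt_ambientGrad A a x), partialDeriv_ambientGrad]
  have e2 : derivAlong ℓ A (tiltDensity ℓ h A) x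
      = ∑ a, ambientGrad ℓ A x a * (derivAlong ℓ A (contractLower ℓ h A a) x
        + ∑ b, contractLower ℓ h A b x * ambientGradDeriv ℓ A x b a) := by
    simp only [derivAlong, e1, mul_add, Finset.sum_add_distrib]
    congr 1
    simp only [Finset.mul_sum]
    rw [Finset.sum_comm]
    exact Finset.sum_congr rfl fun a _ => Finset.sum_congr rfl fun c _ => by ring
  have e3 : derivAlong ℓ A (tiltDensity ℓ h A) x
      = ∑ a, ambientGrad ℓ A x a * partialDeriv a (tiltDensity ℓ h A) x := rfl
  simp only [e0, sum_connectionVarLower hℓ hx hh hsymm, hA, zero_div, zero_mul, sub_zero, mul_sub,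
    Finset.sum_sub_distrib]
  rw [← e2]
  have e4 : ∑ a, ambientGrad ℓ A x a * (1 / 2 * partialDeriv a (tiltDensity ℓ h A) x)
      = 1 / 2 * derivAlong ℓ A (tiltDensity ℓ h A) x := by
    rw [e3, Finset.mul_sum]
    exact Finset.sum_congr rfl fun a _ => by ring
  rw [e4]; ring

/-- The derivative of `⟨X, N⟩` for a curve `X` in the ambient space. -/
theorem hasDerivAt_ambientInner {X : ℝ → Ambient d} {X' : Ambient d} (hX : HasDerivAt X X' s)
    (N : Ambient d) : HasDerivAt (fun s => ambientInner N (X s)) (ambientInner N X') s := by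
  have h1 : HasDerivAt (fun s => (X s).1) X'.1 s := hX.fst
  have h2 : HasDerivAt (fun s => (X s).2.1) X'.2.1 s := hX.snd.fst
  have h3 : ∀ i, HasDerivAt (fun s => (X s).2.2 i) (X'.2.2 i) s := hasDerivAt_pi.1 hX.snd.snd
  exact ((h1.const_mul N.1).neg.sub (h2.const_mul N.2.1)).add
    (HasDerivAt.fun_sum fun i _ => (h3 i).const_mul (N.2.2 i))

/-- A null geodesic is a straight line of the ambient space with direction `κ N`. -/
theorem hasDerivAt_ambientFn_nullGeodesic (hℓ : ℓ ≠ 0) (hβ : IsKleinPoint e β)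
    (hβ1 : ∑ i, β i ^ 2 < 1) (A : Ambient d) (s : ℝ) :
    HasDerivAt (fun s => ambientFn ℓ A (nullGeodesic ℓ t₀ e β κ s₀ s))
      (κ * ambientInner A (nullCovector ℓ t₀ e)) s := by
  have hs := nullGeodesic_mem_bulk (ℓ := ℓ) (t₀ := t₀) (κ := κ) (s₀ := s₀) hβ hβ1 s
  refine (hasDerivAt_comp_curve ((contDiffAt_ambientFn (n := 1) hs A).differentiableAt
    (by norm_num)) (hasDerivAt_nullGeodesic hℓ hβ s)).congr_deriv ?_
  have h1 := inner_ambientGrad hℓ hs A (nullCovector ℓ t₀ e)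
  rw [ambientFn_nullGeodesic hℓ hβ hβ1, mul_zero, zero_div, add_zero] at h1
  rw [← h1, Finset.mul_sum]
  refine Finset.sum_congr rfl fun a _ => ?_
  rw [partialDeriv_ambientFn hℓ hs, Pi.smul_apply, smul_eq_mul]; ring

/-- The product rule for the ambient scalar product of `X` with the position on the geodesic. -/
theorem hasDerivAt_ambientFn_moving (hℓ : ℓ ≠ 0) (hβ : IsKleinPoint e β)
    (hβ1 : ∑ i, β i ^ 2 < 1) {X : ℝ → Ambient d} {X' : Ambient d} (hX : HasDerivAt X X' s) :
    HasDerivAt (fun s => ambientFn ℓ (X s) (nullGeodesic ℓ t₀ e β κ s₀ s))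
      (ambientFn ℓ X' (nullGeodesic ℓ t₀ e β κ s₀ s)
        + κ * ambientInner (nullCovector ℓ t₀ e) (X s)) s := by
  have h1 : HasDerivAt (fun s => (X s).1) X'.1 s := hX.fst
  have h2 : HasDerivAt (fun s => (X s).2.1) X'.2.1 s := hX.snd.fst
  have h3 : ∀ i, HasDerivAt (fun s => (X s).2.2 i) (X'.2.2 i) s := hasDerivAt_pi.1 hX.snd.snd
  have hf := fun A => hasDerivAt_ambientFn_nullGeodesic (t₀ := t₀) (κ := κ) (s₀ := s₀) hℓ hβ hβ1 A s
  have := ((h1.mul (hf (1, 0, 0))).add (h2.mul (hf (0, 1, 0)))).add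
    (HasDerivAt.fun_sum fun i (_ : i ∈ Finset.univ) => (h3 i).mul (hf (0, 0, Pi.single i 1)))
  refine (this.congr_of_eventuallyEq (Eventually.of_forall fun r =>
    ambientFn_eq_combination (X r) _)).congr_deriv ?_
  rw [ambientFn_eq_combination X']
  simp only [ambientInner, Finset.sum_add_distrib]
  have e1 : ∀ i j : Fin d, (Pi.single i 1 : Fin d → ℝ) j * (nullCovector ℓ t₀ e).2.2 j
      = if j = i then (nullCovector ℓ t₀ e).2.2 j else 0 := fun i j => by
    by_cases hij : j = i
    · subst hij; simp
    · simp [hij]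
  simp [e1]
  have e2 : ∑ i, (X s).2.2 i * (κ * (nullCovector ℓ t₀ e).2.2 i)
      = κ * ∑ i, (nullCovector ℓ t₀ e).2.2 i * (X s).2.2 i := by
    rw [Finset.mul_sum]; exact Finset.sum_congr rfl fun i _ => by ring
  rw [e2]; ring

theorem along_nullGeodesic_tiltDensity (hℓ : ℓ ≠ 0) (hβ : IsKleinPoint e β) (s : ℝ) :
    along h (nullGeodesic ℓ t₀ e β κ s₀) s
      = κ ^ 2 * tiltDensity ℓ h (nullCovector ℓ t₀ e) (nullGeodesic ℓ t₀ e β κ s₀ s) := by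
  rw [along, quad, (hasDerivAt_nullGeodesic hℓ hβ s).deriv, tiltDensity, Finset.mul_sum]
  refine Finset.sum_congr rfl fun a _ => ?_
  rw [Finset.mul_sum]
  refine Finset.sum_congr rfl fun b _ => ?_
  simp only [Pi.smul_apply, smul_eq_mul]; ring

theorem hasDerivAt_along_nullGeodesic (hℓ : ℓ ≠ 0) (hβ : IsKleinPoint e β)
    (hβ1 : ∑ i, β i ^ 2 < 1) (hh : ∀ x ∈ bulk d, ∀ a b, ContDiffAt ℝ 2 (fun y => h y a b) x)
    (s : ℝ) : HasDerivAt (along h (nullGeodesic ℓ t₀ e β κ s₀))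
      (κ ^ 3 * derivAlong ℓ (nullCovector ℓ t₀ e) (tiltDensity ℓ h (nullCovector ℓ t₀ e))
        (nullGeodesic ℓ t₀ e β κ s₀ s)) s := by
  have hs := nullGeodesic_mem_bulk (ℓ := ℓ) (t₀ := t₀) (κ := κ) (s₀ := s₀) hβ hβ1 s
  have h1 := (hasDerivAt_comp_curve ((contDiffAt_tiltDensity (n := 2) (ℓ := ℓ) (hh _ hs)
    (nullCovector ℓ t₀ e)).differentiableAt (by norm_num))
    (hasDerivAt_nullGeodesic hℓ hβ s)).const_mul (κ ^ 2)
  refine (h1.congr_of_eventuallyEq (Eventually.of_forall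
    (along_nullGeodesic_tiltDensity hℓ hβ))).congr_deriv ?_
  rw [derivAlong, Finset.mul_sum, Finset.mul_sum]
  refine Finset.sum_congr rfl fun a _ => ?_
  simp only [Pi.smul_apply, smul_eq_mul]; ring

/-- The component of the source along `N` is a total derivative, by `sum_force_lower`; compare
`hasDerivAt_along_nullGeodesic`. So the null condition of the deviation has to hold at one point of
the geodesic only. -/
theorem ambientInner_deviationSource (hℓ : ℓ ≠ 0) (hβ : IsKleinPoint e β)
    (hβ1 : ∑ i, β i ^ 2 < 1) (hh : ∀ x ∈ bulk d, ∀ a b, ContDiffAt ℝ 2 (fun y => h y a b) x)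
    (hsymm : ∀ x ∈ bulk d, (h x).IsSymm) (s : ℝ) :
    κ * deviationSource ℓ h (nullGeodesic ℓ t₀ e β κ s₀) (nullCovector ℓ t₀ e) s
      = -(1 / 2) * (κ ^ 3 * derivAlong ℓ (nullCovector ℓ t₀ e)
        (tiltDensity ℓ h (nullCovector ℓ t₀ e)) (nullGeodesic ℓ t₀ e β κ s₀ s)) := by
  have hs := nullGeodesic_mem_bulk (ℓ := ℓ) (t₀ := t₀) (κ := κ) (s₀ := s₀) hβ hβ1 s
  have h1 := sum_force_lower hℓ hs (fun a b => (hh _ hs a b).differentiableAt (by norm_num))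
    (hsymm _ hs) _ (ambientFn_nullGeodesic hℓ hβ hβ1 s)
  have h2 : ∀ a, force ℓ h (nullGeodesic ℓ t₀ e β κ s₀) s a
      = κ ^ 2 * ∑ b, ∑ c, connectionVar (metric d ℓ) h 0 a b c (nullGeodesic ℓ t₀ e β κ s₀ s)
        * ambientGrad ℓ (nullCovector ℓ t₀ e) (nullGeodesic ℓ t₀ e β κ s₀ s) b
        * ambientGrad ℓ (nullCovector ℓ t₀ e) (nullGeodesic ℓ t₀ e β κ s₀ s) c := fun a => by
    simp only [force, (hasDerivAt_nullGeodesic hℓ hβ s).deriv, Finset.mul_sum]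
    refine Finset.sum_congr rfl fun b _ => Finset.sum_congr rfl fun c _ => ?_
    simp only [Pi.smul_apply, smul_eq_mul]; ring
  simp only [deviationSource, ambientFn_nullGeodesic hℓ hβ hβ1, zero_div, zero_mul, neg_zero,
    zero_sub, h2, mul_assoc (κ ^ 2), ← Finset.mul_sum, h1]
  ring

end NullCondition

/-! ### Construction of null deviations -/

section Construction

variable {d : ℕ} {ℓ : ℝ} {h : TensorField d} {t₀ κ s₀ : ℝ} {e β : Fin d → ℝ} {s : ℝ}

theorem contDiff_ambientGrad_moving {X : ℝ → Ambient d} {γ : ℝ → Coord d} (hX : ContDiff ℝ 2 X)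
    (hγ : ContDiff ℝ 2 γ) : ContDiff ℝ 2 fun s => ambientGrad ℓ (X s) (γ s) := by
  have h1 : ContDiff ℝ 2 fun s => (X s).1 := hX.fst
  have h2 : ContDiff ℝ 2 fun s => (X s).2.1 := hX.snd.fst
  have h3 : ∀ i, ContDiff ℝ 2 fun s => (X s).2.2 i := contDiff_pi.1 hX.snd.snd
  have h4 : ∀ a, ContDiff ℝ 2 fun s => γ s a := contDiff_pi.1 hγ
  have h5 : ContDiff ℝ 2 fun s => conformalFactor (γ s) := contDiff_conformalFactor.comp hγ
  have h6 : ContDiff ℝ 2 fun s => Real.cos (γ s 0 / ℓ) :=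
    Real.contDiff_cos.comp ((h4 0).div_const _)
  have h7 : ContDiff ℝ 2 fun s => Real.sin (γ s 0 / ℓ) :=
    Real.contDiff_sin.comp ((h4 0).div_const _)
  rw [contDiff_pi]
  intro a
  refine Fin.cases ?_ (fun i => ?_) a
  · simp only [ambientGrad_zero, timePartDeriv]
    exact (h5.div (contDiff_const.sub h5) fun s => (two_sub_conformalFactor_pos _).ne').neg.mul
      ((h2.mul h6).sub (h1.mul h7))
  · simp only [ambientGrad_succ, timePart, spaceDot]
    exact contDiff_const.mul (((h4 i.succ).mul (((h1.mul h6).add (h2.mul h7)).add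
      (ContDiff.sum fun j _ => (h3 j).mul (h4 j.succ)))).add ((h5.mul (h3 i)).div_const _))

/-- Vectors tangent to the hyperboloid have arbitrary scalar product with a nonzero tangent vector. -/
theorem exists_ambientInner_eq (hℓ : ℓ ≠ 0) {x : Coord d} (hx : x ∈ bulk d) {N : Ambient d}
    (hN : ambientFn ℓ N x = 0) (hK : ambientGrad ℓ N x ≠ 0) (c : ℝ) :
    ∃ B : Ambient d, ambientFn ℓ B x = 0 ∧ ambientInner N B = c := by
  obtain ⟨a, ha⟩ := Function.ne_iff.1 hK
  have hg : metricDiag ℓ x a ≠ 0 := left_ne_zero_of_mul_eq_one (metricDiag_mul_inv hℓ hx a)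
  obtain ⟨B, hB0, hB⟩ := exists_ambientGrad_eq hℓ hx
    (Pi.single a (c / (metricDiag ℓ x a * ambientGrad ℓ N x a)))
  refine ⟨B, hB0, ?_⟩
  have h1 := inner_ambientGrad hℓ hx N B
  rw [hN, zero_mul, zero_div, add_zero, hB] at h1
  rw [← h1, Finset.sum_eq_single a]
  · have : ambientGrad ℓ N x a ≠ 0 := ha
    simp only [Pi.single_eq_same]; field_simp
  · intro b _ hb; simp [hb]
  · simp

/-- Every complete null geodesic has a null deviation. In the ambient space the linearized geodesic
equation is the equation `Ξ'' = source`, and the deviation is the projection of `Ξ`; the initial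
velocity is chosen so that `Ξ` stays tangent to the hyperboloid and the deviation null. -/
theorem exists_isNullDeviation (hℓ : ℓ ≠ 0) (hβ : IsKleinPoint e β) (hβ1 : ∑ i, β i ^ 2 < 1)
    (hκ : κ ≠ 0) (hh : ∀ x ∈ bulk d, ∀ a b, ContDiffAt ℝ 2 (fun y => h y a b) x)
    (hsymm : ∀ x ∈ bulk d, (h x).IsSymm) :
    ∃ η, IsNullDeviation d ℓ h (nullGeodesic ℓ t₀ e β κ s₀) η := by
  have hγ := isNullGeodesic_nullGeodesic (ℓ := ℓ) (t₀ := t₀) (s₀ := s₀) hℓ hβ hβ1 hκ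
  have hf := ambientFn_nullGeodesic (ℓ := ℓ) (t₀ := t₀) (κ := κ) (s₀ := s₀) hℓ hβ hβ1
  have hvel := fun s => (hasDerivAt_nullGeodesic (ℓ := ℓ) (t₀ := t₀) (κ := κ) (s₀ := s₀) hℓ hβ
    s).deriv
  have hmov := fun (X : ℝ → Ambient d) (X' : Ambient d) s (hX : HasDerivAt X X' s) =>
    hasDerivAt_ambientFn_moving (ℓ := ℓ) (t₀ := t₀) (κ := κ) (s₀ := s₀) hℓ hβ hβ1 hX
  have htilt := hasDerivAt_along_nullGeodesic (ℓ := ℓ) (t₀ := t₀) (κ := κ) (s₀ := s₀) hℓ hβ hβ1 hh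
  have hsrc := ambientInner_deviationSource (ℓ := ℓ) (t₀ := t₀) (κ := κ) (s₀ := s₀) hℓ hβ hβ1 hh
    hsymm
  set N := nullCovector ℓ t₀ e with hN
  set γ := nullGeodesic ℓ t₀ e β κ s₀ with hγdef
  clear_value γ
  have hK : ambientGrad ℓ N (γ 0) ≠ 0 := fun h0 =>
    hγ.velocity_ne_zero 0 (by rw [hvel, h0, smul_zero])
  obtain ⟨B, hB0, hBN⟩ := exists_ambientInner_eq hℓ (hγ.mem_bulk 0) (hf 0) hK
    (-(1 / 2) * along h γ 0 / κ)
  have hrep := fun s => ambientInner_representer fun A =>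
    deviationSource_eq_combination (ℓ := ℓ) (h := h) (hγ.mem_bulk s) A
  have hcont : Continuous fun s => representer fun A => deviationSource ℓ h γ A s :=
    (continuous_deviationSource hℓ hγ hh _).neg.prodMk
      ((continuous_deviationSource hℓ hγ hh _).neg.prodMk
        (continuous_pi fun i => continuous_deviationSource hℓ hγ hh _))
  obtain ⟨X, X', hX, hX', hX0, hX0', hXc⟩ := exists_second_primitive hcont B
  -- the component of the deviation velocity that the null condition fixes
  have hn : ∀ s, κ * ambientInner N (X' s) = -(1 / 2) * along h γ s := by
    have hd : ∀ s, HasDerivAt (fun s => κ * ambientInner N (X' s) + 1 / 2 * along h γ s) 0 s :=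
      fun s => (((hasDerivAt_ambientInner (hX' s) N).const_mul κ).add
        ((htilt s).const_mul (1 / 2))).congr_deriv (by rw [hrep, hsrc]; ring)
    intro s
    have := is_const_of_deriv_eq_zero (fun s => (hd s).differentiableAt) (fun s => (hd s).deriv) s 0
    simp only [hX0', hBN] at this
    have e : κ * (-(1 / 2) * along h γ 0 / κ) = -(1 / 2) * along h γ 0 := by field_simp
    rw [e] at this
    linarith
  -- `Ξ` stays tangent to the hyperboloid
  have hm : ∀ s, ambientFn ℓ (X s) (γ s) = 0 := by
    have hd1 : ∀ s, HasDerivAt (fun s => ambientFn ℓ (X s) (γ s))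
        (ambientFn ℓ (X' s) (γ s) + κ * ambientInner N (X s)) s := fun s => hmov X _ s (hX s)
    have hd2 : ∀ s, HasDerivAt (fun s => ambientFn ℓ (X' s) (γ s) + κ * ambientInner N (X s)) 0 s :=
      fun s => ((hmov X' _ s (hX' s)).add
        ((hasDerivAt_ambientInner (hX s) N).const_mul κ)).congr_deriv (by
          rw [ambientFn_deviationSource hℓ (hγ.mem_bulk s), hn]; ring)
    intro s
    have h0 : ambientInner N (0 : Ambient d) = 0 := by simp [ambientInner]
    have h1 : ambientFn ℓ (0 : Ambient d) (γ 0) = 0 := by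
      rw [ambientFn_eq_combination]; simp
    rw [(eq_affine_of_deriv_deriv_zero hd1 hd2 s).2]
    simp [hX0, hX0', hB0, h0, h1]
  have hη : ContDiff ℝ 2 fun s => ambientGrad ℓ (X s) (γ s) :=
    contDiff_ambientGrad_moving hXc hγ.contDiff
  have hdev : ∀ (A : Ambient d) s, ∑ a, ambientGrad ℓ (X s) (γ s) a
      * partialDeriv a (ambientFn ℓ A) (γ s) = ambientInner A (X s) := fun A s => by
    have h1 := inner_ambientGrad hℓ (hγ.mem_bulk s) A (X s)
    rw [hm, mul_zero, zero_div, add_zero] at h1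
    rw [← h1]
    refine Finset.sum_congr rfl fun a _ => ?_
    rw [partialDeriv_ambientFn hℓ (hγ.mem_bulk s)]; ring
  have hD : ∀ A : Ambient d, deviationDeriv γ (fun s => ambientGrad ℓ (X s) (γ s)) (ambientFn ℓ A)
      = fun s => ambientInner A (X' s) := fun A => funext fun s => by
    refine (hasDerivAt_deviation (hγ.contDiff.differentiable (by norm_num))
      (hη.differentiable (by norm_num))
      (contDiffAt_ambientFn (hγ.mem_bulk s) A)).unique ?_
    simp only [hdev]
    exact hasDerivAt_ambientInner (hX s) A
  refine ⟨_, isNullDeviation_of_hasDerivAt hℓ hγ hh hη fun A s => ?_⟩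
  rw [hD]
  exact (hasDerivAt_ambientInner (hX' s) A).congr_deriv (hrep s A)

end Construction

/-! ### The static perturbation -/

section Static

variable {d : ℕ} {ℓ t₀ κ s₀ ε τ : ℝ} {e β : Fin d → ℝ} {x : Coord d}

theorem one_add_arealRadius_sq (hℓ : ℓ ≠ 0) (hx : x ∈ bulk d) :
    arealRadius ℓ x ^ 2 / ℓ ^ 2 = 4 * (1 - conformalFactor x) / conformalFactor x ^ 2 ∧
    1 + arealRadius ℓ x ^ 2 / ℓ ^ 2
      = ((2 - conformalFactor x) / conformalFactor x) ^ 2 := by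
  have h := (conformalFactor_pos hx).ne'
  have h1 : arealRadius ℓ x ^ 2 / ℓ ^ 2 = 4 * (1 - conformalFactor x) / conformalFactor x ^ 2 := by
    rw [arealRadius, div_pow, mul_pow, Real.sq_sqrt (normSqSpace_nonneg x),
      show 1 - normSqSpace x = conformalFactor x from rfl,
      show normSqSpace x = 1 - conformalFactor x by simp [conformalFactor]]
    field_simp
    ring
  refine ⟨h1, ?_⟩
  rw [h1]
  field_simp
  ring

/-- The extension of `Ω²` times the static perturbation to the compactification. -/
def staticExtension (d : ℕ) (ε : ℝ) : TensorField d := fun x =>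
  Matrix.single 0 0
    (4 * ε * (1 - conformalFactor x) * (conformalFactor x / (2 - conformalFactor x)) ^ (2 * d))

theorem contDiff_staticExtension (d : ℕ) (ε : ℝ) (a b : Fin (d + 1)) :
    ContDiff ℝ 2 fun x => staticExtension d ε x a b := by
  simp only [staticExtension, Matrix.single_apply]
  split_ifs
  · exact (contDiff_const.mul (contDiff_const.sub contDiff_conformalFactor)).mul
      ((contDiff_conformalFactor.div (contDiff_const.sub contDiff_conformalFactor)
        fun x => (two_sub_conformalFactor_pos x).ne').pow _)
  · exact contDiff_const

theorem staticExtension_eq (hℓ : ℓ ≠ 0) (hx : x ∈ bulk d) :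
    staticExtension d ε x = conformalFactor x ^ 2 • staticPerturbation d ℓ ε x := by
  have h := (conformalFactor_pos hx).ne'
  have h2 := (two_sub_conformalFactor_pos x).ne'
  obtain ⟨h3, h4⟩ := one_add_arealRadius_sq hℓ hx
  rw [staticExtension, staticPerturbation, h4, h3, Matrix.smul_single, ← pow_mul, div_pow, div_pow]
  congr 1
  simp only [smul_eq_mul]
  field_simp

theorem isAdmissible_staticPerturbation (hd : 2 ≤ d) (hℓ : ℓ ≠ 0) (ε : ℝ) :
    IsAdmissible d ℓ (staticPerturbation d ℓ ε) := by
  refine ⟨fun x _ => ?_, staticExtension d ε, fun a b => (contDiff_staticExtension d ε a b).contDiffOn,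
    fun x hx => staticExtension_eq hℓ hx, fun x hx v _ _ => ?_⟩
  · rw [Matrix.IsSymm, staticPerturbation, Matrix.transpose_single]
  · have h0 : staticExtension d ε x = 0 := by
      rw [staticExtension, show conformalFactor x = 0 by simp [conformalFactor, hx], zero_div,
        zero_pow (by omega), mul_zero, Matrix.single_zero]
    simp [quad, h0]

/-- The rescaled tilt depends on `β` only through `1 - |β|²`. -/
theorem rescaledTilt_staticExtension (hβ : IsKleinPoint e β) (hτ : 0 ≤ Real.cos τ) :
    rescaledTilt (staticExtension d ε) ℓ t₀ e β τ
      = 4 * ℓ ^ 2 * ε * ((1 - ∑ i, β i ^ 2) ^ d * Real.cos τ ^ (2 * d)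
        - (1 - ∑ i, β i ^ 2) ^ (d + 1) * Real.cos τ ^ (2 * d + 2)) := by
  have hD := (curveDenom_pos β hτ).ne'
  have h1 := conformalFactor_nullCurve (ℓ := ℓ) (t₀ := t₀) hβ hD
  have h2 := two_sub_conformalFactor_nullCurve (ℓ := ℓ) (t₀ := t₀) hβ hD
  have h3 : conformalFactor (nullCurve ℓ t₀ e β τ) / (2 - conformalFactor (nullCurve ℓ t₀ e β τ))
      = kleinFactor β * Real.cos τ := by rw [h2, h1]; field_simp
  have h4 : 1 - conformalFactor (nullCurve ℓ t₀ e β τ)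
      = (1 - kleinFactor β ^ 2 * Real.cos τ ^ 2) / curveDenom β τ ^ 2 := by
    rw [h1]
    field_simp
    unfold curveDenom; ring
  have h5 : ∀ (c : ℝ) (v : Coord d), quad (Matrix.single 0 0 c) v = c * v 0 * v 0 := fun c v => by
    simp only [quad, Matrix.single_apply]
    rw [Finset.sum_eq_single 0, Finset.sum_eq_single 0]
    · simp
    · intro b _ hb; simp [Ne.symm hb]
    · simp
    · intro b _ hb; simp [Ne.symm hb]
    · simp
  rw [rescaledTilt, staticExtension, h5, h3, h4, nullVelocity_zero, mul_pow, pow_mul (kleinFactor β),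
    kleinFactor_sq hβ.le_one]
  field_simp
  ring

theorem le_rescaledTilt_staticExtension (hε : 0 ≤ ε) (hβ : IsKleinPoint e β)
    (hτ : 0 ≤ Real.cos τ) :
    4 * ℓ ^ 2 * ε * ((1 - ∑ i, β i ^ 2) ^ d * Real.cos τ ^ (2 * d)) * Real.sin τ ^ 2
      ≤ rescaledTilt (staticExtension d ε) ℓ t₀ e β τ := by
  have hq : 0 ≤ 1 - ∑ i, β i ^ 2 := by linarith [hβ.le_one]
  have h2 : 0 ≤ ∑ i, β i ^ 2 := Finset.sum_nonneg fun i _ => sq_nonneg _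
  have h1 : Real.sin τ ^ 2 ≤ 1 - (1 - ∑ i, β i ^ 2) * Real.cos τ ^ 2 := by
    nlinarith [Real.sin_sq_add_cos_sq τ, sq_nonneg (Real.cos τ)]
  rw [rescaledTilt_staticExtension hβ hτ]
  calc _ ≤ 4 * ℓ ^ 2 * ε * ((1 - ∑ i, β i ^ 2) ^ d * Real.cos τ ^ (2 * d))
        * (1 - (1 - ∑ i, β i ^ 2) * Real.cos τ ^ 2) := by gcongr
    _ = _ := by ring

theorem hasDerivAt_pow_affine_sq (q b w : ℝ) (m : ℕ) (θ : ℝ) :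
    HasDerivAt (fun θ : ℝ => (q - 2 * b * θ - w * θ ^ 2) ^ (m + 1))
      ((m + 1) * (q - 2 * b * θ - w * θ ^ 2) ^ m * (-(2 * b) - 2 * w * θ)) θ := by
  have h := ((((hasDerivAt_id θ).const_mul (2 * b)).const_sub q).sub
    (((hasDerivAt_id θ).fun_pow 2).const_mul w)).fun_pow (m + 1)
  refine h.congr_deriv ?_
  simp only [Pi.sub_apply, id, Nat.add_sub_cancel]
  push_cast
  ring

theorem deriv_deriv_pow_affine_sq (q b w c₁ c₂ : ℝ) (m : ℕ) :
    deriv (deriv fun θ : ℝ => c₁ * (q - 2 * b * θ - w * θ ^ 2) ^ (m + 2)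
        - c₂ * (q - 2 * b * θ - w * θ ^ 2) ^ (m + 3)) 0
      = c₁ * ((m + 2) * (m + 1) * q ^ m * (2 * b) ^ 2 - (m + 2) * q ^ (m + 1) * (2 * w))
        - c₂ * ((m + 3) * (m + 2) * q ^ (m + 1) * (2 * b) ^ 2
          - (m + 3) * q ^ (m + 2) * (2 * w)) := by
  have h1 : deriv (fun θ : ℝ => c₁ * (q - 2 * b * θ - w * θ ^ 2) ^ (m + 2)
        - c₂ * (q - 2 * b * θ - w * θ ^ 2) ^ (m + 3))
      = fun θ => c₁ * (((m + 1 : ℕ) + 1) * (q - 2 * b * θ - w * θ ^ 2) ^ (m + 1)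
          * (-(2 * b) - 2 * w * θ))
        - c₂ * (((m + 2 : ℕ) + 1) * (q - 2 * b * θ - w * θ ^ 2) ^ (m + 2)
          * (-(2 * b) - 2 * w * θ)) := funext fun θ =>
    (((hasDerivAt_pow_affine_sq q b w (m + 1) θ).const_mul c₁).sub
      ((hasDerivAt_pow_affine_sq q b w (m + 2) θ).const_mul c₂)).deriv
  have hl : HasDerivAt (fun θ : ℝ => -(2 * b) - 2 * w * θ) (-(2 * w)) 0 := by
    refine (((hasDerivAt_id (0 : ℝ)).const_mul (2 * w)).const_sub (-(2 * b))).congr_deriv ?_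
    ring
  have h2 := (((((hasDerivAt_pow_affine_sq q b w m 0).const_mul (((m + 1 : ℕ) : ℝ) + 1)).mul
      hl).const_mul c₁).sub
    ((((hasDerivAt_pow_affine_sq q b w (m + 1) 0).const_mul (((m + 2 : ℕ) : ℝ) + 1)).mul
      hl).const_mul c₂)).deriv
  rw [h1]
  refine Eq.trans h2 ?_
  push_cast
  simp only [mul_zero, sub_zero, zero_pow two_ne_zero]
  ring

/-- The square of the vector `β`, measured by the degenerate form `∑ w_i w_iᵀ`. -/
theorem sum_sum_mul_kleinFrame_sq (hβ : IsKleinPoint e β) :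
    ∑ i, (∑ j, β j * kleinFrame e β i j) ^ 2
      = (∑ j, β j ^ 2) * (1 - ∑ j, β j ^ 2) := by
  have h1 : ∀ i, (∑ j, β j * kleinFrame e β i j) ^ 2
      = ∑ j, ∑ k, β j * β k * (kleinFrame e β i j * kleinFrame e β i k) := fun i => by
    rw [pow_two, Finset.sum_mul_sum]
    exact Finset.sum_congr rfl fun j _ => Finset.sum_congr rfl fun k _ => by ring
  simp only [h1]
  rw [Finset.sum_comm]
  have h2 : ∀ j, ∑ i, ∑ k, β j * β k * (kleinFrame e β i j * kleinFrame e β i k)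
      = β j * β j - β j * e j * ∑ k, β k * e k - β j ^ 2 * ∑ k, β k ^ 2 := fun j => by
    rw [Finset.sum_comm]
    simp only [← Finset.mul_sum, sum_kleinFrame_mul hβ, mul_sub, Finset.sum_sub_distrib,
      mul_ite, mul_one, mul_zero, Finset.sum_ite_eq, Finset.mem_univ, if_true]
    simp only [Finset.mul_sum]
    refine congrArg₂ _ (congrArg₂ _ rfl ?_) ?_
    · exact Finset.sum_congr rfl fun k _ => by ring
    · exact Finset.sum_congr rfl fun k _ => by ring
  simp only [h2, hβ.orth, mul_zero, sub_zero, Finset.sum_sub_distrib, ← Finset.sum_mul]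
  simp only [← pow_two]
  ring

/-- Along `β + θ w` the quantity `q = 1 - |β|²` is a quadratic polynomial in `θ`, and the frame enters
the second derivatives at `θ = 0` only through `∑ |w_i|²` and `∑ (β · w_i)²`. -/
theorem transverseLaplacian_staticExtension (hd : 2 ≤ d) (hβ : IsKleinPoint e β)
    (hβ1 : ∑ i, β i ^ 2 < 1) (hτ : 0 ≤ Real.cos τ) :
    transverseLaplacian (staticExtension d ε) ℓ t₀ e β τ
      = 8 * ℓ ^ 2 * ε * (1 - ∑ i, β i ^ 2) ^ (d - 1) * Real.cos τ ^ (2 * d)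
        * (d * (d - (2 * d - 1) * (1 - ∑ i, β i ^ 2))
          - (d + 1) * (d + 2 - (2 * d + 1) * (1 - ∑ i, β i ^ 2)) * (1 - ∑ i, β i ^ 2)
            * Real.cos τ ^ 2) := by
  obtain ⟨m, rfl⟩ : ∃ m, d = m + 2 := ⟨d - 2, by omega⟩
  set q := 1 - ∑ i, β i ^ 2 with hq
  set c := Real.cos τ with hc
  have h1 : ∀ i, deriv (deriv fun θ : ℝ => rescaledTilt (staticExtension (m + 2) ε) ℓ t₀ e
        (β + θ • kleinFrame e β i) τ) 0
      = 4 * ℓ ^ 2 * ε * c ^ (2 * (m + 2)) * ((m + 2) * (m + 1) * q ^ m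
            * (2 * ∑ j, β j * kleinFrame e β i j) ^ 2
          - (m + 2) * q ^ (m + 1) * (2 * ∑ j, kleinFrame e β i j ^ 2))
        - 4 * ℓ ^ 2 * ε * c ^ (2 * (m + 2) + 2) * ((m + 3) * (m + 2) * q ^ (m + 1)
            * (2 * ∑ j, β j * kleinFrame e β i j) ^ 2
          - (m + 3) * q ^ (m + 2) * (2 * ∑ j, kleinFrame e β i j ^ 2)) := fun i => by
    rw [← deriv_deriv_pow_affine_sq]
    have hev : (fun θ : ℝ => rescaledTilt (staticExtension (m + 2) ε) ℓ t₀ e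
          (β + θ • kleinFrame e β i) τ) =ᶠ[𝓝 0] fun θ =>
        4 * ℓ ^ 2 * ε * c ^ (2 * (m + 2)) * (q - 2 * (∑ j, β j * kleinFrame e β i j) * θ
          - (∑ j, kleinFrame e β i j ^ 2) * θ ^ 2) ^ (m + 2)
        - 4 * ℓ ^ 2 * ε * c ^ (2 * (m + 2) + 2) * (q - 2 * (∑ j, β j * kleinFrame e β i j) * θ
          - (∑ j, kleinFrame e β i j ^ 2) * θ ^ 2) ^ (m + 3) := by
      filter_upwards [(isOpen_kleinInterval β (kleinFrame e β i)).mem_nhds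
        (zero_mem_kleinInterval hβ1 _)] with θ hθ
      have hs : 1 - ∑ j, (β + θ • kleinFrame e β i) j ^ 2
          = q - 2 * (∑ j, β j * kleinFrame e β i j) * θ - (∑ j, kleinFrame e β i j ^ 2) * θ ^ 2 := by
        have : ∑ j, (β + θ • kleinFrame e β i) j ^ 2 = ∑ j, β j ^ 2
            + 2 * (∑ j, β j * kleinFrame e β i j) * θ + (∑ j, kleinFrame e β i j ^ 2) * θ ^ 2 := by
          simp only [Finset.mul_sum, Finset.sum_mul, ← Finset.sum_add_distrib]
          refine Finset.sum_congr rfl fun j _ => ?_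
          simp only [Pi.add_apply, Pi.smul_apply, smul_eq_mul]; ring
        rw [this, hq]; ring
      rw [rescaledTilt_staticExtension (isKleinPoint_add hβ (sum_kleinFrame_orth hβ i) hθ) hτ, hs]
      ring
    exact hev.deriv.deriv_eq
  have h2 := sum_sum_mul_kleinFrame_sq hβ
  have h3 := sum_kleinFrame_sq hβ
  have hb : ∑ j, β j ^ 2 = 1 - q := by rw [hq]; ring
  rw [hb] at h2 h3
  unfold transverseLaplacian
  simp only [h1, Finset.sum_sub_distrib, ← Finset.mul_sum, mul_pow, h2, h3]
  simp only [show m + 2 - 1 = m + 1 from rfl]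
  push_cast
  ring

/-- Near the boundary of the Klein ball the transverse Laplacian is positive. -/
theorem transverseLaplacian_staticExtension_pos (hd : 2 ≤ d) (hℓ : 0 < ℓ) (hε : 0 < ε)
    (hβ : IsKleinPoint e β) (hβ1 : ∑ i, β i ^ 2 < 1) (hq : 1 - ∑ i, β i ^ 2 < 1 / 5)
    (hτ : 0 < Real.cos τ) : 0 < transverseLaplacian (staticExtension d ε) ℓ t₀ e β τ := by
  rw [transverseLaplacian_staticExtension hd hβ hβ1 hτ.le]
  set q := 1 - ∑ i, β i ^ 2 with hqd
  have hq0 : 0 < q := by rw [hqd]; linarith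
  have hd' : (2 : ℝ) ≤ d := by exact_mod_cast hd
  have hc1 : Real.cos τ ^ 2 ≤ 1 := Real.cos_sq_le_one τ
  refine mul_pos (by positivity) ?_
  have h1 : (d + 1 : ℝ) * (d + 2 - (2 * d + 1) * q) * q * Real.cos τ ^ 2
      ≤ (d + 1) * (d + 2) * q := by
    have h2 : (d + 1 : ℝ) * (d + 2 - (2 * d + 1) * q) * q * Real.cos τ ^ 2
        ≤ (d + 1) * (d + 2) * q * Real.cos τ ^ 2 := by
      gcongr
      have : 0 ≤ (2 * d + 1) * q := by positivity
      linarith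
    refine h2.trans (mul_le_of_le_one_right (by positivity) hc1)
  -- `d (2 d - 1) + (d + 1) (d + 2) ≤ 5 d²`
  have h3 : (d * (2 * d - 1) + (d + 1) * (d + 2) : ℝ) ≤ 5 * d ^ 2 := by nlinarith
  have h4 : (d * (2 * d - 1) + (d + 1) * (d + 2) : ℝ) * q ≤ 5 * d ^ 2 * q := by gcongr
  have h5 : 0 < (d : ℝ) ^ 2 := by positivity
  nlinarith

end Static

/-! ### Averaged null curvature and averaged tilt -/

section Main

variable {d : ℕ} {ℓ t₀ κ s₀ ε : ℝ} {e β : Fin d → ℝ} {h : TensorField d} {γ η : ℝ → Coord d}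

theorem IsAdmissible.exists_isNullDeviation (hℓ : 0 < ℓ) (hh : IsAdmissible d ℓ h)
    (hγ : IsNullGeodesic d ℓ γ) : ∃ η, IsNullDeviation d ℓ h γ η := by
  obtain ⟨t₀, e, β, κ, s₀, hβ, hβ1, hκ, rfl⟩ := hγ.exists_eq_nullGeodesic hℓ
  exact AdS.exists_isNullDeviation hℓ.ne' hβ hβ1 hκ (fun x hx => hh.contDiffAt hx) hh.symm

theorem IsAdmissible.integrable_along (hℓ : 0 < ℓ) (hh : IsAdmissible d ℓ h)
    (hγ : IsNullGeodesic d ℓ γ) : Integrable fun s => along h γ s := by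
  obtain ⟨t₀, e, β, κ, s₀, hβ, hβ1, hκ, rfl⟩ := hγ.exists_eq_nullGeodesic hℓ
  obtain ⟨H, hHd, hH, -⟩ := hh.regular
  exact (integrable_along_nullGeodesic hℓ hβ hβ1 hκ hHd hH).1

theorem IsAdmissible.integral_nullCurvatureVariation (hℓ : 0 < ℓ) (hh : IsAdmissible d ℓ h)
    (hγ : IsNullGeodesic d ℓ γ) : ∃ A : ℝ, ∀ η, IsNullDeviation d ℓ h γ η →
      Integrable (nullCurvatureVariation d ℓ h γ η) ∧
      ∫ s, nullCurvatureVariation d ℓ h γ η s = A := by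
  obtain ⟨t₀, e, β, κ, s₀, hβ, hβ1, hκ, rfl⟩ := hγ.exists_eq_nullGeodesic hℓ
  obtain ⟨H, hHd, hH, -⟩ := hh.regular
  exact ⟨_, fun η hη => AdS.integral_nullCurvatureVariation hℓ hβ hβ1 hκ hh.symm
    (fun x hx => hh.contDiffAt hx) hHd hH hη⟩

/-- The linearized ANCC makes the averaged transverse Laplacian nonpositive, so the maximum
principle applies to the averaged tilt. -/
theorem IsAdmissible.bcc_of_linearizedANCC (hd : 2 ≤ d) (hℓ : 0 < ℓ) (hh : IsAdmissible d ℓ h)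
    (hA : LinearizedANCC d ℓ h) : BCC d ℓ h := by
  intro γ hγ
  obtain ⟨t₀, e, β, κ, s₀, hβ, hβ1, hκ, rfl⟩ := hγ.exists_eq_nullGeodesic hℓ
  obtain ⟨H, hHd, hH, hbdy⟩ := hh.regular
  have hneg : ∀ b, IsKleinPoint e b → ∑ i, b i ^ 2 < 1 →
      ∫ τ in (-(Real.pi / 2))..(Real.pi / 2), transverseLaplacian H ℓ t₀ e b τ ≤ 0 := by
    intro b hb hb1
    have hg := isNullGeodesic_nullGeodesic (t₀ := t₀) (κ := 1) (s₀ := 0) hℓ.ne' hb hb1 one_ne_zero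
    obtain ⟨η, hη⟩ := hh.exists_isNullDeviation hℓ hg
    have h1 := hA _ η hg hη
    rw [(AdS.integral_nullCurvatureVariation hℓ hb hb1 one_ne_zero hh.symm
      (fun x hx => hh.contDiffAt hx) hHd hH hη).2] at h1
    have hσ := kleinFactor_pos hb1
    have h2 : 0 < |1| * kleinFactor b / (8 * ℓ ^ 3) := by positivity
    nlinarith
  rw [(integrable_along_nullGeodesic hℓ hβ hβ1 hκ hHd hH).2]
  have hσ := kleinFactor_pos hβ1
  exact mul_nonneg (by positivity) (rescaledAverage_nonneg hd hHd hbdy hneg hβ)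

theorem tilt_staticPerturbation_pos (hℓ : 0 < ℓ) (hε : 0 < ε) (hγ : IsNullGeodesic d ℓ γ) :
    0 < tilt (staticPerturbation d ℓ ε) γ := by
  obtain ⟨t₀, e, β, κ, s₀, hβ, hβ1, hκ, rfl⟩ := hγ.exists_eq_nullGeodesic hℓ
  have hHd := fun a b => (contDiff_staticExtension d ε a b).contDiffOn (s := compactification d)
  have hσ := kleinFactor_pos hβ1
  have hπ := Real.pi_pos
  rw [(integrable_along_nullGeodesic hℓ hβ hβ1 hκ hHd fun x hx => staticExtension_eq hℓ.ne' hx).2]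
  refine mul_pos (by positivity) (intervalIntegral.integral_pos neg_pi_div_two_lt ?_ ?_ ?_)
  · exact (continuousOn_rescaledTilt hHd).comp (f := fun τ : ℝ => (β, τ)) (by fun_prop)
      fun τ hτ => ⟨hβ, hτ⟩
  · intro τ hτ
    have hc : 0 ≤ Real.cos τ := cos_nonneg_of_mem_angles ⟨hτ.1.le, hτ.2⟩
    have hq : 0 < 1 - ∑ i, β i ^ 2 := by linarith
    exact le_trans (by positivity) (le_rescaledTilt_staticExtension hε.le hβ hc)
  · refine ⟨Real.pi / 4, ⟨by linarith, by linarith⟩, ?_⟩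
    have hc : 0 < Real.cos (Real.pi / 4) := Real.cos_pos_of_mem_Ioo ⟨by linarith, by linarith⟩
    have hs : 0 < Real.sin (Real.pi / 4) := Real.sin_pos_of_pos_of_lt_pi (by linarith) (by linarith)
    have hq : 0 < 1 - ∑ i, β i ^ 2 := by linarith
    exact lt_of_lt_of_le (by positivity) (le_rescaledTilt_staticExtension hε.le hβ hc.le)

theorem integral_nullCurvatureVariation_staticPerturbation_neg (hd : 2 ≤ d) (hℓ : 0 < ℓ)
    (hε : 0 < ε) (hβ : IsKleinPoint e β) (hβ1 : ∑ i, β i ^ 2 < 1)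
    (hq : 1 - ∑ i, β i ^ 2 < 1 / 5) (hκ : κ ≠ 0)
    (hη : IsNullDeviation d ℓ (staticPerturbation d ℓ ε) (nullGeodesic ℓ t₀ e β κ s₀) η) :
    ∫ s, nullCurvatureVariation d ℓ (staticPerturbation d ℓ ε) (nullGeodesic ℓ t₀ e β κ s₀) η s
      < 0 := by
  have hh := isAdmissible_staticPerturbation (d := d) (ℓ := ℓ) hd hℓ.ne' ε
  have hHd := fun a b => (contDiff_staticExtension d ε a b).contDiffOn (s := compactification d)
  have hσ := kleinFactor_pos hβ1
  rw [(AdS.integral_nullCurvatureVariation hℓ hβ hβ1 hκ hh.symm (fun x hx => hh.contDiffAt hx) hHd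
    (fun x hx => staticExtension_eq hℓ.ne' hx) hη).2]
  have h1 : 0 < |κ| * kleinFactor β / (8 * ℓ ^ 3) := by positivity
  have h2 : 0 < ∫ τ in (-(Real.pi / 2))..(Real.pi / 2),
      transverseLaplacian (staticExtension d ε) ℓ t₀ e β τ := by
    refine intervalIntegral.intervalIntegral_pos_of_pos_on ?_ (fun τ hτ => ?_) neg_pi_div_two_lt
    · refine ContinuousOn.intervalIntegrable ?_
      rw [Set.uIcc_of_le neg_pi_div_two_lt.le]
      exact continuousOn_transverseLaplacian hβ hβ1 hHd
    · exact transverseLaplacian_staticExtension_pos hd hℓ hε hβ hβ1 hq (Real.cos_pos_of_mem_Ioo hτ)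
  nlinarith

/-- The areal radius at the point of closest approach determines `|β|`. -/
theorem one_add_arealRadius_sq_nullGeodesic (hℓ : ℓ ≠ 0) (hβ : IsKleinPoint e β)
    (hβ1 : ∑ i, β i ^ 2 < 1) :
    (1 + arealRadius ℓ (nullGeodesic ℓ t₀ e β κ s₀ s₀) ^ 2 / ℓ ^ 2) * (1 - ∑ i, β i ^ 2) = 1 := by
  have hx := nullGeodesic_mem_bulk (ℓ := ℓ) (t₀ := t₀) (κ := κ) (s₀ := s₀) hβ hβ1 s₀
  have h0 : geodesicAngle ℓ β κ s₀ s₀ = 0 := by simp [geodesicAngle]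
  have hσ := kleinFactor_pos hβ1
  have hD : curveDenom β 0 ≠ 0 := (curveDenom_pos β (by simp)).ne'
  rw [(one_add_arealRadius_sq hℓ hx).2, nullGeodesic, h0, two_sub_conformalFactor_nullCurve hβ hD,
    conformalFactor_nullCurve hβ hD, ← kleinFactor_sq hβ1.le, Real.cos_zero]
  field_simp

/-- A failure of the ANCC needs a null geodesic near the boundary together with a deviation of it. -/
theorem not_linearizedANCC_staticPerturbation (hd : 2 ≤ d) (hℓ : 0 < ℓ) (hε : 0 < ε) :
    ¬ LinearizedANCC d ℓ (staticPerturbation d ℓ ε) := by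
  intro hA
  set i₀ : Fin d := ⟨0, by omega⟩
  set i₁ : Fin d := ⟨1, by omega⟩
  have hne : i₁ ≠ i₀ := by simp [i₀, i₁]
  have hsum : ∀ (i : Fin d) (c : ℝ), ∑ j, (Pi.single i c : Fin d → ℝ) j ^ 2 = c ^ 2 := fun i c => by
    rw [Finset.sum_eq_single i]
    · simp
    · intro j _ hj; simp [hj]
    · simp
  -- `1 - (19/20)² = 39/400` is below the threshold `1/5`
  have hβ : IsKleinPoint (Pi.single i₀ 1 : Fin d → ℝ) (Pi.single i₁ (19 / 20)) := by
    refine ⟨by rw [hsum]; norm_num, ?_, by rw [hsum]; norm_num⟩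
    refine Finset.sum_eq_zero fun j _ => ?_
    by_cases hj : j = i₁
    · subst hj; simp [hne]
    · simp [hj]
  have hβ1 : ∑ j, (Pi.single i₁ (19 / 20) : Fin d → ℝ) j ^ 2 < 1 := by rw [hsum]; norm_num
  have hg := isNullGeodesic_nullGeodesic (t₀ := 0) (κ := 1) (s₀ := 0) hℓ.ne' hβ hβ1 one_ne_zero
  obtain ⟨η, hη⟩ := (isAdmissible_staticPerturbation hd hℓ.ne' ε).exists_isNullDeviation hℓ hg
  have h1 := hA _ η hg hη
  have h2 := integral_nullCurvatureVariation_staticPerturbation_neg hd hℓ hε hβ hβ1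
    (by rw [hsum]; norm_num) one_ne_zero hη
  linarith

/-- Null geodesics that stay outside the radius `3 ℓ` are close to the boundary of the Klein ball. -/
theorem integral_nullCurvatureVariation_staticPerturbation_neg_of_far (hd : 2 ≤ d) (hℓ : 0 < ℓ)
    (hε : 0 < ε) (hγ : IsNullGeodesic d ℓ γ) (hfar : ∀ s, 3 * ℓ ≤ arealRadius ℓ (γ s))
    (hη : IsNullDeviation d ℓ (staticPerturbation d ℓ ε) γ η) :
    ∫ s, nullCurvatureVariation d ℓ (staticPerturbation d ℓ ε) γ η s < 0 := by
  obtain ⟨t₀, e, β, κ, s₀, hβ, hβ1, hκ, rfl⟩ := hγ.exists_eq_nullGeodesic hℓ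
  refine integral_nullCurvatureVariation_staticPerturbation_neg hd hℓ hε hβ hβ1 ?_ hκ hη
  have h1 := one_add_arealRadius_sq_nullGeodesic (t₀ := t₀) (κ := κ) (s₀ := s₀) hℓ.ne' hβ hβ1
  -- `r = 3 ℓ` at closest approach means `1 - |β|² = 1/10`
  have h2 : 9 ≤ arealRadius ℓ (nullGeodesic ℓ t₀ e β κ s₀ s₀) ^ 2 / ℓ ^ 2 := by
    rw [le_div_iff₀ (by positivity)]
    nlinarith [hfar s₀]
  nlinarith

end Main

end AdS

end

theorem theorem2 (d : ℕ) (hd : 2 ≤ d) (ℓ : ℝ) (hℓ : 0 < ℓ) :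
    -- for every perturbation in the class, both averages are well defined, and ANCC implies BCC
    (∀ h : AdS.TensorField d, AdS.IsAdmissible d ℓ h →
      (∀ γ, AdS.IsNullGeodesic d ℓ γ →
        MeasureTheory.Integrable (fun s => AdS.along h γ s) ∧
        (∃ η, AdS.IsNullDeviation d ℓ h γ η) ∧
        ∃ A : ℝ, ∀ η, AdS.IsNullDeviation d ℓ h γ η →
          MeasureTheory.Integrable (AdS.nullCurvatureVariation d ℓ h γ η) ∧
          ∫ s, AdS.nullCurvatureVariation d ℓ h γ η s = A) ∧
      (AdS.LinearizedANCC d ℓ h → AdS.BCC d ℓ h)) ∧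
    -- the converse fails: the static perturbation is in the class and has `I > 0` everywhere,
    -- but it violates the linearized ANCC, namely along all null geodesics that stay far out
    (∀ ε : ℝ, 0 < ε →
      AdS.IsAdmissible d ℓ (AdS.staticPerturbation d ℓ ε) ∧
      (∀ γ, AdS.IsNullGeodesic d ℓ γ → 0 < AdS.tilt (AdS.staticPerturbation d ℓ ε) γ) ∧
      AdS.BCC d ℓ (AdS.staticPerturbation d ℓ ε) ∧
      ¬ AdS.LinearizedANCC d ℓ (AdS.staticPerturbation d ℓ ε) ∧
      ∃ R : ℝ, ∀ γ η, AdS.IsNullGeodesic d ℓ γ → (∀ s, R ≤ AdS.arealRadius ℓ (γ s)) →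
        AdS.IsNullDeviation d ℓ (AdS.staticPerturbation d ℓ ε) γ η →
        ∫ s, AdS.nullCurvatureVariation d ℓ (AdS.staticPerturbation d ℓ ε) γ η s < 0) := by
  refine ⟨fun h hh => ⟨fun γ hγ => ⟨hh.integrable_along hℓ hγ, hh.exists_isNullDeviation hℓ hγ,
    hh.integral_nullCurvatureVariation hℓ hγ⟩, hh.bcc_of_linearizedANCC hd hℓ⟩, fun ε hε => ?_⟩
  exact ⟨AdS.isAdmissible_staticPerturbation hd hℓ.ne' ε,
    fun γ hγ => AdS.tilt_staticPerturbation_pos hℓ hε hγ,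
    fun γ hγ => (AdS.tilt_staticPerturbation_pos hℓ hε hγ).le,
    AdS.not_linearizedANCC_staticPerturbation hd hℓ hε,
    3 * ℓ, fun γ η hγ hfar hη =>
      AdS.integral_nullCurvatureVariation_staticPerturbation_neg_of_far hd hℓ hε hγ hfar hη⟩
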